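/- **Setting.** Let $F$ be a field of characteristic zero and let $k$ be a (not necessarily commutative) nonzero semisimple ring containing $F$ in its centre, such that $k^e=k\otimes_F k^{op}$ is semisimple. A $k$-bimodule is one with symmetric $F$-action, i.e. a left $k^e$-module; a $k$-algebra is an $F$-algebra $B$ with a unital homomorphism of $F$-algebras $k\to B$ (not necessarily central), and morphisms of $k$-algebras respect these; $\otimes$ is over $k$. Let $V$ be a $k$-bimodule, $N\ge 2$, $R\subseteq V^{\otimes N}$ a subbimodule, and $A=TV/\langle R\rangle$, graded by $\deg V=1$. Let $I_+=\bigoplus_{n\ge1}A_n$, identified with $A/k$, let $F^n=\bigoplus_{i\le n}V^{\otimes i}$, let $\pi_N:TV\to V^{\otimes N}$ be the projection, and let $R_{N+1}=(R\otimes V)\cap(V\otimes R)$. Assume that $\mathrm{Tor}^A_3(k,k)$ is concentrated in degree $N+1$. *Weak PBW-deformations.* Let $P\subseteq F^N$ be a subbimodule with $\pi_N(P)=R$, and $U=TV/\langle P\rangle$ with the filtration induced by $F^\bullet$. Let $p:A\to\mathrm{gr}(U)$ be the canonical surjection, sending the class in $A_n$ of $x\in V^{\otimes n}$ to the class in $\mathrm{gr}_n(U)$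 of the image of $x$ in $U$. Then $U$ is a *PBW-deformation* of $A$ if $p$ is an isomorphism. It is a *weak PBW-deformation*, described by $k^e$-linear maps $\varphi_j:R\to V^{\otimes j}$ ($0\le j<N$), if $P\cap F^{N-1}=0$, $P=\{r-\sum_{j<N}\varphi_j(r):r\in R\}$ and, writing $\partial\varphi=\varphi\otimes 1_V-1_V\otimes\varphi$ on $R_{N+1}$, $$\partial\varphi_{N-1}(R_{N+1})\subseteq R,\qquad \varphi_0\circ\partial\varphi_{N-1}=0,\qquad \varphi_j\circ\partial\varphi_{N-1}+\partial\varphi_{j-1}=0\quad(0<j<N).$$ *Deformations.* A graded deformation $A_t$ of $A$ (preserving the unit) is a structure of graded $k[t]$-algebra with unit $1$ on the $k[t]$-bimodule $A[t]$ ($\deg t=1$, $t$ central) inducing the product of $A$ modulo $t$. It is given by $k^e$-linear maps $\psi_j:(A/k)^{\otimes2}\to A$, $j\ge1$, if $a\times b=ab+\sum_{j\ge1}\psi_j(a,b)t^j$ for $a,b\in A$. A map $\psi_j$ is normalized if $\psi_j(a\otimes b)=0$ for homogeneous $a,b\in I_+$ with $\deg a+\deg b<N$. The algebra $A_t/\langle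 t-1\rangle$ is filtered by the images of $\bigoplus_{i\le n}A_i\subseteq A$ under $A\to A_t\to A_t/\langle t-1\rangle$, and $\rho:\mathrm{gr}(A_t/\langle t-1\rangle)\to\mathrm{gr}(A)\cong A$ is induced by $\sum_j a_jt^j\mapsto\sum_j a_j$. *Resolutions.* Write $\psi^\sim$ for the $A$-bimodule extension $A\otimes W\otimes A\to M$ of a $k^e$-linear map $\psi:W\to M$. Let $\bar C_n=A\otimes I_+^{\otimes n}\otimes A$ with the bar differentials $\bar b_n$, and let $K_0,\dots,K_3=A\otimes A,\ A\otimes V\otimes A,\ A\otimes R\otimes A,\ A\otimes R_{N+1}\otimes A$ with $d_1(1|v|1)=v|1-1|v$, $d_2(1|r|1)=\sum r_1|r_2|r_3$, $d_3(1|w|1)=\sum v_i|s_i|1-\sum 1|r_i|u_i$ for $w=\sum r_iu_i=\sum v_is_i$ ($r_i,s_i\in R$; $u_i,v_i\in V$). Here and below $\sum x_1|x_2|x_3$ runs over all decompositions of $x$ into three tensor factors with $x_2\in V$, i.e. $v_1\cdots v_n\mapsto\sum_i v_1\cdots v_{i-1}|v_i|v_{i+1}\cdots v_n$; factors of degree $0$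 count as zero in $A/k$. Let $\sigma_0=\mathrm{id}$, $\sigma_1(1|v|1)=1|v|1$, $\sigma_2(1|r|1)=\sum1|r_1|r_2|r_3$, $\sigma_3(1|w|1)=\sum 1|v_i|s_{i,1}|s_{i,2}|s_{i,3}$. An element $1|a_1|\cdots|a_n|1$ with homogeneous $a_i\in I_+$ is normalized if $\sum\deg a_i<N$; a relation decomposition of $r\in R$ is a sum $\sum_i1|a_1^i|\cdots|a_n^i|1$ of such elements with $\sum_l\deg a_l^i=N$ and all $\deg a_l^i>0$ (so that the factors, for $n\ge 2$, lie in $TV$) and $\sum_i a_1^i\cdots a_n^i=r$ in $TV$; a double relation decomposition of $w\in R_{N+1}$ is a sum $\sum_i1|a_i|b_i|c_i|1$ with degrees $1,N-1,1$ and $\sum_i a_ib_ic_i=w$ in $TV$. *Comparison data* are morphisms of graded $A$-bimodules $\tau_n:\bar C_n\to K_n$ and $s_n:\bar C_n\to\bar C_{n+1}$ ($n\le3$, $\tau_0=\mathrm{id}$, $s_0=0$) with $\tau_{n-1}\bar b_n=d_n\tau_n$ and $\bar b_{n+1}s_n+s_{n-1}\bar b_n=1-\sigma_n\tau_n$ for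 $1\le n\le 3$, such that - $\tau_1(1|a|1)=\sum a_1|a_2|a_3$ and $s_1(1|a|1)=-\sum1|a_1|a_2|a_3$ if $\deg a<N$; - $\tau_2$ vanishes on normalized elements, and $\tau_2=1|r|1$ on relation decompositions of $r$; $s_2(\sum_i 1|a_i|b_i|1)=\sum_i1|a_i|b_{i,1}|b_{i,2}|b_{i,3}$ on normalized elements and relation decompositions; - $\tau_3$ vanishes on normalized elements and relation decompositions, and $\tau_3=1|w|1$ on double relation decompositions of $w$; $s_3(\sum_i1|a_i|b_i|c_i|1)=-\sum_i1|a_i|b_i|c_{i,1}|c_{i,2}|c_{i,3}$ on normalized elements, relation decompositions and double relation decompositions. **Theorem.** 1. Let $A_t$ be a graded deformation of $A$ given by normalized maps $\psi_j$, $j\ge 1$. Then there are $k^e$-linear maps $\varphi_j:R\to V^{\otimes j}$ ($0\le j<N$), determined by $\varphi_{N-j}^\sim=\psi_j^\sim\circ\sigma_2$ for $1\le j\le N$ (with $V^{\otimes i}=A_i$ for $i<N$). Put $P=\{r-\sum_{j<N}\varphi_j(r):r\in R\}$ and $U=TV/\langle P\rangle$. Then $\pi_N(P)=R$, $U$ is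 a weak PBW-deformation of $A$ described by the $\varphi_j$, $U$ is a PBW-deformation of $A$, and there is an isomorphism of filtered $k$-algebras $g:U\to A_t/\langle t-1\rangle$ such that $$A\xrightarrow{\ p\ }\mathrm{gr}(U)\xrightarrow{\mathrm{gr}(g)}\mathrm{gr}(A_t/\langle t-1\rangle)\xrightarrow{\ \rho\ }A$$ is the identity. 2. Comparison data exist. Conversely, let $P\subseteq F^N$ with $\pi_N(P)=R$ be such that $U=TV/\langle P\rangle$ is a weak PBW-deformation of $A$, described by the maps $\varphi_j$, and choose any comparison data $(\tau_\bullet,s_\bullet)$. Put $(\psi'_j)^\sim=\varphi_{N-j}^\sim\circ\tau_2$ for $1\le j\le N$ and $\psi'_j=0$ for $j>N$, and define $\psi_j:(A/k)^{\otimes 2}\to A$ recursively by $\psi_1=\psi'_1$ and $$\psi_{j+1}^\sim=(\psi'_{j+1})^\sim-(\psi'_{j+1})^\sim\circ\bar b_3\circ s_2-\mathrm{sq}(\psi_1,\dots,\psi_j)^\sim\circ s_2\qquad(j\ge1),$$ where $\mathrm{sq}(\psi_1,\dots,\psi_j)(a,b,c)=\sum_{i=1}^j\big(\psi_i(a,\psi_{j+1-i}(b,c))-\psi_i(\psi_{j+1-i}(a,b),c)\big)$.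 Then the $\psi_j$ are normalized, they give a graded deformation $A_t$ of $A$, $U$ is a PBW-deformation of $A$, and there is an isomorphism of filtered $k$-algebras $g:U\to A_t/\langle t-1\rangle$ such that the composition $A\xrightarrow{p}\mathrm{gr}(U)\xrightarrow{\mathrm{gr}(g)}\mathrm{gr}(A_t/\langle t-1\rangle)\xrightarrow{\rho}A$ is the identity. In particular, every weak PBW-deformation of $A$ is a PBW-deformation. -/

import Mathlib

open scoped TensorProduct
open MulOpposite

noncomputable section

namespace PBW

/-! ### Bimodules and their balanced tensor product -/

/-- The enveloping algebra `k ⊗_F k^op`.  A `k`-bimodule with symmetric action of `F` is a left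
module over it. -/
abbrev Env (F : Type*) (k : Type*) [Field F] [Ring k] [Algebra F k] : Type _ := k ⊗[F] kᵐᵒᵖ

section Shortcuts

/- Instances that are found by unification anyway, stated to speed up the search. -/
variable {F k : Type*} [Field F] [Ring k] [Algebra F k]

instance : Ring (Env F k) := inferInstance
instance : Semiring (Env F k) := inferInstance
instance : Algebra F (Env F k) := inferInstance
instance {M : Type*} [AddCommMonoid M] [Module (Env F k) M] : SMul (Env F k) M := inferInstance
instance {M : Type*} [AddCommGroup M] [Module F M] [Module (Env F k) M]
    [IsScalarTower F (Env F k) M] (S : Submodule (Env F k) M) : Module F S := inferInstance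
instance {M : Type*} [AddCommGroup M] [Module F M] [Module (Env F k) M]
    [IsScalarTower F (Env F k) M] (S : Submodule (Env F k) M) : IsScalarTower F (Env F k) S :=
  inferInstance

end Shortcuts

section Bimodules

variable {F k : Type*} [Field F] [Ring k] [Algebra F k]
variable {M M' N N' P Q : Type*}
  [AddCommGroup M] [Module F M] [Module (Env F k) M] [IsScalarTower F (Env F k) M]
  [AddCommGroup M'] [Module F M'] [Module (Env F k) M'] [IsScalarTower F (Env F k) M']
  [AddCommGroup N] [Module F N] [Module (Env F k) N] [IsScalarTower F (Env F k) N]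
  [AddCommGroup N'] [Module F N'] [Module (Env F k) N'] [IsScalarTower F (Env F k) N']
  [AddCommGroup P] [Module F P] [Module (Env F k) P] [IsScalarTower F (Env F k) P]
  [AddCommGroup Q] [Module F Q]

variable (F) in
/-- The left action `c.m` of `c : k` on a bimodule. -/
def lsm (c : k) : M →ₗ[F] M where
  toFun m := (c ⊗ₜ[F] (1 : kᵐᵒᵖ) : Env F k) • m
  map_add' := smul_add _
  map_smul' _ _ := smul_comm _ _ _

variable (F) in
/-- The right action `m.c` of `c : k` on a bimodule. -/
def rsm (c : k) : M →ₗ[F] M where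
  toFun m := ((1 : k) ⊗ₜ[F] op c : Env F k) • m
  map_add' := smul_add _
  map_smul' _ _ := smul_comm _ _ _

theorem lsm_rsm (c d : k) (m : M) : lsm F c (rsm F d m) = rsm F d (lsm F c m) := by
  simp [lsm, rsm, smul_smul]

theorem lsm_algebraMap (s : F) (m : M) : lsm F (algebraMap F k s) m = s • m := by
  have : (algebraMap F k s ⊗ₜ[F] (1 : kᵐᵒᵖ) : Env F k) = s • 1 := by
    rw [Algebra.algebraMap_eq_smul_one, ← TensorProduct.smul_tmul']; rfl
  simp [lsm, this]

theorem rsm_algebraMap (s : F) (m : M) : rsm F (algebraMap F k s) m = s • m := by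
  have : ((1 : k) ⊗ₜ[F] op (algebraMap F k s) : Env F k) = s • 1 := by
    rw [Algebra.algebraMap_eq_smul_one, op_smul, TensorProduct.tmul_smul]; rfl
  simp [rsm, this]

theorem env_smul_eq (c d : k) (m : M) :
    (c ⊗ₜ[F] op d : Env F k) • m = lsm F c (rsm F d m) := by
  simp [lsm, rsm, smul_smul]

theorem map_lsm (f : M →ₗ[Env F k] N) (c : k) (m : M) : f (lsm F c m) = lsm F c (f m) :=
  f.map_smul _ _

theorem map_rsm (f : M →ₗ[Env F k] N) (c : k) (m : M) : f (rsm F c m) = rsm F c (f m) :=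
  f.map_smul _ _

/-- An `F`-linear map commuting with both actions of `k` is a morphism of bimodules. -/
def envLin (f : M →ₗ[F] N) (hl : ∀ c m, f (lsm F (k := k) c m) = lsm F c (f m))
    (hr : ∀ c m, f (rsm F (k := k) c m) = rsm F c (f m)) : M →ₗ[Env F k] N where
  toFun := f
  map_add' := f.map_add
  map_smul' e m := by
    induction e using TensorProduct.induction_on with
    | zero =>
      exact (congrArg f (zero_smul (Env F k) m)).trans
        (f.map_zero.trans (zero_smul (Env F k) (f m)).symm)
    | tmul c d =>
      have := env_smul_eq (F := F) c d.unop m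
      rw [op_unop] at this
      rw [this, hl, hr, ← env_smul_eq, op_unop]; rfl
    | add x y hx hy => simp only [add_smul, map_add, hx, hy, RingHom.id_apply] at *

variable (F k M N) in
/-- The relations `m.c ⊗ n = m ⊗ c.n`. -/
def balanced : Submodule F (M ⊗[F] N) :=
  Submodule.span F {x | ∃ (m : M) (c : k) (n : N), x = rsm F c m ⊗ₜ n - m ⊗ₜ lsm F c n}

variable (F k M N) in
/-- The tensor product `M ⊗_k N` of bimodules over the (noncommutative) ring `k`. -/
def BT : Type _ := (M ⊗[F] N) ⧸ balanced F k M N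

instance : AddCommGroup (BT F k M N) :=
  inferInstanceAs (AddCommGroup ((M ⊗[F] N) ⧸ balanced F k M N))

instance : Module F (BT F k M N) :=
  inferInstanceAs (Module F ((M ⊗[F] N) ⧸ balanced F k M N))

instance : AddCommMonoid (BT F k M N) := inferInstance

namespace BT

/-- The projection from the tensor product over `F`. -/
def proj : M ⊗[F] N →ₗ[F] BT F k M N := (balanced F k M N).mkQ

variable (F k) in
/-- The class of `m ⊗ n`. -/
def mk (m : M) (n : N) : BT F k M N := proj (m ⊗ₜ n)

theorem mk_add_left (m m' : M) (n : N) : mk F k (m + m') n = mk F k m n + mk F k m' n := by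
  simp [mk, TensorProduct.add_tmul]

theorem mk_add_right (m : M) (n n' : N) : mk F k m (n + n') = mk F k m n + mk F k m n' := by
  simp [mk, TensorProduct.tmul_add]

theorem mk_smul_left (s : F) (m : M) (n : N) : mk F k (s • m) n = s • mk F k m n := by
  simp [mk, ← TensorProduct.smul_tmul']

theorem mk_smul_right (s : F) (m : M) (n : N) : mk F k m (s • n) = s • mk F k m n := by
  simp [mk]

theorem mk_bal (m : M) (c : k) (n : N) : mk F k (rsm F c m) n = mk F k m (lsm F c n) := by
  rw [← sub_eq_zero, mk, mk, ← map_sub]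
  exact (Submodule.Quotient.mk_eq_zero _).2 (Submodule.subset_span ⟨m, c, n, rfl⟩)

theorem induction {p : BT F k M N → Prop} (x : BT F k M N) (zero : p 0)
    (tmul : ∀ m n, p (mk F k m n)) (add : ∀ x y, p x → p y → p (x + y)) : p x := by
  obtain ⟨y, rfl⟩ : ∃ y, proj y = x := (balanced F k M N).mkQ_surjective x
  induction y using TensorProduct.induction_on with
  | zero => rw [map_zero]; exact zero
  | tmul m n => exact tmul m n
  | add a b ha hb => rw [map_add]; exact add _ _ ha hb

theorem hom_ext {f g : BT F k M N →ₗ[F] Q} (h : ∀ m n, f (mk F k m n) = g (mk F k m n)) :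
    f = g := by
  ext x
  induction x using BT.induction with
  | zero => simp
  | tmul m n => exact h m n
  | add a b ha hb => simp [ha, hb]

/-- A balanced `F`-bilinear map induces an `F`-linear map on the tensor product over `k`. -/
def liftF (f : M → N → Q) (hl : ∀ m m' n, f (m + m') n = f m n + f m' n)
    (hs : ∀ (s : F) m n, f (s • m) n = s • f m n)
    (hr : ∀ m n n', f m (n + n') = f m n + f m n')
    (hb : ∀ m (c : k) n, f (rsm F c m) n = f m (lsm F c n)) :
    BT F k M N →ₗ[F] Q :=
  (balanced F k M N).liftQ (TensorProduct.lift (LinearMap.mk₂ F f hl hs hr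
    (fun s m n => by
      rw [← lsm_algebraMap (k := k), ← hb, rsm_algebraMap, hs]))) <| by
    refine Submodule.span_le.2 ?_
    rintro _ ⟨m, c, n, rfl⟩
    simp [hb]

@[simp] theorem liftF_mk (f : M → N → Q) (hl hs hr hb) (m : M) (n : N) :
    liftF (F := F) (k := k) f hl hs hr hb (mk F k m n) = f m n := rfl

/-- Functoriality in the left factor. -/
def mapL (f : M →ₗ[F] M') (h : ∀ (c : k) m, f (rsm F c m) = rsm F c (f m)) :
    BT F k M N →ₗ[F] BT F k M' N :=
  liftF (fun m n => mk F k (f m) n)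
    (by intros; simp [mk_add_left]) (by intros; simp [mk_smul_left])
    (by intros; simp [mk_add_right]) (by intros; simp [h, mk_bal])

@[simp] theorem mapL_mk (f : M →ₗ[F] M') (h) (m : M) (n : N) :
    mapL (k := k) f h (mk F k m n) = mk F k (f m) n := rfl

/-- Functoriality in the right factor. -/
def mapR (g : N →ₗ[F] N') (h : ∀ (c : k) n, g (lsm F c n) = lsm F c (g n)) :
    BT F k M N →ₗ[F] BT F k M N' :=
  liftF (fun m n => mk F k m (g n))
    (by intros; simp [mk_add_left]) (by intros; simp [mk_smul_left])
    (by intros; simp [mk_add_right]) (by intros; simp [h, mk_bal])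

@[simp] theorem mapR_mk (g : N →ₗ[F] N') (h) (m : M) (n : N) :
    mapR (k := k) g h (mk F k m n) = mk F k m (g n) := rfl

variable (F k M) in
/-- The left action of `k` on a bimodule, as a morphism of `F`-algebras. -/
def lactHom : k →ₐ[F] Module.End F M :=
  (Algebra.lsmul F F M : Env F k →ₐ[F] Module.End F M).comp Algebra.TensorProduct.includeLeft

variable (F k M) in
/-- The right action of `k` on a bimodule, as a morphism of `F`-algebras. -/
def ractHom : kᵐᵒᵖ →ₐ[F] Module.End F M :=
  (Algebra.lsmul F F M : Env F k →ₐ[F] Module.End F M).comp Algebra.TensorProduct.includeRight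

theorem lactHom_apply (c : k) (m : M) : lactHom F k M c m = lsm F c m := rfl
theorem ractHom_apply (c : kᵐᵒᵖ) (m : M) : ractHom F k M c m = rsm F c.unop m := rfl

theorem lsm_mul (c d : k) (m : M) : lsm F (c * d) m = lsm F c (lsm F d m) := by
  simp only [← lactHom_apply, map_mul, Module.End.mul_apply]
theorem rsm_mul (c d : k) (m : M) : rsm F (c * d) m = rsm F d (rsm F c m) := by
  exact congrFun (congrArg DFunLike.coe (map_mul (ractHom F k M) (op d) (op c))) m
theorem lsm_one (m : M) : lsm F (1 : k) m = m := by
  simp only [← lactHom_apply, map_one, Module.End.one_apply]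
theorem rsm_one (m : M) : rsm F (1 : k) m = m := by
  exact congrFun (congrArg DFunLike.coe (map_one (ractHom F k M))) m
theorem lsm_add (c d : k) (m : M) : lsm F (c + d) m = lsm F c m + lsm F d m := by
  simp only [← lactHom_apply, map_add, LinearMap.add_apply]
theorem rsm_add (c d : k) (m : M) : rsm F (c + d) m = rsm F c m + rsm F d m := by
  exact congrFun (congrArg DFunLike.coe (map_add (ractHom F k M) (op c) (op d))) m

variable (F k M N) in
/-- Left multiplication `c.(m ⊗ n) = (c.m) ⊗ n`. -/
def leftHom : k →ₐ[F] Module.End F (BT F k M N) :=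
  AlgHom.ofLinearMap
    { toFun := fun c => mapL (lsm F c) (fun d m => lsm_rsm c d m)
      map_add' := fun c d => hom_ext fun m n => by simp [lsm_add, mk_add_left]
      map_smul' := fun s c => hom_ext fun m n => by
        simp [Algebra.smul_def, lsm_mul, lsm_algebraMap, mk_smul_left] }
    (hom_ext fun m n => by simp [lsm_one])
    (fun c d => hom_ext fun m n => by simp [lsm_mul])

variable (F k M N) in
/-- Right multiplication `(m ⊗ n).c = m ⊗ (n.c)`. -/
def rightHom : kᵐᵒᵖ →ₐ[F] Module.End F (BT F k M N) :=
  AlgHom.ofLinearMap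
    { toFun := fun c => mapR (rsm F c.unop) (fun d m => (lsm_rsm d c.unop m).symm)
      map_add' := fun c d => hom_ext fun m n => by simp [rsm_add, mk_add_right]
      map_smul' := fun s c => hom_ext fun m n => by
        simp [Algebra.smul_def, rsm_mul, rsm_algebraMap, mk_smul_right] }
    (hom_ext fun m n => by simp [rsm_one])
    (fun c d => hom_ext fun m n => by simp [rsm_mul])

theorem leftHom_mk (c : k) (m : M) (n : N) :
    leftHom F k M N c (mk F k m n) = mk F k (lsm F c m) n := rfl

theorem rightHom_mk (c : kᵐᵒᵖ) (m : M) (n : N) :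
    rightHom F k M N c (mk F k m n) = mk F k m (rsm F c.unop n) := rfl

variable (F k M N) in
/-- The outer bimodule structure of `M ⊗_k N`: `c.(m ⊗ n).d = (c.m) ⊗ (n.d)`. -/
def envHom : Env F k →ₐ[F] Module.End F (BT F k M N) :=
  Algebra.TensorProduct.lift (leftHom F k M N) (rightHom F k M N) (fun c d => by
    change leftHom F k M N c * rightHom F k M N d = rightHom F k M N d * leftHom F k M N c
    refine hom_ext fun m n => ?_
    simp [leftHom_mk, rightHom_mk])

instance : Module (Env F k) (BT F k M N) := Module.compHom _ (envHom F k M N).toRingHom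

theorem env_smul_def (e : Env F k) (x : BT F k M N) : e • x = envHom F k M N e x := rfl

instance : IsScalarTower F (Env F k) (BT F k M N) where
  smul_assoc s e x := by simp [env_smul_def]

@[simp] theorem lsm_mk (c : k) (m : M) (n : N) : lsm F c (mk F k m n) = mk F k (lsm F c m) n := by
  change envHom F k M N (c ⊗ₜ[F] 1) (mk F k m n) = _
  rw [envHom, Algebra.TensorProduct.lift_tmul, map_one, mul_one, leftHom_mk]

@[simp] theorem rsm_mk (c : k) (m : M) (n : N) : rsm F c (mk F k m n) = mk F k m (rsm F c n) := by
  change envHom F k M N (1 ⊗ₜ[F] op c) (mk F k m n) = _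
  rw [envHom, Algebra.TensorProduct.lift_tmul, map_one, one_mul, rightHom_mk, unop_op]

/-- A bimodule map out of `M ⊗_k N`, from a biadditive balanced bilinear map. -/
def lift (f : M → N → P) (hl : ∀ m m' n, f (m + m') n = f m n + f m' n)
    (hr : ∀ m n n', f m (n + n') = f m n + f m n')
    (hb : ∀ m (c : k) n, f (rsm F c m) n = f m (lsm F c n))
    (hc : ∀ (c : k) m n, f (lsm F c m) n = lsm F c (f m n))
    (hd : ∀ (c : k) m n, f m (rsm F c n) = rsm F c (f m n)) :
    BT F k M N →ₗ[Env F k] P :=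
  envLin
    (liftF f hl (fun s m n => by rw [← lsm_algebraMap (k := k), hc, lsm_algebraMap]) hr hb)
    (fun c x => by
      induction x using BT.induction with
      | zero => simp
      | tmul m n => simp [hc]
      | add a b ha hb => simp only [map_add, ha, hb])
    (fun c x => by
      induction x using BT.induction with
      | zero => simp
      | tmul m n => simp [hd]
      | add a b ha hb => simp only [map_add, ha, hb])

@[simp] theorem lift_mk (f : M → N → P) (hl hr hb hc hd) (m : M) (n : N) :
    lift (F := F) (k := k) f hl hr hb hc hd (mk F k m n) = f m n := rfl

/-- The tensor product `f ⊗ g` of two bimodule maps. -/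
def map (f : M →ₗ[Env F k] M') (g : N →ₗ[Env F k] N') :
    BT F k M N →ₗ[Env F k] BT F k M' N' :=
  lift (fun m n => mk F k (f m) (g n)) (by intros; simp [mk_add_left])
    (by intros; simp [mk_add_right]) (by intros; simp [map_lsm, map_rsm, mk_bal])
    (by intros; simp [map_lsm]) (by intros; simp [map_rsm])

@[simp] theorem map_mk (f : M →ₗ[Env F k] M') (g : N →ₗ[Env F k] N') (m : M) (n : N) :
    map f g (mk F k m n) = mk F k (f m) (g n) := rfl

/-- The associativity isomorphism `m ⊗ (n ⊗ p) ↦ (m ⊗ n) ⊗ p`. -/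
def assoc : BT F k M (BT F k N P) →ₗ[Env F k] BT F k (BT F k M N) P :=
  lift
    (fun m => liftF (fun n p => mk F k (mk F k m n) p)
      (by intros; simp [mk_add_left, mk_add_right]) (by intros; simp [mk_smul_left, mk_smul_right])
      (by intros; simp [mk_add_right]) (by intros; simp [← mk_bal]))
    (fun m m' x => by
      induction x using BT.induction with
      | zero => simp
      | tmul n p => simp [mk_add_left]
      | add a b ha hb => simp only [map_add, ha, hb]; abel)
    (fun m x y => map_add _ x y)
    (fun m c x => by
      induction x using BT.induction with
      | zero => simp
      | tmul n p => simp [mk_bal]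
      | add a b ha hb => simp only [map_add, ha, hb])
    (fun c m x => by
      induction x using BT.induction with
      | zero => simp
      | tmul n p => simp
      | add a b ha hb => simp only [map_add, ha, hb])
    (fun c m x => by
      induction x using BT.induction with
      | zero => simp
      | tmul n p => simp
      | add a b ha hb => simp only [map_add, ha, hb])

@[simp] theorem assoc_mk (m : M) (n : N) (p : P) :
    assoc (mk F k m (mk F k n p)) = mk F k (mk F k m n) p := rfl

/-- The elements of degree `d` of `M ⊗_k N`, for given gradings of `M` and `N`. -/
def deg (GM : ℕ → Submodule F M) (GN : ℕ → Submodule F N) (d : ℕ) : Submodule F (BT F k M N) :=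
  Submodule.span F {x | ∃ i j m n, i + j = d ∧ m ∈ GM i ∧ n ∈ GN j ∧ x = mk F k m n}

end BT

variable (F M) in
/-- The grading of a module placed in the single degree `d`. -/
def pureDeg (d : ℕ) : ℕ → Submodule F M := fun i => if i = d then ⊤ else ⊥

end Bimodules

/-! ### Algebras over `k` -/

/-- A `k`-algebra: an `F`-algebra `B` with a unital ring homomorphism `k → B`, whose image need not
be central. -/
class KAlg (F k B : Type*) [Field F] [Ring k] [Algebra F k] [Ring B] [Algebra F B] where
  /-- The structure morphism. -/
  str : k →ₐ[F] B

/-- The structure morphism `k → B` of a `k`-algebra. -/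
def KAlg.unit (F : Type*) {k : Type*} (B : Type*) [Field F] [Ring k] [Algebra F k] [Ring B]
    [Algebra F B] [KAlg F k B] : k →ₐ[F] B := KAlg.str

section KAlg

variable (F k : Type*) [Field F] [Ring k] [Algebra F k]

instance : KAlg F k k := ⟨AlgHom.id F k⟩

variable {B : Type*} [Ring B] [Algebra F B] [KAlg F k B]

/-- The bimodule structure of a `k`-algebra. -/
def KAlg.envHom : Env F k →ₐ[F] Module.End F B :=
  Algebra.TensorProduct.lift
    ((Algebra.lmul F B).comp (KAlg.unit F B))
    (AlgHom.ofLinearMap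
      { toFun := fun c => LinearMap.mulRight F (KAlg.unit F B c.unop)
        map_add' := fun c d => by ext b; simp [mul_add]
        map_smul' := fun s c => by ext b; simp }
      (by ext b; simp) (fun c d => by ext b; simp [mul_assoc]))
    (fun c d => by
      change _ * _ = _ * _
      ext b; simp [mul_assoc])

instance KAlg.moduleEnv : Module (Env F k) B := Module.compHom _ (KAlg.envHom F k (B := B)).toRingHom

instance : IsScalarTower F (Env F k) B where
  smul_assoc s e x := by
    change KAlg.envHom F k (B := B) (s • e) x = s • KAlg.envHom F k (B := B) e x
    simp

variable {k}

theorem KAlg.lsm_eq (c : k) (b : B) : lsm F c b = KAlg.unit F _ c * b := by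
  change KAlg.envHom F k (c ⊗ₜ[F] 1) b = _
  rw [KAlg.envHom, Algebra.TensorProduct.lift_tmul, map_one, mul_one]; rfl

theorem KAlg.rsm_eq (c : k) (b : B) : rsm F c b = b * KAlg.unit F _ c := by
  change KAlg.envHom F k (1 ⊗ₜ[F] op c) b = _
  rw [KAlg.envHom, Algebra.TensorProduct.lift_tmul, map_one, one_mul]; rfl

end KAlg

/-! ### The tensor algebra of a bimodule -/

section TensorAlg

variable (F k V : Type*) [Field F] [Ring k] [Algebra F k]
  [AddCommGroup V] [Module F V] [Module (Env F k) V] [IsScalarTower F (Env F k) V]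

/-- The relations that turn the tensor algebra over `F` of `k × V` into the tensor algebra over `k`
of the bimodule `V`. -/
inductive TRel : TensorAlgebra F (k × V) → TensorAlgebra F (k × V) → Prop
  | one : TRel (TensorAlgebra.ι F ((1 : k), (0 : V))) 1
  | mul (c d : k) : TRel (TensorAlgebra.ι F (c * d, (0 : V)))
      (TensorAlgebra.ι F (c, 0) * TensorAlgebra.ι F (d, 0))
  | left (c : k) (v : V) : TRel (TensorAlgebra.ι F ((0 : k), lsm F c v))
      (TensorAlgebra.ι F (c, 0) * TensorAlgebra.ι F (0, v))
  | right (c : k) (v : V) : TRel (TensorAlgebra.ι F ((0 : k), rsm F c v))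
      (TensorAlgebra.ι F (0, v) * TensorAlgebra.ι F (c, 0))

/-- The tensor algebra `TV` over `k` of the bimodule `V`: the universal `k`-algebra with a bimodule
morphism from `V`. -/
def TAlg : Type _ := RingQuot (TRel F k V)

instance : Ring (TAlg F k V) := inferInstanceAs (Ring (RingQuot (TRel F k V)))
instance : Algebra F (TAlg F k V) := inferInstanceAs (Algebra F (RingQuot (TRel F k V)))

namespace TAlg

/-- The generators `k × V → TV`. -/
def gen : k × V →ₗ[F] TAlg F k V :=
  (RingQuot.mkAlgHom F (TRel F k V)).toLinearMap ∘ₗ TensorAlgebra.ι F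

variable {V}

theorem gen_one : gen F k V (1, 0) = 1 :=
  (RingQuot.mkAlgHom_rel F (TRel.one (F := F) (k := k) (V := V))).trans (map_one _)

theorem gen_mul (c d : k) : gen F k V (c * d, 0) = gen F k V (c, 0) * gen F k V (d, 0) :=
  (RingQuot.mkAlgHom_rel F (TRel.mul (F := F) (V := V) c d)).trans (map_mul _ _ _)

theorem gen_left (c : k) (v : V) :
    gen F k V (0, lsm F c v) = gen F k V (c, 0) * gen F k V (0, v) :=
  (RingQuot.mkAlgHom_rel F (TRel.left (F := F) c v)).trans (map_mul _ _ _)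

theorem gen_right (c : k) (v : V) :
    gen F k V (0, rsm F c v) = gen F k V (0, v) * gen F k V (c, 0) :=
  (RingQuot.mkAlgHom_rel F (TRel.right (F := F) c v)).trans (map_mul _ _ _)

instance : KAlg F k (TAlg F k V) where
  str := AlgHom.ofLinearMap (gen F k V ∘ₗ LinearMap.inl F k V) (gen_one F k)
    (fun c d => gen_mul F k c d)

/-- The inclusion `V → TV`. -/
def ι : V →ₗ[Env F k] TAlg F k V :=
  envLin (gen F k V ∘ₗ LinearMap.inr F k V)
    (fun c v => (gen_left F k c v).trans (KAlg.lsm_eq F c _).symm)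
    (fun c v => (gen_right F k c v).trans (KAlg.rsm_eq F c _).symm)

variable {F k} {B : Type*} [Ring B] [Algebra F B]

/-- The universal property of the tensor algebra. -/
def lift (f : k →ₐ[F] B) (g : V →ₗ[F] B) (hl : ∀ c v, g (lsm F c v) = f c * g v)
    (hr : ∀ c v, g (rsm F c v) = g v * f c) : TAlg F k V →ₐ[F] B :=
  RingQuot.liftAlgHom F ⟨TensorAlgebra.lift F (f.toLinearMap.coprod g), by
    intro x y h
    induction h with
    | one => simp
    | mul c d => simp
    | left c v => simp [hl]
    | right c v => simp [hr]⟩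

theorem lift_gen (f : k →ₐ[F] B) (g : V →ₗ[F] B) (hl hr) (x : k × V) :
    lift f g hl hr (gen F k V x) = f x.1 + g x.2 := by
  have : lift f g hl hr (gen F k V x) =
    TensorAlgebra.lift F (f.toLinearMap.coprod g) (TensorAlgebra.ι F x) :=
    RingQuot.liftAlgHom_mkAlgHom_apply F _ _ _
  simp [this]

@[simp] theorem lift_unit (f : k →ₐ[F] B) (g : V →ₗ[F] B) (hl hr) (c : k) :
    lift f g hl hr (KAlg.unit F _ c) = f c := by
  exact (lift_gen f g hl hr (c, 0)).trans (by simp)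

@[simp] theorem lift_ι (f : k →ₐ[F] B) (g : V →ₗ[F] B) (hl hr) (v : V) :
    lift f g hl hr (ι F k v) = g v := by
  exact (lift_gen f g hl hr (0, v)).trans (by simp)

variable (F k V)

/-- The homogeneous component `V^{⊗ n}` of the tensor algebra. -/
def deg (n : ℕ) : Submodule (Env F k) (TAlg F k V) :=
  Submodule.span _ {x | ∃ l : List V, l.length = n ∧ x = (l.map (ι F k)).prod}

/-- The filtration `F^n = ⨁_{i ≤ n} V^{⊗ i}` of the tensor algebra. -/
def fil (n : ℕ) : Submodule (Env F k) (TAlg F k V) := ⨆ i ≤ n, deg F k V i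

/-- The algebra morphism `TV → TV[X]` with `c ↦ c` and `v ↦ v X`: the coefficient of `X^n` of the
image of `x` is the homogeneous component of degree `n` of `x`. -/
def split : TAlg F k V →ₐ[F] Polynomial (TAlg F k V) :=
  lift (Polynomial.CAlgHom.comp (KAlg.unit F _))
    (LinearMap.mulRight F Polynomial.X ∘ₗ Polynomial.CAlgHom.toLinearMap ∘ₗ
      (ι F k).restrictScalars F)
    (fun c v => by simp [map_lsm, KAlg.lsm_eq, mul_assoc])
    (fun c v => by simp [map_rsm, KAlg.rsm_eq, mul_assoc, Polynomial.X_mul_C])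

/-- The canonical projection `π_n : TV → V^{⊗ n}`, with values in `TV`. -/
def proj (n : ℕ) : TAlg F k V →ₗ[F] TAlg F k V :=
  (Polynomial.lcoeff (TAlg F k V) n).restrictScalars F ∘ₗ (split F k V).toLinearMap

variable {F k V}

/-- The homogeneous elements of degree `n` with respect to a morphism to a polynomial algebra. -/
theorem deg_induction {B : Type*} [Ring B] [Algebra F B] [KAlg F k B]
    (f : TAlg F k V →ₐ[F] B) (Φ : TAlg F k V →ₐ[F] Polynomial B)
    (h0 : ∀ c : k, Φ (KAlg.unit F _ c) = Polynomial.C (f (KAlg.unit F _ c)))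
    (h1 : ∀ v : V, Φ (ι F k v) = Polynomial.C (f (ι F k v)) * Polynomial.X)
    {n : ℕ} {x : TAlg F k V} (hx : x ∈ deg F k V n) :
    Φ x = Polynomial.C (f x) * Polynomial.X ^ n := by
  have key : ∀ l : List V, Φ (l.map (ι F k)).prod =
      Polynomial.C (f (l.map (ι F k)).prod) * Polynomial.X ^ l.length := by
    intro l
    induction l with
    | nil => simp
    | cons v l ih =>
      simp only [List.map_cons, List.prod_cons, map_mul, h1, ih, List.length_cons, pow_succ']
      rw [mul_assoc, mul_assoc, ← mul_assoc Polynomial.X, Polynomial.X_mul_C]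
      simp only [mul_assoc]
  induction hx using Submodule.span_induction with
  | mem x h =>
    obtain ⟨l, rfl, rfl⟩ := h
    exact key l
  | zero => simp
  | add x y _ _ hx hy => simp [hx, hy, add_mul]
  | smul e x _ hx =>
    induction e using TensorProduct.induction_on with
    | zero =>
      have := zero_smul (Env F k) x
      rw [show ((0 : k ⊗[F] kᵐᵒᵖ) • x : TAlg F k V) = 0 from this]
      simp
    | tmul c d =>
      have h := env_smul_eq (F := F) c d.unop x
      rw [op_unop, KAlg.lsm_eq, KAlg.rsm_eq] at h
      rw [h]
      simp only [map_mul, h0, hx, mul_assoc]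
      rw [Polynomial.X_pow_mul_C]
    | add a b ha hb =>
      have := add_smul (a : Env F k) b x
      rw [this]
      simp only [map_add, ha, hb, add_mul]

theorem split_deg {n : ℕ} {x : TAlg F k V} (hx : x ∈ deg F k V n) :
    split F k V x = Polynomial.C x * Polynomial.X ^ n :=
  deg_induction (AlgHom.id F _) (split F k V) (fun c => by simp [split])
    (fun v => by simp [split]) hx

theorem proj_deg {n m : ℕ} {x : TAlg F k V} (hx : x ∈ deg F k V n) :
    proj F k V m x = if m = n then x else 0 := by
  simp [proj, split_deg hx, Polynomial.coeff_X_pow]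

theorem deg_le_fil {i n : ℕ} (h : i ≤ n) : deg F k V i ≤ fil F k V n :=
  le_iSup₂_of_le i h le_rfl

end TAlg
end TensorAlg

/-! ### Quotients of the tensor algebra and homogeneous algebras -/

section Quotients

variable (F k V : Type*) [Field F] [Ring k] [Algebra F k]
  [AddCommGroup V] [Module F V] [Module (Env F k) V] [IsScalarTower F (Env F k) V]

/-- The quotient `TV / ⟨S⟩` by the two-sided ideal generated by `S`. -/
def TQuot (S : Set (TAlg F k V)) : Type _ := TAlg F k V ⧸ (TwoSidedIdeal.span S).asIdeal

variable {F k V} (S : Set (TAlg F k V))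

instance : Ring (TQuot F k V S) :=
  inferInstanceAs (Ring (TAlg F k V ⧸ (TwoSidedIdeal.span S).asIdeal))
instance : Algebra F (TQuot F k V S) :=
  inferInstanceAs (Algebra F (TAlg F k V ⧸ (TwoSidedIdeal.span S).asIdeal))

/-- The projection `TV → TV / ⟨S⟩`. -/
def TQuot.mk : TAlg F k V →ₐ[F] TQuot F k V S :=
  Ideal.Quotient.mkₐ F (TwoSidedIdeal.span S).asIdeal

instance : KAlg F k (TQuot F k V S) := ⟨(TQuot.mk S).comp (KAlg.unit F _)⟩

namespace TQuot

theorem mk_unit (c : k) : TQuot.mk S (KAlg.unit F _ c) = KAlg.unit F _ c := rfl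

theorem mk_surjective : Function.Surjective (TQuot.mk S) :=
  Ideal.Quotient.mkₐ_surjective F _

theorem mk_eq_zero_iff {x : TAlg F k V} : TQuot.mk S x = 0 ↔ x ∈ TwoSidedIdeal.span S :=
  Ideal.Quotient.eq_zero_iff_mem.trans TwoSidedIdeal.mem_asIdeal

theorem mk_rel {x : TAlg F k V} (h : x ∈ S) : TQuot.mk S x = 0 :=
  (mk_eq_zero_iff S).2 (TwoSidedIdeal.subset_span h)

/-- The projection `TV → TV / ⟨S⟩` as a morphism of bimodules. -/
def mkE : TAlg F k V →ₗ[Env F k] TQuot F k V S :=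
  envLin (TQuot.mk S).toLinearMap
    (fun c x => by simp [KAlg.lsm_eq, mk_unit]) (fun c x => by simp [KAlg.rsm_eq, mk_unit])

@[simp] theorem mkE_apply (x : TAlg F k V) : mkE S x = TQuot.mk S x := rfl

variable {S}

/-- Morphisms out of `TV / ⟨S⟩`. -/
def lift {B : Type*} [Ring B] [Algebra F B] (f : TAlg F k V →ₐ[F] B) (h : ∀ x ∈ S, f x = 0) :
    TQuot F k V S →ₐ[F] B :=
  Ideal.Quotient.liftₐ _ f <| by
    intro x hx
    have : TwoSidedIdeal.span S ≤ TwoSidedIdeal.ker f :=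
      TwoSidedIdeal.span_le.2 fun y hy => (TwoSidedIdeal.mem_ker f).2 (h y hy)
    exact (TwoSidedIdeal.mem_ker f).1 (this (TwoSidedIdeal.mem_asIdeal.1 hx))

@[simp] theorem lift_mk {B : Type*} [Ring B] [Algebra F B] (f : TAlg F k V →ₐ[F] B)
    (h : ∀ x ∈ S, f x = 0) (x : TAlg F k V) : lift f h (TQuot.mk S x) = f x := rfl

variable (S)

/-- The image of `V^{⊗ n}`. -/
def deg (n : ℕ) : Submodule F (TQuot F k V S) :=
  ((TAlg.deg F k V n).restrictScalars F).map (TQuot.mk S).toLinearMap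

/-- The filtration of `TV / ⟨S⟩` induced by the filtration of `TV`. -/
def fil (n : ℕ) : Submodule F (TQuot F k V S) :=
  ((TAlg.fil F k V n).restrictScalars F).map (TQuot.mk S).toLinearMap

end TQuot

variable (F k V)

/-- The data of an `N`-homogeneous algebra: `N ≥ 2` and a subbimodule `R ⊆ V^{⊗ N}`. -/
structure HomogData where
  /-- The degree of the relations. -/
  N : ℕ
  two_le : 2 ≤ N
  /-- The bimodule of relations. -/
  R : Submodule (Env F k) (TAlg F k V)
  R_le : R ≤ TAlg.deg F k V N

variable {F k V}

namespace HomogData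

variable (h : HomogData F k V)

/-- The `N`-homogeneous algebra `A = TV / ⟨R⟩`. -/
abbrev A : Type _ := TQuot F k V (h.R : Set (TAlg F k V))

/-- The projection `TV → A`. -/
abbrev q : TAlg F k V →ₗ[Env F k] h.A := TQuot.mkE _

/-- The homogeneous component `A_n`. -/
abbrev deg (n : ℕ) : Submodule F h.A := TQuot.deg _ n

theorem mk_mem_deg {n : ℕ} {x : TAlg F k V} (hx : x ∈ TAlg.deg F k V n) :
    TQuot.mk (h.R : Set (TAlg F k V)) x ∈ h.deg n := ⟨x, hx, rfl⟩

/-- The filtration `⨁_{i ≤ n} A_i`. -/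
abbrev fil (n : ℕ) : Submodule F h.A := TQuot.fil _ n

/-- The morphism `A → A[X]` sending a homogeneous element `a` of degree `n` to `a X^n`. -/
def split : h.A →ₐ[F] Polynomial h.A :=
  TQuot.lift ((Polynomial.mapAlgHom (TQuot.mk _)).comp (TAlg.split F k V)) (by
    intro r hr
    have : TQuot.mk (h.R : Set (TAlg F k V)) r = 0 := TQuot.mk_rel _ hr
    simp [TAlg.split_deg (h.R_le hr), this])

/-- The homogeneous component of degree `n` of an element of `A`. -/
def comp (n : ℕ) : h.A →ₗ[F] h.A :=
  (Polynomial.lcoeff h.A n).restrictScalars F ∘ₗ h.split.toLinearMap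

theorem comp_deg {m n : ℕ} {a : h.A} (ha : a ∈ h.deg n) :
    h.comp m a = if m = n then a else 0 := by
  obtain ⟨x, hx, rfl⟩ := ha
  have hx : x ∈ TAlg.deg F k V n := hx
  have : h.split (TQuot.mk _ x) = Polynomial.C (TQuot.mk _ x) * Polynomial.X ^ n := by
    simp [split, TAlg.split_deg hx]
  simp [comp, this, Polynomial.coeff_X_pow]

/-- The augmentation `TV → k` that kills `V`. -/
def augT : TAlg F k V →ₐ[F] k :=
  TAlg.lift (AlgHom.id F k) 0 (by simp) (by simp)

theorem augT_deg {n : ℕ} (hn : n ≠ 0) {x : TAlg F k V} (hx : x ∈ TAlg.deg F k V n) :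
    augT x = 0 := by
  have := TAlg.deg_induction (augT (F := F) (k := k) (V := V))
    (Polynomial.CAlgHom.comp augT) (fun c => by simp) (fun v => by simp [augT]) hx
  have := congrArg (fun p => Polynomial.coeff p 0) this
  simpa [Polynomial.coeff_X_pow, hn.symm] using this

/-- The augmentation `A → k`. -/
def aug : h.A →ₐ[F] k :=
  TQuot.lift augT fun _ hr => augT_deg (by have := h.two_le; omega) (h.R_le hr)

@[simp] theorem aug_unit (c : k) : h.aug (KAlg.unit F _ c) = c := by
  change augT (KAlg.unit F _ c) = c
  simp [augT]

/-- The augmentation as a morphism of bimodules. -/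
def augE : h.A →ₗ[Env F k] k :=
  envLin h.aug.toLinearMap (fun c x => by simp [KAlg.lsm_eq]; rfl)
    (fun c x => by simp [KAlg.rsm_eq]; rfl)

/-- The subbimodule `I_+` of `A` of elements without component of degree zero, which is identified
with `A / k`. -/
def I : Submodule (Env F k) h.A := LinearMap.ker h.augE

/-- The structure morphism `k → A` as a morphism of bimodules. -/
def unitE : k →ₗ[Env F k] h.A :=
  envLin (KAlg.unit F h.A).toLinearMap
    (fun c x => by simp only [KAlg.lsm_eq]; exact map_mul (KAlg.unit F (k := k) h.A) c x)
    (fun c x => by simp only [KAlg.rsm_eq]; exact map_mul (KAlg.unit F (k := k) h.A) x c)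

/-- The projection `A → A / k ≅ I_+`. -/
def p : h.A →ₗ[Env F k] h.I :=
  LinearMap.codRestrict h.I (LinearMap.id - h.unitE ∘ₗ h.augE) (fun a => by
    change h.aug (a - KAlg.unit F _ (h.aug a)) = 0
    simp)

/-- The inclusion `V → A`. -/
def ιA : V →ₗ[Env F k] h.A := h.q ∘ₗ TAlg.ι F k

/-- The inclusion `V → I_+`. -/
def ιI : V →ₗ[Env F k] h.I := h.p ∘ₗ h.ιA

/-- The class in `A / k ≅ I_+` of an element of the tensor algebra. -/
def cls : TAlg F k V →ₗ[Env F k] h.I := h.p ∘ₗ h.q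

/-- The grading of `I_+`. -/
def degI (n : ℕ) : Submodule F h.I :=
  (h.deg n).comap (h.I.subtype.restrictScalars F)

end HomogData
end Quotients

/-! ### Free bimodules -/

section FreeBimodules

variable (F k A W : Type*) [Field F] [Ring k] [Algebra F k] [Ring A] [Algebra F A] [KAlg F k A]
  [AddCommGroup W] [Module F W] [Module (Env F k) W] [IsScalarTower F (Env F k) W]

/-- The `A`-bimodule `A ⊗_k W ⊗_k A`. -/
abbrev FB : Type _ := BT F k A (BT F k W A)

variable {A W} in
/-- The element `a|w|b`. -/
def FB.mk (a : A) (w : W) (b : A) : FB F k A W := BT.mk F k a (BT.mk F k w b)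

theorem FB.hom_ext {Q : Type*} [AddCommGroup Q] [Module F Q] {f g : FB F k A W →ₗ[F] Q}
    (H : ∀ a w b, f (FB.mk F k a w b) = g (FB.mk F k a w b)) : f = g := by
  refine BT.hom_ext (F := F) (k := k) (M := A) (N := BT F k W A) fun a y => ?_
  induction y using BT.induction with
  | zero => 
    have : BT.mk F k a (0 : BT F k W A) = 0 := by
      simpa using BT.mk_smul_right (k := k) (0 : F) a (0 : BT F k W A)
    rw [this]; exact (map_zero f).trans (map_zero g).symm
  | tmul w b => exact H a w b
  | add x y hx hy =>
    rw [BT.mk_add_right]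
    exact (map_add f _ _).trans ((congrArg₂ _ hx hy).trans (map_add g _ _).symm)

/-- Left multiplication `a.(a'|w|b) = aa'|w|b`. -/
def FB.leftHom : A →ₐ[F] Module.End F (FB F k A W) :=
  AlgHom.ofLinearMap
    { toFun := fun a => BT.mapL (LinearMap.mulLeft F a) (fun c m => by
        simp [KAlg.rsm_eq, mul_assoc])
      map_add' := fun a b => BT.hom_ext fun x y => by
        simp [add_mul, BT.mk_add_left]
      map_smul' := fun s a => BT.hom_ext fun x y => by
        simp [BT.mk_smul_left] }
    (BT.hom_ext fun x y => by simp)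
    (fun a b => BT.hom_ext fun x y => by simp)

/-- Right multiplication on the last factor of `W ⊗_k A`. -/
def FB.rightAux (b : A) : BT F k W A →ₗ[F] BT F k W A :=
  BT.mapR (LinearMap.mulRight F b) (fun c m => by simp [KAlg.lsm_eq, mul_assoc])

variable {A W} in
@[simp] theorem FB.rightAux_mk (b : A) (w : W) (a : A) :
    FB.rightAux F k A W b (BT.mk F k w a) = BT.mk F k w (a * b) := rfl

/-- Right multiplication `(a|w|b').b = a|w|b'b`. -/
def FB.rightHom : Aᵐᵒᵖ →ₐ[F] Module.End F (FB F k A W) :=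
  AlgHom.ofLinearMap
    { toFun := fun b => BT.mapR (FB.rightAux F k A W b.unop) (fun c y => by
        induction y using BT.induction with
        | zero => simp
        | tmul w b => simp
        | add x y hx hy => simp only [map_add, hx, hy])
      map_add' := fun a b => FB.hom_ext _ _ _ _ fun x w y => by
        simp [FB.mk, mul_add, BT.mk_add_right]
      map_smul' := fun s a => FB.hom_ext _ _ _ _ fun x w y => by
        simp [FB.mk, BT.mk_smul_right] }
    (FB.hom_ext _ _ _ _ fun x w y => by simp [FB.mk])
    (fun a b => FB.hom_ext _ _ _ _ fun x w y => by simp [FB.mk, mul_assoc])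

instance : Module A (FB F k A W) := Module.compHom _ (FB.leftHom F k A W).toRingHom
instance : Module Aᵐᵒᵖ (FB F k A W) := Module.compHom _ (FB.rightHom F k A W).toRingHom

variable {F k A W}

@[simp] theorem FB.smul_mk (a a' : A) (w : W) (b : A) :
    a • FB.mk F k a' w b = FB.mk F k (a * a') w b := rfl

@[simp] theorem FB.op_smul_mk (a : A) (w : W) (b b' : A) :
    op b • FB.mk F k a w b' = FB.mk F k a w (b' * b) := rfl

end FreeBimodules

section Extension

variable {F k A W M X B Y : Type*} [Field F] [Ring k] [Algebra F k] [Ring A] [Algebra F A] [KAlg F k A]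
  [AddCommGroup W] [Module F W] [Module (Env F k) W] [IsScalarTower F (Env F k) W]
  [AddCommGroup X] [Module F X] [Module (Env F k) X] [IsScalarTower F (Env F k) X]
  [AddCommGroup Y] [Module F Y] [Module (Env F k) Y] [IsScalarTower F (Env F k) Y]
  [Ring B] [Algebra F B] [KAlg F k B]
  [AddCommGroup M] [Module F M] [Module (Env F k) M] [IsScalarTower F (Env F k) M]
  [Module A M] [Module Aᵐᵒᵖ M] [SMulCommClass A Aᵐᵒᵖ M] [IsScalarTower F A M]
  [IsScalarTower F Aᵐᵒᵖ M]

instance : IsScalarTower F A (FB F k A W) where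
  smul_assoc s a x := by
    change FB.leftHom F k A W (s • a) x = s • FB.leftHom F k A W a x
    simp

instance : IsScalarTower F Aᵐᵒᵖ (FB F k A W) where
  smul_assoc s a x := by
    change FB.rightHom F k A W (s • a) x = s • FB.rightHom F k A W a x
    simp

instance : SMulCommClass A Aᵐᵒᵖ (FB F k A W) where
  smul_comm a b x := by
    change FB.leftHom F k A W a (FB.rightHom F k A W b x) =
      FB.rightHom F k A W b (FB.leftHom F k A W a x)
    have : FB.leftHom F k A W a ∘ₗ FB.rightHom F k A W b =
        FB.rightHom F k A W b ∘ₗ FB.leftHom F k A W a :=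
      FB.hom_ext _ _ _ _ fun x w y => rfl
    exact congrArg (fun f => f x) this

/-- Compatibility of the actions of `A` and of `k` on an `A`-bimodule. -/
class ABimod (F k A M : Type*) [Field F] [Ring k] [Algebra F k] [Ring A] [Algebra F A] [KAlg F k A]
    [AddCommGroup M] [Module F M] [Module (Env F k) M] [IsScalarTower F (Env F k) M]
    [Module A M] [Module Aᵐᵒᵖ M] : Prop where
  left : ∀ (c : k) (m : M), lsm F c m = KAlg.unit F A c • m
  right : ∀ (c : k) (m : M), rsm F c m = op (KAlg.unit F A c) • m

instance : ABimod F k A A where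
  left c m := KAlg.lsm_eq F c m
  right c m := KAlg.rsm_eq F c m

instance : ABimod F k A (FB F k A W) where
  left c x := by
    change lsm F c x = FB.leftHom F k A W (KAlg.unit F A c) x
    have : lsm F c = FB.leftHom F k A W (KAlg.unit F A c) :=
      FB.hom_ext _ _ _ _ fun a w b => by
        rw [FB.mk, BT.lsm_mk, KAlg.lsm_eq]; rfl
    exact congrArg (fun f => f x) this
  right c x := by
    change rsm F c x = FB.rightHom F k A W (op (KAlg.unit F A c)) x
    have : rsm F c = FB.rightHom F k A W (op (KAlg.unit F A c)) :=
      FB.hom_ext _ _ _ _ fun a w b => by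
        rw [FB.mk, BT.rsm_mk, BT.rsm_mk, KAlg.rsm_eq]; rfl
    exact congrArg (fun f => f x) this

/-- An additive map commuting with both actions of `k` is a morphism of bimodules. -/
def envMk (f : W → X) (ha : ∀ w w', f (w + w') = f w + f w')
    (hl : ∀ (c : k) w, f (lsm F c w) = lsm F c (f w))
    (hr : ∀ (c : k) w, f (rsm F c w) = rsm F c (f w)) : W →ₗ[Env F k] X :=
  envLin ⟨⟨f, ha⟩, fun s w => by
    simp only [RingHom.id_apply]
    rw [← lsm_algebraMap (k := k), hl, lsm_algebraMap]⟩ hl hr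

section
variable [ABimod F k A M]

/-- Auxiliary map `w ⊗ b ↦ ψ(w).b`. -/
def extAux (ψ : W →ₗ[Env F k] M) : BT F k W A →ₗ[F] M :=
  BT.liftF (fun w b => op b • ψ w) (by intros; simp)
    (fun s w b => by
      have : ψ (s • w) = s • ψ w := (ψ.restrictScalars F).map_smul s w
      rw [this, smul_comm])
    (by intros; simp [add_smul])
    (fun w c b => by
      rw [map_rsm, ABimod.right (A := A), KAlg.lsm_eq, smul_smul, ← op_mul])

/-- The unique extension `ψ^~ : A ⊗ W ⊗ A → M`, `a|w|b ↦ a.ψ(w).b`, of a morphism of `k`-bimodules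
`ψ : W → M` to a morphism of `A`-bimodules. -/
def ext (ψ : W →ₗ[Env F k] M) : FB F k A W →ₗ[F] M :=
  BT.liftF (fun a y => a • extAux ψ y) (by intros; simp [add_smul]) (by intros; simp)
    (by intros; simp)
    (fun a c y => by
      rw [KAlg.rsm_eq, mul_smul]
      congr 1
      induction y using BT.induction with
      | zero => simp
      | tmul w b =>
        simp only [extAux, BT.lsm_mk, BT.liftF_mk, map_lsm]
        rw [ABimod.left (A := A), smul_comm]
      | add x y hx hy => simp only [map_add, smul_add, hx, hy])

@[simp] theorem ext_mk (ψ : W →ₗ[Env F k] M) (a : A) (w : W) (b : A) :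
    ext ψ (FB.mk F k a w b) = a • op b • ψ w := rfl

end

variable (F k A W X) in
/-- Morphisms of `A`-bimodules `A ⊗ W ⊗ A → A ⊗ X ⊗ A`. -/
structure BimodHom where
  /-- The underlying map. -/
  toLin : FB F k A W →ₗ[F] FB F k A X
  map_smul : ∀ (a : A) x, toLin (a • x) = a • toLin x
  map_op_smul : ∀ (b : A) x, toLin (op b • x) = op b • toLin x

instance : CoeFun (BimodHom F k A W X) (fun _ => FB F k A W → FB F k A X) := ⟨fun f => f.toLin⟩

/-- The map `x ⊗ w ↦ j(x)|w|1`. -/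
def genL (j : X →ₗ[Env F k] A) : BT F k X W →ₗ[Env F k] FB F k A W :=
  BT.lift (fun x w => FB.mk F k (j x) w 1) (by intros; simp [FB.mk, BT.mk_add_left])
    (by intros; simp [FB.mk, BT.mk_add_left, BT.mk_add_right])
    (by intros; simp [FB.mk, map_rsm, BT.mk_bal])
    (by intros; simp [FB.mk, map_lsm])
    (by intros; simp [FB.mk, BT.mk_bal, KAlg.lsm_eq, KAlg.rsm_eq])

/-- The map `w ⊗ x ↦ 1|w|j(x)`. -/
def genR (j : X →ₗ[Env F k] A) : BT F k W X →ₗ[Env F k] FB F k A W :=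
  BT.lift (fun w x => FB.mk F k 1 w (j x)) (by intros; simp [FB.mk, BT.mk_add_left, BT.mk_add_right])
    (by intros; simp [FB.mk, BT.mk_add_right])
    (by intros; simp [FB.mk, map_lsm, BT.mk_bal])
    (by intros; simp only [FB.mk, BT.lsm_mk]; rw [← BT.lsm_mk, ← BT.mk_bal]; simp [KAlg.lsm_eq, KAlg.rsm_eq])
    (by intros; simp [FB.mk, map_rsm])

/-- The map `w ↦ 1|w|1`. -/
def gen : W →ₗ[Env F k] FB F k A W :=
  envMk (fun w => FB.mk F k 1 w 1) (by intros; simp [FB.mk, BT.mk_add_left, BT.mk_add_right])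
    (by intros; simp only [FB.mk, BT.lsm_mk]; rw [← BT.lsm_mk, ← BT.mk_bal]; simp [KAlg.lsm_eq, KAlg.rsm_eq])
    (by intros; simp [FB.mk, BT.mk_bal, KAlg.lsm_eq, KAlg.rsm_eq])

/-- The map `x ↦ j(x)|1|1 - 1|1|j(x)` to `A ⊗_k k ⊗_k A`, i.e. to `A ⊗_k A`. -/
def genD (j : X →ₗ[Env F k] A) : X →ₗ[Env F k] FB F k A k :=
  envMk (fun x => FB.mk F k (j x) 1 1)
    (by intros; simp [FB.mk, BT.mk_add_left]) (by intros; simp [FB.mk, map_lsm])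
    (by
      intro c x
      have h1 : rsm F c (1 : k) = lsm F c (1 : k) := by simp [KAlg.lsm_eq, KAlg.rsm_eq]
      have h2 : rsm F c (1 : A) = lsm F c (1 : A) := by simp [KAlg.lsm_eq, KAlg.rsm_eq]
      simp only [FB.mk, map_rsm, BT.mk_bal, BT.lsm_mk, BT.rsm_mk, h2]
      rw [← BT.mk_bal, h1]) -
  envMk (fun x => FB.mk F k 1 1 (j x))
    (by intros; simp [FB.mk, BT.mk_add_right])
    (by
      intro c x
      have h1 : rsm F c (1 : k) = lsm F c (1 : k) := by simp [KAlg.lsm_eq, KAlg.rsm_eq]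
      have h2 : rsm F c (1 : A) = lsm F c (1 : A) := by simp [KAlg.lsm_eq, KAlg.rsm_eq]
      simp only [FB.mk, map_lsm, BT.lsm_mk, ← h2, BT.mk_bal]
      rw [← BT.mk_bal, h1])
    (by intros; simp [FB.mk, map_rsm])

/-- The map `x ⊗ y ↦ j(x) j'(y)` to a `k`-algebra. -/
def mulMap (j : X →ₗ[Env F k] B) (j' : Y →ₗ[Env F k] B) : BT F k X Y →ₗ[Env F k] B :=
  BT.lift (fun x y => j x * j' y) (by intros; simp [add_mul]) (by intros; simp [mul_add])
    (by intros; simp [map_rsm, map_lsm, KAlg.rsm_eq, KAlg.lsm_eq, mul_assoc])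
    (by intros; simp [map_lsm, KAlg.lsm_eq, mul_assoc])
    (by intros; simp [map_rsm, KAlg.rsm_eq, mul_assoc])

end Extension

/-! ### The normalized bar resolution -/

section Resolutions

variable {F k V : Type*} [Field F] [Ring k] [Algebra F k]
  [AddCommGroup V] [Module F V] [Module (Env F k) V] [IsScalarTower F (Env F k) V]

namespace HomogData

variable (h : HomogData F k V)

/-- `I_+ ⊗_k I_+`. -/
abbrev I2 : Type _ := BT F k h.I h.I

/-- `I_+ ⊗_k I_+ ⊗_k I_+`. -/
abbrev I3 : Type _ := BT F k h.I h.I2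

/-- `I_+ ⊗_k I_+ ⊗_k I_+ ⊗_k I_+`. -/
abbrev I4 : Type _ := BT F k h.I h.I3

/-- The product `I_+ ⊗ I_+ → I_+`. -/
def μ : h.I2 →ₗ[Env F k] h.I :=
  LinearMap.codRestrict h.I (mulMap h.I.subtype h.I.subtype) (fun x => by
    change h.aug _ = 0
    induction x using BT.induction with
    | zero => simp
    | tmul a b =>
      have ha : h.aug a.1 = 0 := a.2
      have : h.aug (a.1 * b.1) = 0 := by rw [map_mul, ha, zero_mul]
      exact this
    | add x y hx hy => rw [map_add, map_add, hx, hy, add_zero])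

/-- `a ⊗ b ⊗ c ↦ ab ⊗ c`. -/
def m31 : h.I3 →ₗ[Env F k] h.I2 := BT.map h.μ LinearMap.id ∘ₗ BT.assoc

/-- `a ⊗ b ⊗ c ↦ a ⊗ bc`. -/
def m32 : h.I3 →ₗ[Env F k] h.I2 := BT.map LinearMap.id h.μ

/-- `a ⊗ b ⊗ c ⊗ d ↦ ab ⊗ c ⊗ d`. -/
def m41 : h.I4 →ₗ[Env F k] h.I3 := BT.map h.μ LinearMap.id ∘ₗ BT.assoc

/-- `a ⊗ b ⊗ c ⊗ d ↦ a ⊗ bc ⊗ d`. -/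
def m42 : h.I4 →ₗ[Env F k] h.I3 := BT.map LinearMap.id h.m31

/-- `a ⊗ b ⊗ c ⊗ d ↦ a ⊗ b ⊗ cd`. -/
def m43 : h.I4 →ₗ[Env F k] h.I3 := BT.map LinearMap.id h.m32

/-- The grading of `I_+ ⊗ I_+`. -/
def degI2 : ℕ → Submodule F h.I2 := BT.deg h.degI h.degI

/-- The grading of `I_+ ⊗ I_+ ⊗ I_+`. -/
def degI3 : ℕ → Submodule F h.I3 := BT.deg h.degI h.degI2

/-- The grading of `I_+ ⊗ I_+ ⊗ I_+ ⊗ I_+`. -/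
def degI4 : ℕ → Submodule F h.I4 := BT.deg h.degI h.degI3

/-- `Tor_3^A(k,k)` is concentrated in degree `N + 1`.  Here `Tor_•^A(k,k)` is the homology of the
complex `I_+^{⊗ •} = k ⊗_A (A ⊗_k I_+^{⊗ •} ⊗_k A) ⊗_A k` obtained from the normalized bar
resolution, with differentials `a ⊗ b ⊗ c ↦ ab ⊗ c - a ⊗ bc` and
`a ⊗ b ⊗ c ⊗ d ↦ ab ⊗ c ⊗ d - a ⊗ bc ⊗ d + a ⊗ b ⊗ cd` (up to a global sign). -/
def TorThreeConcentrated : Prop :=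
  ∀ m : ℕ, m ≠ h.N + 1 → ∀ x ∈ h.degI3 m, h.m31 x - h.m32 x = 0 →
    ∃ y : h.I4, h.m41 y - h.m42 y + h.m43 y = x

/-- The differential `A ⊗ I_+ ⊗ A → A ⊗ A` of the normalized bar resolution. -/
def b1 : FB F k h.A h.I →ₗ[F] FB F k h.A k :=
  ext (genD (F := F) (k := k) (X := h.I) h.I.subtype)

/-- `1|a|b|1 ↦ a|b|1 - 1|ab|1 + 1|a|b`. -/
def b2 : FB F k h.A h.I2 →ₗ[F] FB F k h.A h.I :=
  ext (genL h.I.subtype - gen ∘ₗ h.μ + genR h.I.subtype)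

/-- `1|a|b|c|1 ↦ a|b|c|1 - 1|ab|c|1 + 1|a|bc|1 - 1|a|b|c`. -/
def b3 : FB F k h.A h.I3 →ₗ[F] FB F k h.A h.I2 :=
  ext (genL h.I.subtype - gen ∘ₗ h.m31 + gen ∘ₗ h.m32 - genR h.I.subtype ∘ₗ BT.assoc)

/-- `1|a|b|c|d|1 ↦ a|b|c|d|1 - 1|ab|c|d|1 + 1|a|bc|d|1 - 1|a|b|cd|1 + 1|a|b|c|d`. -/
def b4 : FB F k h.A h.I4 →ₗ[F] FB F k h.A h.I3 :=
  ext (genL h.I.subtype - gen ∘ₗ h.m41 + gen ∘ₗ h.m42 - gen ∘ₗ h.m43 +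
    genR h.I.subtype ∘ₗ BT.assoc ∘ₗ BT.map LinearMap.id BT.assoc)

/-! ### The beginning of the bimodule Koszul complex -/

/-- The algebra morphism `x ↦ (x, ∑ x₁|x₂|x₃)`, the sum being over the decompositions of `x` with
`x₂` of degree one. -/
def decompHom : TAlg F k V →ₐ[F] TrivSqZeroExt h.A (FB F k h.A V) :=
  TAlg.lift ((TrivSqZeroExt.inlAlgHom F h.A (FB F k h.A V)).comp (KAlg.unit F h.A))
    ((TrivSqZeroExt.inlAlgHom F h.A (FB F k h.A V)).toLinearMap ∘ₗ h.ιA.restrictScalars F +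
      (TrivSqZeroExt.inrHom h.A (FB F k h.A V)).restrictScalars F ∘ₗ gen.restrictScalars F)
    (fun c v => by
      ext
      · simp [map_lsm, KAlg.lsm_eq]
      · simp [map_lsm, ABimod.left (A := h.A) (M := FB F k h.A V)])
    (fun c v => by
      ext
      · simp [map_rsm, KAlg.rsm_eq]
      · simp [map_rsm, ABimod.right (A := h.A) (M := FB F k h.A V)])

/-- The map `x ↦ ∑ x₁|x₂|x₃`, the sum being over all decompositions of `x` in three factors with
`x₂` of degree one; so `v₁ ⋯ v_n ↦ ∑_i v₁⋯v_{i-1}|v_i|v_{i+1}⋯v_n`. -/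
def decomp : TAlg F k V →ₗ[Env F k] FB F k h.A V :=
  envMk (fun x => (h.decompHom x).snd) (by intros; simp)
    (fun c x => by
      rw [ABimod.left (A := h.A) (M := FB F k h.A V), KAlg.lsm_eq]
      simp [decompHom])
    (fun c x => by
      rw [ABimod.right (A := h.A) (M := FB F k h.A V), KAlg.rsm_eq]
      simp [decompHom])

/-- The subbimodule `R ⊗ V` of `TV`, as an abstract tensor product. -/
abbrev RV : Type _ := BT F k h.R V

/-- The subbimodule `V ⊗ R` of `TV`, as an abstract tensor product. -/
abbrev VR : Type _ := BT F k V h.R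

/-- The inclusion `R ⊗ V → TV`. -/
def mulRV : h.RV →ₗ[Env F k] TAlg F k V := mulMap h.R.subtype (TAlg.ι F k)

/-- The inclusion `V ⊗ R → TV`. -/
def mulVR : h.VR →ₗ[Env F k] TAlg F k V := mulMap (TAlg.ι F k) h.R.subtype

/-- `R_{N+1} = (R ⊗ V) ∩ (V ⊗ R)`: the pairs formed by an element of `R ⊗ V` and an element of
`V ⊗ R` with the same image in `TV`. -/
def RN1 : Submodule (Env F k) (h.RV × h.VR) :=
  LinearMap.eqLocus (h.mulRV ∘ₗ LinearMap.fst _ _ _) (h.mulVR ∘ₗ LinearMap.snd _ _ _)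

/-- The inclusion `R_{N+1} → R ⊗ V`. -/
def toRV : h.RN1 →ₗ[Env F k] h.RV := LinearMap.fst _ _ _ ∘ₗ h.RN1.subtype

/-- The inclusion `R_{N+1} → V ⊗ R`. -/
def toVR : h.RN1 →ₗ[Env F k] h.VR := LinearMap.snd _ _ _ ∘ₗ h.RN1.subtype

/-- `d₁(1|v|1) = v|1 - 1|v`. -/
def d1 : FB F k h.A V →ₗ[F] FB F k h.A k := ext (genD h.ιA)

/-- `d₂(1|r|1) = ∑ r₁|r₂|r₃`. -/
def d2 : FB F k h.A h.R →ₗ[F] FB F k h.A V := ext (h.decomp ∘ₗ h.R.subtype)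

/-- `d₃(1|w|1) = ∑ v_i|s_i|1 - ∑ 1|r_i|u_i` for `w = ∑ r_i u_i = ∑ v_i s_i`, with `r_i, s_i ∈ R`
and `u_i, v_i ∈ V`. -/
def d3 : FB F k h.A h.RN1 →ₗ[F] FB F k h.A h.R :=
  ext (genL h.ιA ∘ₗ h.toVR - genR h.ιA ∘ₗ h.toRV)

/-! ### Comparison of the two resolutions -/

/-- `a|v|b ↦ (a ⊗ v) ⊗ b`, with `a` and `v` seen in `A / k ≅ I_+`. -/
def regroup : FB F k h.A V →ₗ[Env F k] BT F k h.I2 h.A :=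
  BT.map (BT.map h.p h.ιI) LinearMap.id ∘ₗ BT.assoc

/-- `σ₁(1|v|1) = 1|v|1`. -/
def σ1 : FB F k h.A V →ₗ[F] FB F k h.A h.I := ext (gen ∘ₗ h.ιI)

/-- `x ↦ ∑ 1|x₁|x₂|x₃`, the sum being over the decompositions of `x` with `x₂` of degree one. -/
def split2 : TAlg F k V →ₗ[Env F k] FB F k h.A h.I2 :=
  genR LinearMap.id ∘ₗ h.regroup ∘ₗ h.decomp

/-- `a ⊗ y ↦ ∑ 1|a|y₁|y₂|y₃`, the sum being over the decompositions of `y` with `y₂` of degree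
one. -/
def split3 : BT F k h.I (TAlg F k V) →ₗ[Env F k] FB F k h.A h.I3 :=
  genR LinearMap.id ∘ₗ BT.assoc ∘ₗ BT.map LinearMap.id (h.regroup ∘ₗ h.decomp)

/-- `a ⊗ b ⊗ z ↦ ∑ 1|a|b|z₁|z₂|z₃`, the sum being over the decompositions of `z` with `z₂` of
degree one. -/
def split4 : BT F k h.I (BT F k h.I (TAlg F k V)) →ₗ[Env F k] FB F k h.A h.I4 :=
  genR LinearMap.id ∘ₗ BT.assoc ∘ₗ
    BT.map LinearMap.id (BT.assoc ∘ₗ BT.map LinearMap.id (h.regroup ∘ₗ h.decomp))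

/-- `σ₂(1|r|1) = ∑ 1|r₁|r₂|r₃`. -/
def σ2 : FB F k h.A h.R →ₗ[F] FB F k h.A h.I2 := ext (h.split2 ∘ₗ h.R.subtype)

/-- `σ₃(1|w|1) = ∑ 1|v_i|s_{i,1}|s_{i,2}|s_{i,3}` for `w = ∑ v_i s_i`. -/
def σ3 : FB F k h.A h.RN1 →ₗ[F] FB F k h.A h.I3 :=
  ext (h.split3 ∘ₗ BT.map h.ιI h.R.subtype ∘ₗ h.toVR)

/-- The grading of `A ⊗ W ⊗ A`, for a given grading of `W`. -/
def degFB {W : Type*} [AddCommGroup W] [Module F W] [Module (Env F k) W]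
    [IsScalarTower F (Env F k) W] (GW : ℕ → Submodule F W) : ℕ → Submodule F (FB F k h.A W) :=
  BT.deg h.deg (BT.deg GW h.deg)

/-- A morphism of `A`-bimodules `A ⊗ W ⊗ A → A ⊗ X ⊗ A` of degree zero, for given gradings of `W`
and `X`. -/
def IsGradedHom {W X : Type*} [AddCommGroup W] [Module F W] [Module (Env F k) W]
    [IsScalarTower F (Env F k) W] [AddCommGroup X] [Module F X] [Module (Env F k) X]
    [IsScalarTower F (Env F k) X] (GW : ℕ → Submodule F W) (GX : ℕ → Submodule F X)
    (f : BimodHom F k h.A W X) : Prop :=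
  ∀ n, ∀ x ∈ h.degFB GW n, f x ∈ h.degFB GX n

/-- The element `1|w|1` of `A ⊗ W ⊗ A`. -/
def bar {W : Type*} [AddCommGroup W] [Module F W] [Module (Env F k) W]
    [IsScalarTower F (Env F k) W] (w : W) : FB F k h.A W := gen w

/-- The class of `x ⊗ y` in `I_+ ⊗ I_+`, for `x`, `y` in `TV`. -/
def cls2 (x y : TAlg F k V) : h.I2 := BT.mk F k (h.cls x) (h.cls y)

/-- The class of `x ⊗ y ⊗ z` in `I_+ ⊗ I_+ ⊗ I_+`, for `x`, `y`, `z` in `TV`. -/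
def cls3 (x y z : TAlg F k V) : h.I3 := BT.mk F k (h.cls x) (h.cls2 y z)

/-- The families `(x_i, y_i)` of homogeneous elements of `TV` of positive degrees summing to `N`
with `∑ x_i y_i = r`: their classes `∑ x_i ⊗ y_i` are the relation decompositions of `r`. -/
def IsRelDecomp2 (r : TAlg F k V) {n : ℕ} (x y : Fin n → TAlg F k V) : Prop :=
  (∀ i, ∃ a b, 0 < a ∧ 0 < b ∧ a + b = h.N ∧ x i ∈ TAlg.deg F k V a ∧ y i ∈ TAlg.deg F k V b) ∧
  ∑ i, x i * y i = r

/-- Similarly, the relation decompositions `∑ x_i ⊗ y_i ⊗ z_i` of `r`. -/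
def IsRelDecomp3 (r : TAlg F k V) {n : ℕ} (x y z : Fin n → TAlg F k V) : Prop :=
  (∀ i, ∃ a b c, 0 < a ∧ 0 < b ∧ 0 < c ∧ a + b + c = h.N ∧ x i ∈ TAlg.deg F k V a ∧
    y i ∈ TAlg.deg F k V b ∧ z i ∈ TAlg.deg F k V c) ∧
  ∑ i, x i * y i * z i = r

/-- The double relation decompositions `∑ x_i ⊗ y_i ⊗ z_i` of `w ∈ R_{N+1}`: here `x_i` and `z_i`
have degree `1` and `y_i` has degree `N - 1`. -/
def IsDoubleRelDecomp (w : TAlg F k V) {n : ℕ} (x y z : Fin n → TAlg F k V) : Prop :=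
  (∀ i, x i ∈ TAlg.deg F k V 1 ∧ y i ∈ TAlg.deg F k V (h.N - 1) ∧ z i ∈ TAlg.deg F k V 1) ∧
  ∑ i, x i * y i * z i = w

/-- Families `(τ_1, τ_2, τ_3, s_1, s_2, s_3)` of morphisms of bimodules, where `τ_n` goes from the
normalized bar resolution to the Koszul complex and `s_n` raises the homological degree in the
normalized bar resolution.  Moreover, `τ_0` is the identity and `s_0 = 0`. -/
def ComparisonMaps : Type _ :=
  BimodHom F k h.A h.I V × BimodHom F k h.A h.I2 h.R × BimodHom F k h.A h.I3 h.RN1 ×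
  BimodHom F k h.A h.I h.I2 × BimodHom F k h.A h.I2 h.I3 × BimodHom F k h.A h.I3 h.I4

namespace ComparisonMaps

variable {h} (c : h.ComparisonMaps)

/-- `τ_1`. -/
def τ1 : BimodHom F k h.A h.I V := c.1
/-- `τ_2`. -/
def τ2 : BimodHom F k h.A h.I2 h.R := c.2.1
/-- `τ_3`. -/
def τ3 : BimodHom F k h.A h.I3 h.RN1 := c.2.2.1
/-- `s_1`. -/
def s1 : BimodHom F k h.A h.I h.I2 := c.2.2.2.1
/-- `s_2`. -/
def s2 : BimodHom F k h.A h.I2 h.I3 := c.2.2.2.2.1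
/-- `s_3`. -/
def s3 : BimodHom F k h.A h.I3 h.I4 := c.2.2.2.2.2

/-- All maps have degree zero. -/
def IsGraded : Prop :=
  h.IsGradedHom h.degI (pureDeg F V 1) c.τ1 ∧
  h.IsGradedHom h.degI2 (pureDeg F h.R h.N) c.τ2 ∧
  h.IsGradedHom h.degI3 (pureDeg F h.RN1 (h.N + 1)) c.τ3 ∧
  h.IsGradedHom h.degI h.degI2 c.s1 ∧
  h.IsGradedHom h.degI2 h.degI3 c.s2 ∧
  h.IsGradedHom h.degI3 h.degI4 c.s3

/-- The `τ_n` form a morphism of complexes, in degrees `≤ 3`. -/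
def IsChainMap : Prop :=
  (∀ x, h.b1 x = h.d1 (c.τ1 x)) ∧
  (∀ x, c.τ1 (h.b2 x) = h.d2 (c.τ2 x)) ∧
  (∀ x, c.τ2 (h.b3 x) = h.d3 (c.τ3 x))

/-- The `s_n` form a homotopy between `σ τ` and the identity, in degrees `≤ 3`. -/
def IsHomotopy : Prop :=
  (∀ x, h.b2 (c.s1 x) = x - h.σ1 (c.τ1 x)) ∧
  (∀ x, h.b3 (c.s2 x) + c.s1 (h.b2 x) = x - h.σ2 (c.τ2 x)) ∧
  (∀ x, h.b4 (c.s3 x) + c.s2 (h.b3 x) = x - h.σ3 (c.τ3 x))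

/-- The prescribed values on `1|a|1` with `deg a < N`: `τ_1(1|a|1) = ∑ a₁|a₂|a₃` and
`s_1(1|a|1) = - ∑ 1|a₁|a₂|a₃`. -/
def Values1 : Prop :=
  ∀ a < h.N, ∀ x ∈ TAlg.deg F k V a,
    c.τ1 (h.bar (h.cls x)) = h.decomp x ∧ c.s1 (h.bar (h.cls x)) = -h.split2 x

/-- The prescribed values on normalized elements `1|a|b|1`: `τ_2(1|a|b|1) = 0` and
`s_2(1|a|b|1) = ∑ 1|a|b₁|b₂|b₃`. -/
def Norm2 : Prop :=
  ∀ a b, 0 < a → 0 < b → a + b < h.N →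
    ∀ x ∈ TAlg.deg F k V a, ∀ y ∈ TAlg.deg F k V b,
      c.τ2 (h.bar (h.cls2 x y)) = 0 ∧
      c.s2 (h.bar (h.cls2 x y)) = h.split3 (BT.mk F k (h.cls x) y)

/-- The prescribed values on relation decompositions `∑ 1|a_i|b_i|1` of `r`, namely
`τ_2(∑ 1|a_i|b_i|1) = 1|r|1` and `s_2(∑ 1|a_i|b_i|1) = ∑ 1|a_i|b_{i,1}|b_{i,2}|b_{i,3}`. -/
def Rel2 : Prop :=
  ∀ (r : h.R) (n : ℕ) (x y : Fin n → TAlg F k V), h.IsRelDecomp2 r x y →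
    c.τ2 (h.bar (∑ i, h.cls2 (x i) (y i))) = h.bar r ∧
    c.s2 (h.bar (∑ i, h.cls2 (x i) (y i))) = h.split3 (∑ i, BT.mk F k (h.cls (x i)) (y i))

/-- The prescribed values on normalized elements `1|a|b|c|1`: `τ_3(1|a|b|c|1) = 0` and
`s_3(1|a|b|c|1) = - ∑ 1|a|b|c₁|c₂|c₃`. -/
def Norm3 : Prop :=
  ∀ a b d, 0 < a → 0 < b → 0 < d → a + b + d < h.N →
    ∀ x ∈ TAlg.deg F k V a, ∀ y ∈ TAlg.deg F k V b, ∀ z ∈ TAlg.deg F k V d,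
      c.τ3 (h.bar (h.cls3 x y z)) = 0 ∧
      c.s3 (h.bar (h.cls3 x y z)) = -h.split4 (BT.mk F k (h.cls x) (BT.mk F k (h.cls y) z))

/-- The prescribed values on relation decompositions `∑ 1|a_i|b_i|c_i|1`: here
`τ_3(∑ 1|a_i|b_i|c_i|1) = 0` and
`s_3(∑ 1|a_i|b_i|c_i|1) = - ∑ 1|a_i|b_i|c_{i,1}|c_{i,2}|c_{i,3}`. -/
def Rel3 : Prop :=
  ∀ (r : h.R) (n : ℕ) (x y z : Fin n → TAlg F k V), h.IsRelDecomp3 r x y z →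
    c.τ3 (h.bar (∑ i, h.cls3 (x i) (y i) (z i))) = 0 ∧
    c.s3 (h.bar (∑ i, h.cls3 (x i) (y i) (z i))) =
      -h.split4 (∑ i, BT.mk F k (h.cls (x i)) (BT.mk F k (h.cls (y i)) (z i)))

/-- The prescribed values on double relation decompositions `∑ 1|a_i|b_i|c_i|1` of `w`: here
`τ_3(∑ 1|a_i|b_i|c_i|1) = 1|w|1` and
`s_3(∑ 1|a_i|b_i|c_i|1) = - ∑ 1|a_i|b_i|c_{i,1}|c_{i,2}|c_{i,3}`. -/
def DoubleRel3 : Prop :=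
  ∀ (w : h.RN1) (n : ℕ) (x y z : Fin n → TAlg F k V),
    h.IsDoubleRelDecomp (h.mulRV (h.toRV w)) x y z →
    c.τ3 (h.bar (∑ i, h.cls3 (x i) (y i) (z i))) = h.bar w ∧
    c.s3 (h.bar (∑ i, h.cls3 (x i) (y i) (z i))) =
      -h.split4 (∑ i, BT.mk F k (h.cls (x i)) (BT.mk F k (h.cls (y i)) (z i)))

end ComparisonMaps

/-- `c` consists of comparison morphisms and homotopies of graded bimodules that have the
prescribed values on normalized elements and on (double) relation decompositions. -/
def IsComparison (c : h.ComparisonMaps) : Prop :=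
  c.IsGraded ∧ c.IsChainMap ∧ c.IsHomotopy ∧ c.Values1 ∧ c.Norm2 ∧ c.Rel2 ∧ c.Norm3 ∧ c.Rel3 ∧
    c.DoubleRel3

end HomogData
end Resolutions

/-! ### Filtered algebras and PBW-deformations -/

section Filtered

variable {F M M' : Type*} [Field F] [AddCommGroup M] [Module F M] [AddCommGroup M'] [Module F M']

/-- The step `Fil^{n-1}` of a filtration, which is zero for `n = 0`. -/
def lower (Fil : ℕ → Submodule F M) (n : ℕ) : Submodule F M := ⨆ i < n, Fil i

/-- The component `Fil^n / Fil^{n-1}` of the associated graded object of a filtration. -/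
abbrev Gr (Fil : ℕ → Submodule F M) (n : ℕ) : Type _ :=
  Fil n ⧸ (lower Fil n).comap (Fil n).subtype

/-- The class in the associated graded object. -/
abbrev Gr.mk {Fil : ℕ → Submodule F M} {n : ℕ} : Fil n →ₗ[F] Gr Fil n := Submodule.mkQ _

theorem lower_map {Fil : ℕ → Submodule F M} {Fil' : ℕ → Submodule F M'} (f : M →ₗ[F] M')
    (hf : ∀ n, (Fil n).map f ≤ Fil' n) (n : ℕ) : (lower Fil n).map f ≤ lower Fil' n := by
  simp only [lower, Submodule.map_iSup]
  exact iSup₂_mono fun i _ => hf i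

/-- The component of degree `n` of the morphism induced by a filtered map between the associated
graded objects. -/
def Gr.map {Fil : ℕ → Submodule F M} {Fil' : ℕ → Submodule F M'} (f : M →ₗ[F] M')
    (hf : ∀ n, (Fil n).map f ≤ Fil' n) (n : ℕ) : Gr Fil n →ₗ[F] Gr Fil' n :=
  Submodule.mapQ _ _ (f.restrict fun x hx => hf n ⟨x, hx, rfl⟩) (by
    rintro ⟨x, hx⟩ h
    exact lower_map f hf n ⟨x, h, rfl⟩)

theorem lower_mono (Fil : ℕ → Submodule F M) {i n : ℕ} (h : i < n) : Fil i ≤ lower Fil n :=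
  le_iSup₂_of_le i h le_rfl

end Filtered

section Deformations

variable {F k V : Type*} [Field F] [Ring k] [Algebra F k]
  [AddCommGroup V] [Module F V] [Module (Env F k) V] [IsScalarTower F (Env F k) V]

namespace TAlg

theorem mul_ι_mem {m : ℕ} {x : TAlg F k V} (hx : x ∈ deg F k V m) (v : V) :
    x * ι F k v ∈ deg F k V (m + 1) := by
  induction hx using Submodule.span_induction generalizing v with
  | mem x h =>
    obtain ⟨l, rfl, rfl⟩ := h
    exact Submodule.subset_span ⟨l ++ [v], by simp, by simp⟩
  | zero => simp
  | add x y _ _ hx hy => rw [add_mul]; exact add_mem (hx v) (hy v)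
  | smul e x _ hx =>
    induction e using TensorProduct.induction_on with
    | zero =>
      have := zero_smul (Env F k) x
      rw [show ((0 : k ⊗[F] kᵐᵒᵖ) • x : TAlg F k V) = 0 from this]
      simp
    | tmul c d =>
      have h := env_smul_eq (F := F) c d.unop x
      rw [op_unop, KAlg.lsm_eq, KAlg.rsm_eq] at h
      rw [h, mul_assoc, mul_assoc, ← KAlg.lsm_eq F d.unop (ι F k v), ← map_lsm, ← KAlg.lsm_eq]
      exact Submodule.smul_mem _ _ (hx _)
    | add a b ha hb =>
      have := add_smul (a : Env F k) b x
      rw [this, add_mul]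
      exact add_mem ha hb

theorem deg_mul {m n : ℕ} {x y : TAlg F k V} (hx : x ∈ deg F k V m) (hy : y ∈ deg F k V n) :
    x * y ∈ deg F k V (m + n) := by
  induction hy using Submodule.span_induction generalizing x with
  | mem y h =>
    obtain ⟨l, rfl, rfl⟩ := h
    clear * - hx
    induction l generalizing x m with
    | nil => simpa using hx
    | cons v l ih =>
      have := ih (mul_ι_mem hx v)
      simp only [List.map_cons, List.prod_cons, List.length_cons, ← mul_assoc]
      rwa [show m + (l.length + 1) = m + 1 + l.length by omega]
  | zero => simp
  | add y z _ _ hy hz => rw [mul_add]; exact add_mem (hy hx) (hz hx)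
  | smul e y _ hy =>
    induction e using TensorProduct.induction_on with
    | zero =>
      have := zero_smul (Env F k) y
      rw [show ((0 : k ⊗[F] kᵐᵒᵖ) • y : TAlg F k V) = 0 from this]
      simp
    | tmul c d =>
      have h := env_smul_eq (F := F) c d.unop y
      rw [op_unop, KAlg.lsm_eq, KAlg.rsm_eq] at h
      have hx' : rsm F c x ∈ deg F k V m := Submodule.smul_mem _ _ hx
      rw [KAlg.rsm_eq] at hx'
      rw [h, ← mul_assoc, ← mul_assoc, ← KAlg.rsm_eq F d.unop]
      exact Submodule.smul_mem _ _ (hy hx')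
    | add a b ha hb =>
      have := add_smul (a : Env F k) b y
      rw [this, mul_add]
      exact add_mem ha hb

theorem fil_mul {m n : ℕ} {x y : TAlg F k V} (hx : x ∈ fil F k V m) (hy : y ∈ fil F k V n) :
    x * y ∈ fil F k V (m + n) := by
  refine Submodule.iSup_induction' (p := fun i => ⨆ (_ : i ≤ m), deg F k V i)
    (motive := fun x _ => x * y ∈ fil F k V (m + n)) ?_ (by simp)
    (fun a b _ _ ha hb => by rw [add_mul]; exact add_mem ha hb) hx
  intro i x hx
  by_cases hi : i ≤ m
  swap
  · simp only [hi, iSup_false, Submodule.mem_bot] at hx; simp [hx]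
  simp only [hi, iSup_true] at hx
  refine Submodule.iSup_induction' (p := fun j => ⨆ (_ : j ≤ n), deg F k V j)
    (motive := fun y _ => x * y ∈ fil F k V (m + n)) ?_ (by simp)
    (fun a b _ _ ha hb => by rw [mul_add]; exact add_mem ha hb) hy
  intro j y hy
  by_cases hj : j ≤ n
  swap
  · simp only [hj, iSup_false, Submodule.mem_bot] at hy; simp [hy]
  simp only [hj, iSup_true] at hy
  exact deg_le_fil (by omega) (deg_mul hx hy)

end TAlg

namespace TQuot

variable (S : Set (TAlg F k V))

theorem fil_mul {m n : ℕ} {x y : TQuot F k V S} (hx : x ∈ fil S m) (hy : y ∈ fil S n) :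
    x * y ∈ fil S (m + n) := by
  obtain ⟨x, hx, rfl⟩ := hx
  obtain ⟨y, hy, rfl⟩ := hy
  exact ⟨x * y, TAlg.fil_mul hx hy, map_mul (TQuot.mk S) x y⟩

theorem mk_mem_fil {n : ℕ} {x : TAlg F k V} (hx : x ∈ TAlg.fil F k V n) :
    TQuot.mk S x ∈ fil S n := ⟨x, hx, rfl⟩

theorem unit_mem_fil (c : k) (n : ℕ) : KAlg.unit F (TQuot F k V S) c ∈ fil S n := by
  rw [← mk_unit]
  refine mk_mem_fil S (TAlg.deg_le_fil (Nat.zero_le n) ?_)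
  have h1 : (1 : TAlg F k V) ∈ TAlg.deg F k V 0 :=
    Submodule.subset_span ⟨[], rfl, by simp⟩
  have : KAlg.unit F (TAlg F k V) c = lsm F c 1 := by rw [KAlg.lsm_eq, mul_one]
  rw [this]
  exact Submodule.smul_mem _ _ h1

theorem lower_mul {m n : ℕ} {x y : TQuot F k V S} (hx : x ∈ lower (fil S) m) (hy : y ∈ fil S n) :
    x * y ∈ lower (fil S) (m + n) := by
  refine Submodule.iSup_induction' (p := fun i => ⨆ (_ : i < m), fil S i)
    (motive := fun x _ => x * y ∈ lower (fil S) (m + n)) ?_ (by simp)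
    (fun a b _ _ ha hb => by rw [add_mul]; exact add_mem ha hb) hx
  intro i x hx
  by_cases hi : i < m
  swap
  · simp only [hi, iSup_false, Submodule.mem_bot] at hx; simp [hx]
  simp only [hi, iSup_true] at hx
  exact lower_mono _ (by omega) (fil_mul S hx hy)

theorem mul_lower {m n : ℕ} {x y : TQuot F k V S} (hx : x ∈ fil S m) (hy : y ∈ lower (fil S) n) :
    x * y ∈ lower (fil S) (m + n) := by
  refine Submodule.iSup_induction' (p := fun i => ⨆ (_ : i < n), fil S i)
    (motive := fun y _ => x * y ∈ lower (fil S) (m + n)) ?_ (by simp)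
    (fun a b _ _ ha hb => by rw [mul_add]; exact add_mem ha hb) hy
  intro i y hy
  by_cases hi : i < n
  swap
  · simp only [hi, iSup_false, Submodule.mem_bot] at hy; simp [hy]
  simp only [hi, iSup_true] at hy
  exact lower_mono _ (by omega) (fil_mul S hx hy)

/-- The polynomials over `TV / ⟨S⟩` whose coefficient of degree `i` lies in the `i`-th step of the
filtration. -/
def rees : Subalgebra F (Polynomial (TQuot F k V S)) where
  carrier := {f | ∀ i, f.coeff i ∈ fil S i}
  mul_mem' {f g} hf hg n := by
    rw [Polynomial.coeff_mul]
    refine sum_mem fun ij h => ?_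
    rw [← Finset.HasAntidiagonal.mem_antidiagonal.1 h]
    exact fil_mul S (hf _) (hg _)
  add_mem' {f g} hf hg n := by
    rw [Polynomial.coeff_add]; exact add_mem (hf n) (hg n)
  algebraMap_mem' s n := by
    rw [Polynomial.algebraMap_apply, Polynomial.coeff_C]
    split_ifs
    · have := unit_mem_fil S (algebraMap F k s) n
      rwa [AlgHom.commutes] at this
    · exact zero_mem _

/-- The morphism to the Rees algebra with `c ↦ c` and `v ↦ v X`. -/
def toRees : TAlg F k V →ₐ[F] rees S :=
  TAlg.lift
    (AlgHom.codRestrict (Polynomial.CAlgHom.comp (KAlg.unit F _)) (rees S) (fun c n => by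
      rw [AlgHom.comp_apply, Polynomial.CAlgHom_apply, Polynomial.coeff_C]
      split_ifs
      · exact unit_mem_fil S c n
      · exact zero_mem _))
    (LinearMap.codRestrict (Subalgebra.toSubmodule (rees S))
      (LinearMap.mulRight F Polynomial.X ∘ₗ Polynomial.CAlgHom.toLinearMap ∘ₗ
        (TQuot.mk S).toLinearMap ∘ₗ (TAlg.ι F k).restrictScalars F) (fun v n => by
        simp only [LinearMap.comp_apply, LinearMap.mulRight_apply, AlgHom.toLinearMap_apply,
          Polynomial.CAlgHom_apply, Polynomial.coeff_C_mul, Polynomial.coeff_X]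
        split_ifs with h
        · rw [mul_one]
          refine mk_mem_fil S (TAlg.deg_le_fil h.le ?_)
          exact Submodule.subset_span ⟨[v], rfl, by simp⟩
        · rw [mul_zero]; exact zero_mem _))
    (fun c v => Subtype.ext (by
      change Polynomial.C (TQuot.mk S (TAlg.ι F k (lsm F c v))) * Polynomial.X =
        Polynomial.C (KAlg.unit F _ c) * (Polynomial.C (TQuot.mk S (TAlg.ι F k v)) * Polynomial.X)
      simp [map_lsm, KAlg.lsm_eq, mul_assoc, mk_unit]))
    (fun c v => Subtype.ext (by
      change Polynomial.C (TQuot.mk S (TAlg.ι F k (rsm F c v))) * Polynomial.X =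
        Polynomial.C (TQuot.mk S (TAlg.ι F k v)) * Polynomial.X * Polynomial.C (KAlg.unit F _ c)
      simp [map_rsm, KAlg.rsm_eq, mul_assoc, mk_unit, Polynomial.X_mul_C]))

theorem toRees_deg {n : ℕ} {x : TAlg F k V} (hx : x ∈ TAlg.deg F k V n) :
    (toRees S x : Polynomial (TQuot F k V S)) =
      Polynomial.C (TQuot.mk S x) * Polynomial.X ^ n :=
  TAlg.deg_induction (TQuot.mk S) ((rees S).val.comp (toRees S))
    (fun c => by simp [toRees, mk_unit]; rfl) (fun v => by simp [toRees]; rfl) hx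

end TQuot

theorem TAlg.sub_proj_mem {N : ℕ} (hN : 0 < N) {x : TAlg F k V} (hx : x ∈ TAlg.fil F k V N) :
    x - TAlg.proj F k V N x ∈ TAlg.fil F k V (N - 1) := by
  refine Submodule.iSup_induction' (p := fun i => ⨆ (_ : i ≤ N), TAlg.deg F k V i)
    (motive := fun x _ => x - TAlg.proj F k V N x ∈ TAlg.fil F k V (N - 1)) ?_ (by simp)
    (fun a b _ _ ha hb => by rw [map_add, add_sub_add_comm]; exact add_mem ha hb) hx
  intro i x hx
  by_cases hi : i ≤ N
  swap
  · simp only [hi, iSup_false, Submodule.mem_bot] at hx; simp [hx]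
  simp only [hi, iSup_true] at hx
  rw [TAlg.proj_deg hx]
  split_ifs with h
  · simp
  · rw [sub_zero]
    exact TAlg.deg_le_fil (by omega) hx

namespace HomogData

variable (h : HomogData F k V)

/-- The data of a filtered algebra `U = TV / ⟨P⟩` with associated homogeneous algebra `A`: a
subbimodule `P` of `F^N` with `π_N(P) = R`. -/
structure FilteredRel where
  /-- The bimodule of nonhomogeneous relations. -/
  P : Submodule (Env F k) (TAlg F k V)
  P_le : P ≤ TAlg.fil F k V h.N
  R_eq : (h.R : Set (TAlg F k V)) = TAlg.proj F k V h.N '' (P : Set (TAlg F k V))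

namespace FilteredRel

variable {h} (S : h.FilteredRel)

/-- The filtered algebra `U = TV / ⟨P⟩`. -/
abbrev U : Type _ := TQuot F k V (S.P : Set (TAlg F k V))

/-- The filtration of `U`. -/
abbrev fil : ℕ → Submodule F S.U := TQuot.fil _

theorem mk_R_mem {r : TAlg F k V} (hr : r ∈ h.R) :
    TQuot.mk (S.P : Set (TAlg F k V)) r ∈ lower S.fil h.N := by
  have hr' : r ∈ (h.R : Set (TAlg F k V)) := hr
  rw [S.R_eq] at hr'
  obtain ⟨x, hx, rfl⟩ := hr'
  have h1 : TQuot.mk (S.P : Set (TAlg F k V)) x = 0 := TQuot.mk_rel _ hx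
  have h2 : TQuot.mk (S.P : Set (TAlg F k V)) (TAlg.proj F k V h.N x) =
      -TQuot.mk (S.P : Set (TAlg F k V)) (x - TAlg.proj F k V h.N x) := by
    rw [map_sub, h1]; simp
  have hN := h.two_le
  rw [h2]
  exact neg_mem (lower_mono _ (by omega)
    (TQuot.mk_mem_fil _ (TAlg.sub_proj_mem (by omega) (S.P_le hx))))

theorem coeff_toRees_mem {x : TAlg F k V}
    (hx : x ∈ TwoSidedIdeal.span (h.R : Set (TAlg F k V))) (n : ℕ) :
    (TQuot.toRees (S.P : Set (TAlg F k V)) x : Polynomial S.U).coeff n ∈ lower S.fil n := by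
  let J : TwoSidedIdeal (TAlg F k V) := TwoSidedIdeal.mk'
    {x | ∀ n, (TQuot.toRees (S.P : Set (TAlg F k V)) x : Polynomial S.U).coeff n ∈
      lower S.fil n}
    (fun n => by simp)
    (fun {x y} hx hy n => by
      simp only [map_add, Subalgebra.coe_add, Polynomial.coeff_add]
      exact add_mem (hx n) (hy n))
    (fun {x} hx n => by
      simp only [map_neg, Subalgebra.coe_neg, Polynomial.coeff_neg]
      exact neg_mem (hx n))
    (fun {x y} hy n => by
      rw [map_mul, Subalgebra.coe_mul, Polynomial.coeff_mul]
      refine sum_mem fun ij hij => ?_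
      rw [← Finset.HasAntidiagonal.mem_antidiagonal.1 hij]
      exact TQuot.mul_lower _ ((TQuot.toRees (S.P : Set (TAlg F k V)) x).2 _) (hy _))
    (fun {x y} hx n => by
      rw [map_mul, Subalgebra.coe_mul, Polynomial.coeff_mul]
      refine sum_mem fun ij hij => ?_
      rw [← Finset.HasAntidiagonal.mem_antidiagonal.1 hij]
      exact TQuot.lower_mul _ (hx _) ((TQuot.toRees (S.P : Set (TAlg F k V)) y).2 _))
  have hJ : TwoSidedIdeal.span (h.R : Set (TAlg F k V)) ≤ J := by
    refine TwoSidedIdeal.span_le.2 fun r hr => ?_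
    refine (TwoSidedIdeal.mem_mk' _ _ _ _ _ _ _).2 fun n => ?_
    rw [TQuot.toRees_deg _ (h.R_le hr), Polynomial.coeff_C_mul, Polynomial.coeff_X_pow]
    split_ifs with hn
    · rw [mul_one, hn]; exact S.mk_R_mem hr
    · simp
  exact (TwoSidedIdeal.mem_mk' _ _ _ _ _ _ _).1 (hJ hx) n

/-- The projection `V^{⊗ n} → A_n`. -/
def degProj (h : HomogData F k V) (n : ℕ) : (TAlg.deg F k V n).restrictScalars F →ₗ[F] h.deg n :=
  (TQuot.mk (h.R : Set (TAlg F k V))).toLinearMap.restrict fun _ hx => h.mk_mem_deg hx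

theorem degProj_surjective (n : ℕ) : Function.Surjective (degProj h n) := by
  rintro ⟨_, x, hx, rfl⟩
  exact ⟨⟨x, hx⟩, rfl⟩

/-- The map `V^{⊗ n} → gr_n(U)`. -/
def toGr (n : ℕ) : (TAlg.deg F k V n).restrictScalars F →ₗ[F] Gr S.fil n :=
  Gr.mk ∘ₗ (TQuot.mk (S.P : Set (TAlg F k V))).toLinearMap.restrict
    fun _ hx => TQuot.mk_mem_fil _ (TAlg.deg_le_fil le_rfl hx)

/-- The canonical morphism `p : A → gr(U)`, in degree `n`: the class of `x ∈ V^{⊗ n}` in `A_n` is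
sent to the class of the image of `x` in `U`. -/
def p (n : ℕ) : h.deg n →ₗ[F] Gr S.fil n :=
  (LinearMap.ker (degProj h n)).liftQ (S.toGr n) (by
    rintro ⟨x, hx⟩ h0
    have h1 : TQuot.mk (h.R : Set (TAlg F k V)) x = 0 := congrArg Subtype.val h0
    have h2 := S.coeff_toRees_mem ((TQuot.mk_eq_zero_iff _).1 h1) n
    have hx' : x ∈ TAlg.deg F k V n := hx
    rw [TQuot.toRees_deg _ hx', Polynomial.coeff_C_mul, Polynomial.coeff_X_pow, if_pos rfl,
      mul_one] at h2
    exact (Submodule.Quotient.mk_eq_zero _).2 h2) ∘ₗ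
  ((degProj h n).quotKerEquivOfSurjective (degProj_surjective n)).symm.toLinearMap

theorem p_mk (n : ℕ) (x : TAlg F k V) (hx : x ∈ TAlg.deg F k V n) :
    S.p n ⟨TQuot.mk _ x, h.mk_mem_deg hx⟩ =
      Gr.mk ⟨TQuot.mk _ x, TQuot.mk_mem_fil _ (TAlg.deg_le_fil le_rfl hx)⟩ := by
  have : ((degProj h n).quotKerEquivOfSurjective (degProj_surjective n)).symm
      ⟨TQuot.mk _ x, h.mk_mem_deg hx⟩ = Submodule.Quotient.mk ⟨x, hx⟩ := by
    rw [LinearEquiv.symm_apply_eq]; rfl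
  simp only [p, LinearMap.comp_apply, LinearEquiv.coe_coe, this]
  rfl

/-- `U` is a PBW-deformation of `A`: the canonical morphism `p : A → gr(U)` is an isomorphism. -/
def IsPBW : Prop := ∀ n, Function.Bijective (S.p n)

end FilteredRel

/-- The map `φ ⊗ 1_V - 1_V ⊗ φ` on `R_{N+1}`, for `φ : R → TV`. -/
def diff (φ : h.R →ₗ[Env F k] TAlg F k V) : h.RN1 →ₗ[Env F k] TAlg F k V :=
  mulMap φ (TAlg.ι F k) ∘ₗ h.toRV - mulMap (TAlg.ι F k) φ ∘ₗ h.toVR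

/-- The bimodule `P` is `{r - ∑_{j < N} φ_j(r) : r ∈ R}`, where `φ_j` takes values in `V^{⊗ j}`. -/
def FilteredRel.IsGraphOf {h : HomogData F k V} (S : h.FilteredRel)
    (φ : ℕ → h.R →ₗ[Env F k] TAlg F k V) : Prop :=
  (∀ j < h.N, ∀ r, φ j r ∈ TAlg.deg F k V j) ∧
  ∀ x, x ∈ S.P ↔ ∃ r : h.R, x = r - ∑ j ∈ Finset.range h.N, φ j r

/-- `U = TV / ⟨P⟩` is a weak PBW-deformation of `A`, where `P` is described by the maps
`φ_j : R → V^{⊗ j}`, `0 ≤ j < N`. -/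
structure IsWeakPBW (S : h.FilteredRel) (φ : ℕ → h.R →ₗ[Env F k] TAlg F k V) : Prop where
  disjoint : S.P ⊓ TAlg.fil F k V (h.N - 1) = ⊥
  graph : S.IsGraphOf φ
  mem_R : ∀ w, h.diff (φ (h.N - 1)) w ∈ h.R
  zero : ∀ w, φ 0 ⟨h.diff (φ (h.N - 1)) w, mem_R w⟩ = 0
  pos : ∀ j, 0 < j → j < h.N → ∀ w,
    φ j ⟨h.diff (φ (h.N - 1)) w, mem_R w⟩ + h.diff (φ (j - 1)) w = 0

end HomogData
end Deformations

/-! ### Graded deformations -/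

section GradedDeformations

variable {F k V : Type*} [Field F] [Ring k] [Algebra F k]
  [AddCommGroup V] [Module F V] [Module (Env F k) V] [IsScalarTower F (Env F k) V]

namespace HomogData

variable (h : HomogData F k V)

/-- The component of degree `n` of the identification `gr(A) ≅ A`, with values in `A`. -/
def grToA (n : ℕ) : Gr h.fil n →ₗ[F] h.A :=
  ((lower h.fil n).comap (h.fil n).subtype).liftQ (h.comp n ∘ₗ (h.fil n).subtype) (by
    rintro ⟨a, ha⟩ h0
    change h.comp n a = 0
    have h0 : a ∈ lower h.fil n := h0
    refine (iSup₂_le fun i hi => ?_ : lower h.fil n ≤ LinearMap.ker (h.comp n)) h0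
    rintro _ ⟨x, hx, rfl⟩
    change h.comp n (TQuot.mk _ x) = 0
    refine Submodule.iSup_induction' (p := fun j => ⨆ (_ : j ≤ i), TAlg.deg F k V j)
      (motive := fun x _ => h.comp n (TQuot.mk _ x) = 0) ?_ (by simp)
      (fun a b _ _ ha hb => by rw [map_add, map_add, ha, hb, add_zero]) hx
    intro j x hx
    by_cases hj : j ≤ i
    swap
    · simp only [hj, iSup_false, Submodule.mem_bot] at hx; simp [hx]
    simp only [hj, iSup_true] at hx
    rw [h.comp_deg (h.mk_mem_deg hx), if_neg (by omega)])

/-- The inclusion `k[t] → A[t]`, used to write the `k[t]`-bimodule structure of `A[t]` in terms of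
the trivial product. -/
def incl (c : Polynomial k) : Polynomial h.A :=
  c.map (KAlg.unit F h.A : k →ₐ[F] h.A).toRingHom

/-- The homogeneous component of degree `m` of `A[t]`, where `t` has degree `1`. -/
def degPoly (m : ℕ) : Submodule F (Polynomial h.A) :=
  Submodule.span F {x | ∃ i j a, i + j = m ∧ a ∈ h.deg i ∧
    x = Polynomial.C a * Polynomial.X ^ j}

/-- A polynomial graded deformation of `A` that preserves the unit: a structure of graded
`k[t]`-algebra with unit `1` on the `k[t]`-bimodule `A[t]` that reduces to `A` modulo `t`. -/
structure GradedDeformation where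
  /-- The deformed product. -/
  mul : Polynomial h.A →ₗ[F] Polynomial h.A →ₗ[F] Polynomial h.A
  mul_assoc : ∀ x y z, mul (mul x y) z = mul x (mul y z)
  one_mul : ∀ x, mul 1 x = x
  mul_one : ∀ x, mul x 1 = x
  smul_mul : ∀ (c : Polynomial k) x y, mul (h.incl c * x) y = h.incl c * mul x y
  mul_bal : ∀ (c : Polynomial k) x y, mul (x * h.incl c) y = mul x (h.incl c * y)
  mul_smul : ∀ (c : Polynomial k) x y, mul x (y * h.incl c) = mul x y * h.incl c
  graded : ∀ m n, ∀ x ∈ h.degPoly m, ∀ y ∈ h.degPoly n, mul x y ∈ h.degPoly (m + n)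
  special : ∀ x y, (mul x y).coeff 0 = x.coeff 0 * y.coeff 0

namespace GradedDeformation

variable {h} (D : h.GradedDeformation)

/-- The algebra `A_t`: the module `A[t]` with the deformed product. -/
def Alg (_ : h.GradedDeformation) : Type _ := Polynomial h.A

instance : AddCommGroup D.Alg := inferInstanceAs (AddCommGroup (Polynomial h.A))
instance : Module F D.Alg := inferInstanceAs (Module F (Polynomial h.A))

/-- The identity map from `A[t]` with its trivial product to `A_t`. -/
def of : Polynomial h.A ≃ₗ[F] D.Alg := LinearEquiv.refl F (Polynomial h.A)

instance : Mul D.Alg := ⟨fun x y => D.of (D.mul (D.of.symm x) (D.of.symm y))⟩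
instance : One D.Alg := ⟨D.of 1⟩

theorem mul_def (x y : D.Alg) : x * y = D.of (D.mul (D.of.symm x) (D.of.symm y)) := rfl
theorem one_def : (1 : D.Alg) = D.of 1 := rfl
@[simp] theorem of_mul_of (x y : Polynomial h.A) : D.of x * D.of y = D.of (D.mul x y) := rfl

instance : Ring D.Alg where
  __ := (inferInstance : AddCommGroup D.Alg)
  left_distrib x y z := by simp [mul_def]
  right_distrib x y z := by simp [mul_def]
  zero_mul x := by simp [mul_def]
  mul_zero x := by simp [mul_def]
  mul_assoc x y z := by simp [mul_def, D.mul_assoc]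
  one_mul x := by simp [mul_def, one_def, D.one_mul]
  mul_one x := by simp [mul_def, one_def, D.mul_one]

instance : Algebra F D.Alg :=
  Algebra.ofModule (fun s x y => by simp [mul_def]) (fun s x y => by simp [mul_def])

instance : KAlg F k D.Alg where
  str := AlgHom.ofLinearMap
    { toFun := fun c => D.of (h.incl (Polynomial.C c))
      map_add' := fun c d => by simp [incl]
      map_smul' := fun s c => by
        rw [RingHom.id_apply, ← map_smul]
        congr 1
        have : KAlg.unit F h.A (s • c) = s • KAlg.unit F h.A c := map_smul _ _ _
        simp [incl, this, Polynomial.smul_C] }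
    (by simp [incl, one_def])
    (fun c d => by
      have h1 := D.smul_mul (Polynomial.C c) 1 (h.incl (Polynomial.C d))
      rw [D.one_mul, _root_.mul_one] at h1
      change D.of (h.incl (Polynomial.C (c * d))) =
        D.of (D.mul (h.incl (Polynomial.C c)) (h.incl (Polynomial.C d)))
      rw [h1]
      simp [incl])

/-- The algebra `A_t / ⟨t - 1⟩`. -/
def Fiber : Type _ :=
  D.Alg ⧸ (TwoSidedIdeal.span {D.of Polynomial.X - 1}).asIdeal

instance : Ring D.Fiber :=
  inferInstanceAs (Ring (D.Alg ⧸ (TwoSidedIdeal.span {D.of Polynomial.X - 1}).asIdeal))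
instance : Algebra F D.Fiber :=
  inferInstanceAs (Algebra F (D.Alg ⧸ (TwoSidedIdeal.span {D.of Polynomial.X - 1}).asIdeal))

/-- The projection `A_t → A_t / ⟨t - 1⟩`. -/
def quot : D.Alg →ₐ[F] D.Fiber := Ideal.Quotient.mkₐ F _

instance : KAlg F k D.Fiber := ⟨D.quot.comp (KAlg.unit F D.Alg)⟩

/-- The map `A → A_t → A_t / ⟨t - 1⟩`. -/
def fromA : h.A →ₗ[F] D.Fiber :=
  D.quot.toLinearMap ∘ₗ D.of.toLinearMap ∘ₗ Polynomial.CAlgHom.toLinearMap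

/-- The filtration of `A_t / ⟨t - 1⟩` induced by the filtration of `A`. -/
def fil (n : ℕ) : Submodule F D.Fiber := (h.fil n).map D.fromA

/-- The map `A_t → A`, `∑ a_j t^j ↦ ∑ a_j`. -/
def sumCoeff : D.Alg →ₗ[F] h.A :=
  (Polynomial.leval (1 : h.A)).restrictScalars F ∘ₗ D.of.symm.toLinearMap

theorem incl_X : h.incl Polynomial.X = Polynomial.X := by simp [incl]

theorem mul_X_left (x y : Polynomial h.A) :
    D.mul (Polynomial.X * x) y = Polynomial.X * D.mul x y := by
  have := D.smul_mul Polynomial.X x y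
  rwa [incl_X] at this

theorem mul_X_right (x y : Polynomial h.A) :
    D.mul x (Polynomial.X * y) = Polynomial.X * D.mul x y := by
  have := D.mul_smul Polynomial.X x y
  rwa [incl_X, ← Polynomial.X_mul, ← Polynomial.X_mul] at this

theorem sumCoeff_span {x : D.Alg} (hx : x ∈ TwoSidedIdeal.span {D.of Polynomial.X - 1}) :
    D.sumCoeff x = 0 := by
  let J : TwoSidedIdeal D.Alg := TwoSidedIdeal.mk'
    {x | ∃ y : Polynomial h.A, x = D.of (Polynomial.X * y - y)}
    ⟨0, by simp⟩
    (by
      rintro _ _ ⟨y, rfl⟩ ⟨z, rfl⟩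
      exact ⟨y + z, by rw [← map_add]; congr 1; rw [mul_add]; abel⟩)
    (by
      rintro _ ⟨y, rfl⟩
      exact ⟨-y, by rw [← map_neg]; congr 1; rw [mul_neg]; abel⟩)
    (by
      rintro x _ ⟨y, rfl⟩
      exact ⟨D.mul (D.of.symm x) y, by
        rw [mul_def, LinearEquiv.symm_apply_apply, map_sub, mul_X_right]⟩)
    (by
      rintro _ x ⟨y, rfl⟩
      exact ⟨D.mul y (D.of.symm x), by
        rw [mul_def, LinearEquiv.symm_apply_apply, map_sub, LinearMap.sub_apply, mul_X_left]⟩)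
  have hJ : TwoSidedIdeal.span {D.of Polynomial.X - 1} ≤ J := by
    refine TwoSidedIdeal.span_le.2 ?_
    rintro _ rfl
    refine (TwoSidedIdeal.mem_mk' _ _ _ _ _ _ _).2 ⟨1, ?_⟩
    rw [_root_.mul_one, map_sub]; rfl
  obtain ⟨y, rfl⟩ := (TwoSidedIdeal.mem_mk' _ _ _ _ _ _ _).1 (hJ hx)
  change Polynomial.leval (1 : h.A) (Polynomial.X * y - y) = 0
  rw [map_sub, Polynomial.X_mul]
  simp [Polynomial.leval_apply]

/-- The map `ρ^* : A_t / ⟨t - 1⟩ → A` induced by `∑ a_j t^j ↦ ∑ a_j`. -/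
def rhoStar : D.Fiber →ₗ[F] h.A :=
  (((TwoSidedIdeal.span {D.of Polynomial.X - 1}).asIdeal).restrictScalars F).liftQ D.sumCoeff
    (fun _ hx => D.sumCoeff_span (TwoSidedIdeal.mem_asIdeal.1 hx))

@[simp] theorem rhoStar_fromA (a : h.A) : D.rhoStar (D.fromA a) = a := by
  change Polynomial.leval (1 : h.A) (Polynomial.C a) = a
  simp [Polynomial.leval_apply]

theorem rhoStar_fil (n : ℕ) : (D.fil n).map D.rhoStar ≤ h.fil n := by
  rintro _ ⟨_, ⟨a, ha, rfl⟩, rfl⟩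
  rwa [rhoStar_fromA]

/-- The morphism `ρ : gr(A_t / ⟨t - 1⟩) → gr(A) ≅ A` induced by `ρ^*`, in degree `n` and with values
in `A`. -/
def rho (n : ℕ) : Gr D.fil n →ₗ[F] h.A := h.grToA n ∘ₗ Gr.map D.rhoStar D.rhoStar_fil n

/-- The deformed product is `a × b = ab + ∑_{j ≥ 1} ψ_j(a, b) t^j`, for maps
`ψ_j : A/k ⊗ A/k → A`. -/
def GivenBy (ψ : ℕ → h.I2 →ₗ[Env F k] h.A) : Prop :=
  ∀ (a b : h.A) (j : ℕ), 1 ≤ j →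
    (D.mul (Polynomial.C a) (Polynomial.C b)).coeff j = ψ j (BT.mk F k (h.p a) (h.p b))

end GradedDeformation

/-- A map `ψ : A/k ⊗ A/k → A` is normalized: it vanishes on `a ⊗ b` for `a, b ∈ I_+` homogeneous
with `deg a + deg b < N`. -/
def IsNormalized (ψ : h.I2 →ₗ[Env F k] h.A) : Prop :=
  ∀ i j, i + j < h.N → ∀ a ∈ h.degI i, ∀ b ∈ h.degI j, ψ (BT.mk F k a b) = 0

/-- An isomorphism of filtered `k`-algebras `U → A_t / ⟨t - 1⟩` such that the composition
`A → gr(U) → gr(A_t / ⟨t - 1⟩) → A` of `p`, the induced morphism and `ρ` is the identity. -/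
structure IsGoodIso (S : h.FilteredRel) (D : h.GradedDeformation) (g : S.U ≃ₐ[F] D.Fiber) :
    Prop where
  unit : ∀ c : k, g (KAlg.unit F _ c) = KAlg.unit F _ c
  fil : ∀ n, (S.fil n).map g.toLinearMap = D.fil n
  comp : ∀ (n : ℕ) (a : h.deg n),
    D.rho n (Gr.map g.toLinearMap (fun n => (fil n).le) n (S.p n a)) = a

/-! ### The two constructions -/

/-- The relation `φ_{N-j}^~ = ψ_j^~ ∘ σ₂` (`1 ≤ j ≤ N`) between the maps `φ_{N-j} : R → V^{⊗ N-j}`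
and the deformation; `V^{⊗ N-j}` is identified with its image `A_{N-j}` in `A`. -/
def IsInduced (ψ : ℕ → h.I2 →ₗ[Env F k] h.A) (φ : ℕ → h.R →ₗ[Env F k] TAlg F k V) : Prop :=
  ∀ j, 1 ≤ j → j ≤ h.N → (∀ r, φ (h.N - j) r ∈ TAlg.deg F k V (h.N - j)) ∧
    ∀ x, ext (h.q ∘ₗ φ (h.N - j)) x = ext (ψ j) (h.σ2 x)

/-- The maps `ψ'_j^~ = φ_{N-j}^~ ∘ τ₂` for `1 ≤ j ≤ N`, and `0` otherwise. -/
def psiPrime (c : h.ComparisonMaps) (φ : ℕ → h.R →ₗ[Env F k] TAlg F k V) (j : ℕ) :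
    FB F k h.A h.I2 →ₗ[F] h.A :=
  if 1 ≤ j ∧ j ≤ h.N then ext (h.q ∘ₗ φ (h.N - j)) ∘ₗ c.τ2.toLin else 0

/-- The map `sq(ψ₁, …, ψ_j)`:
`a ⊗ b ⊗ c ↦ ∑_{i=1}^j ψ_i(a, ψ_{j+1-i}(b, c)) - ψ_i(ψ_{j+1-i}(a, b), c)`. -/
def sq (ψ : ℕ → h.I2 →ₗ[Env F k] h.A) (j : ℕ) : h.I3 →ₗ[Env F k] h.A :=
  ∑ i ∈ Finset.Icc 1 j,
    (ψ i ∘ₗ BT.map LinearMap.id (h.p ∘ₗ ψ (j + 1 - i)) -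
      ψ i ∘ₗ BT.map (h.p ∘ₗ ψ (j + 1 - i)) LinearMap.id ∘ₗ BT.assoc)

/-- The recursion `ψ₁^~ = ψ'₁^~` and `ψ_{j+1}^~ = ψ'_{j+1}^~ - η_{j+1}^~` with
`η_{j+1}^~ = d(ψ'_{j+1})^~ ∘ s₂ + sq(ψ₁, …, ψ_j)^~ ∘ s₂`, where `d f = f ∘ b₃`. -/
def IsRecursive (c : h.ComparisonMaps) (φ : ℕ → h.R →ₗ[Env F k] TAlg F k V)
    (ψ : ℕ → h.I2 →ₗ[Env F k] h.A) : Prop :=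
  (∀ x, ext (ψ 1) x = h.psiPrime c φ 1 x) ∧
  ∀ j, 1 ≤ j → ∀ x, ext (ψ (j + 1)) x = h.psiPrime c φ (j + 1) x -
    (h.psiPrime c φ (j + 1) (h.b3 (c.s2 x)) + ext (h.sq ψ j) (c.s2 x))

end HomogData
end GradedDeformations

end PBW

end

/-! Two complexes of free A-bimodules carry the proof: the normalized bar resolution and the start
K_0, …, K_3 of the Koszul complex. Bilinear maps ψ_j define an associative product on A[t] exactly
when every coefficient of the associator vanishes. On I_+ ⊗ I_+ ⊗ I_+ the coefficient of t^{n+1} is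
ψ_{n+1}^~ ∘ b_3 + sq(ψ_1, …, ψ_n), which is `assocE ψ n`.

Comparison data. The bar resolution is contracted by a|w|b ↦ 1|a ⊗ w|b (`contr`), a right A-linear
map of square zero, and the maps σ_n are built from it. Since k^e is semisimple, the projection TV →
A and the differentials d_2, d_3 have graded bimodule sections θ, e_2, e_3. Then τ_1(a) is the
decomposition of θ(a), and τ_2(a|b) = G(θ(a)θ(b)), where G(x) is a preimage under d_2 of the
decomposition of x - θ(q(x)). For τ_3 the complex K must be exact at K_2, and this is where the
hypothesis on Tor_3 enters (`Sections.exists_d3`). The proof is an induction on the degree, in the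
manner of Nakayama's lemma. Degrees up to N + 1 are treated by hand. In a higher degree, a d_2-cycle
z satisfies σ_2(z) = b_3(y), and the vanishing of Tor_3 allows y to be chosen in I_+ C_3 + C_3 I_+.
Hence z = τ_2(b_3(y)) is a combination of multiples of cycles of smaller degree. The homotopies are
s_n = contr ∘ (1 - σ_n τ_n - s_{n-1} b_n) for n = 2, 3. As contr has square zero, the unwanted terms
vanish in low degrees, and the prescribed values remain.

From weak PBW to a deformation. In degrees at most N the corrections in the recursion vanish and ψ_j
= ψ'_j. Hence the ψ_j are normalized; in total degree N the value ψ_j(x, y) depends only on the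
product xy in TV, and on relations it is given by φ_{N-j}. If the associator vanishes in lower
orders, the pentagon identity makes its next coefficient vanish on boundaries b_4, so sq vanishes on
them too. Inserting the homotopy identity b_4 s_3 + s_2 b_3 = 1 - σ_3 τ_3 into the recursion leaves
(ψ'_{n+1} b_3 + sq) ∘ σ_3 ∘ τ_3. On w in R_{N+1}, for 0 < n < N, the factor before τ_3 equals minus
the class of φ_{N-n}(∂φ_{N-1}(w)) + ∂φ_{N-n-1}(w), which is zero for a weak PBW-deformation; the
other n are similar (`Comparison.IsRecursive.assocE_eq_zero`).

From a deformation to U. The inclusion of V extends to an algebra morphism TV → A_t. Setting t = 1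
identifies A_t / ⟨t - 1⟩ with A as a vector space, and the composite TV → A, called `sumT`, agrees
with the projection q up to lower filtration. If `sumT` kills P, then U → A_t / ⟨t - 1⟩ is
surjective, and it is injective by descent on the filtration degree (`mk_eq_zero_of_sumT`). Since
the composite through gr(U) is the identity of A, the canonical map p is injective. That P is killed
follows from normalization: below degree N nothing is deformed, and in degree N the coefficient of
t^j is ψ_j^~ applied to ∑ 1|x_1|x_2|x_3.

From a deformation to weak PBW. The maps φ_j are lifted along θ. For w = ∑ r u = ∑ v s in R_{N+1},
replacing each relation by its lower terms in both expressions shows that ∑_j ∂φ_j(w) becomes zero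
at t = 1. Its component of degree N therefore lies in R. Replacing that component by its lower terms
leaves an element of degree below N, where `sumT` is injective, and its homogeneous components are
the remaining conditions (`exists_diff_eq`). -/

open scoped TensorProduct
open MulOpposite

noncomputable section

namespace PBW

universe u₁ u₂ u₃ u₄

set_option linter.unusedSectionVars false

/-! ### Module classes with canonical paths to the additive structure -/

/-- `F`-vector spaces. -/
abbrev FModule (F W : Type*) [Field F] [AddCommGroup W] : Type _ := Module F W

/-- Left modules over `k ⊗ kᵐᵒᵖ`. -/
abbrev EnvModule (F k W : Type*) [Field F] [Ring k] [Algebra F k] [AddCommGroup W] : Type _ :=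
  Module (Env F k) W

/-- Compatibility of the actions of `F` and `k ⊗ kᵐᵒᵖ`. -/
abbrev EnvTower (F k W : Type*) [Field F] [Ring k] [Algebra F k] [AddCommGroup W] [FModule F W]
    [EnvModule F k W] : Prop := IsScalarTower F (Env F k) W

/-! ### Gradings with bimodule projections -/

section Gradings

variable {F k : Type*} [Field F] [Ring k] [Algebra F k]
variable {M M' N N' X Y : Type*}
  [AddCommGroup M] [FModule F M] [EnvModule F k M] [EnvTower F k M]
  [AddCommGroup M'] [FModule F M'] [EnvModule F k M'] [EnvTower F k M']
  [AddCommGroup N] [FModule F N] [EnvModule F k N] [EnvTower F k N]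
  [AddCommGroup N'] [FModule F N'] [EnvModule F k N'] [EnvTower F k N']

theorem BT.mk_zero_left (n : N) : BT.mk F k (0 : M) n = 0 := by
  simpa using BT.mk_smul_left (k := k) (0 : F) (0 : M) n

theorem BT.mk_zero_right (m : M) : BT.mk F k m (0 : N) = 0 := by
  simpa using BT.mk_smul_right (k := k) (0 : F) m (0 : N)

theorem BT.mk_neg_left (m : M) (n : N) : BT.mk F k (-m) n = -BT.mk F k m n := by
  simpa using BT.mk_smul_left (k := k) (-1 : F) m n

theorem BT.mk_neg_right (m : M) (n : N) : BT.mk F k m (-n) = -BT.mk F k m n := by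
  simpa using BT.mk_smul_right (k := k) (-1 : F) m n

theorem BT.mk_sub_left (m m' : M) (n : N) :
    BT.mk F k (m - m') n = BT.mk F k m n - BT.mk F k m' n := by
  rw [sub_eq_add_neg, BT.mk_add_left, BT.mk_neg_left, sub_eq_add_neg]

theorem BT.mk_sub_right (m : M) (n n' : N) :
    BT.mk F k m (n - n') = BT.mk F k m n - BT.mk F k m n' := by
  rw [sub_eq_add_neg, BT.mk_add_right, BT.mk_neg_right, sub_eq_add_neg]

theorem env_map_smul (f : M →ₗ[Env F k] M') (s : F) (m : M) : f (s • m) = s • f m :=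
  (f.restrictScalars F).map_smul s m

/-- A grading by sub-bimodules, given by the projections on the homogeneous components. -/
structure Grading (F k : Type*) [Field F] [Ring k] [Algebra F k] {M : Type*} [AddCommGroup M]
    [FModule F M] [EnvModule F k M] [EnvTower F k M]
    (G : ℕ → Submodule F M) where
  /-- The projection on the component of degree `n`. -/
  proj : ℕ → M →ₗ[Env F k] M
  mem : ∀ n m, proj n m ∈ G n
  of_mem : ∀ {n m}, m ∈ G n → ∀ j, proj j m = if j = n then m else 0
  top : ⨆ n, G n = ⊤

namespace Grading

variable {G : ℕ → Submodule F M} {G' : ℕ → Submodule F M'} {GN : ℕ → Submodule F N}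
variable (𝒢 : Grading F k G) (𝒢' : Grading F k G') (𝒢N : Grading F k GN)

include 𝒢 in
theorem induction {p : M → Prop} (m : M) (zero : p 0) (hom : ∀ n, ∀ m ∈ G n, p m)
    (add : ∀ x y, p x → p y → p (x + y)) : p m :=
  Submodule.iSup_induction (p := G) (motive := p) (by rw [𝒢.top]; trivial) hom zero add

theorem proj_self {n : ℕ} {m : M} (hm : m ∈ G n) : 𝒢.proj n m = m := by
  rw [𝒢.of_mem hm, if_pos rfl]

theorem proj_ne {n j : ℕ} {m : M} (hm : m ∈ G n) (hj : j ≠ n) : 𝒢.proj j m = 0 := by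
  rw [𝒢.of_mem hm, if_neg hj]

include 𝒢 in
theorem lsm_mem (c : k) {n : ℕ} {m : M} (hm : m ∈ G n) : lsm F c m ∈ G n := by
  rw [← 𝒢.proj_self hm, ← map_lsm]; exact 𝒢.mem _ _

include 𝒢 in
theorem rsm_mem (c : k) {n : ℕ} {m : M} (hm : m ∈ G n) : rsm F c m ∈ G n := by
  rw [← 𝒢.proj_self hm, ← map_rsm]; exact 𝒢.mem _ _

theorem finite (m : M) : {n | 𝒢.proj n m ≠ 0}.Finite := by
  induction m using 𝒢.induction with
  | zero => simp
  | hom n m hm =>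
    refine (Set.finite_singleton n).subset fun j hj => ?_
    by_contra h
    exact hj (𝒢.proj_ne hm h)
  | add x y hx hy =>
    refine (hx.union hy).subset fun j hj => ?_
    by_contra h
    simp only [Set.mem_union, Set.mem_ofPred_eq, not_or, not_not] at h
    exact hj (by rw [map_add, h.1, h.2, add_zero])

theorem finite_comp (f : ℕ → M →ₗ[Env F k] M') (m : M) :
    (Function.support fun n => f n (𝒢.proj n m)).Finite :=
  (𝒢.finite m).subset fun n hn h => hn (by simp [h])

/-- The linear map that is `f n` on the component of degree `n`. -/
def glue (f : ℕ → M →ₗ[Env F k] M') : M →ₗ[Env F k] M' where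
  toFun m := ∑ᶠ n, f n (𝒢.proj n m)
  map_add' x y := by
    rw [← finsum_add_distrib (𝒢.finite_comp f x) (𝒢.finite_comp f y)]
    simp
  map_smul' e x := by
    have := (DistribSMul.toAddMonoidHom M' e).map_finsum (𝒢.finite_comp f x)
    simp only [DistribSMul.toAddMonoidHom_apply] at this
    simp [this]

theorem glue_of_mem (f : ℕ → M →ₗ[Env F k] M') {n : ℕ} {m : M} (hm : m ∈ G n) :
    𝒢.glue f m = f n m := by
  change ∑ᶠ n, f n (𝒢.proj n m) = _
  rw [finsum_eq_single _ n (fun j hj => by rw [𝒢.proj_ne hm hj, map_zero]), 𝒢.proj_self hm]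

theorem glue_apply_finset (f : ℕ → M →ₗ[Env F k] M') (m : M) :
    ∃ s : Finset ℕ, 𝒢.glue f m = ∑ n ∈ s, f n (𝒢.proj n m) :=
  ⟨(𝒢.finite_comp f m).toFinset, finsum_eq_sum _ (𝒢.finite_comp f m)⟩

include 𝒢 in
theorem hom_ext {f g : M →ₗ[Env F k] M'} (h : ∀ n, ∀ m ∈ G n, f m = g m) : f = g := by
  ext m
  induction m using 𝒢.induction with
  | zero => simp
  | hom n m hm => exact h n m hm
  | add x y hx hy => rw [map_add, map_add, hx, hy]

theorem exists_sum (m : M) : ∃ s : Finset ℕ, m = ∑ n ∈ s, 𝒢.proj n m := by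
  obtain ⟨s, hs⟩ := 𝒢.glue_apply_finset (fun _ => LinearMap.id) m
  have : 𝒢.glue (fun _ => LinearMap.id) = LinearMap.id (R := Env F k) (M := M) :=
    𝒢.hom_ext fun n m hm => 𝒢.glue_of_mem _ hm
  rw [this] at hs
  exact ⟨s, hs⟩

theorem map_proj (f : M →ₗ[Env F k] M') (hf : ∀ n, ∀ m ∈ G n, f m ∈ G' n) (n : ℕ) (m : M) :
    f (𝒢.proj n m) = 𝒢'.proj n (f m) := by
  induction m using 𝒢.induction with
  | zero => simp
  | hom i m hm =>
    rw [𝒢.of_mem hm, 𝒢'.of_mem (hf _ _ hm)]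
    split_ifs <;> simp
  | add x y hx hy => simp only [map_add, hx, hy]

variable (F k) in
/-- A bimodule in a single degree. -/
def pure (d : ℕ) : Grading F k (pureDeg F M d) where
  proj n := if n = d then LinearMap.id else 0
  mem n m := by
    simp only [pureDeg]
    split_ifs <;> simp
  of_mem {n m} hm j := by
    simp only [pureDeg] at hm
    split_ifs at hm with h
    · subst h; split_ifs <;> simp
    · rw [(Submodule.mem_bot F).1 hm]; simp
  top := by
    refine eq_top_iff.2 (le_iSup_of_le d ?_)
    simp [pureDeg]

/-- The grading of a tensor product. -/
def bt : Grading F k (BT.deg (k := k) G GN) where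
  proj n := ∑ ij ∈ Finset.HasAntidiagonal.antidiagonal n, BT.map (𝒢.proj ij.1) (𝒢N.proj ij.2)
  mem n x := by
    rw [LinearMap.sum_apply]
    induction x using BT.induction with
    | zero => simp
    | tmul a b =>
      refine sum_mem fun ij hij => Submodule.subset_span ?_
      exact ⟨ij.1, ij.2, _, _, Finset.HasAntidiagonal.mem_antidiagonal.1 hij,
        𝒢.mem _ _, 𝒢N.mem _ _, rfl⟩
    | add x y hx hy =>
      simp only [map_add, Finset.sum_add_distrib]; exact add_mem hx hy
  of_mem {n x} hx e := by
    rw [LinearMap.sum_apply]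
    induction hx using Submodule.span_induction with
    | mem x h =>
      obtain ⟨i, j, a, b, rfl, ha, hb, rfl⟩ := h
      have key : ∀ p : ℕ × ℕ, BT.map (𝒢.proj p.1) (𝒢N.proj p.2) (BT.mk F k a b) =
          if p = (i, j) then BT.mk F k a b else 0 := by
        rintro ⟨p, q⟩
        rw [BT.map_mk, 𝒢.of_mem ha, 𝒢N.of_mem hb]
        by_cases h1 : p = i
        · by_cases h2 : q = j
          · simp [h1, h2]
          · simp [h2, BT.mk_zero_right]
        · simp [h1, BT.mk_zero_left]
      simp only [key, Finset.sum_ite_eq', Finset.HasAntidiagonal.mem_antidiagonal, eq_comm]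
    | zero => simp
    | add x y _ _ hx hy =>
      simp only [map_add, Finset.sum_add_distrib, hx, hy]; split_ifs <;> simp
    | smul s x _ hx =>
      simp only [env_map_smul, ← Finset.smul_sum, hx]; split_ifs <;> simp
  top := by
    refine eq_top_iff.2 fun x hx => ?_
    clear hx
    induction x using BT.induction with
    | zero => simp
    | tmul a b =>
      induction a using 𝒢.induction with
      | zero => rw [BT.mk_zero_left]; exact zero_mem _
      | hom i a ha =>
        induction b using 𝒢N.induction with
        | zero => rw [BT.mk_zero_right]; exact zero_mem _
        | hom j b hb =>
          exact Submodule.mem_iSup_of_mem (i + j)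
            (Submodule.subset_span ⟨i, j, a, b, rfl, ha, hb, rfl⟩)
        | add x y hx hy => rw [BT.mk_add_right]; exact add_mem hx hy
      | add x y hx hy => rw [BT.mk_add_left]; exact add_mem hx hy
    | add x y hx hy => exact add_mem hx hy

/-- The grading of a sub-bimodule that is stable under the projections. -/
def sub (S : Submodule (Env F k) M) (hS : ∀ n, ∀ m ∈ S, 𝒢.proj n m ∈ S) :
    Grading F k (fun n => (G n).comap (S.subtype.restrictScalars F)) where
  proj n := (𝒢.proj n).restrict (hS n)
  mem n m := 𝒢.mem n m
  of_mem {n m} hm j := by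
    refine Subtype.ext ?_
    change 𝒢.proj j m.1 = _
    rw [𝒢.of_mem (show m.1 ∈ G n from hm)]
    split_ifs <;> rfl
  top := by
    refine eq_top_iff.2 fun m _ => ?_
    obtain ⟨s, hs⟩ := 𝒢.exists_sum m.1
    have : m = ∑ n ∈ s, (𝒢.proj n).restrict (hS n) m := by
      refine Subtype.ext ?_
      rw [Submodule.coe_sum]
      exact hs
    rw [this]
    exact sum_mem fun n _ => Submodule.mem_iSup_of_mem n (𝒢.mem n m.1)

variable [IsSemisimpleRing (Env F k)]

include 𝒢 𝒢' in
/-- Over a semisimple enveloping algebra, a morphism of graded bimodules has a graded section on its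
range. -/
theorem exists_section (f : M →ₗ[Env F k] M') (hf : ∀ n, ∀ m ∈ G n, f m ∈ G' n) :
    ∃ s : M' →ₗ[Env F k] M, (∀ n, ∀ m ∈ G' n, s m ∈ G n) ∧
      ∀ m ∈ LinearMap.range f, f (s m) = m := by
  have : Module.Projective (Env F k) (LinearMap.range f) :=
    Module.projective_of_isSemisimpleRing _ _
  obtain ⟨s₀, hs₀⟩ := Module.projective_lifting_property f.rangeRestrict LinearMap.id
    f.surjective_rangeRestrict
  obtain ⟨Q, hQ⟩ := exists_isCompl (LinearMap.range f)
  let e : M' →ₗ[Env F k] LinearMap.range f := Submodule.projectionOnto _ Q hQ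
  have he : ∀ m ∈ LinearMap.range f, f (s₀ (e m)) = m := by
    intro m hm
    have h1 : e m = ⟨m, hm⟩ := Submodule.projectionOnto_apply_left hQ ⟨m, hm⟩
    rw [h1]
    exact congrArg Subtype.val (LinearMap.congr_fun hs₀ ⟨m, hm⟩)
  -- The section `s₀ ∘ e` need not respect degrees. Its degree-preserving part is still a section,
  -- because f commutes with the projections on homogeneous components.
  refine ⟨𝒢'.glue fun n => 𝒢.proj n ∘ₗ s₀ ∘ₗ e, fun n m hm => ?_, fun m hm => ?_⟩
  · rw [𝒢'.glue_of_mem _ hm]; exact 𝒢.mem _ _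
  · have hproj : ∀ n, f (𝒢.proj n (s₀ (e (𝒢'.proj n m)))) = 𝒢'.proj n m := by
      intro n
      rw [𝒢.map_proj 𝒢' f hf, he, 𝒢'.proj_self (𝒢'.mem _ _)]
      obtain ⟨x, rfl⟩ := hm
      rw [← 𝒢.map_proj 𝒢' f hf]
      exact ⟨_, rfl⟩
    obtain ⟨t, ht⟩ := 𝒢'.exists_sum m
    have h2 : ∀ n, 𝒢'.glue (fun n => 𝒢.proj n ∘ₗ s₀ ∘ₗ e) (𝒢'.proj n m) =
        𝒢.proj n (s₀ (e (𝒢'.proj n m))) := fun n => 𝒢'.glue_of_mem _ (𝒢'.mem n m)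
    conv_lhs => rw [ht]
    simp only [map_sum, h2, hproj]
    exact ht.symm

end Grading
end Gradings

/-! ### The tensor algebra and its quotients as graded bimodules -/

namespace TAlg

variable {F k V : Type*} [Field F] [Ring k] [Algebra F k]
  [AddCommGroup V] [FModule F V] [EnvModule F k V] [EnvTower F k V]
  {B : Type*} [Ring B] [Algebra F B]

theorem gen_eq (c : k) (v : V) : gen F k V (c, v) = KAlg.unit F _ c + ι F k v := by
  have : ((c, v) : k × V) = (c, 0) + (0, v) := by simp
  rw [this, map_add]; rfl

theorem induction {p : TAlg F k V → Prop} (x : TAlg F k V) (unit : ∀ c : k, p (KAlg.unit F _ c))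
    (ι : ∀ v, p (ι F k v)) (mul : ∀ x y, p x → p y → p (x * y))
    (add : ∀ x y, p x → p y → p (x + y)) : p x := by
  obtain ⟨y, rfl⟩ := RingQuot.mkAlgHom_surjective F (TRel F k V) x
  induction y using TensorAlgebra.induction with
  | algebraMap s =>
    have := unit (algebraMap F k s)
    rw [AlgHom.commutes] at this
    rwa [AlgHom.commutes]
  | ι v =>
    have h := gen_eq (F := F) v.1 v.2
    change p (gen F k V v)
    rw [h]; exact add _ _ (unit _) (ι _)
  | mul x y hx hy => rw [map_mul]; exact mul _ _ hx hy
  | add x y hx hy => rw [map_add]; exact add _ _ hx hy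

theorem algHom_ext {f g : TAlg F k V →ₐ[F] B}
    (hu : ∀ c : k, f (KAlg.unit F _ c) = g (KAlg.unit F _ c))
    (hι : ∀ v : V, f (ι F k v) = g (ι F k v)) : f = g := by
  ext x
  induction x using TAlg.induction with
  | unit c => exact hu c
  | ι v => exact hι v
  | mul x y hx hy => rw [map_mul, map_mul, hx, hy]
  | add x y hx hy => rw [map_add, map_add, hx, hy]

theorem unit_mem_deg (c : k) : KAlg.unit F (TAlg F k V) c ∈ deg F k V 0 := by
  have h1 : (1 : TAlg F k V) ∈ deg F k V 0 := Submodule.subset_span ⟨[], rfl, by simp⟩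
  have : KAlg.unit F (TAlg F k V) c = lsm F c 1 := by rw [KAlg.lsm_eq, mul_one]
  rw [this]
  exact Submodule.smul_mem _ _ h1

theorem ι_mem_deg (v : V) : ι F k v ∈ deg F k V 1 :=
  Submodule.subset_span ⟨[v], rfl, by simp⟩

variable (F k V) in
/-- The projection on a homogeneous component, as a morphism of bimodules. -/
def projE (n : ℕ) : TAlg F k V →ₗ[Env F k] TAlg F k V :=
  envLin (proj F k V n)
    (fun c x => by simp [KAlg.lsm_eq, proj, split])
    (fun c x => by simp [KAlg.rsm_eq, proj, split])

theorem projE_apply (n : ℕ) (x : TAlg F k V) : projE F k V n x = proj F k V n x := rfl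

theorem mem_iSup_deg (x : TAlg F k V) :
    x ∈ (⨆ n, (deg F k V n).restrictScalars F : Submodule F (TAlg F k V)) := by
  induction x using TAlg.induction with
  | unit c => exact Submodule.mem_iSup_of_mem 0 (unit_mem_deg c)
  | ι v => exact Submodule.mem_iSup_of_mem 1 (ι_mem_deg v)
  | mul x y hx hy =>
    induction hx using Submodule.iSup_induction' with
    | zero => rw [zero_mul]; exact zero_mem _
    | add a b _ _ ha hb => rw [add_mul]; exact add_mem ha hb
    | mem i x hx =>
      induction hy using Submodule.iSup_induction' with
      | zero => rw [mul_zero]; exact zero_mem _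
      | add a b _ _ ha hb => rw [mul_add]; exact add_mem ha hb
      | mem j y hy =>
        exact Submodule.mem_iSup_of_mem (i + j) (deg_mul (F := F) hx hy)
  | add x y hx hy => exact add_mem hx hy

variable (F k V) in
/-- The grading of the tensor algebra. -/
def grading : Grading F k (fun n => (deg F k V n).restrictScalars F) where
  proj := projE F k V
  mem n x := by
    induction mem_iSup_deg x using Submodule.iSup_induction' with
    | zero => simp
    | add a b _ _ ha hb => rw [map_add]; exact add_mem ha hb
    | mem i x hx =>
      have hx : x ∈ deg F k V i := hx
      rw [projE_apply, proj_deg hx]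
      split_ifs with h
      · rw [h]; exact hx
      · exact zero_mem _
  of_mem {n x} hx j := proj_deg hx
  top := eq_top_iff.2 fun x _ => mem_iSup_deg x

theorem proj_mem (n : ℕ) (x : TAlg F k V) : proj F k V n x ∈ deg F k V n :=
  (grading F k V).mem n x

theorem proj_mul (n : ℕ) (x y : TAlg F k V) : proj F k V n (x * y) =
    ∑ ij ∈ Finset.HasAntidiagonal.antidiagonal n, proj F k V ij.1 x * proj F k V ij.2 y := by
  simp [proj, Polynomial.coeff_mul]

/-- As S is stable under both actions of k, its additive closure is already a sub-bimodule. The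
induction thus needs no step for scalars of k^e. -/
theorem deg_induction_env {S : Set (TAlg F k V)} {p : TAlg F k V → Prop} (zero : p 0)
    (add : ∀ x y, p x → p y → p (x + y)) (mem : ∀ x ∈ S, p x)
    (hl : ∀ (c : k), ∀ x ∈ S, KAlg.unit F _ c * x ∈ S)
    (hr : ∀ (c : k), ∀ x ∈ S, x * KAlg.unit F _ c ∈ S)
    {x : TAlg F k V} (hx : x ∈ Submodule.span (Env F k) S) : p x := by
  have key : ∀ (e : Env F k), ∀ x ∈ AddSubmonoid.closure S, e • x ∈ AddSubmonoid.closure S := by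
    intro e x hx
    induction e using TensorProduct.induction_on with
    | zero =>
      have := zero_smul (Env F k) x
      rw [show ((0 : k ⊗[F] kᵐᵒᵖ) • x : TAlg F k V) = 0 from this]
      exact zero_mem _
    | tmul c d =>
      have h := env_smul_eq (F := F) c d.unop x
      rw [op_unop, KAlg.lsm_eq, KAlg.rsm_eq] at h
      rw [h]
      clear h
      induction hx using AddSubmonoid.closure_induction with
      | mem x hx => exact AddSubmonoid.subset_closure (hl _ _ (hr _ _ hx))
      | zero => simp
      | add x y _ _ hx hy => rw [add_mul, mul_add]; exact add_mem hx hy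
    | add a b ha hb =>
      have := add_smul (a : Env F k) b x
      rw [this]; exact add_mem ha hb
  have hx' : x ∈ AddSubmonoid.closure S := by
    induction hx using Submodule.span_induction with
    | mem x hx => exact AddSubmonoid.subset_closure hx
    | zero => exact zero_mem _
    | add x y _ _ hx hy => exact add_mem hx hy
    | smul e x _ hx => exact key e x hx
  clear hx
  induction hx' using AddSubmonoid.closure_induction with
  | mem x hx => exact mem x hx
  | zero => exact zero
  | add x y _ _ hx hy => exact add _ _ hx hy

theorem exists_unit_of_mem_deg_zero {x : TAlg F k V} (hx : x ∈ deg F k V 0) :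
    ∃ c : k, x = KAlg.unit F _ c := by
  have hle : deg F k V 0 ≤ Submodule.span (Env F k) {x | ∃ c : k, x = KAlg.unit F _ c} := by
    refine Submodule.span_mono ?_
    rintro _ ⟨l, hl, rfl⟩
    exact ⟨1, by simp [List.length_eq_zero_iff.1 hl]⟩
  refine deg_induction_env (p := fun x => ∃ c : k, x = KAlg.unit F _ c) ⟨0, by simp⟩ ?_ ?_ ?_ ?_
    (hle hx)
  · rintro _ _ ⟨c, rfl⟩ ⟨d, rfl⟩; exact ⟨c + d, (map_add _ _ _).symm⟩
  · exact fun x hx => hx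
  · rintro d _ ⟨c, rfl⟩; exact ⟨d * c, (map_mul _ _ _).symm⟩
  · rintro d _ ⟨c, rfl⟩; exact ⟨c * d, (map_mul _ _ _).symm⟩

/-- The elements of degree `n + 1` are sums of products `y v` with `y` of degree `n`. -/
theorem deg_succ_induction {n : ℕ} {p : TAlg F k V → Prop} (zero : p 0)
    (add : ∀ x y, p x → p y → p (x + y)) (mul : ∀ y ∈ deg F k V n, ∀ v, p (y * ι F k v))
    {x : TAlg F k V} (hx : x ∈ deg F k V (n + 1)) : p x := by
  have hle : deg F k V (n + 1) ≤
      Submodule.span (Env F k) {x | ∃ y ∈ deg F k V n, ∃ v, x = y * ι F k v} := by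
    refine Submodule.span_mono ?_
    rintro _ ⟨l, hl, rfl⟩
    obtain ⟨l', v, rfl⟩ : ∃ l' v, l = l' ++ [v] := by
      rcases List.eq_nil_or_concat l with rfl | h
      · simp at hl
      · simpa using h
    simp only [List.length_append, List.length_singleton, Nat.add_right_cancel_iff] at hl
    exact ⟨_, Submodule.subset_span ⟨l', hl, rfl⟩, v, by simp⟩
  refine deg_induction_env zero add ?_ ?_ ?_ (hle hx)
  · rintro _ ⟨y, hy, v, rfl⟩; exact mul y hy v
  · rintro c _ ⟨y, hy, v, rfl⟩
    refine ⟨KAlg.unit F _ c * y, ?_, v, by rw [mul_assoc]⟩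
    simpa using deg_mul (unit_mem_deg c) hy
  · rintro c _ ⟨y, hy, v, rfl⟩
    refine ⟨y, hy, rsm F c v, by rw [map_rsm, KAlg.rsm_eq, mul_assoc]⟩

theorem exists_ι_of_mem_deg_one {x : TAlg F k V} (hx : x ∈ deg F k V 1) :
    ∃ v : V, x = ι F k v := by
  refine deg_succ_induction (n := 0) (p := fun x => ∃ v : V, x = ι F k v) ⟨0, by simp⟩ ?_ ?_ hx
  · rintro _ _ ⟨v, rfl⟩ ⟨w, rfl⟩; exact ⟨v + w, by simp⟩
  · intro y hy v
    obtain ⟨c, rfl⟩ := exists_unit_of_mem_deg_zero hy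
    exact ⟨lsm F c v, by rw [map_lsm, KAlg.lsm_eq]⟩

theorem proj_eq_zero_of_mem_fil {n j : ℕ} (h : n < j) {x : TAlg F k V} (hx : x ∈ fil F k V n) :
    proj F k V j x = 0 := by
  refine (iSup₂_le fun i hi y hy => ?_ : fil F k V n ≤ LinearMap.ker (projE F k V j)) hx
  rw [LinearMap.mem_ker, projE_apply, proj_deg hy, if_neg (by omega)]

theorem mem_fil_induction {n : ℕ} {p : TAlg F k V → Prop} (zero : p 0)
    (add : ∀ x y, p x → p y → p (x + y)) (deg : ∀ i ≤ n, ∀ x ∈ deg F k V i, p x)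
    {x : TAlg F k V} (hx : x ∈ fil F k V n) : p x := by
  refine Submodule.iSup_induction' (p := fun i => ⨆ (_ : i ≤ n), TAlg.deg F k V i)
    (motive := fun x _ => p x) ?_ zero (fun a b _ _ ha hb => add _ _ ha hb) hx
  intro i x hx
  by_cases hi : i ≤ n
  · simp only [hi, iSup_true] at hx; exact deg i hi x hx
  · simp only [hi, iSup_false, Submodule.mem_bot] at hx; rw [hx]; exact zero

theorem fil_mono {m n : ℕ} (h : m ≤ n) : fil F k V m ≤ fil F k V n :=
  iSup₂_le fun _ hi => deg_le_fil (hi.trans h)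

end TAlg

namespace HomogData

variable {F k V : Type*} [Field F] [Ring k] [Algebra F k]
  [AddCommGroup V] [FModule F V] [EnvModule F k V] [EnvTower F k V]
variable (h : HomogData F k V)

theorem mk_surjective : Function.Surjective (TQuot.mk (h.R : Set (TAlg F k V))) :=
  TQuot.mk_surjective _

theorem q_mul (x y : TAlg F k V) : h.q (x * y) = h.q x * h.q y := map_mul (TQuot.mk _) x y

theorem q_unit (c : k) : h.q (KAlg.unit F _ c) = KAlg.unit F h.A c := rfl

theorem q_mem_deg {n : ℕ} {x : TAlg F k V} (hx : x ∈ TAlg.deg F k V n) : h.q x ∈ h.deg n :=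
  h.mk_mem_deg hx

theorem q_R (r : h.R) : h.q r = 0 := TQuot.mk_rel _ r.2

/-- The homogeneous components of the ideal of relations, in degrees at most `N`. -/
theorem proj_of_q_eq_zero {x : TAlg F k V} (hx : h.q x = 0) :
    (∀ i < h.N, TAlg.proj F k V i x = 0) ∧ TAlg.proj F k V h.N x ∈ h.R := by
  have hx : x ∈ TwoSidedIdeal.span (h.R : Set (TAlg F k V)) := (TQuot.mk_eq_zero_iff _).1 hx
  -- The two properties define a two-sided ideal: in a product, the component of degree N only
  -- involves the component of degree N of the factor in J, multiplied by a scalar of k.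
  let J : TwoSidedIdeal (TAlg F k V) := TwoSidedIdeal.mk'
    {x | (∀ i < h.N, TAlg.proj F k V i x = 0) ∧ TAlg.proj F k V h.N x ∈ h.R}
    ⟨fun i _ => by simp, by simp⟩
    (fun hx hy => ⟨fun i hi => by rw [map_add, hx.1 i hi, hy.1 i hi, add_zero],
      by rw [map_add]; exact add_mem hx.2 hy.2⟩)
    (fun hx => ⟨fun i hi => by rw [map_neg, hx.1 i hi, neg_zero],
      by rw [map_neg]; exact neg_mem hx.2⟩)
    (by
      rintro x y ⟨h1, h2⟩
      refine ⟨fun i hi => ?_, ?_⟩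
      · rw [TAlg.proj_mul]
        refine Finset.sum_eq_zero fun ij hij => ?_
        have := Finset.HasAntidiagonal.mem_antidiagonal.1 hij
        rw [h1 _ (by omega), mul_zero]
      · rw [TAlg.proj_mul]
        refine sum_mem fun ij hij => ?_
        have := Finset.HasAntidiagonal.mem_antidiagonal.1 hij
        by_cases h0 : ij.2 < h.N
        · rw [h1 _ h0, mul_zero]; exact zero_mem _
        · obtain ⟨c, hc⟩ := TAlg.exists_unit_of_mem_deg_zero (TAlg.proj_mem 0 x)
          rw [show ij.1 = 0 by omega, show ij.2 = h.N by omega, hc, ← KAlg.lsm_eq]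
          exact h.R.smul_mem _ h2)
    (by
      rintro x y ⟨h1, h2⟩
      refine ⟨fun i hi => ?_, ?_⟩
      · rw [TAlg.proj_mul]
        refine Finset.sum_eq_zero fun ij hij => ?_
        have := Finset.HasAntidiagonal.mem_antidiagonal.1 hij
        rw [h1 _ (by omega), zero_mul]
      · rw [TAlg.proj_mul]
        refine sum_mem fun ij hij => ?_
        have := Finset.HasAntidiagonal.mem_antidiagonal.1 hij
        by_cases h0 : ij.1 < h.N
        · rw [h1 _ h0, zero_mul]; exact zero_mem _
        · obtain ⟨c, hc⟩ := TAlg.exists_unit_of_mem_deg_zero (TAlg.proj_mem 0 y)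
          rw [show ij.2 = 0 by omega, show ij.1 = h.N by omega, hc, ← KAlg.rsm_eq]
          exact h.R.smul_mem _ h2)
  have hJ : TwoSidedIdeal.span (h.R : Set (TAlg F k V)) ≤ J := by
    refine TwoSidedIdeal.span_le.2 fun r hr => ?_
    refine (TwoSidedIdeal.mem_mk' _ _ _ _ _ _ _).2 ⟨fun i hi => ?_, ?_⟩
    · rw [TAlg.proj_deg (h.R_le hr), if_neg (by omega)]
    · rw [TAlg.proj_deg (h.R_le hr), if_pos rfl]; exact hr
  have h3 := (TwoSidedIdeal.mem_mk' _ _ _ _ _ _ _).1 (hJ hx)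
  exact h3

theorem eq_zero_of_q {n : ℕ} (hn : n < h.N) {x : TAlg F k V} (hx : x ∈ TAlg.deg F k V n)
    (h0 : h.q x = 0) : x = 0 := by
  have := (h.proj_of_q_eq_zero h0).1 n hn
  rwa [TAlg.proj_deg hx, if_pos rfl] at this

theorem mem_R_of_q {x : TAlg F k V} (hx : x ∈ TAlg.deg F k V h.N) (h0 : h.q x = 0) : x ∈ h.R := by
  have := (h.proj_of_q_eq_zero h0).2
  rwa [TAlg.proj_deg hx, if_pos rfl] at this

theorem eq_zero_of_q_of_mem_fil {x : TAlg F k V} (hx : x ∈ TAlg.fil F k V (h.N - 1))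
    (h0 : h.q x = 0) : x = 0 := by
  obtain ⟨s, hs⟩ := (TAlg.grading F k V).exists_sum x
  rw [hs]
  refine Finset.sum_eq_zero fun n _ => ?_
  change TAlg.proj F k V n x = 0
  have := h.two_le
  by_cases hn : n < h.N
  · exact (h.proj_of_q_eq_zero h0).1 n hn
  · exact TAlg.proj_eq_zero_of_mem_fil (by omega) hx

theorem comp_q (n : ℕ) (x : TAlg F k V) : h.comp n (h.q x) = h.q (TAlg.proj F k V n x) := by
  obtain ⟨s, hs⟩ := (TAlg.grading F k V).exists_sum x
  have hsum : h.q x = ∑ i ∈ s, h.q ((TAlg.grading F k V).proj i x) := by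
    conv_lhs => rw [hs, map_sum]
  have h2 : TAlg.proj F k V n x =
      ∑ i ∈ s, TAlg.proj F k V n ((TAlg.grading F k V).proj i x) := by
    conv_lhs => rw [hs, map_sum]
  rw [hsum, h2, map_sum, map_sum]
  refine Finset.sum_congr rfl fun i _ => ?_
  have hi : (TAlg.grading F k V).proj i x ∈ TAlg.deg F k V i := (TAlg.grading F k V).mem i x
  rw [h.comp_deg (h.q_mem_deg hi), TAlg.proj_deg hi]
  split_ifs <;> simp

/-- The grading of `A`. -/
def gradingA : Grading F k h.deg where
  proj n := envLin (h.comp n)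
    (fun c a => by
      obtain ⟨x, rfl⟩ := h.mk_surjective a
      change h.comp n (lsm F c (h.q x)) = lsm F c (h.comp n (h.q x))
      rw [← map_lsm, comp_q, comp_q, ← map_lsm]
      exact congrArg _ (map_lsm (TAlg.projE F k V n) c x))
    (fun c a => by
      obtain ⟨x, rfl⟩ := h.mk_surjective a
      change h.comp n (rsm F c (h.q x)) = rsm F c (h.comp n (h.q x))
      rw [← map_rsm, comp_q, comp_q, ← map_rsm]
      exact congrArg _ (map_rsm (TAlg.projE F k V n) c x))
  mem n a := by
    obtain ⟨x, rfl⟩ := h.mk_surjective a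
    change h.comp n (h.q x) ∈ _
    rw [comp_q]; exact h.q_mem_deg (TAlg.proj_mem n x)
  of_mem {n a} ha j := h.comp_deg ha
  top := by
    refine eq_top_iff.2 fun a _ => ?_
    obtain ⟨x, rfl⟩ := h.mk_surjective a
    obtain ⟨s, hs⟩ := (TAlg.grading F k V).exists_sum x
    change h.q x ∈ _
    rw [hs, map_sum]
    exact sum_mem fun n _ => Submodule.mem_iSup_of_mem n
      (h.q_mem_deg ((TAlg.grading F k V).mem n x))

theorem unit_mem_deg (c : k) : KAlg.unit F h.A c ∈ h.deg 0 :=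
  h.q_mem_deg (TAlg.unit_mem_deg c)

theorem exists_unit_of_mem_deg_zero {a : h.A} (ha : a ∈ h.deg 0) :
    ∃ c : k, a = KAlg.unit F h.A c := by
  obtain ⟨x, hx, rfl⟩ := ha
  obtain ⟨c, rfl⟩ := TAlg.exists_unit_of_mem_deg_zero hx
  exact ⟨c, rfl⟩

theorem aug_deg {n : ℕ} (hn : n ≠ 0) {a : h.A} (ha : a ∈ h.deg n) : h.aug a = 0 := by
  obtain ⟨x, hx, rfl⟩ := ha
  exact augT_deg hn hx

theorem unit_aug_of_mem_deg_zero {a : h.A} (ha : a ∈ h.deg 0) :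
    KAlg.unit F h.A (h.aug a) = a := by
  obtain ⟨c, rfl⟩ := h.exists_unit_of_mem_deg_zero ha
  simp

theorem p_coe (a : h.A) : (h.p a : h.A) = a - KAlg.unit F h.A (h.aug a) := rfl

theorem aug_coe (a : h.I) : h.aug (a : h.A) = 0 := a.2

theorem p_I (a : h.I) : h.p (a : h.A) = a := Subtype.ext (by simp [p_coe, aug_coe])

theorem p_coe_of_mem_deg {n : ℕ} (hn : n ≠ 0) {a : h.A} (ha : a ∈ h.deg n) :
    (h.p a : h.A) = a := by
  rw [p_coe, h.aug_deg hn ha]; simp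

theorem p_mem_degI {n : ℕ} {a : h.A} (ha : a ∈ h.deg n) : h.p a ∈ h.degI n := by
  change (h.p a : h.A) ∈ h.deg n
  by_cases hn : n = 0
  · subst hn
    rw [p_coe, h.unit_aug_of_mem_deg_zero ha, sub_self]; exact zero_mem _
  · rwa [h.p_coe_of_mem_deg hn ha]

/-- The grading of `I_+`. -/
def gradingI : Grading F k h.degI :=
  h.gradingA.sub h.I fun n a ha => by
    change h.aug (h.comp n a) = 0
    -- Only degree 0 needs an argument: the augmentation vanishes in positive degrees, so a and its
    -- component of degree 0 have the same augmentation.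
    by_cases hn : n = 0
    · subst hn
      obtain ⟨x, rfl⟩ := h.mk_surjective a
      have ha : h.aug (h.q x) = 0 := ha
      change h.aug (h.comp 0 (h.q x)) = 0
      obtain ⟨s, hs⟩ := h.gradingA.exists_sum (h.q x)
      rw [hs, map_sum] at ha
      by_cases h0 : 0 ∈ s
      · rw [Finset.sum_eq_single_of_mem 0 h0] at ha
        · exact ha
        · intro j _ hj
          exact h.aug_deg hj (h.gradingA.mem j _)
      · have : h.comp 0 (h.q x) = 0 := by
          rw [hs, map_sum]
          refine Finset.sum_eq_zero fun j hj => ?_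
          rw [h.comp_deg (h.gradingA.mem j _), if_neg]
          rintro rfl; exact h0 hj
        rw [this, map_zero]
    · exact h.aug_deg hn (h.gradingA.mem n a)

theorem cls_mem_degI {n : ℕ} {x : TAlg F k V} (hx : x ∈ TAlg.deg F k V n) :
    h.cls x ∈ h.degI n := h.p_mem_degI (h.q_mem_deg hx)

theorem ιA_eq (v : V) : h.ιA v = h.q (TAlg.ι F k v) := rfl

theorem ιA_mem_deg (v : V) : h.ιA v ∈ h.deg 1 := h.q_mem_deg (TAlg.ι_mem_deg v)

theorem ιI_mem_degI (v : V) : h.ιI v ∈ h.degI 1 := h.cls_mem_degI (TAlg.ι_mem_deg v)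

theorem μ_coe (a b : h.I) : (h.μ (BT.mk F k a b) : h.A) = a * b := rfl

end HomogData

/-! ### Free bimodules and their morphisms -/

section FreeBimoduleMaps

variable {F k A W M X Y : Type*} [Field F] [Ring k] [Algebra F k] [Ring A]
  [Algebra F A] [KAlg F k A]
  [AddCommGroup W] [FModule F W] [EnvModule F k W] [EnvTower F k W]
  [AddCommGroup X] [FModule F X] [EnvModule F k X] [EnvTower F k X]
  [AddCommGroup Y] [FModule F Y] [EnvModule F k Y] [EnvTower F k Y]
  [AddCommGroup M] [FModule F M] [EnvModule F k M] [EnvTower F k M]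
  [Module A M] [Module Aᵐᵒᵖ M] [SMulCommClass A Aᵐᵒᵖ M] [IsScalarTower F A M]
  [IsScalarTower F Aᵐᵒᵖ M]

namespace FB

theorem induction {p : FB F k A W → Prop} (x : FB F k A W) (zero : p 0)
    (mk : ∀ a w b, p (FB.mk F k a w b)) (add : ∀ x y, p x → p y → p (x + y)) : p x := by
  induction x using BT.induction with
  | zero => exact zero
  | tmul a y =>
    induction y using BT.induction with
    | zero => rw [BT.mk_zero_right]; exact zero
    | tmul w b => exact mk a w b
    | add x y hx hy => rw [BT.mk_add_right]; exact add _ _ hx hy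
  | add x y hx hy => exact add _ _ hx hy

theorem mk_add_left (a a' : A) (w : W) (b : A) :
    FB.mk F k (a + a') w b = FB.mk F k a w b + FB.mk F k a' w b := BT.mk_add_left _ _ _

theorem mk_sub_left (a a' : A) (w : W) (b : A) :
    FB.mk F k (a - a') w b = FB.mk F k a w b - FB.mk F k a' w b := BT.mk_sub_left _ _ _

theorem mk_zero_left (w : W) (b : A) : FB.mk F k 0 w b = 0 := BT.mk_zero_left _

theorem mk_add_mid (a : A) (w w' : W) (b : A) :
    FB.mk F k a (w + w') b = FB.mk F k a w b + FB.mk F k a w' b := by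
  rw [FB.mk, BT.mk_add_left, BT.mk_add_right]; rfl

theorem mk_zero_mid (a b : A) : FB.mk F k a (0 : W) b = 0 := by
  rw [FB.mk, BT.mk_zero_left, BT.mk_zero_right]

theorem mk_add_right (a : A) (w : W) (b b' : A) :
    FB.mk F k a w (b + b') = FB.mk F k a w b + FB.mk F k a w b' := by
  rw [FB.mk, BT.mk_add_right, BT.mk_add_right]; rfl

theorem mk_sub_right (a : A) (w : W) (b b' : A) :
    FB.mk F k a w (b - b') = FB.mk F k a w b - FB.mk F k a w b' := by
  rw [FB.mk, BT.mk_sub_right, BT.mk_sub_right]; rfl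

theorem mk_mul_unit (a : A) (c : k) (w : W) (b : A) :
    FB.mk F k (a * KAlg.unit F A c) w b = FB.mk F k a (lsm F c w) b := by
  rw [← KAlg.rsm_eq, FB.mk, BT.mk_bal, BT.lsm_mk]; rfl

theorem mk_unit_mul (a : A) (w : W) (c : k) (b : A) :
    FB.mk F k a w (KAlg.unit F A c * b) = FB.mk F k a (rsm F c w) b := by
  rw [← KAlg.lsm_eq, FB.mk, ← BT.mk_bal]; rfl

end FB

theorem gen_apply (w : W) : (gen w : FB F k A W) = FB.mk F k 1 w 1 := rfl

theorem smul_gen (a : A) (w : W) : a • (gen w : FB F k A W) = FB.mk F k a w 1 := by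
  rw [gen_apply, FB.smul_mk, mul_one]

theorem op_smul_gen (b : A) (w : W) : op b • (gen w : FB F k A W) = FB.mk F k 1 w b := by
  rw [gen_apply, FB.op_smul_mk, one_mul]

theorem FB.mk_eq (a : A) (w : W) (b : A) : FB.mk F k a w b = a • op b • gen w := by
  rw [op_smul_gen, FB.smul_mk, mul_one]

@[simp] theorem genL_mk (j : X →ₗ[Env F k] A) (x : X) (w : W) :
    genL j (BT.mk F k x w) = FB.mk F k (j x) w 1 := rfl

@[simp] theorem genR_mk (j : X →ₗ[Env F k] A) (w : W) (x : X) :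
    genR j (BT.mk F k w x) = FB.mk F k 1 w (j x) := rfl

theorem genD_apply (j : X →ₗ[Env F k] A) (x : X) :
    genD j x = FB.mk F k (j x) (1 : k) 1 - FB.mk F k 1 (1 : k) (j x) := rfl

/-- The `F`-linear maps between two bimodules that are morphisms of `A`-bimodules. -/
structure IsBimodHom (A : Type*) [Ring A] [Algebra F A] {M M' : Type*} [AddCommGroup M] [Module F M]
    [Module A M] [Module Aᵐᵒᵖ M] [AddCommGroup M'] [Module F M'] [Module A M'] [Module Aᵐᵒᵖ M']
    (f : M →ₗ[F] M') : Prop where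
  smul : ∀ (a : A) x, f (a • x) = a • f x
  op_smul : ∀ (b : A) x, f (op b • x) = op b • f x

theorem IsBimodHom.mk_apply {f : FB F k A W →ₗ[F] M} (hf : IsBimodHom A f) (a : A) (w : W) (b : A) :
    f (FB.mk F k a w b) = a • op b • f (gen w) := by
  rw [FB.mk_eq, hf.smul, hf.op_smul]

/-- The elements 1|w|1 generate A ⊗ W ⊗ A as a bimodule. Most identities between bimodule maps below
are reduced to these generators. -/
theorem IsBimodHom.ext {f g : FB F k A W →ₗ[F] M} (hf : IsBimodHom A f) (hg : IsBimodHom A g)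
    (h : ∀ w, f (gen w) = g (gen w)) (x : FB F k A W) : f x = g x := by
  induction x using FB.induction with
  | zero => rw [map_zero, map_zero]
  | mk a w b => rw [hf.mk_apply, hg.mk_apply, h]
  | add x y hx hy => rw [map_add, map_add, hx, hy]

section Algebraic

variable {M' M'' : Type*} [AddCommGroup M'] [Module F M'] [Module A M'] [Module Aᵐᵒᵖ M']
  [AddCommGroup M''] [Module F M''] [Module A M''] [Module Aᵐᵒᵖ M'']

omit [SMulCommClass A Aᵐᵒᵖ M] [IsScalarTower F A M] [IsScalarTower F Aᵐᵒᵖ M] in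
theorem IsBimodHom.comp {f : M' →ₗ[F] M''} {g : M →ₗ[F] M'} (hf : IsBimodHom A f)
    (hg : IsBimodHom A g) : IsBimodHom A (f ∘ₗ g) :=
  ⟨fun a x => by simp [hg.smul, hf.smul], fun b x => by simp [hg.op_smul, hf.op_smul]⟩

omit [SMulCommClass A Aᵐᵒᵖ M] [IsScalarTower F A M] [IsScalarTower F Aᵐᵒᵖ M] in
theorem IsBimodHom.sub {f g : M →ₗ[F] M'} (hf : IsBimodHom A f)
    (hg : IsBimodHom A g) : IsBimodHom A (f - g) :=
  ⟨fun a x => by simp [hg.smul, hf.smul, smul_sub],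
    fun b x => by simp [hg.op_smul, hf.op_smul, smul_sub]⟩

omit [SMulCommClass A Aᵐᵒᵖ M] [IsScalarTower F A M] [IsScalarTower F Aᵐᵒᵖ M] in
theorem IsBimodHom.add {f g : M →ₗ[F] M'} (hf : IsBimodHom A f)
    (hg : IsBimodHom A g) : IsBimodHom A (f + g) :=
  ⟨fun a x => by simp [hg.smul, hf.smul, smul_add],
    fun b x => by simp [hg.op_smul, hf.op_smul, smul_add]⟩

theorem IsBimodHom.zero : IsBimodHom A (0 : M →ₗ[F] M') :=
  ⟨fun a x => by simp, fun b x => by simp⟩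

theorem IsBimodHom.id : IsBimodHom A (LinearMap.id : M →ₗ[F] M) :=
  ⟨fun a x => by simp, fun b x => by simp⟩

theorem BimodHom.isBimodHom (f : BimodHom F k A W X) : IsBimodHom A f.toLin :=
  ⟨f.map_smul, f.map_op_smul⟩

end Algebraic

/-- A morphism of `A`-bimodules is a morphism of `k`-bimodules. -/
def IsBimodHom.toEnv [ABimod F k A M] {M' : Type*} [AddCommGroup M'] [FModule F M']
    [EnvModule F k M'] [EnvTower F k M'] [Module A M'] [Module Aᵐᵒᵖ M']
    [ABimod F k A M'] {f : M' →ₗ[F] M} (hf : IsBimodHom A f) : M' →ₗ[Env F k] M :=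
  envLin f (fun c x => by rw [ABimod.left (A := A), hf.smul, ← ABimod.left (A := A)])
    (fun c x => by rw [ABimod.right (A := A), hf.op_smul, ← ABimod.right (A := A)])

variable [ABimod F k A M]

theorem ext_gen (ψ : W →ₗ[Env F k] M) (w : W) : ext ψ (gen w : FB F k A W) = ψ w := by
  rw [gen_apply, ext_mk]; simp

theorem ext_isBimodHom (ψ : W →ₗ[Env F k] M) : IsBimodHom A (ext ψ : FB F k A W →ₗ[F] M) where
  smul a x := by
    induction x using FB.induction with
    | zero => simp
    | mk a' w b => rw [FB.smul_mk, ext_mk, ext_mk, mul_smul]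
    | add x y hx hy => rw [smul_add, map_add, map_add, hx, hy, smul_add]
  op_smul b x := by
    induction x using FB.induction with
    | zero => simp
    | mk a' w b' => rw [FB.op_smul_mk, ext_mk, ext_mk, op_mul, mul_smul, smul_comm]
    | add x y hx hy => rw [smul_add, map_add, map_add, hx, hy, smul_add]

/-- The extension `ψ^~` as a morphism of `k`-bimodules. -/
def extE (ψ : W →ₗ[Env F k] M) : FB F k A W →ₗ[Env F k] M := (ext_isBimodHom (A := A) ψ).toEnv

theorem ext_smul (ψ : W →ₗ[Env F k] M) (a : A) (x : FB F k A W) : ext ψ (a • x) = a • ext ψ x :=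
  (ext_isBimodHom ψ).smul a x

theorem ext_op_smul (ψ : W →ₗ[Env F k] M) (b : A) (x : FB F k A W) :
    ext ψ (op b • x) = op b • ext ψ x := (ext_isBimodHom ψ).op_smul b x

theorem ext_zero (x : FB F k A W) : ext (0 : W →ₗ[Env F k] M) x = 0 :=
  (ext_isBimodHom 0).ext IsBimodHom.zero (fun w => by simp [ext_gen]) x

/-- The morphism of `A`-bimodules with given values on the elements `1|w|1`. -/
def BimodHom.of (f : W →ₗ[Env F k] FB F k A X) : BimodHom F k A W X where
  toLin := ext f
  map_smul := ext_smul f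
  map_op_smul := ext_op_smul f

end FreeBimoduleMaps

section Compositions

variable {F k A W X Y Z M : Type*} [Field F] [Ring k] [Algebra F k] [Ring A] [Algebra F A]
  [KAlg F k A] [AddCommGroup W] [FModule F W] [EnvModule F k W] [EnvTower F k W]
  [AddCommGroup X] [FModule F X] [EnvModule F k X] [EnvTower F k X]
  [AddCommGroup Y] [FModule F Y] [EnvModule F k Y] [EnvTower F k Y]
  [AddCommGroup Z] [FModule F Z] [EnvModule F k Z] [EnvTower F k Z]
  [AddCommGroup M] [FModule F M] [EnvModule F k M] [EnvTower F k M]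
  [Module A M] [Module Aᵐᵒᵖ M] [SMulCommClass A Aᵐᵒᵖ M] [IsScalarTower F A M]
  [IsScalarTower F Aᵐᵒᵖ M]

theorem IsBimodHom.ext_comp {f : FB F k A X →ₗ[F] M} {g : FB F k A W →ₗ[F] FB F k A X}
    {f' : FB F k A Y →ₗ[F] M} {g' : FB F k A W →ₗ[F] FB F k A Y} (hf : IsBimodHom A f)
    (hg : IsBimodHom A g) (hf' : IsBimodHom A f') (hg' : IsBimodHom A g')
    (h : ∀ w, f (g (gen w)) = f' (g' (gen w))) (x : FB F k A W) : f (g x) = f' (g' x) :=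
  (hf.comp hg).ext (hf'.comp hg') h x

theorem IsBimodHom.ext_comp_zero {f : FB F k A X →ₗ[F] M} {g : FB F k A W →ₗ[F] FB F k A X}
    (hf : IsBimodHom A f) (hg : IsBimodHom A g) (h : ∀ w, f (g (gen w)) = 0) (x : FB F k A W) :
    f (g x) = 0 :=
  (hf.comp hg).ext IsBimodHom.zero (g := 0) h x

theorem IsBimodHom.ext_homotopy {b : FB F k A X →ₗ[F] FB F k A W}
    {s : FB F k A W →ₗ[F] FB F k A X} {s' : FB F k A Y →ₗ[F] FB F k A W}
    {b' : FB F k A W →ₗ[F] FB F k A Y} {σ : FB F k A Z →ₗ[F] FB F k A W}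
    {τ : FB F k A W →ₗ[F] FB F k A Z} (hb : IsBimodHom A b) (hs : IsBimodHom A s)
    (hs' : IsBimodHom A s') (hb' : IsBimodHom A b') (hσ : IsBimodHom A σ) (hτ : IsBimodHom A τ)
    (h : ∀ w, b (s (gen w)) + s' (b' (gen w)) = gen w - σ (τ (gen w))) (x : FB F k A W) :
    b (s x) + s' (b' x) = x - σ (τ x) :=
  ((hb.comp hs).add (hs'.comp hb')).ext (IsBimodHom.id.sub (hσ.comp hτ)) h x

theorem IsBimodHom.ext_homotopy_one {b : FB F k A X →ₗ[F] FB F k A W}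
    {s : FB F k A W →ₗ[F] FB F k A X} {σ : FB F k A Z →ₗ[F] FB F k A W}
    {τ : FB F k A W →ₗ[F] FB F k A Z} (hb : IsBimodHom A b) (hs : IsBimodHom A s)
    (hσ : IsBimodHom A σ) (hτ : IsBimodHom A τ)
    (h : ∀ w, b (s (gen w)) = gen w - σ (τ (gen w))) (x : FB F k A W) : b (s x) = x - σ (τ x) :=
  (hb.comp hs).ext (IsBimodHom.id.sub (hσ.comp hτ)) h x

theorem FB.induction₂ {p : FB F k A (BT F k X W) → Prop} (x : FB F k A (BT F k X W)) (zero : p 0)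
    (mk : ∀ a y w b, p (FB.mk F k a (BT.mk F k y w) b)) (add : ∀ x y, p x → p y → p (x + y)) :
    p x := by
  induction x using FB.induction with
  | zero => exact zero
  | mk a w b =>
    induction w using BT.induction with
    | zero => rw [FB.mk_zero_mid]; exact zero
    | tmul u v => exact mk a u v b
    | add x y hx hy => rw [FB.mk_add_mid]; exact add _ _ hx hy
  | add x y hx hy => exact add _ _ hx hy

theorem FB.induction₃ {p : FB F k A (BT F k X (BT F k Y W)) → Prop}
    (x : FB F k A (BT F k X (BT F k Y W))) (zero : p 0)
    (mk : ∀ a y z w b, p (FB.mk F k a (BT.mk F k y (BT.mk F k z w)) b))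
    (add : ∀ x y, p x → p y → p (x + y)) : p x := by
  induction x using FB.induction₂ with
  | zero => exact zero
  | mk a y w b =>
    induction w using BT.induction with
    | zero => rw [BT.mk_zero_right, FB.mk_zero_mid]; exact zero
    | tmul u v => exact mk a y u v b
    | add x y hx hy => rw [BT.mk_add_right, FB.mk_add_mid]; exact add _ _ hx hy
  | add x y hx hy => exact add _ _ hx hy

end Compositions

theorem add_of_homotopy {A B C : Type*} [AddCommGroup A] [AddCommGroup B] [AddCommGroup C]
    {b : B → A} {s : A → B} {s' : C → A} {b' : A → C} (hb : ∀ x y, b (x + y) = b x + b y)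
    (hs : ∀ x y, s (x + y) = s x + s y) (hs' : ∀ x y, s' (x + y) = s' x + s' y)
    (hb' : ∀ x y, b' (x + y) = b' x + b' y) {x y : A} (hx : b (s x) + s' (b' x) = x)
    (hy : b (s y) + s' (b' y) = y) : b (s (x + y)) + s' (b' (x + y)) = x + y := by
  rw [hs, hb, hb', hs', add_add_add_comm, hx, hy]

/-- The inductive step in the construction of a homotopy: with s contracting, g = 1|t|1, u = σ(τ(g))
and v the previous homotopy applied to the boundary of g, the next value is s(g - u - v) as soon as
g - u - v is a cycle. -/
theorem homotopy_aux {A B C : Type*} [AddCommGroup A] [AddCommGroup B] [AddCommGroup C]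
    {b : B → A} {s : A → B} {s' : C → A} {b' : A → C} {g u v : A}
    (h : ∀ x, b (s x) + s' (b' x) = x) (h0 : s' 0 = 0) (hz : b' (g - u - v) = 0) :
    b (s (g - u - v)) + v = g - u := by
  have := h (g - u - v)
  rw [hz, h0, add_zero] at this
  rw [this, sub_add_cancel]

/-! ### The setting

The modules that enter the comparison of the normalized bar resolution with the Koszul complex,
with their structure, in an abstract form. -/

/-- The structure of the modules `A`, `I_+`, `R` and `R_{N+1}` attached to a homogeneous algebra. -/
structure Setting (F : Type u₁) (k : Type u₂) (V : Type u₃) [Field F] [Ring k] [Algebra F k]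
    [AddCommGroup V] [FModule F V] [EnvModule F k V] [EnvTower F k V] where
  /-- The homogeneous algebra. -/
  A : Type u₄
  [ringA : Ring A]
  [algA : Algebra F A]
  [kalgA : KAlg F k A]
  /-- The augmentation ideal. -/
  I : Type u₄
  [groupI : AddCommGroup I]
  [moduleI : Module F I]
  [envI : Module (Env F k) I]
  [towerI : IsScalarTower F (Env F k) I]
  /-- The relations. -/
  R : Type u₄
  [groupR : AddCommGroup R]
  [moduleR : Module F R]
  [envR : Module (Env F k) R]
  [towerR : IsScalarTower F (Env F k) R]
  /-- The bimodule `R_{N+1}`. -/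
  S : Type u₄
  [groupS : AddCommGroup S]
  [moduleS : Module F S]
  [envS : Module (Env F k) S]
  [towerS : IsScalarTower F (Env F k) S]
  /-- The degree of the relations. -/
  N : ℕ
  two_le : 2 ≤ N
  /-- The projection `TV → A`. -/
  q : TAlg F k V →ₗ[Env F k] A
  q_mul : ∀ x y, q (x * y) = q x * q y
  q_unit : ∀ c : k, q (KAlg.unit F _ c) = KAlg.unit F A c
  /-- The grading of `A`. -/
  deg : ℕ → Submodule F A
  /-- The projections on the homogeneous components of `A`. -/
  gradingA : Grading F k deg
  mem_deg : ∀ {n a}, a ∈ deg n ↔ ∃ x ∈ TAlg.deg F k V n, q x = a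
  /-- The augmentation of `A`. -/
  aug : A →ₐ[F] k
  aug_unit : ∀ c : k, aug (KAlg.unit F A c) = c
  aug_deg : ∀ {n}, n ≠ 0 → ∀ {a}, a ∈ deg n → aug a = 0
  /-- The inclusion `I_+ → A`. -/
  j : I →ₗ[Env F k] A
  /-- The projection `A → A / k ≅ I_+`. -/
  p : A →ₗ[Env F k] I
  p_j : ∀ a, p (j a) = a
  j_p : ∀ a, j (p a) = a - KAlg.unit F A (aug a)
  /-- The product of `I_+`. -/
  μ : BT F k I I →ₗ[Env F k] I
  j_μ : ∀ a b, j (μ (BT.mk F k a b)) = j a * j b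
  /-- The grading of `I_+`. -/
  degI : ℕ → Submodule F I
  /-- The projections on the homogeneous components of `I_+`. -/
  gradingI : Grading F k degI
  mem_degI : ∀ {n a}, a ∈ degI n ↔ j a ∈ deg n
  /-- The inclusion `R → TV`. -/
  incR : R →ₗ[Env F k] TAlg F k V
  incR_injective : Function.Injective incR
  incR_mem : ∀ r, incR r ∈ TAlg.deg F k V N
  q_incR : ∀ r, q (incR r) = 0
  mem_span_of_q : ∀ {x}, q x = 0 → x ∈ TwoSidedIdeal.span (Set.range incR)
  eq_zero_of_q : ∀ {n}, n < N → ∀ {x}, x ∈ TAlg.deg F k V n → q x = 0 → x = 0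
  /-- The inclusion `R_{N+1} → R ⊗ V`. -/
  toRV : S →ₗ[Env F k] BT F k R V
  /-- The inclusion `R_{N+1} → V ⊗ R`. -/
  toVR : S →ₗ[Env F k] BT F k V R
  S_ext : ∀ {w w'}, toRV w = toRV w' → toVR w = toVR w' → w = w'
  mulMap_toRV : ∀ w, mulMap incR (TAlg.ι F k) (toRV w) = mulMap (TAlg.ι F k) incR (toVR w)
  exists_S : ∀ {x y}, mulMap incR (TAlg.ι F k) x = mulMap (TAlg.ι F k) incR y →
    ∃ w, toRV w = x ∧ toVR w = y
  /-- The map `x ↦ ∑ x₁|x₂|x₃`. -/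
  decomp : TAlg F k V →ₗ[Env F k] FB F k A V
  decomp_unit : ∀ c : k, decomp (KAlg.unit F _ c) = 0
  decomp_ι : ∀ v, decomp (TAlg.ι F k v) = gen v
  decomp_mul : ∀ x y, decomp (x * y) = q x • decomp y + op (q y) • decomp x

namespace Setting

attribute [instance] ringA algA kalgA groupI moduleI envI towerI groupR moduleR envR towerR
  groupS moduleS envS towerS

variable {F : Type u₁} {k : Type u₂} {V : Type u₃} [Field F] [Ring k] [Algebra F k]
  [AddCommGroup V] [FModule F V] [EnvModule F k V] [EnvTower F k V]
variable (M : Setting.{u₁, u₂, u₃, u₄} F k V)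

theorem q_mem {n : ℕ} {x : TAlg F k V} (hx : x ∈ TAlg.deg F k V n) : M.q x ∈ M.deg n :=
  M.mem_deg.2 ⟨x, hx, rfl⟩

theorem deg_mul {m n : ℕ} {a b : M.A} (ha : a ∈ M.deg m) (hb : b ∈ M.deg n) :
    a * b ∈ M.deg (m + n) := by
  obtain ⟨x, hx, rfl⟩ := M.mem_deg.1 ha
  obtain ⟨y, hy, rfl⟩ := M.mem_deg.1 hb
  rw [← M.q_mul]
  exact M.q_mem (TAlg.deg_mul hx hy)

theorem unit_mem_deg (c : k) : KAlg.unit F M.A c ∈ M.deg 0 := by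
  rw [← M.q_unit]
  exact M.q_mem (TAlg.unit_mem_deg c)

theorem one_mem_deg : (1 : M.A) ∈ M.deg 0 := by
  have := M.unit_mem_deg 1
  rwa [map_one] at this

theorem exists_unit_of_mem_deg_zero {a : M.A} (ha : a ∈ M.deg 0) :
    ∃ c : k, KAlg.unit F M.A c = a := by
  obtain ⟨x, hx, rfl⟩ := M.mem_deg.1 ha
  obtain ⟨c, rfl⟩ := TAlg.exists_unit_of_mem_deg_zero hx
  exact ⟨c, (M.q_unit c).symm⟩

theorem p_unit (c : k) : M.p (KAlg.unit F M.A c) = 0 := by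
  rw [← M.p_j (M.p _), M.j_p, M.aug_unit, sub_self, map_zero]

theorem p_one : M.p 1 = 0 := by
  have := M.p_unit 1
  rwa [map_one] at this

theorem aug_j (a : M.I) : M.aug (M.j a) = 0 := by
  rw [← M.p_j a, M.j_p, map_sub, M.aug_unit, sub_self]

theorem j_injective : Function.Injective M.j := Function.LeftInverse.injective M.p_j

theorem j_p_of_mem_deg {n : ℕ} (hn : n ≠ 0) {a : M.A} (ha : a ∈ M.deg n) : M.j (M.p a) = a := by
  rw [M.j_p, M.aug_deg hn ha, map_zero, sub_zero]

theorem p_mem_degI {n : ℕ} {a : M.A} (ha : a ∈ M.deg n) : M.p a ∈ M.degI n := by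
  rcases eq_or_ne n 0 with rfl | hn
  · obtain ⟨c, rfl⟩ := M.exists_unit_of_mem_deg_zero ha
    rw [M.p_unit]; exact zero_mem _
  · rw [M.mem_degI, M.j_p_of_mem_deg hn ha]; exact ha

theorem degI_zero {a : M.I} (ha : a ∈ M.degI 0) : a = 0 := by
  obtain ⟨c, hc⟩ := M.exists_unit_of_mem_deg_zero (M.mem_degI.1 ha)
  rw [← M.p_j a, ← hc, M.p_unit]

/-- Splits a into an element of I_+ and the scalar ε(a). The scalar part supplies the term that
closes the identities `b2_contr`, `b3_contr` and `b4_contr`. -/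
theorem p_mul_j (a : M.A) (w : M.I) :
    M.p (a * M.j w) = M.μ (BT.mk F k (M.p a) w) + lsm F (M.aug a) w := by
  apply M.j_injective
  rw [map_add, M.j_μ, map_lsm, KAlg.lsm_eq, M.j_p, M.j_p, map_mul, M.aug_j, mul_zero, map_zero,
    sub_zero, ← add_mul, sub_add_cancel]

/-- The class in `A / k ≅ I_+` of an element of the tensor algebra. -/
def cls : TAlg F k V →ₗ[Env F k] M.I := M.p ∘ₗ M.q

/-- The inclusion `V → A`. -/
def ιA : V →ₗ[Env F k] M.A := M.q ∘ₗ TAlg.ι F k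

/-- The inclusion `V → I_+`. -/
def ιI : V →ₗ[Env F k] M.I := M.p ∘ₗ M.ιA

theorem cls_apply (x : TAlg F k V) : M.cls x = M.p (M.q x) := rfl

theorem cls_mem {n : ℕ} {x : TAlg F k V} (hx : x ∈ TAlg.deg F k V n) : M.cls x ∈ M.degI n :=
  M.p_mem_degI (M.q_mem hx)

theorem j_cls {n : ℕ} (hn : n ≠ 0) {x : TAlg F k V} (hx : x ∈ TAlg.deg F k V n) :
    M.j (M.cls x) = M.q x := M.j_p_of_mem_deg hn (M.q_mem hx)

theorem cls_of_mem_deg_zero {x : TAlg F k V} (hx : x ∈ TAlg.deg F k V 0) : M.cls x = 0 :=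
  M.degI_zero (M.cls_mem hx)

theorem cls_incR (r : M.R) : M.cls (M.incR r) = 0 := by rw [cls_apply, M.q_incR, map_zero]

theorem ιI_apply (v : V) : M.ιI v = M.cls (TAlg.ι F k v) := rfl

theorem j_ιI (v : V) : M.j (M.ιI v) = M.ιA v := M.j_cls one_ne_zero (TAlg.ι_mem_deg v)

theorem ιA_mem (v : V) : M.ιA v ∈ M.deg 1 := M.q_mem (TAlg.ι_mem_deg v)

theorem ιI_mem (v : V) : M.ιI v ∈ M.degI 1 := M.cls_mem (TAlg.ι_mem_deg v)

theorem μ_cls {m : ℕ} (hm : m ≠ 0) {x y : TAlg F k V} (hx : x ∈ TAlg.deg F k V m)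
    {n : ℕ} (hn : n ≠ 0) (hy : y ∈ TAlg.deg F k V n) :
    M.μ (BT.mk F k (M.cls x) (M.cls y)) = M.cls (x * y) := by
  apply M.j_injective
  rw [M.j_μ, M.j_cls hm hx, M.j_cls hn hy, M.j_cls (by omega) (TAlg.deg_mul hx hy), M.q_mul]

/-! ### Gradings of free bimodules -/

/-- The grading of `A ⊗ W ⊗ A`. -/
def degFB {W : Type*} [AddCommGroup W] [FModule F W] [EnvModule F k W]
    [EnvTower F k W] (GW : ℕ → Submodule F W) : ℕ → Submodule F (FB F k M.A W) :=
  BT.deg M.deg (BT.deg GW M.deg)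

section

variable {W : Type*} [AddCommGroup W] [FModule F W] [EnvModule F k W]
  [EnvTower F k W] {GW : ℕ → Submodule F W}

/-- The projections on the homogeneous components of `A ⊗ W ⊗ A`. -/
def gradingFB (𝒢 : Grading F k GW) : Grading F k (M.degFB GW) :=
  M.gradingA.bt (𝒢.bt M.gradingA)

theorem mk_mem_degFB {i j l : ℕ} {a b : M.A} {w : W} (ha : a ∈ M.deg i) (hw : w ∈ GW j)
    (hb : b ∈ M.deg l) : FB.mk F k a w b ∈ M.degFB GW (i + j + l) :=
  Submodule.subset_span ⟨i, j + l, a, _, by omega, ha,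
    Submodule.subset_span ⟨j, l, w, b, rfl, hw, hb, rfl⟩, rfl⟩

theorem degFB_induction {n : ℕ} {p : FB F k M.A W → Prop} (zero : p 0)
    (mk : ∀ i j l, i + j + l = n → ∀ a ∈ M.deg i, ∀ w ∈ GW j, ∀ b ∈ M.deg l, p (FB.mk F k a w b))
    (add : ∀ x y, p x → p y → p (x + y)) {x : FB F k M.A W} (hx : x ∈ M.degFB GW n) : p x := by
  have hp : ∀ {m : ℕ} {y : BT F k W M.A}, y ∈ BT.deg (k := k) GW M.deg m → ∀ i, i + m = n →
      ∀ a ∈ M.deg i, p (BT.mk F k a y) := by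
    intro m y hy
    induction hy using Submodule.span_induction with
    | mem y hy =>
      obtain ⟨j, l, w, b, rfl, hw, hb, rfl⟩ := hy
      intro i hi a ha
      exact mk i j l (by omega) a ha w hw b hb
    | zero => intro i _ a _; rw [BT.mk_zero_right]; exact zero
    | add x y _ _ hx hy =>
      intro i hi a ha
      rw [BT.mk_add_right]; exact add _ _ (hx i hi a ha) (hy i hi a ha)
    | smul s y _ hy =>
      intro i hi a ha
      rw [BT.mk_smul_right, ← BT.mk_smul_left]
      exact hy i hi _ (Submodule.smul_mem _ _ ha)
  -- Treating all F-multiples at once absorbs the scalars into the first tensor factor, so p need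
  -- not be assumed stable under scalars.
  have key : ∀ s : F, p (s • x) := by
    induction hx using Submodule.span_induction with
    | mem x hx =>
      obtain ⟨i, m, a, y, hi, ha, hy, rfl⟩ := hx
      intro s
      rw [← BT.mk_smul_left]
      exact hp hy i hi _ (Submodule.smul_mem _ _ ha)
    | zero => intro s; rw [smul_zero]; exact zero
    | add x y _ _ hx hy => intro s; rw [smul_add]; exact add _ _ (hx s) (hy s)
    | smul t x _ hx => intro s; rw [smul_smul]; exact hx _
  simpa using key 1

theorem gen_mem_degFB {n : ℕ} {w : W} (hw : w ∈ GW n) : (gen w : FB F k M.A W) ∈ M.degFB GW n := by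
  have := M.mk_mem_degFB M.one_mem_deg hw M.one_mem_deg
  rwa [zero_add, add_zero] at this

theorem smul_mem_degFB {i n : ℕ} {a : M.A} (ha : a ∈ M.deg i) {x : FB F k M.A W}
    (hx : x ∈ M.degFB GW n) : a • x ∈ M.degFB GW (i + n) := by
  refine M.degFB_induction (p := fun x => a • x ∈ M.degFB GW (i + n)) ?_ ?_ ?_ hx
  · rw [smul_zero]; exact zero_mem _
  · intro j l m e a' ha' w hw b hb
    rw [FB.smul_mk, ← e, ← add_assoc, ← add_assoc]
    exact M.mk_mem_degFB (M.deg_mul ha ha') hw hb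
  · intro x y hx hy
    rw [smul_add]; exact add_mem hx hy

theorem op_smul_mem_degFB {i n : ℕ} {b : M.A} (hb : b ∈ M.deg i) {x : FB F k M.A W}
    (hx : x ∈ M.degFB GW n) : op b • x ∈ M.degFB GW (n + i) := by
  refine M.degFB_induction (p := fun x => op b • x ∈ M.degFB GW (n + i)) ?_ ?_ ?_ hx
  · rw [smul_zero]; exact zero_mem _
  · intro j l m e a' ha' w hw b' hb'
    rw [FB.op_smul_mk, ← e, add_assoc]
    exact M.mk_mem_degFB ha' hw (M.deg_mul hb' hb)
  · intro x y hx hy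
    rw [smul_add]; exact add_mem hx hy

/-- Outer factors have nonnegative degree, so A ⊗ W ⊗ A starts in degree d. Hence graded maps to K_2
vanish below degree N and graded maps to K_3 vanish below degree N + 1. -/
theorem degFB_pure_of_lt {d n : ℕ} (hn : n < d) {x : FB F k M.A W}
    (hx : x ∈ M.degFB (pureDeg F W d) n) : x = 0 := by
  refine M.degFB_induction (p := fun x => x = 0) rfl ?_ ?_ hx
  · intro i j l e a ha w hw b hb
    simp only [pureDeg] at hw
    rw [if_neg (by omega), Submodule.mem_bot] at hw
    rw [hw, FB.mk_zero_mid]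
  · intro x y hx hy
    rw [hx, hy, add_zero]

theorem _root_.PBW.mem_pureDeg (d : ℕ) (w : W) : w ∈ pureDeg F W d d := by simp [pureDeg]

theorem _root_.PBW.eq_zero_of_mem_pureDeg {d j : ℕ} (hj : j ≠ d) {w : W}
    (hw : w ∈ pureDeg F W d j) : w = 0 := by
  simpa [pureDeg, hj] using hw

theorem mk_unit_unit (c d : k) (w : W) : FB.mk F k (KAlg.unit F M.A c) w (KAlg.unit F M.A d) =
    gen (lsm F c (rsm F d w)) := by
  rw [gen_apply, ← FB.mk_mul_unit, ← FB.mk_unit_mul, one_mul, mul_one]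

/-- In the lowest degree both outer factors are scalars of k and can be moved into W. -/
theorem degFB_pure_self {d : ℕ} {x : FB F k M.A W}
    (hx : x ∈ M.degFB (pureDeg F W d) d) : ∃ w, x = gen w := by
  refine M.degFB_induction (p := fun x => ∃ w, x = gen w) ⟨0, (map_zero _).symm⟩ ?_ ?_ hx
  · intro i j l e a ha w hw b hb
    by_cases hj : j = d
    · obtain ⟨c, rfl⟩ := M.exists_unit_of_mem_deg_zero (a := a) (by rwa [show i = 0 by omega] at ha)
      obtain ⟨c', rfl⟩ := M.exists_unit_of_mem_deg_zero (a := b)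
        (by rwa [show l = 0 by omega] at hb)
      exact ⟨_, M.mk_unit_unit c c' w⟩
    · rw [eq_zero_of_mem_pureDeg hj hw, FB.mk_zero_mid]
      exact ⟨0, (map_zero _).symm⟩
  · rintro _ _ ⟨v, rfl⟩ ⟨w, rfl⟩
    exact ⟨v + w, (map_add _ _ _).symm⟩

/-- The map `w ⊗ b ↦ w ε(b)` on `W ⊗ A`. -/
def augRight : BT F k W M.A →ₗ[Env F k] W :=
  BT.lift (fun w b => rsm F (M.aug b) w)
    (by intros; simp) (by intros; simp [BT.rsm_add])
    (by intros; rw [KAlg.lsm_eq, map_mul, M.aug_unit, BT.rsm_mul])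
    (by intros; rw [lsm_rsm])
    (by intros; rw [KAlg.rsm_eq, map_mul, M.aug_unit, BT.rsm_mul])

/-- The map `A ⊗ W ⊗ A → W` that applies the augmentation to the outer factors. -/
def augFB : FB F k M.A W →ₗ[Env F k] W :=
  BT.lift (fun a y => lsm F (M.aug a) (M.augRight y))
    (by intros; simp [BT.lsm_add]) (by intros; simp)
    (by intro a c y; rw [KAlg.rsm_eq, map_mul, M.aug_unit, BT.lsm_mul, map_lsm])
    (by intros; rw [KAlg.lsm_eq, map_mul, M.aug_unit, BT.lsm_mul])
    (by intros; rw [map_rsm, lsm_rsm])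

theorem augFB_mk (a : M.A) (w : W) (b : M.A) :
    M.augFB (FB.mk F k a w b) = lsm F (M.aug a) (rsm F (M.aug b) w) := rfl

theorem augFB_gen (w : W) : M.augFB (gen w) = w := by
  rw [gen_apply, augFB_mk, map_one, BT.lsm_one, BT.rsm_one]

theorem _root_.PBW.lsm_zero_left (w : W) : lsm F (0 : k) w = 0 := by
  simpa using lsm_algebraMap (k := k) (0 : F) w

theorem _root_.PBW.rsm_zero_left (w : W) : rsm F (0 : k) w = 0 := by
  simpa using rsm_algebraMap (k := k) (0 : F) w

theorem augFB_smul_j (a : M.I) (x : FB F k M.A W) : M.augFB (M.j a • x) = 0 := by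
  induction x using FB.induction with
  | zero => rw [smul_zero, map_zero]
  | mk a' w b => rw [FB.smul_mk, augFB_mk, map_mul, M.aug_j, zero_mul, lsm_zero_left]
  | add x y hx hy => rw [smul_add, map_add, hx, hy, add_zero]

theorem augFB_op_smul_j (b : M.I) (x : FB F k M.A W) : M.augFB (op (M.j b) • x) = 0 := by
  induction x using FB.induction with
  | zero => rw [smul_zero, map_zero]
  | mk a' w b =>
    rw [FB.op_smul_mk, augFB_mk, map_mul, M.aug_j, mul_zero, rsm_zero_left, map_zero]
  | add x y hx hy => rw [smul_add, map_add, hx, hy, add_zero]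

theorem augFB_mem {n : ℕ} (𝒢 : Grading F k GW) {x : FB F k M.A W} (hx : x ∈ M.degFB GW n) :
    M.augFB x ∈ GW n := by
  refine M.degFB_induction (p := fun x => M.augFB x ∈ GW n) ?_ ?_ ?_ hx
  · rw [map_zero]; exact zero_mem _
  · intro i j l e a ha w hw b hb
    rw [augFB_mk]
    by_cases hi : i = 0
    · by_cases hl : l = 0
      · rw [show n = j by omega]
        exact 𝒢.lsm_mem _ (𝒢.rsm_mem _ hw)
      · rw [M.aug_deg hl hb, rsm_zero_left, map_zero]
        exact zero_mem _
    · rw [M.aug_deg hi ha, lsm_zero_left]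
      exact zero_mem _
  · intro x y hx hy
    rw [map_add]; exact add_mem hx hy

/-- The elements of `I_+ (A ⊗ W ⊗ A) + (A ⊗ W ⊗ A) I_+`. -/
theorem sub_gen_augFB_mem (x : FB F k M.A W) : x - gen (M.augFB x) ∈ AddSubmonoid.closure
    ({y | ∃ (a : M.I) (z : FB F k M.A W), y = M.j a • z} ∪
      {y | ∃ (a : M.I) (z : FB F k M.A W), y = op (M.j a) • z}) := by
  induction x using FB.induction with
  | zero => rw [map_zero, map_zero, sub_zero]; exact zero_mem _
  | mk a w b =>
    have h1 : FB.mk F k a w b - gen (M.augFB (FB.mk F k a w b)) =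
        M.j (M.p a) • FB.mk F k 1 w b +
          op (M.j (M.p b)) • FB.mk F k (KAlg.unit F M.A (M.aug a)) w 1 := by
      rw [augFB_mk, ← mk_unit_unit, FB.smul_mk, FB.op_smul_mk, mul_one, one_mul, M.j_p, M.j_p,
        FB.mk_sub_left, FB.mk_sub_right]
      abel
    rw [h1]
    exact add_mem (AddSubmonoid.subset_closure (Or.inl ⟨_, _, rfl⟩))
      (AddSubmonoid.subset_closure (Or.inr ⟨_, _, rfl⟩))
  | add x y hx hy =>
    rw [map_add, map_add, add_sub_add_comm]; exact add_mem hx hy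

/-- The map `a|w|b ↦ 1|a ⊗ w|b`, a contracting homotopy of the normalized bar resolution. -/
def contr : FB F k M.A W →ₗ[Env F k] FB F k M.A (BT F k M.I W) :=
  genR LinearMap.id ∘ₗ BT.assoc ∘ₗ BT.map M.p LinearMap.id

theorem contr_mk (a : M.A) (w : W) (b : M.A) :
    M.contr (FB.mk F k a w b) = FB.mk F k 1 (BT.mk F k (M.p a) w) b := rfl

/-- Multiplying by a and contracting inserts one more tensor factor; `split3` is obtained in this
way from `split2`, and `split4` from `split3`. -/
theorem contr_smul_genR (a : M.A) (t : BT F k W M.A) :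
    M.contr (a • genR LinearMap.id t) = genR LinearMap.id (BT.assoc (BT.mk F k (M.p a) t)) := by
  induction t using BT.induction with
  | zero => rw [map_zero, smul_zero, map_zero, BT.mk_zero_right, map_zero, map_zero]
  | tmul w b => rw [genR_mk, FB.smul_mk, mul_one, contr_mk, BT.assoc_mk, genR_mk]
  | add x y hx hy =>
    simpa only [map_add, smul_add, BT.mk_add_right] using congrArg₂ (· + ·) hx hy

attribute [irreducible] contr

theorem contr_gen (w : W) : M.contr (gen w) = 0 := by
  rw [gen_apply, contr_mk, p_one, BT.mk_zero_left, FB.mk_zero_mid]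

theorem contr_op_smul (b : M.A) (x : FB F k M.A W) : M.contr (op b • x) = op b • M.contr x := by
  induction x using FB.induction with
  | zero => rw [smul_zero, map_zero, smul_zero]
  | mk a' w b => rw [FB.op_smul_mk, contr_mk, contr_mk, FB.op_smul_mk]
  | add x y hx hy => rw [smul_add, map_add, map_add, hx, hy, smul_add]

theorem contr_j_smul_gen (u : M.I) (w : W) :
    M.contr (M.j u • (gen w : FB F k M.A W)) = gen (BT.mk F k u w) := by
  rw [smul_gen, contr_mk, M.p_j, gen_apply]

/-- A contraction has first factor 1, whose class in A/k is zero. This normalization is what gives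
the homotopies their prescribed values. -/
theorem contr_contr (x : FB F k M.A W) : M.contr (M.contr x) = 0 := by
  induction x using FB.induction with
  | zero => rw [map_zero, map_zero]
  | mk a w b => rw [contr_mk, contr_mk, p_one, BT.mk_zero_left, FB.mk_zero_mid]
  | add x y hx hy => rw [map_add, map_add, hx, hy, add_zero]

theorem contr_mem {n : ℕ} {x : FB F k M.A W} (hx : x ∈ M.degFB GW n) :
    M.contr x ∈ M.degFB (BT.deg M.degI GW) n := by
  refine M.degFB_induction (p := fun x => M.contr x ∈ M.degFB (BT.deg M.degI GW) n) ?_ ?_ ?_ hx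
  · rw [map_zero]; exact zero_mem _
  · intro i j l e a ha w hw b hb
    rw [contr_mk, ← e]
    have := M.mk_mem_degFB (GW := BT.deg (k := k) M.degI GW) M.one_mem_deg
      (Submodule.subset_span ⟨i, j, _, _, rfl, M.p_mem_degI ha, hw, rfl⟩) hb
    rwa [zero_add] at this
  · intro x y hx hy
    rw [map_add]; exact add_mem hx hy

theorem ext_genD (j : W →ₗ[Env F k] M.A) (a : M.A) (x : W) (b : M.A) :
    ext (genD j) (FB.mk F k a x b) =
      FB.mk F k (a * j x) (1 : k) b - FB.mk F k a (1 : k) (j x * b) := by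
  rw [ext_mk, genD_apply, smul_sub, smul_sub, FB.op_smul_mk, FB.op_smul_mk, FB.smul_mk, FB.smul_mk,
    one_mul, mul_one]

theorem mk_j_p_add (a : M.A) (w : W) (b : M.A) :
    FB.mk F k (M.j (M.p a)) w b + FB.mk F k 1 (lsm F (M.aug a) w) b = FB.mk F k a w b := by
  rw [← FB.mk_mul_unit, one_mul, ← FB.mk_add_left, M.j_p, sub_add_cancel]

end

variable {W X : Type*} [AddCommGroup W] [FModule F W] [EnvModule F k W]
  [EnvTower F k W] [AddCommGroup X] [FModule F X] [EnvModule F k X]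
  [EnvTower F k X] {GW : ℕ → Submodule F W} {GX : ℕ → Submodule F X}

theorem bimodHom_mem_degFB {f : FB F k M.A W →ₗ[F] FB F k M.A X} (hf : IsBimodHom M.A f)
    (hg : ∀ n, ∀ w ∈ GW n, f (gen w) ∈ M.degFB GX n) {n : ℕ} {x : FB F k M.A W}
    (hx : x ∈ M.degFB GW n) : f x ∈ M.degFB GX n := by
  refine M.degFB_induction (p := fun x => f x ∈ M.degFB GX n) ?_ ?_ ?_ hx
  · rw [map_zero]; exact zero_mem _
  · intro i j l e a ha w hw b hb
    rw [hf.mk_apply, ← e]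
    have := M.smul_mem_degFB ha (M.op_smul_mem_degFB hb (hg j w hw))
    rwa [← add_assoc] at this
  · intro x y hx hy
    rw [map_add]; exact add_mem hx hy

theorem ext_mem_degFB {f : W →ₗ[Env F k] FB F k M.A X}
    (hg : ∀ n, ∀ w ∈ GW n, f w ∈ M.degFB GX n) {n : ℕ} {x : FB F k M.A W}
    (hx : x ∈ M.degFB GW n) : ext f x ∈ M.degFB GX n :=
  M.bimodHom_mem_degFB (ext_isBimodHom f) (fun n w hw => by rw [ext_gen]; exact hg n w hw) hx

end Setting

/-! ### Decompositions and the bar differentials -/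

namespace Setting

variable {F : Type u₁} {k : Type u₂} {V : Type u₃} [Field F] [Ring k] [Algebra F k]
  [AddCommGroup V] [FModule F V] [EnvModule F k V] [EnvTower F k V]
variable (M : Setting.{u₁, u₂, u₃, u₄} F k V)

/-- `I_+ ⊗ I_+`. -/
abbrev I2 : Type _ := BT F k M.I M.I

/-- `I_+ ⊗ I_+ ⊗ I_+`. -/
abbrev I3 : Type _ := BT F k M.I M.I2

/-- `I_+ ⊗ I_+ ⊗ I_+ ⊗ I_+`. -/
abbrev I4 : Type _ := BT F k M.I M.I3

section Shortcuts

instance (priority := 2000) : AddCommGroup M.I2 :=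
  instAddCommGroupBT (M := M.I) (N := M.I)
instance (priority := 2000) : Module F M.I2 :=
  instModuleBT (M := M.I) (N := M.I)
instance (priority := 2000) : Module (Env F k) M.I2 :=
  BT.instModuleEnv (M := M.I) (N := M.I)
instance (priority := 2000) : IsScalarTower F (Env F k) M.I2 :=
  BT.instIsScalarTowerEnv (M := M.I) (N := M.I)
instance (priority := 2000) : AddCommGroup M.I3 :=
  instAddCommGroupBT (M := M.I) (N := M.I2)
instance (priority := 2000) : Module F M.I3 :=
  instModuleBT (M := M.I) (N := M.I2)
instance (priority := 2000) : Module (Env F k) M.I3 :=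
  BT.instModuleEnv (M := M.I) (N := M.I2)
instance (priority := 2000) : IsScalarTower F (Env F k) M.I3 :=
  BT.instIsScalarTowerEnv (M := M.I) (N := M.I2)
instance (priority := 2000) : AddCommGroup M.I4 :=
  instAddCommGroupBT (M := M.I) (N := M.I3)
instance (priority := 2000) : Module F M.I4 :=
  instModuleBT (M := M.I) (N := M.I3)
instance (priority := 2000) : Module (Env F k) M.I4 :=
  BT.instModuleEnv (M := M.I) (N := M.I3)
instance (priority := 2000) : IsScalarTower F (Env F k) M.I4 :=
  BT.instIsScalarTowerEnv (M := M.I) (N := M.I3)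

end Shortcuts

/-- `a ⊗ b ⊗ c ↦ ab ⊗ c`. -/
def m31 : M.I3 →ₗ[Env F k] M.I2 := BT.map M.μ LinearMap.id ∘ₗ BT.assoc

/-- `a ⊗ b ⊗ c ↦ a ⊗ bc`. -/
def m32 : M.I3 →ₗ[Env F k] M.I2 := BT.map LinearMap.id M.μ

/-- `a ⊗ b ⊗ c ⊗ d ↦ ab ⊗ c ⊗ d`. -/
def m41 : M.I4 →ₗ[Env F k] M.I3 := BT.map M.μ LinearMap.id ∘ₗ BT.assoc

/-- `a ⊗ b ⊗ c ⊗ d ↦ a ⊗ bc ⊗ d`. -/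
def m42 : M.I4 →ₗ[Env F k] M.I3 := BT.map LinearMap.id M.m31

/-- `a ⊗ b ⊗ c ⊗ d ↦ a ⊗ b ⊗ cd`. -/
def m43 : M.I4 →ₗ[Env F k] M.I3 := BT.map LinearMap.id M.m32

/-- The grading of `I_+ ⊗ I_+`. -/
def degI2 : ℕ → Submodule F M.I2 := BT.deg M.degI M.degI

/-- The grading of `I_+ ⊗ I_+ ⊗ I_+`. -/
def degI3 : ℕ → Submodule F M.I3 := BT.deg M.degI M.degI2

/-- The grading of `I_+ ⊗ I_+ ⊗ I_+ ⊗ I_+`. -/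
def degI4 : ℕ → Submodule F M.I4 := BT.deg M.degI M.degI3

/-- `Tor_3^A(k,k)` is concentrated in degree `N + 1`. -/
def TorThreeConcentrated : Prop :=
  ∀ m : ℕ, m ≠ M.N + 1 → ∀ x ∈ M.degI3 m, M.m31 x - M.m32 x = 0 →
    ∃ y : M.I4, M.m41 y - M.m42 y + M.m43 y = x

/-- The first bar differential. -/
def b1 : FB F k M.A M.I →ₗ[F] FB F k M.A k := ext (genD M.j)

/-- The second bar differential. -/
def b2 : FB F k M.A M.I2 →ₗ[F] FB F k M.A M.I :=
  ext (genL M.j - gen ∘ₗ M.μ + genR M.j)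

/-- The third bar differential. -/
def b3 : FB F k M.A M.I3 →ₗ[F] FB F k M.A M.I2 :=
  ext (genL M.j - gen ∘ₗ M.m31 + gen ∘ₗ M.m32 - genR M.j ∘ₗ BT.assoc)

/-- The fourth bar differential. -/
def b4 : FB F k M.A M.I4 →ₗ[F] FB F k M.A M.I3 :=
  ext (genL M.j - gen ∘ₗ M.m41 + gen ∘ₗ M.m42 - gen ∘ₗ M.m43 +
    genR M.j ∘ₗ BT.assoc ∘ₗ BT.map LinearMap.id BT.assoc)

/-- `1|v|1 ↦ v|1 - 1|v`. -/
def d1 : FB F k M.A V →ₗ[F] FB F k M.A k := ext (genD M.ιA)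

/-- `1|r|1 ↦ ∑ r₁|r₂|r₃`. -/
def d2 : FB F k M.A M.R →ₗ[F] FB F k M.A V := ext (M.decomp ∘ₗ M.incR)

/-- `1|w|1 ↦ ∑ v_i|s_i|1 - ∑ 1|r_i|u_i` for `w = ∑ r_i u_i = ∑ v_i s_i`. -/
def d3 : FB F k M.A M.S →ₗ[F] FB F k M.A M.R :=
  ext (genL M.ιA ∘ₗ M.toVR - genR M.ιA ∘ₗ M.toRV)

/-- `a|v|b ↦ (a ⊗ v) ⊗ b`. -/
def regroup : FB F k M.A V →ₗ[Env F k] BT F k M.I2 M.A :=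
  BT.map (BT.map M.p M.ιI) LinearMap.id ∘ₗ BT.assoc

/-- `1|v|1 ↦ 1|v|1`. -/
def σ1 : FB F k M.A V →ₗ[F] FB F k M.A M.I := ext (gen ∘ₗ M.ιI)

/-- `x ↦ ∑ 1|x₁|x₂|x₃`. -/
def split2 : TAlg F k V →ₗ[Env F k] FB F k M.A M.I2 :=
  genR LinearMap.id ∘ₗ M.regroup ∘ₗ M.decomp

/-- `a ⊗ y ↦ ∑ 1|a|y₁|y₂|y₃`. -/
def split3 : BT F k M.I (TAlg F k V) →ₗ[Env F k] FB F k M.A M.I3 :=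
  genR LinearMap.id ∘ₗ BT.assoc ∘ₗ BT.map LinearMap.id (M.regroup ∘ₗ M.decomp)

/-- `a ⊗ b ⊗ z ↦ ∑ 1|a|b|z₁|z₂|z₃`. -/
def split4 : BT F k M.I (BT F k M.I (TAlg F k V)) →ₗ[Env F k] FB F k M.A M.I4 :=
  genR LinearMap.id ∘ₗ BT.assoc ∘ₗ
    BT.map LinearMap.id (BT.assoc ∘ₗ BT.map LinearMap.id (M.regroup ∘ₗ M.decomp))

/-- `1|r|1 ↦ ∑ 1|r₁|r₂|r₃`. -/
def σ2 : FB F k M.A M.R →ₗ[F] FB F k M.A M.I2 := ext (M.split2 ∘ₗ M.incR)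

/-- `1|w|1 ↦ ∑ 1|v_i|s_{i,1}|s_{i,2}|s_{i,3}` for `w = ∑ v_i s_i`. -/
def σ3 : FB F k M.A M.S →ₗ[F] FB F k M.A M.I3 :=
  ext (M.split3 ∘ₗ BT.map M.ιI M.incR ∘ₗ M.toVR)

theorem b1_hom : IsBimodHom M.A M.b1 := ext_isBimodHom _

theorem b2_hom : IsBimodHom M.A M.b2 := ext_isBimodHom _

theorem b3_hom : IsBimodHom M.A M.b3 := ext_isBimodHom _

theorem b4_hom : IsBimodHom M.A M.b4 := ext_isBimodHom _

theorem d1_hom : IsBimodHom M.A M.d1 := ext_isBimodHom _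

theorem d2_hom : IsBimodHom M.A M.d2 := ext_isBimodHom _

theorem d3_hom : IsBimodHom M.A M.d3 := ext_isBimodHom _

theorem σ1_hom : IsBimodHom M.A M.σ1 := ext_isBimodHom _

theorem σ2_hom : IsBimodHom M.A M.σ2 := ext_isBimodHom _

theorem σ3_hom : IsBimodHom M.A M.σ3 := ext_isBimodHom _

theorem decomp_mul_ι (y : TAlg F k V) (v : V) : M.decomp (y * TAlg.ι F k v) =
    FB.mk F k (M.q y) v 1 + op (M.ιA v) • M.decomp y := by
  rw [M.decomp_mul, M.decomp_ι, smul_gen]; rfl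

theorem decomp_ι_mul (v : V) (y : TAlg F k V) : M.decomp (TAlg.ι F k v * y) =
    M.ιA v • M.decomp y + FB.mk F k 1 v (M.q y) := by
  rw [M.decomp_mul, M.decomp_ι, op_smul_gen]; rfl

theorem decomp_of_mem_deg_zero {x : TAlg F k V} (hx : x ∈ TAlg.deg F k V 0) : M.decomp x = 0 := by
  obtain ⟨c, rfl⟩ := TAlg.exists_unit_of_mem_deg_zero hx
  exact M.decomp_unit c

theorem decomp_mem {n : ℕ} {x : TAlg F k V} (hx : x ∈ TAlg.deg F k V n) :
    M.decomp x ∈ M.degFB (pureDeg F V 1) n := by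
  induction n generalizing x with
  | zero => rw [M.decomp_of_mem_deg_zero hx]; exact zero_mem _
  | succ n ih =>
    refine TAlg.deg_succ_induction (p := fun x => M.decomp x ∈ M.degFB (pureDeg F V 1) (n + 1))
      (by rw [map_zero]; exact zero_mem _) (fun x y hx hy => by rw [map_add]; exact add_mem hx hy)
      (fun y hy v => ?_) hx
    rw [decomp_mul_ι]
    have h1 := M.mk_mem_degFB (M.q_mem hy) (mem_pureDeg (F := F) 1 v) M.one_mem_deg
    rw [add_zero] at h1
    exact add_mem h1 (M.op_smul_mem_degFB (M.ιA_mem v) (ih hy))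

/-- Both sides are derivations along TV → A that vanish on k and agree on V. -/
theorem d1_decomp (x : TAlg F k V) :
    M.d1 (M.decomp x) = FB.mk F k (M.q x) (1 : k) 1 - FB.mk F k 1 (1 : k) (M.q x) := by
  induction x using TAlg.induction with
  | unit c =>
    have h1 := FB.mk_mul_unit (F := F) (1 : M.A) c (1 : k) (1 : M.A)
    have h2 := FB.mk_unit_mul (F := F) (1 : M.A) (1 : k) c (1 : M.A)
    rw [one_mul, KAlg.lsm_eq, mul_one] at h1
    rw [mul_one, KAlg.rsm_eq, one_mul] at h2
    rw [M.decomp_unit, map_zero, M.q_unit, h1, h2, sub_self]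
  | ι v =>
    rw [M.decomp_ι, gen_apply, d1, ext_genD, one_mul, mul_one]; rfl
  | mul x y hx hy =>
    have e1 : M.d1 (M.q x • M.decomp y) = M.q x • M.d1 (M.decomp y) := ext_smul _ _ _
    have e2 : M.d1 (op (M.q y) • M.decomp x) = op (M.q y) • M.d1 (M.decomp x) := ext_op_smul _ _ _
    rw [M.decomp_mul, map_add, e1, e2, hx, hy, smul_sub, smul_sub, FB.smul_mk, FB.smul_mk,
      FB.op_smul_mk, FB.op_smul_mk, M.q_mul, one_mul, mul_one]
    abel
  | add x y hx hy =>
    rw [map_add, map_add, hx, hy, map_add, FB.mk_add_left, FB.mk_add_right]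
    abel

theorem σ1_mk (a : M.A) (v : V) (b : M.A) :
    M.σ1 (FB.mk F k a v b) = FB.mk F k a (M.ιI v) b := by
  rw [σ1, ext_mk, LinearMap.comp_apply, op_smul_gen, FB.smul_mk, mul_one]

theorem genR_regroup (y : FB F k M.A V) : genR LinearMap.id (M.regroup y) = M.contr (M.σ1 y) := by
  induction y using FB.induction with
  | zero => rw [map_zero, map_zero, map_zero, map_zero]
  | mk a v b => rw [σ1_mk, contr_mk]; rfl
  | add x y hx hy => simpa only [map_add] using congrArg₂ (· + ·) hx hy

/-- Exhibits `split2` as a contraction: further contractions kill it, and its boundary follows from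
the contraction identity. -/
theorem split2_eq (x : TAlg F k V) : M.split2 x = M.contr (M.σ1 (M.decomp x)) :=
  M.genR_regroup _

theorem contr_smul_split2 (a : M.A) (x : TAlg F k V) :
    M.contr (a • M.split2 x) = M.split3 (BT.mk F k (M.p a) x) := M.contr_smul_genR a _

theorem contr_smul_split3 (a : M.A) (b : M.I) (x : TAlg F k V) :
    M.contr (a • M.split3 (BT.mk F k b x)) =
      M.split4 (BT.mk F k (M.p a) (BT.mk F k b x)) := M.contr_smul_genR a _

theorem contr_split3 (t : BT F k M.I (TAlg F k V)) : M.contr (M.split3 t) = 0 := by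
  induction t using BT.induction with
  | zero => simp only [map_zero]
  | tmul a x => rw [← M.p_j a, ← contr_smul_split2, contr_contr]
  | add x y hx hy => simpa only [map_add, add_zero] using congrArg₂ (· + ·) hx hy

theorem split2_mul_ι (y : TAlg F k V) (v : V) : M.split2 (y * TAlg.ι F k v) =
    gen (BT.mk F k (M.cls y) (M.ιI v)) + op (M.ιA v) • M.split2 y := by
  rw [split2_eq, split2_eq, decomp_mul_ι, map_add, map_add, σ1_mk, contr_mk]
  have : M.σ1 (op (M.ιA v) • M.decomp y) = op (M.ιA v) • M.σ1 (M.decomp y) := ext_op_smul _ _ _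
  rw [this, contr_op_smul]; rfl

theorem split2_of_mem_deg_zero {x : TAlg F k V} (hx : x ∈ TAlg.deg F k V 0) : M.split2 x = 0 := by
  rw [split2_eq, M.decomp_of_mem_deg_zero hx, map_zero, map_zero]

theorem split3_mul_ι (a : M.I) (y : TAlg F k V) (v : V) :
    M.split3 (BT.mk F k a (y * TAlg.ι F k v)) =
      gen (BT.mk F k a (BT.mk F k (M.cls y) (M.ιI v))) +
        op (M.ιA v) • M.split3 (BT.mk F k a y) := by
  rw [← M.p_j a, ← contr_smul_split2, ← contr_smul_split2, split2_mul_ι, smul_add, map_add,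
    smul_gen, contr_mk, smul_comm, contr_op_smul]
  rfl

theorem b1_mk (a : M.A) (w : M.I) (b : M.A) : M.b1 (FB.mk F k a w b) =
    FB.mk F k (a * M.j w) (1 : k) b - FB.mk F k a (1 : k) (M.j w * b) := M.ext_genD _ a w b

theorem b2_mk (a : M.A) (u v : M.I) (b : M.A) : M.b2 (FB.mk F k a (BT.mk F k u v) b) =
    FB.mk F k (a * M.j u) v b - FB.mk F k a (M.μ (BT.mk F k u v)) b +
      FB.mk F k a u (M.j v * b) := by
  rw [b2, ext_mk]
  simp only [LinearMap.add_apply, LinearMap.sub_apply, LinearMap.comp_apply, genL_mk, genR_mk,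
    gen_apply, smul_add, smul_sub, FB.smul_mk, FB.op_smul_mk, one_mul, mul_one]

theorem b3_mk (a : M.A) (u v w : M.I) (b : M.A) :
    M.b3 (FB.mk F k a (BT.mk F k u (BT.mk F k v w)) b) =
      FB.mk F k (a * M.j u) (BT.mk F k v w) b - FB.mk F k a (BT.mk F k (M.μ (BT.mk F k u v)) w) b +
      FB.mk F k a (BT.mk F k u (M.μ (BT.mk F k v w))) b -
        FB.mk F k a (BT.mk F k u v) (M.j w * b) := by
  rw [b3, ext_mk]
  simp only [LinearMap.add_apply, LinearMap.sub_apply, LinearMap.comp_apply, genL_mk, genR_mk,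
    gen_apply, smul_add, smul_sub, FB.smul_mk, FB.op_smul_mk, one_mul, mul_one, BT.assoc_mk]
  rfl

theorem b4_mk (a : M.A) (u v w x : M.I) (b : M.A) :
    M.b4 (FB.mk F k a (BT.mk F k u (BT.mk F k v (BT.mk F k w x))) b) =
      FB.mk F k (a * M.j u) (BT.mk F k v (BT.mk F k w x)) b -
      FB.mk F k a (BT.mk F k (M.μ (BT.mk F k u v)) (BT.mk F k w x)) b +
      FB.mk F k a (BT.mk F k u (BT.mk F k (M.μ (BT.mk F k v w)) x)) b -
      FB.mk F k a (BT.mk F k u (BT.mk F k v (M.μ (BT.mk F k w x)))) b +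
      FB.mk F k a (BT.mk F k u (BT.mk F k v w)) (M.j x * b) := by
  rw [b4, ext_mk]
  simp only [LinearMap.add_apply, LinearMap.sub_apply, LinearMap.comp_apply, genL_mk, genR_mk,
    gen_apply, smul_add, smul_sub, FB.smul_mk, FB.op_smul_mk, one_mul, mul_one, BT.assoc_mk,
    BT.map_mk, LinearMap.id_apply]
  rfl

/-- The structure morphism `k → A` as a morphism of bimodules. -/
def unitE : k →ₗ[Env F k] M.A :=
  envLin (KAlg.unit F M.A).toLinearMap
    (fun c x => by rw [KAlg.lsm_eq, KAlg.lsm_eq]; exact map_mul (KAlg.unit F (k := k) M.A) c x)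
    (fun c x => by rw [KAlg.rsm_eq, KAlg.rsm_eq]; exact map_mul (KAlg.unit F (k := k) M.A) x c)

/-- The map `a|c|b ↦ 1|ac|b`. -/
def contr0 : FB F k M.A k →ₗ[Env F k] FB F k M.A M.I :=
  genR LinearMap.id ∘ₗ BT.map M.p (mulMap M.unitE LinearMap.id)

theorem contr0_mk (a : M.A) (b : M.A) :
    M.contr0 (FB.mk F k a (1 : k) b) = FB.mk F k 1 (M.p a) b := by
  change FB.mk F k 1 (M.p a) (KAlg.unit F M.A 1 * b) = _
  rw [map_one, one_mul]

/-- In b₂(1|a|w|b) the first term misses the scalar part of a, which is supplied by 1|aw|b because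
the class of aw in A/k is (a - ε(a))w + ε(a)w. The other terms cancel. The identities in the next
two degrees hold for the same reason. -/
theorem b2_contr (x : FB F k M.A M.I) : M.b2 (M.contr x) + M.contr0 (M.b1 x) = x := by
  induction x using FB.induction with
  | zero => simp only [map_zero, add_zero]
  | mk a w b =>
    rw [contr_mk, b2_mk, b1_mk, map_sub, contr0_mk, contr0_mk, p_mul_j, FB.mk_add_mid, one_mul]
    conv_rhs => rw [← mk_j_p_add]
    abel
  | add x y hx hy =>
    exact add_of_homotopy (map_add M.b2) (map_add M.contr) (map_add M.contr0) (map_add M.b1) hx hy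

theorem b3_contr (x : FB F k M.A M.I2) : M.b3 (M.contr x) + M.contr (M.b2 x) = x := by
  induction x using FB.induction₂ with
  | zero => simp only [map_zero, add_zero]
  | mk a u v b =>
    rw [contr_mk, b3_mk, b2_mk, map_add M.contr, map_sub M.contr, contr_mk, contr_mk, contr_mk,
      p_mul_j, BT.mk_add_left, FB.mk_add_mid, one_mul, ← BT.lsm_mk]
    conv_rhs => rw [← mk_j_p_add]
    abel
  | add x y hx hy =>
    exact add_of_homotopy (map_add M.b3) (map_add M.contr) (map_add M.contr) (map_add M.b2) hx hy

theorem b4_contr (x : FB F k M.A M.I3) : M.b4 (M.contr x) + M.contr (M.b3 x) = x := by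
  induction x using FB.induction₃ with
  | zero => simp only [map_zero, add_zero]
  | mk a u v w b =>
    rw [contr_mk, b4_mk, b3_mk, map_sub M.contr, map_add M.contr, map_sub M.contr, contr_mk,
      contr_mk, contr_mk, contr_mk, p_mul_j, BT.mk_add_left, FB.mk_add_mid, one_mul,
      ← BT.lsm_mk]
    conv_rhs => rw [← mk_j_p_add]
    abel
  | add x y hx hy =>
    exact add_of_homotopy (map_add M.b4) (map_add M.contr) (map_add M.contr) (map_add M.b3) hx hy

end Setting

/-! ### Relations between the differentials -/

namespace Setting

variable {F : Type u₁} {k : Type u₂} {V : Type u₃} [Field F] [Ring k] [Algebra F k]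
  [AddCommGroup V] [FModule F V] [EnvModule F k V] [EnvTower F k V]
variable (M : Setting.{u₁, u₂, u₃, u₄} F k V)

theorem b1_b2 (x : FB F k M.A M.I2) : M.b1 (M.b2 x) = 0 := by
  refine M.b1_hom.ext_comp_zero M.b2_hom (fun w => ?_) x
  induction w using BT.induction with
  | zero => rw [map_zero, map_zero, map_zero]
  | tmul u v =>
    rw [gen_apply, b2_mk, map_add, map_sub, b1_mk, b1_mk, b1_mk, M.j_μ, one_mul, mul_one, one_mul,
      mul_one]
    abel
  | add u v hu hv => rw [map_add, map_add, map_add, hu, hv, add_zero]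

/-- Morphisms of bimodules that vanish on the image of the contraction are zero. -/
theorem eq_zero_of_contr {W : Type*} [AddCommGroup W] [FModule F W] [EnvModule F k W]
    [EnvTower F k W] {X : Type*} [AddCommGroup X] [FModule F X] [EnvModule F k X]
    [EnvTower F k X] [Module M.A X] [Module M.Aᵐᵒᵖ X] [SMulCommClass M.A M.Aᵐᵒᵖ X]
    [IsScalarTower F M.A X] [IsScalarTower F M.Aᵐᵒᵖ X]
    {f : FB F k M.A (BT F k M.I W) →ₗ[F] X} (hf : IsBimodHom M.A f)
    (h : ∀ x, f (M.contr x) = 0) (x : FB F k M.A (BT F k M.I W)) : f x = 0 := by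
  refine hf.ext IsBimodHom.zero (g := 0) (fun w => ?_) x
  change f (gen w) = 0
  induction w using BT.induction with
  | zero => rw [map_zero, map_zero]
  | tmul u v =>
    have h1 := h (FB.mk F k (M.j u) v 1)
    rwa [contr_mk, M.p_j] at h1
  | add u v hu hv => rw [map_add, map_add, hu, hv, add_zero]

/-- Formal consequence of the contraction h: b₃h = 1 - hb₂ gives b₂b₃h = b₂ - b₂hb₂, which is zero
by the identity one degree lower and b₁b₂ = 0. The image of h generates the bimodule. -/
theorem b2_b3 (x : FB F k M.A M.I3) : M.b2 (M.b3 x) = 0 := by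
  refine M.eq_zero_of_contr (f := M.b2 ∘ₗ M.b3) (M.b2_hom.comp M.b3_hom) (fun y => ?_) x
  have h1 := M.b2_contr (M.b2 y)
  rw [M.b1_b2, map_zero, add_zero] at h1
  rw [LinearMap.comp_apply, ← sub_eq_of_eq_add (M.b3_contr y).symm, map_sub, h1, sub_self]

theorem b3_b4 (x : FB F k M.A M.I4) : M.b3 (M.b4 x) = 0 := by
  refine M.eq_zero_of_contr (f := M.b3 ∘ₗ M.b4) (M.b3_hom.comp M.b4_hom) (fun y => ?_) x
  have h1 := M.b3_contr (M.b3 y)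
  rw [M.b2_b3, map_zero, add_zero] at h1
  rw [LinearMap.comp_apply, ← sub_eq_of_eq_add (M.b4_contr y).symm, map_sub, h1, sub_self]

theorem b1_σ1 (x : FB F k M.A V) : M.b1 (M.σ1 x) = M.d1 x := by
  induction x using FB.induction with
  | zero => rw [map_zero, map_zero, map_zero]
  | mk a v b =>
    rw [σ1_mk, b1_mk, M.j_ιI]
    exact (M.ext_genD M.ιA a v b).symm
  | add x y hx hy => rw [map_add, map_add, map_add, hx, hy]

/-- The chain σ₁(∑ x₁|x₂|x₃) has boundary x|1 - 1|x, and contracting this boundary gives 1|x|1. The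
claim is then the contraction identity. -/
theorem b2_split2 (x : TAlg F k V) :
    M.b2 (M.split2 x) = M.σ1 (M.decomp x) - gen (M.cls x) := by
  have h1 := M.b2_contr (M.σ1 (M.decomp x))
  rw [← split2_eq, b1_σ1, d1_decomp, map_sub, contr0_mk, contr0_mk, M.p_one, FB.mk_zero_mid,
    sub_zero] at h1
  exact eq_sub_of_add_eq h1

theorem σ2_gen (r : M.R) : M.σ2 (gen r) = M.split2 (M.incR r) := ext_gen _ _

theorem d2_gen (r : M.R) : M.d2 (gen r) = M.decomp (M.incR r) := ext_gen _ _

theorem d3_gen (w : M.S) : M.d3 (gen w) = genL M.ιA (M.toVR w) - genR M.ιA (M.toRV w) := ext_gen _ _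

theorem σ3_gen (w : M.S) : M.σ3 (gen w) = M.split3 (BT.map M.ιI M.incR (M.toVR w)) := ext_gen _ _

theorem b2_σ2 (x : FB F k M.A M.R) : M.b2 (M.σ2 x) = M.σ1 (M.d2 x) := by
  refine M.b2_hom.ext_comp M.σ2_hom M.σ1_hom M.d2_hom (fun r => ?_) x
  rw [σ2_gen, d2_gen, b2_split2, M.cls_incR, map_zero, sub_zero]

/-- By the derivation rule, the decomposition of v r has besides v • (decomposition of r) only the
term 1|v|r, and r vanishes in A. The same argument on the right gives `d2_genR`. -/
theorem d2_genL (y : BT F k V M.R) :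
    M.d2 (genL M.ιA y) = M.decomp (mulMap (TAlg.ι F k) M.incR y) := by
  induction y using BT.induction with
  | zero => rw [map_zero, map_zero, map_zero, map_zero]
  | tmul v r =>
    have h1 : M.d2 (M.ιA v • gen r) = M.ιA v • M.d2 (gen r) := M.d2_hom.smul _ _
    have h2 : mulMap (TAlg.ι F k) M.incR (BT.mk F k v r) = TAlg.ι F k v * M.incR r := rfl
    rw [genL_mk, ← smul_gen, h1, d2_gen, h2, decomp_ι_mul, M.q_incR, ← op_smul_gen, op_zero,
      zero_smul, add_zero]
  | add x y hx hy => rw [map_add, map_add, map_add, map_add, hx, hy]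

theorem d2_genR (y : BT F k M.R V) :
    M.d2 (genR M.ιA y) = M.decomp (mulMap M.incR (TAlg.ι F k) y) := by
  induction y using BT.induction with
  | zero => rw [map_zero, map_zero, map_zero, map_zero]
  | tmul r v =>
    have h1 : M.d2 (op (M.ιA v) • gen r) = op (M.ιA v) • M.d2 (gen r) := M.d2_hom.op_smul _ _
    have h2 : mulMap M.incR (TAlg.ι F k) (BT.mk F k r v) = M.incR r * TAlg.ι F k v := rfl
    rw [genR_mk, ← op_smul_gen, h1, d2_gen, h2, decomp_mul_ι, M.q_incR, FB.mk_zero_left, zero_add]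
  | add x y hx hy => rw [map_add, map_add, map_add, map_add, hx, hy]

theorem b3_split3 (a : M.I) (x : TAlg F k V) : M.b3 (M.split3 (BT.mk F k a x)) =
    M.j a • M.split2 x - M.contr (M.j a • M.σ1 (M.decomp x)) + gen (BT.mk F k a (M.cls x)) := by
  have h1 := M.b3_contr (M.j a • M.split2 x)
  have h2 : M.b2 (M.j a • M.split2 x) = M.j a • M.b2 (M.split2 x) := M.b2_hom.smul _ _
  rw [contr_smul_split2, M.p_j, h2, b2_split2, smul_sub, map_sub, smul_gen, contr_mk, M.p_j] at h1
  rw [← sub_eq_of_eq_add h1.symm, gen_apply]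
  abel

/-- Multiplying by v before or after contracting gives two chains with the same boundary. The
contraction identity at v • `split2`(r) exhibits their difference as a boundary, which becomes b₃ ∘
σ₃. -/
theorem σ2_genL (y : BT F k V M.R) :
    M.σ2 (genL M.ιA y) = M.b3 (M.split3 (BT.map M.ιI M.incR y)) +
      M.split2 (mulMap (TAlg.ι F k) M.incR y) := by
  induction y using BT.induction with
  | zero => simp only [map_zero, add_zero]
  | tmul v r =>
    have h1 : M.σ2 (M.ιA v • gen r) = M.ιA v • M.σ2 (gen r) := M.σ2_hom.smul _ _
    have h2 : mulMap (TAlg.ι F k) M.incR (BT.mk F k v r) = TAlg.ι F k v * M.incR r := rfl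
    have h3 : M.σ1 (M.ιA v • M.decomp (M.incR r)) = M.ιA v • M.σ1 (M.decomp (M.incR r)) :=
      M.σ1_hom.smul _ _
    rw [genL_mk, ← smul_gen, h1, σ2_gen, h2, BT.map_mk, b3_split3, M.cls_incR, BT.mk_zero_right,
      map_zero, add_zero, split2_eq _ (_ * _), decomp_ι_mul, M.q_incR, ← op_smul_gen, op_zero,
      zero_smul, add_zero, h3, M.j_ιI, sub_add_cancel]
  | add x y hx hy =>
    simp only [map_add, hx, hy]
    abel

theorem σ2_genR (y : BT F k M.R V) :
    M.σ2 (genR M.ιA y) = M.split2 (mulMap M.incR (TAlg.ι F k) y) := by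
  induction y using BT.induction with
  | zero => simp only [map_zero]
  | tmul r v =>
    have h1 : M.σ2 (op (M.ιA v) • gen r) = op (M.ιA v) • M.σ2 (gen r) := M.σ2_hom.op_smul _ _
    have h2 : mulMap M.incR (TAlg.ι F k) (BT.mk F k r v) = M.incR r * TAlg.ι F k v := rfl
    rw [genR_mk, ← op_smul_gen, h1, σ2_gen, h2, split2_mul_ι, M.cls_incR, BT.mk_zero_left,
      map_zero, zero_add]
  | add x y hx hy => simp only [map_add, hx, hy]

/-- The two expressions ∑ v s and ∑ r u of w agree in TV, so the two `split2` terms cancel. -/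
theorem b3_σ3 (x : FB F k M.A M.S) : M.b3 (M.σ3 x) = M.σ2 (M.d3 x) := by
  refine M.b3_hom.ext_comp M.σ3_hom M.σ2_hom M.d3_hom (fun w => ?_) x
  rw [σ3_gen, d3_gen, map_sub, σ2_genL, σ2_genR, M.mulMap_toRV, add_sub_cancel_right]

/-! ### Degrees -/

theorem split2_mem {n : ℕ} {x : TAlg F k V} (hx : x ∈ TAlg.deg F k V n) :
    M.split2 x ∈ M.degFB M.degI2 n := by
  rw [split2_eq]
  refine M.contr_mem (M.ext_mem_degFB (GW := pureDeg F V 1) (fun n v hv => ?_) (M.decomp_mem hx))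
  rcases eq_or_ne n 1 with rfl | hn
  · exact M.gen_mem_degFB (M.ιI_mem v)
  · rw [eq_zero_of_mem_pureDeg hn hv, map_zero]; exact zero_mem _

theorem σ2_mem {n : ℕ} {x : FB F k M.A M.R} (hx : x ∈ M.degFB (pureDeg F M.R M.N) n) :
    M.σ2 x ∈ M.degFB M.degI2 n := by
  refine M.ext_mem_degFB (fun n r hr => ?_) hx
  rcases eq_or_ne n M.N with rfl | hn
  · exact M.split2_mem (M.incR_mem r)
  · rw [eq_zero_of_mem_pureDeg hn hr, map_zero]; exact zero_mem _

theorem d2_mem {n : ℕ} {x : FB F k M.A M.R} (hx : x ∈ M.degFB (pureDeg F M.R M.N) n) :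
    M.d2 x ∈ M.degFB (pureDeg F V 1) n := by
  refine M.ext_mem_degFB (fun n r hr => ?_) hx
  rcases eq_or_ne n M.N with rfl | hn
  · exact M.decomp_mem (M.incR_mem r)
  · rw [eq_zero_of_mem_pureDeg hn hr, map_zero]; exact zero_mem _

theorem genL_ιA_mem {W : Type*} [AddCommGroup W] [FModule F W] [EnvModule F k W]
    [EnvTower F k W] (d : ℕ) (y : BT F k V W) :
    genL M.ιA y ∈ M.degFB (pureDeg F W d) (d + 1) := by
  induction y using BT.induction with
  | zero => rw [map_zero]; exact zero_mem _
  | tmul v w =>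
    have h1 := M.mk_mem_degFB (M.ιA_mem v) (mem_pureDeg (F := F) d w) M.one_mem_deg
    rwa [add_zero, add_comm] at h1
  | add x y hx hy => rw [map_add]; exact add_mem hx hy

theorem genR_ιA_mem {W : Type*} [AddCommGroup W] [FModule F W] [EnvModule F k W]
    [EnvTower F k W] (d : ℕ) (y : BT F k W V) :
    genR M.ιA y ∈ M.degFB (pureDeg F W d) (d + 1) := by
  induction y using BT.induction with
  | zero => rw [map_zero]; exact zero_mem _
  | tmul w v =>
    have h1 := M.mk_mem_degFB M.one_mem_deg (mem_pureDeg (F := F) d w) (M.ιA_mem v)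
    rwa [zero_add] at h1
  | add x y hx hy => rw [map_add]; exact add_mem hx hy

theorem d3_mem {n : ℕ} {x : FB F k M.A M.S} (hx : x ∈ M.degFB (pureDeg F M.S (M.N + 1)) n) :
    M.d3 x ∈ M.degFB (pureDeg F M.R M.N) n := by
  refine M.ext_mem_degFB (fun n w hw => ?_) hx
  rcases eq_or_ne n (M.N + 1) with rfl | hn
  · exact sub_mem (M.genL_ιA_mem M.N _) (M.genR_ιA_mem M.N _)
  · rw [eq_zero_of_mem_pureDeg hn hw, map_zero]; exact zero_mem _

theorem σ3_mem {n : ℕ} {x : FB F k M.A M.S} (hx : x ∈ M.degFB (pureDeg F M.S (M.N + 1)) n) :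
    M.σ3 x ∈ M.degFB M.degI3 n := by
  refine M.ext_mem_degFB (fun n w hw => ?_) hx
  rcases eq_or_ne n (M.N + 1) with rfl | hn
  · change M.split3 (BT.map M.ιI M.incR (M.toVR w)) ∈ _
    generalize M.toVR w = y
    induction y using BT.induction with
    | zero => rw [map_zero, map_zero]; exact zero_mem _
    | tmul v r =>
      rw [BT.map_mk, ιI, LinearMap.comp_apply, ← contr_smul_split2, add_comm]
      exact M.contr_mem (M.smul_mem_degFB (M.ιA_mem v) (M.split2_mem (M.incR_mem r)))
    | add x y hx hy => rw [map_add, map_add]; exact add_mem hx hy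
  · rw [eq_zero_of_mem_pureDeg hn hw, map_zero]; exact zero_mem _

theorem mk_mem_degI2 {m n : ℕ} {a b : M.I} (ha : a ∈ M.degI m) (hb : b ∈ M.degI n) :
    BT.mk F k a b ∈ M.degI2 (m + n) := Submodule.subset_span ⟨m, n, a, b, rfl, ha, hb, rfl⟩

theorem mk_mem_degI3 {m n : ℕ} {a : M.I} {b : M.I2} (ha : a ∈ M.degI m) (hb : b ∈ M.degI2 n) :
    BT.mk F k a b ∈ M.degI3 (m + n) := Submodule.subset_span ⟨m, n, a, b, rfl, ha, hb, rfl⟩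

theorem μ_mk_mem {m n : ℕ} {a b : M.I} (ha : a ∈ M.degI m) (hb : b ∈ M.degI n) :
    M.μ (BT.mk F k a b) ∈ M.degI (m + n) := by
  rw [M.mem_degI, M.j_μ]; exact M.deg_mul (M.mem_degI.1 ha) (M.mem_degI.1 hb)

end Setting

/-! ### The setting attached to a homogeneous algebra -/

namespace HomogData

variable {F k V : Type*} [Field F] [Ring k] [Algebra F k]
  [AddCommGroup V] [FModule F V] [EnvModule F k V] [EnvTower F k V]
variable (h : HomogData F k V)

theorem fst_decompHom (x : TAlg F k V) : (h.decompHom x).fst = h.q x := by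
  have : (TrivSqZeroExt.fstHom F h.A (FB F k h.A V)).comp h.decompHom =
      TQuot.mk (h.R : Set (TAlg F k V)) :=
    TAlg.algHom_ext (fun c => by simp [decompHom]; rfl)
      (fun v => by simp [decompHom, ιA_eq])
  exact congrArg (fun f => f x) this

theorem decomp_mul (x y : TAlg F k V) :
    h.decomp (x * y) = h.q x • h.decomp y + op (h.q y) • h.decomp x := by
  rw [← fst_decompHom, ← fst_decompHom]
  change (h.decompHom (x * y)).snd = _
  rw [map_mul, TrivSqZeroExt.snd_mul]
  rfl

theorem decomp_unit (c : k) : h.decomp (KAlg.unit F _ c) = 0 := by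
  change (h.decompHom _).snd = 0
  simp [decompHom]

theorem decomp_ι (v : V) : h.decomp (TAlg.ι F k v) = gen v := by
  change (h.decompHom _).snd = _
  simp [decompHom]

/-- The setting attached to a homogeneous algebra. -/
@[reducible] def setting : Setting F k V where
  A := h.A
  I := h.I
  R := h.R
  S := h.RN1
  N := h.N
  two_le := h.two_le
  q := h.q
  q_mul := h.q_mul
  q_unit := h.q_unit
  deg := h.deg
  gradingA := h.gradingA
  mem_deg := Iff.rfl
  aug := h.aug
  aug_unit := h.aug_unit
  aug_deg := fun hn _ ha => h.aug_deg hn ha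
  j := h.I.subtype
  p := h.p
  p_j := h.p_I
  j_p := h.p_coe
  μ := h.μ
  j_μ := h.μ_coe
  degI := h.degI
  gradingI := h.gradingI
  mem_degI := Iff.rfl
  incR := h.R.subtype
  incR_injective := Subtype.val_injective
  incR_mem := fun r => h.R_le r.2
  q_incR := h.q_R
  mem_span_of_q := fun {x} hx => by
    have h1 := (TQuot.mk_eq_zero_iff _).1 hx
    rwa [show Set.range h.R.subtype = (h.R : Set (TAlg F k V)) from Subtype.range_coe]
  eq_zero_of_q := fun hn _ hx => h.eq_zero_of_q hn hx
  toRV := h.toRV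
  toVR := h.toVR
  S_ext := fun h1 h2 => Subtype.ext (Prod.ext h1 h2)
  mulMap_toRV := fun w => w.2
  exists_S := fun {x y} hxy => ⟨⟨(x, y), hxy⟩, rfl, rfl⟩
  decomp := h.decomp
  decomp_unit := h.decomp_unit
  decomp_ι := h.decomp_ι
  decomp_mul := h.decomp_mul

end HomogData

/-! ### Decompositions with an outer factor of degree one -/

namespace Setting

variable {F : Type u₁} {k : Type u₂} {V : Type u₃} [Field F] [Ring k] [Algebra F k]
  [AddCommGroup V] [FModule F V] [EnvModule F k V] [EnvTower F k V]
variable (M : Setting.{u₁, u₂, u₃, u₄} F k V) {W : Type*} [AddCommGroup W] [FModule F W]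
  [EnvModule F k W]
    [EnvTower F k W]

/-- The map `a ⊗ w ↦ ε(a) w`. -/
def augLeft : BT F k M.A W →ₗ[Env F k] W :=
  BT.lift (fun a w => lsm F (M.aug a) w)
    (by intros; simp [BT.lsm_add]) (by intros; simp)
    (by intros; rw [KAlg.rsm_eq, map_mul, M.aug_unit, BT.lsm_mul])
    (by intros; rw [KAlg.lsm_eq, map_mul, M.aug_unit, BT.lsm_mul])
    (by intros; rw [lsm_rsm])

theorem augLeft_mk (a : M.A) (w : W) : M.augLeft (BT.mk F k a w) = lsm F (M.aug a) w := rfl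

theorem aug_ιA (v : V) : M.aug (M.ιA v) = 0 := M.aug_deg one_ne_zero (M.ιA_mem v)

theorem augLeft_ιA_smul (v : V) (x : FB F k M.A W) : M.augLeft (M.ιA v • x) = 0 := by
  induction x using FB.induction with
  | zero => rw [smul_zero, map_zero]
  | mk a w b => rw [FB.smul_mk, FB.mk, augLeft_mk, map_mul, aug_ιA, zero_mul, lsm_zero_left]
  | add x y hx hy => rw [smul_add, map_add, hx, hy, add_zero]

/-- Apply the augmentation to the last factor. -/
def augLast : FB F k M.A W →ₗ[Env F k] BT F k M.A W := BT.map LinearMap.id M.augRight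

theorem augLast_mk (a : M.A) (w : W) (b : M.A) :
    M.augLast (FB.mk F k a w b) = BT.mk F k a (rsm F (M.aug b) w) := rfl

theorem augLast_ιA_smul (v : V) (x : FB F k M.A W) : M.augLast (op (M.ιA v) • x) = 0 := by
  induction x using FB.induction with
  | zero => rw [smul_zero, map_zero]
  | mk a w b =>
    rw [FB.op_smul_mk, augLast_mk, map_mul, aug_ιA, mul_zero, rsm_zero_left, BT.mk_zero_right]
  | add x y hx hy => rw [smul_add, map_add, hx, hy, add_zero]

end Setting

namespace TAlg

variable {F k V : Type*} [Field F] [Ring k] [Algebra F k]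
  [AddCommGroup V] [FModule F V] [EnvModule F k V] [EnvTower F k V]

/-- The elements of degree `n + 1` are sums of products `v y` with `y` of degree `n`. -/
theorem succ_deg_induction {n : ℕ} {p : TAlg F k V → Prop} (zero : p 0)
    (add : ∀ x y, p x → p y → p (x + y)) (mul : ∀ v, ∀ y ∈ deg F k V n, p (ι F k v * y))
    {x : TAlg F k V} (hx : x ∈ deg F k V (n + 1)) : p x := by
  have hle : deg F k V (n + 1) ≤
      Submodule.span (Env F k) {x | ∃ v, ∃ y ∈ deg F k V n, x = ι F k v * y} := by
    refine Submodule.span_mono ?_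
    rintro _ ⟨l, hl, rfl⟩
    rcases l with _ | ⟨v, l⟩
    · simp at hl
    · exact ⟨v, _, Submodule.subset_span ⟨l, by simpa using hl, rfl⟩, by simp⟩
  refine deg_induction_env zero add ?_ ?_ ?_ (hle hx)
  · rintro _ ⟨v, y, hy, rfl⟩; exact mul v y hy
  · rintro c _ ⟨v, y, hy, rfl⟩
    exact ⟨lsm F c v, y, hy, by rw [map_lsm, KAlg.lsm_eq, mul_assoc]⟩
  · rintro c _ ⟨v, y, hy, rfl⟩
    have h1 := deg_mul hy (unit_mem_deg (F := F) (V := V) c)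
    rw [add_zero] at h1
    exact ⟨v, y * KAlg.unit F _ c, h1, by rw [mul_assoc]⟩

theorem exists_sum_mul_ι {n : ℕ} {x : TAlg F k V} (hx : x ∈ deg F k V (n + 1)) :
    ∃ (m : ℕ) (y : Fin m → TAlg F k V) (v : Fin m → V), (∀ i, y i ∈ deg F k V n) ∧
      x = ∑ i, y i * ι F k (v i) := by
  refine deg_succ_induction (n := n) (p := fun x => ∃ (m : ℕ) (y : Fin m → TAlg F k V)
    (v : Fin m → V), (∀ i, y i ∈ deg F k V n) ∧ x = ∑ i, y i * ι F k (v i))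
    ⟨0, Fin.elim0, Fin.elim0, fun i => i.elim0, by simp⟩ ?_ ?_ hx
  · rintro _ _ ⟨m, y, v, hy, rfl⟩ ⟨m', y', v', hy', rfl⟩
    refine ⟨m + m', Fin.append y y', Fin.append v v', fun i => ?_, ?_⟩
    · induction i using Fin.addCases with
      | left i => simpa using hy i
      | right i => simpa using hy' i
    · simp [Fin.sum_univ_add]
  · exact fun y hy v => ⟨1, fun _ => y, fun _ => v, fun _ => hy, by simp⟩

end TAlg

namespace Setting

variable {F : Type u₁} {k : Type u₂} {V : Type u₃} [Field F] [Ring k] [Algebra F k]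
  [AddCommGroup V] [FModule F V] [EnvModule F k V] [EnvTower F k V]

/-- The decomposition of v y has exactly one term with a scalar in front, namely 1|v|y; applying the
augmentation to the first factor isolates it. The inverse of q then turns y back into a tensor. The
right-hand version uses the last factor. -/
theorem exists_unshuffle_of_injective (M : Setting.{u₁, u₂, u₃, u₄} F k V)
    (hq : Function.Bijective M.q) :
    ∃ (f : TAlg F k V →ₗ[Env F k] BT F k V (TAlg F k V))
      (g : TAlg F k V →ₗ[Env F k] BT F k (TAlg F k V) V),
      (∀ v y, f (TAlg.ι F k v * y) = BT.mk F k v y) ∧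
      ∀ y v, g (y * TAlg.ι F k v) = BT.mk F k y v := by
  let e : TAlg F k V ≃ₗ[Env F k] M.A := LinearEquiv.ofBijective M.q hq
  have he : ∀ x, e.symm.toLinearMap (M.q x) = x := fun x => e.symm_apply_apply x
  refine ⟨BT.map LinearMap.id e.symm.toLinearMap ∘ₗ M.augLeft ∘ₗ M.decomp,
    BT.map e.symm.toLinearMap LinearMap.id ∘ₗ M.augLast ∘ₗ M.decomp, fun v y => ?_, fun y v => ?_⟩
  · rw [LinearMap.comp_apply, LinearMap.comp_apply, decomp_ι_mul, map_add, augLeft_ιA_smul,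
      zero_add, FB.mk, augLeft_mk, map_one, BT.lsm_one, BT.map_mk, he, LinearMap.id_apply]
  · rw [LinearMap.comp_apply, LinearMap.comp_apply, decomp_mul_ι, map_add, augLast_ιA_smul,
      add_zero, augLast_mk, map_one, BT.rsm_one, BT.map_mk, he, LinearMap.id_apply]

end Setting

namespace TAlg

variable (F k V : Type*) [Field F] [Ring k] [Algebra F k]
  [AddCommGroup V] [FModule F V] [EnvModule F k V] [EnvTower F k V]

theorem exists_unshuffle : ∃ (f : TAlg F k V →ₗ[Env F k] BT F k V (TAlg F k V))
      (g : TAlg F k V →ₗ[Env F k] BT F k (TAlg F k V) V),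
      (∀ v y, f (TAlg.ι F k v * y) = BT.mk F k v y) ∧
      ∀ y v, g (y * TAlg.ι F k v) = BT.mk F k y v := by
  -- With no relations the homogeneous algebra is TV itself, whatever the degree assigned to the
  -- relations; 2 is the least one allowed.
  let h : HomogData F k V := ⟨2, le_rfl, ⊥, bot_le⟩
  refine h.setting.exists_unshuffle_of_injective ⟨?_, h.mk_surjective⟩
  refine (injective_iff_map_eq_zero h.q).2 fun x hx => ?_
  have h1 : x ∈ TwoSidedIdeal.span ((⊥ : Submodule (Env F k) (TAlg F k V)) : Set (TAlg F k V)) :=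
    (TQuot.mk_eq_zero_iff _).1 hx
  have h2 : TwoSidedIdeal.span ((⊥ : Submodule (Env F k) (TAlg F k V)) : Set (TAlg F k V)) ≤ ⊥ :=
    TwoSidedIdeal.span_le.2 fun y hy => by
      rw [(Submodule.mem_bot _).1 hy]; exact zero_mem _
  exact (TwoSidedIdeal.mem_bot _).1 (h2 h1)

/-- The map `v y ↦ v ⊗ y`. -/
def unshuffleL : TAlg F k V →ₗ[Env F k] BT F k V (TAlg F k V) := (exists_unshuffle F k V).choose

/-- The map `y v ↦ y ⊗ v`. -/
def unshuffleR : TAlg F k V →ₗ[Env F k] BT F k (TAlg F k V) V :=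
  (exists_unshuffle F k V).choose_spec.choose

variable {F k V}

theorem unshuffleL_ι_mul (v : V) (y : TAlg F k V) :
    unshuffleL F k V (ι F k v * y) = BT.mk F k v y :=
  (exists_unshuffle F k V).choose_spec.choose_spec.1 v y

theorem unshuffleR_mul_ι (y : TAlg F k V) (v : V) :
    unshuffleR F k V (y * ι F k v) = BT.mk F k y v :=
  (exists_unshuffle F k V).choose_spec.choose_spec.2 y v

end TAlg

namespace Setting

variable {F : Type u₁} {k : Type u₂} {V : Type u₃} [Field F] [Ring k] [Algebra F k]
  [AddCommGroup V] [FModule F V] [EnvModule F k V] [EnvTower F k V]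
variable (M : Setting.{u₁, u₂, u₃, u₄} F k V)

theorem unshuffleL_mulMap (y : BT F k V M.R) :
    TAlg.unshuffleL F k V (mulMap (TAlg.ι F k) M.incR y) = BT.map LinearMap.id M.incR y := by
  induction y using BT.induction with
  | zero => simp only [map_zero]
  | tmul v r => exact TAlg.unshuffleL_ι_mul v (M.incR r)
  | add x y hx hy => simp only [map_add, hx, hy]

theorem unshuffleR_mulMap (y : BT F k M.R V) :
    TAlg.unshuffleR F k V (mulMap M.incR (TAlg.ι F k) y) = BT.map M.incR LinearMap.id y := by
  induction y using BT.induction with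
  | zero => simp only [map_zero]
  | tmul r v => exact TAlg.unshuffleR_mul_ι (M.incR r) v
  | add x y hx hy => simp only [map_add, hx, hy]

/-- The element of `TV` given by an element of `R_{N+1}`. -/
def incS (w : M.S) : TAlg F k V := mulMap M.incR (TAlg.ι F k) (M.toRV w)

theorem incS_eq (w : M.S) : M.incS w = mulMap (TAlg.ι F k) M.incR (M.toVR w) := M.mulMap_toRV w

theorem unshuffleL_incS (w : M.S) :
    TAlg.unshuffleL F k V (M.incS w) = BT.map LinearMap.id M.incR (M.toVR w) := by
  rw [incS_eq, unshuffleL_mulMap]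

theorem unshuffleR_incS (w : M.S) :
    TAlg.unshuffleR F k V (M.incS w) = BT.map M.incR LinearMap.id (M.toRV w) :=
  M.unshuffleR_mulMap _

end Setting

/-! ### Sections and the comparison maps -/

namespace Setting

variable {F : Type u₁} {k : Type u₂} {V : Type u₃} [Field F] [Ring k] [Algebra F k]
  [AddCommGroup V] [FModule F V] [EnvModule F k V] [EnvTower F k V]

/-- Graded sections of `TV → A` and of the differentials of the Koszul complex. -/
structure Sections (M : Setting.{u₁, u₂, u₃, u₄} F k V) where
  /-- A section of `TV → A`. -/
  θ : M.A →ₗ[Env F k] TAlg F k V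
  θ_mem : ∀ {n a}, a ∈ M.deg n → θ a ∈ TAlg.deg F k V n
  q_θ : ∀ a, M.q (θ a) = a
  /-- A section of the second differential. -/
  e2 : FB F k M.A V →ₗ[Env F k] FB F k M.A M.R
  e2_mem : ∀ {n x}, x ∈ M.degFB (pureDeg F V 1) n → e2 x ∈ M.degFB (pureDeg F M.R M.N) n
  d2_e2 : ∀ y, M.d2 (e2 (M.d2 y)) = M.d2 y
  /-- A section of the third differential. -/
  e3 : FB F k M.A M.R →ₗ[Env F k] FB F k M.A M.S
  e3_mem : ∀ {n x}, x ∈ M.degFB (pureDeg F M.R M.N) n → e3 x ∈ M.degFB (pureDeg F M.S (M.N + 1)) n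
  d3_e3 : ∀ y, M.d3 (e3 (M.d3 y)) = M.d3 y

variable (M : Setting.{u₁, u₂, u₃, u₄} F k V)

theorem exists_sections [IsSemisimpleRing (Env F k)] : Nonempty M.Sections := by
  obtain ⟨θ, h1, h2⟩ := (TAlg.grading F k V).exists_section M.gradingA M.q
    (fun n x hx => M.q_mem hx)
  obtain ⟨e2, h3, h4⟩ := (M.gradingFB (Grading.pure F k M.N)).exists_section
    (M.gradingFB (Grading.pure F k 1)) (extE (M.decomp ∘ₗ M.incR)) (fun n x hx => M.d2_mem hx)
  obtain ⟨e3, h5, h6⟩ := (M.gradingFB (Grading.pure F k (M.N + 1))).exists_section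
    (M.gradingFB (Grading.pure F k M.N)) (extE (genL M.ιA ∘ₗ M.toVR - genR M.ιA ∘ₗ M.toRV))
    (fun n x hx => M.d3_mem hx)
  have h7 : ∀ a, a ∈ LinearMap.range M.q := by
    intro a
    induction a using M.gradingA.induction with
    | zero => exact zero_mem _
    | hom n a ha => obtain ⟨x, -, rfl⟩ := M.mem_deg.1 ha; exact ⟨x, rfl⟩
    | add x y hx hy => exact add_mem hx hy
  exact ⟨⟨θ, fun {n a} => h1 n a, fun a => h2 a (h7 a), e2, fun {n x} => h3 n x,
    fun y => h4 _ ⟨y, rfl⟩, e3, fun {n x} => h5 n x, fun y => h6 _ ⟨y, rfl⟩⟩⟩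

theorem b2_gen_mk (u v : M.I) : M.b2 (gen (BT.mk F k u v)) =
    M.j u • gen v - gen (M.μ (BT.mk F k u v)) + op (M.j v) • gen u := by
  rw [smul_gen, op_smul_gen]; exact ext_gen _ _

section

variable {X : Type*} [AddCommGroup X] [FModule F X] [EnvModule F k X]
  [EnvTower F k X] [Module M.A X] [Module M.Aᵐᵒᵖ X] [SMulCommClass M.A M.Aᵐᵒᵖ X]
  [IsScalarTower F M.A X] [IsScalarTower F M.Aᵐᵒᵖ X] [ABimod F k M.A X]
  {f : M.I2 →ₗ[Env F k] X}

/-- Decomposing y v yields 1|y|v|1 and the decomposition of y times v, by `split2_mul_ι`. Both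
contribute zero when f vanishes in total degree below N. -/
theorem ext_split2_of_lt
    (h0 : ∀ a b, 0 < a → 0 < b → a + b < M.N → ∀ x ∈ TAlg.deg F k V a, ∀ y ∈ TAlg.deg F k V b,
      f (BT.mk F k (M.cls x) (M.cls y)) = 0)
    {n : ℕ} (hn : n < M.N) {x : TAlg F k V} (hx : x ∈ TAlg.deg F k V n) :
    ext f (M.split2 x) = 0 := by
  induction n generalizing x with
  | zero => rw [M.split2_of_mem_deg_zero hx, map_zero]
  | succ n ih =>
    refine TAlg.deg_succ_induction (p := fun x => ext f (M.split2 x) = 0)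
      (by rw [map_zero, map_zero]) (fun x y hx hy => by rw [map_add, map_add, hx, hy, add_zero])
      (fun y hy v => ?_) hx
    rw [split2_mul_ι, map_add, ext_gen, ext_op_smul, ih (by omega) hy, smul_zero, add_zero]
    rcases Nat.eq_zero_or_pos n with rfl | hn'
    · rw [M.cls_of_mem_deg_zero hy, BT.mk_zero_left, map_zero]
    · exact h0 n 1 hn' one_pos hn y hy _ (TAlg.ι_mem_deg v)

/-- In degree N only the last term 1|y|v|1 can contribute, since all others contain a pair of total
degree below N. -/
theorem ext_split2_eq {G : TAlg F k V →ₗ[Env F k] X}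
    (h0 : ∀ a b, 0 < a → 0 < b → a + b < M.N → ∀ x ∈ TAlg.deg F k V a, ∀ y ∈ TAlg.deg F k V b,
      f (BT.mk F k (M.cls x) (M.cls y)) = 0)
    (h1 : ∀ a b, 0 < a → 0 < b → a + b = M.N → ∀ x ∈ TAlg.deg F k V a, ∀ y ∈ TAlg.deg F k V b,
      f (BT.mk F k (M.cls x) (M.cls y)) = G (x * y))
    {x : TAlg F k V} (hx : x ∈ TAlg.deg F k V M.N) : ext f (M.split2 x) = G x := by
  -- Since N ≥ 2, splitting off one letter leaves a factor of positive degree n + 1, as needed to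
  -- apply `h1`.
  obtain ⟨n, hn⟩ : ∃ n, M.N = n + 1 + 1 := ⟨M.N - 2, by have := M.two_le; omega⟩
  rw [hn] at hx
  refine TAlg.deg_succ_induction (p := fun x => ext f (M.split2 x) = G x)
    (by rw [map_zero, map_zero, map_zero])
    (fun x y hx hy => by rw [map_add, map_add, map_add, hx, hy]) (fun y hy v => ?_) hx
  rw [split2_mul_ι, map_add, ext_gen, ext_op_smul, M.ext_split2_of_lt h0 (by omega) hy, smul_zero,
    add_zero]
  exact h1 (n + 1) 1 (by omega) one_pos (by omega) y hy _ (TAlg.ι_mem_deg v)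

end

/-! ### The comparison maps in degrees one and two. -/

namespace Sections

variable {M} (T : M.Sections)

/-- There are no relations below degree N, so any graded section of TV → A is the inverse there. -/
theorem θ_q {n : ℕ} (hn : n < M.N) {x : TAlg F k V} (hx : x ∈ TAlg.deg F k V n) :
    T.θ (M.q x) = x := by
  refine sub_eq_zero.1 (M.eq_zero_of_q hn (sub_mem (T.θ_mem (M.q_mem hx)) hx) ?_)
  rw [map_sub, T.q_θ, sub_self]

/-- Lifting of elements of `I_+` to the tensor algebra. -/
def θI : M.I →ₗ[Env F k] TAlg F k V := T.θ ∘ₗ M.j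

theorem θI_apply (a : M.I) : T.θI a = T.θ (M.j a) := rfl

theorem q_θI (a : M.I) : M.q (T.θI a) = M.j a := T.q_θ _

theorem cls_θI (a : M.I) : M.cls (T.θI a) = a := by rw [cls_apply, q_θI, M.p_j]

theorem θI_mem {n : ℕ} {a : M.I} (ha : a ∈ M.degI n) : T.θI a ∈ TAlg.deg F k V n :=
  T.θ_mem (M.mem_degI.1 ha)

theorem θI_cls {n : ℕ} (hn : 0 < n) (hN : n < M.N) {x : TAlg F k V}
    (hx : x ∈ TAlg.deg F k V n) : T.θI (M.cls x) = x := by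
  rw [θI_apply, M.j_cls hn.ne' hx, T.θ_q hN hx]

/-- The Koszul coordinate `TV → A ⊗ R ⊗ A` of the relation `x = θ(x)`. -/
def G : TAlg F k V →ₗ[Env F k] FB F k M.A M.R :=
  T.e2 ∘ₗ M.decomp ∘ₗ (LinearMap.id - T.θ ∘ₗ M.q)

theorem G_apply (x : TAlg F k V) : T.G x = T.e2 (M.decomp (x - T.θ (M.q x))) := rfl

theorem G_mem {n : ℕ} {x : TAlg F k V} (hx : x ∈ TAlg.deg F k V n) :
    T.G x ∈ M.degFB (pureDeg F M.R M.N) n :=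
  T.e2_mem (M.decomp_mem (sub_mem hx (T.θ_mem (M.q_mem hx))))

theorem G_of_lt {n : ℕ} (hn : n < M.N) {x : TAlg F k V} (hx : x ∈ TAlg.deg F k V n) :
    T.G x = 0 := M.degFB_pure_of_lt hn (T.G_mem hx)

/-- The last term of a decomposition. -/
def last : FB F k M.A V →ₗ[Env F k] TAlg F k V := mulMap T.θ (TAlg.ι F k) ∘ₗ M.augLast

/-- The term y|v|1 of the decomposition of y v determines y v as long as y has degree below N, where
TV → A is injective. -/
theorem last_decomp {n : ℕ} (hn : n < M.N) {x : TAlg F k V} (hx : x ∈ TAlg.deg F k V (n + 1)) :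
    T.last (M.decomp x) = x := by
  refine TAlg.deg_succ_induction (p := fun x => T.last (M.decomp x) = x)
    (by rw [map_zero, map_zero]) (fun x y hx hy => by rw [map_add, map_add, hx, hy])
    (fun y hy v => ?_) hx
  rw [decomp_mul_ι, last, LinearMap.comp_apply, map_add, augLast_ιA_smul, add_zero, augLast_mk,
    map_one, BT.rsm_one]
  change T.θ (M.q y) * TAlg.ι F k v = _
  rw [T.θ_q hn hy]

/-- In other words, d₂ is injective in degree N. -/
theorem eq_zero_of_decomp_incR (T : M.Sections) {r : M.R}
    (hr : M.decomp (M.incR r) = 0) : r = 0 := by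
  obtain ⟨n, hn⟩ : ∃ n, M.N = n + 1 := ⟨M.N - 1, by have := M.two_le; omega⟩
  apply M.incR_injective
  have h1 := M.incR_mem r
  rw [hn] at h1
  rw [← T.last_decomp (by omega) h1, hr, map_zero, map_zero]

/-- For reasons of degree G(r) has the form 1|r'|1, and d₂ cannot distinguish it from 1|r|1, where
d₂ is injective. -/
theorem G_incR (r : M.R) : T.G (M.incR r) = gen r := by
  obtain ⟨r', hr'⟩ := M.degFB_pure_self (T.G_mem (M.incR_mem r))
  have h1 : M.d2 (T.G (M.incR r)) = M.d2 (gen r) := by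
    rw [G_apply, M.q_incR, map_zero, sub_zero, ← d2_gen, T.d2_e2]
  rw [hr', d2_gen, d2_gen] at h1
  have h2 : r' - r = 0 := T.eq_zero_of_decomp_incR (by rw [map_sub, map_sub, h1, sub_self])
  rw [hr', sub_eq_zero.1 h2]

end Sections

/-- Exactness of K at K₁, in the form needed for G. For x in the kernel of q the derivation rule has
one term only, so the elements with this property form an ideal; it contains R. -/
theorem decomp_mem_range {x : TAlg F k V} (hx : M.q x = 0) : ∃ y, M.d2 y = M.decomp x := by
  let J : TwoSidedIdeal (TAlg F k V) := TwoSidedIdeal.mk'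
    {x | M.q x = 0 ∧ ∃ y, M.d2 y = M.decomp x}
    ⟨map_zero _, 0, by rw [map_zero, map_zero]⟩
    (by
      rintro x x' ⟨h1, y, h2⟩ ⟨h3, y', h4⟩
      exact ⟨by rw [map_add, h1, h3, add_zero], y + y', by rw [map_add, map_add, h2, h4]⟩)
    (by
      rintro x ⟨h1, y, h2⟩
      exact ⟨by rw [map_neg, h1, neg_zero], -y, by rw [map_neg, map_neg, h2]⟩)
    (by
      rintro x x' ⟨h1, y, h2⟩
      refine ⟨by rw [M.q_mul, h1, mul_zero], M.q x • y, ?_⟩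
      have h3 : M.d2 (M.q x • y) = M.q x • M.d2 y := M.d2_hom.smul _ _
      rw [h3, h2, M.decomp_mul, h1, op_zero, zero_smul, add_zero])
    (by
      rintro x x' ⟨h1, y, h2⟩
      refine ⟨by rw [M.q_mul, h1, zero_mul], op (M.q x') • y, ?_⟩
      have h3 : M.d2 (op (M.q x') • y) = op (M.q x') • M.d2 y := M.d2_hom.op_smul _ _
      rw [h3, h2, M.decomp_mul, h1, zero_smul, zero_add])
  have hJ : TwoSidedIdeal.span (Set.range M.incR) ≤ J := by
    refine TwoSidedIdeal.span_le.2 ?_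
    rintro _ ⟨r, rfl⟩
    exact (TwoSidedIdeal.mem_mk' _ _ _ _ _ _ _).2 ⟨M.q_incR r, gen r, M.d2_gen r⟩
  exact ((TwoSidedIdeal.mem_mk' _ _ _ _ _ _ _).1 (hJ (M.mem_span_of_q hx))).2

namespace Sections

variable {M} (T : M.Sections)

theorem d2_G (x : TAlg F k V) : M.d2 (T.G x) = M.decomp x - M.decomp (T.θ (M.q x)) := by
  obtain ⟨y, hy⟩ := M.decomp_mem_range (x := x - T.θ (M.q x)) (by rw [map_sub, T.q_θ, sub_self])
  rw [G_apply, ← hy, T.d2_e2, hy, map_sub]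

/-- The comparison map in degree one. -/
def τ1E : M.I →ₗ[Env F k] FB F k M.A V := M.decomp ∘ₗ T.θI

/-- The comparison map in degree two. -/
def τ2E : M.I2 →ₗ[Env F k] FB F k M.A M.R := T.G ∘ₗ mulMap T.θI T.θI

theorem τ1E_apply (a : M.I) : T.τ1E a = M.decomp (T.θI a) := rfl

theorem τ2E_mk (a b : M.I) : T.τ2E (BT.mk F k a b) = T.G (T.θI a * T.θI b) := rfl

theorem τ1E_mem {n : ℕ} {a : M.I} (ha : a ∈ M.degI n) : T.τ1E a ∈ M.degFB (pureDeg F V 1) n :=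
  M.decomp_mem (T.θI_mem ha)

theorem τ2E_mem {n : ℕ} {t : M.I2} (ht : t ∈ M.degI2 n) :
    T.τ2E t ∈ M.degFB (pureDeg F M.R M.N) n := by
  induction ht using Submodule.span_induction with
  | mem x hx =>
    obtain ⟨i, j, a, b, rfl, ha, hb, rfl⟩ := hx
    exact T.G_mem (TAlg.deg_mul (T.θI_mem ha) (T.θI_mem hb))
  | zero => rw [map_zero]; exact zero_mem _
  | add x y _ _ hx hy => rw [map_add]; exact add_mem hx hy
  | smul s x _ hx => rw [env_map_smul]; exact Submodule.smul_mem _ _ hx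

theorem τ2E_cls {a b : ℕ} (ha : 0 < a) (hb : 0 < b) (hab : a + b ≤ M.N) {x y : TAlg F k V}
    (hx : x ∈ TAlg.deg F k V a) (hy : y ∈ TAlg.deg F k V b) :
    T.τ2E (BT.mk F k (M.cls x) (M.cls y)) = T.G (x * y) := by
  rw [τ2E_mk, T.θI_cls ha (by omega) hx, T.θI_cls hb (by omega) hy]

theorem τ2_split2_incR (r : M.R) : ext T.τ2E (M.split2 (M.incR r)) = gen r := by
  rw [M.ext_split2_eq (G := T.G) ?_ ?_ (M.incR_mem r), G_incR]
  · intro a b ha hb hab x hx y hy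
    rw [T.τ2E_cls ha hb hab.le hx hy, T.G_of_lt hab (TAlg.deg_mul hx hy)]
  · intro a b ha hb hab x hx y hy
    exact T.τ2E_cls ha hb hab.le hx hy

/-- Lets a cycle of K be carried to the bar resolution, modified there, and brought back. -/
theorem τ2_σ2 (z : FB F k M.A M.R) : ext T.τ2E (M.σ2 z) = z := by
  refine ((ext_isBimodHom T.τ2E).comp M.σ2_hom).ext IsBimodHom.id
    (g := LinearMap.id) (fun r => ?_) z
  change ext T.τ2E (M.σ2 (gen r)) = gen r
  rw [σ2_gen, τ2_split2_incR]

theorem b1_eq (x : FB F k M.A M.I) : M.b1 x = M.d1 (ext T.τ1E x) := by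
  refine M.b1_hom.ext (M.d1_hom.comp (ext_isBimodHom T.τ1E)) (fun a => ?_) x
  change ext (genD M.j) (gen a) = M.d1 (ext T.τ1E (gen a))
  rw [ext_gen, ext_gen, τ1E_apply, d1_decomp, q_θI, genD_apply]

/-- By the derivation rule the left side at 1|a|b|1 is the decomposition of θ(a)θ(b) - θ(ab). This
element of the ideal of relations is the one to which G assigns a preimage under d₂. -/
theorem τ1_b2 (x : FB F k M.A M.I2) : ext T.τ1E (M.b2 x) = M.d2 (ext T.τ2E x) := by
  refine (ext_isBimodHom T.τ1E).ext_comp M.b2_hom M.d2_hom (ext_isBimodHom T.τ2E) (fun t => ?_) x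
  rw [ext_gen]
  induction t using BT.induction with
  | zero => simp only [map_zero]
  | tmul u v =>
    rw [τ2E_mk, d2_G, M.q_mul, q_θI, q_θI, ← M.j_μ, b2_gen_mk, map_add, map_sub, ext_smul,
      ext_op_smul, ext_gen, ext_gen, ext_gen, τ1E_apply, τ1E_apply, τ1E_apply, M.decomp_mul, q_θI,
      q_θI, θI_apply _ (M.μ _)]
    abel
  | add x y hx hy => simp only [map_add, hx, hy]

theorem d2_τ2_b3 (x : FB F k M.A M.I3) : M.d2 (ext T.τ2E (M.b3 x)) = 0 := by
  rw [← τ1_b2, b2_b3, map_zero]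

/-- A left inverse of `V → A`. -/
def toV : M.A →ₗ[Env F k] V := M.augFB ∘ₗ M.decomp ∘ₗ T.θ

theorem toV_ιA (v : V) : T.toV (M.ιA v) = v := by
  have h1 : T.θ (M.ιA v) = TAlg.ι F k v :=
    T.θ_q (lt_of_lt_of_le one_lt_two M.two_le) (TAlg.ι_mem_deg v)
  rw [toV, LinearMap.comp_apply, LinearMap.comp_apply, h1, M.decomp_ι, augFB_gen]

/-- Injectivity of d₃ in degree N + 1. In ∑ v|s|1 - ∑ 1|r|u, applying the augmentation to the last
factor kills the second sum and recovers the first; once this is zero, the first factor recovers the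
second. -/
theorem eq_zero_of_d3_gen (T : M.Sections) {w : M.S} (hw : M.d3 (gen w) = 0) : w = 0 := by
  rw [d3_gen] at hw
  have h1 : ∀ y : BT F k V M.R, BT.map T.toV LinearMap.id (M.augLast (genL M.ιA y)) = y := by
    intro y
    induction y using BT.induction with
    | zero => simp only [map_zero]
    | tmul v r => rw [genL_mk, augLast_mk, map_one, BT.rsm_one, BT.map_mk, toV_ιA]; rfl
    | add x y hx hy => simp only [map_add, hx, hy]
  have h2 : ∀ y : BT F k M.R V, M.augLast (genR M.ιA y) = 0 := by
    intro y
    induction y using BT.induction with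
    | zero => simp only [map_zero]
    | tmul r v => rw [genR_mk, ← op_smul_gen, augLast_ιA_smul]
    | add x y hx hy => simp only [map_add, hx, hy, add_zero]
  have h3 : ∀ y : BT F k M.R V, BT.map LinearMap.id T.toV (M.augLeft (genR M.ιA y)) = y := by
    intro y
    induction y using BT.induction with
    | zero => simp only [map_zero]
    | tmul r v =>
      rw [genR_mk, FB.mk, augLeft_mk, map_one, BT.lsm_one, BT.map_mk, toV_ιA]; rfl
    | add x y hx hy => simp only [map_add, hx, hy]
  have h4 : M.toVR w = 0 := by
    rw [← h1 (M.toVR w), sub_eq_zero.1 hw, h2, map_zero]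
  have h5 : M.toRV w = 0 := by
    rw [h4, map_zero, zero_sub, neg_eq_zero] at hw
    rw [← h3 (M.toRV w), hw, map_zero, map_zero]
  exact M.S_ext (by rw [h5, map_zero]) (by rw [h4, map_zero])

end Sections
end Setting

/-! ### Exactness of the Koszul complex -/

namespace Setting

variable {F : Type u₁} {k : Type u₂} {V : Type u₃} [Field F] [Ring k] [Algebra F k]
  [AddCommGroup V] [FModule F V] [EnvModule F k V] [EnvTower F k V]
variable (M : Setting.{u₁, u₂, u₃, u₄} F k V)

section

variable {W X : Type*} [AddCommGroup W] [FModule F W] [EnvModule F k W]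
  [EnvTower F k W] [AddCommGroup X] [FModule F X] [EnvModule F k X]
  [EnvTower F k X]

theorem augFB_smul (a : M.A) (x : FB F k M.A W) :
    M.augFB (a • x) = lsm F (M.aug a) (M.augFB x) := by
  induction x using FB.induction with
  | zero => rw [smul_zero, map_zero, map_zero]
  | mk a' w b => rw [FB.smul_mk, augFB_mk, augFB_mk, map_mul, BT.lsm_mul]
  | add x y hx hy => rw [smul_add, map_add, hx, hy, map_add, map_add]

theorem augFB_op_smul (a : M.A) (x : FB F k M.A W) :
    M.augFB (op a • x) = rsm F (M.aug a) (M.augFB x) := by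
  induction x using FB.induction with
  | zero => rw [smul_zero, map_zero, map_zero]
  | mk a' w b => rw [FB.op_smul_mk, augFB_mk, augFB_mk, map_mul, BT.rsm_mul, lsm_rsm]
  | add x y hx hy => rw [smul_add, map_add, hx, hy, map_add, map_add]

theorem augFB_genL (y : BT F k M.I W) : M.augFB (genL M.j y) = 0 := by
  induction y using BT.induction with
  | zero => rw [map_zero, map_zero]
  | tmul u t => rw [genL_mk, ← smul_gen, augFB_smul_j]
  | add x y hx hy => rw [map_add, map_add, hx, hy, add_zero]

theorem augFB_genR (y : BT F k W M.I) : M.augFB (genR M.j y) = 0 := by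
  induction y using BT.induction with
  | zero => rw [map_zero, map_zero]
  | tmul u t => rw [genR_mk, ← op_smul_gen, augFB_op_smul_j]
  | add x y hx hy => rw [map_add, map_add, hx, hy, add_zero]

theorem augFB_bimodHom {f : FB F k M.A W →ₗ[F] FB F k M.A X} (hf : IsBimodHom M.A f)
    {φ : W →ₗ[Env F k] X} (h : ∀ w, M.augFB (f (gen w)) = φ w) (x : FB F k M.A W) :
    M.augFB (f x) = φ (M.augFB x) := by
  induction x using FB.induction with
  | zero => rw [map_zero, map_zero, map_zero, map_zero]
  | mk a w b => rw [hf.mk_apply, augFB_smul, augFB_op_smul, h, augFB_mk, map_lsm, map_rsm]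
  | add x y hx hy => rw [map_add, map_add, map_add, map_add, hx, hy]

/-- Outside degree d every a|w|b has an outer factor in I_+, and a morphism of bimodules preserves
such elements. -/
theorem augFB_bimodHom_of_ne {f : FB F k M.A W →ₗ[F] FB F k M.A X} (hf : IsBimodHom M.A f)
    {d n : ℕ} (hn : n ≠ d) {x : FB F k M.A W} (hx : x ∈ M.degFB (pureDeg F W d) n) :
    M.augFB (f x) = 0 := by
  have h1 := eq_zero_of_mem_pureDeg hn (M.augFB_mem (Grading.pure F k d) hx)
  rw [M.augFB_bimodHom hf (φ := M.augFB ∘ₗ hf.toEnv ∘ₗ gen) (fun w => rfl), h1, map_zero]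

theorem exists_of_mem_degFB_pure_succ {d : ℕ} {x : FB F k M.A W}
    (hx : x ∈ M.degFB (pureDeg F W d) (d + 1)) :
    ∃ (y : BT F k V W) (z : BT F k W V), x = genL M.ιA y + genR M.ιA z := by
  have hA : ∀ a ∈ M.deg 1, ∃ v, a = M.ιA v := by
    intro a ha
    obtain ⟨y, hy, rfl⟩ := M.mem_deg.1 ha
    obtain ⟨v, rfl⟩ := TAlg.exists_ι_of_mem_deg_one hy
    exact ⟨v, rfl⟩
  refine M.degFB_induction (p := fun x => ∃ (y : BT F k V W) (z : BT F k W V),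
    x = genL M.ιA y + genR M.ιA z) ⟨0, 0, by rw [map_zero, map_zero, add_zero]⟩ ?_ ?_ hx
  · intro i j l e a ha w hw b hb
    by_cases hj : j = d
    · obtain ⟨rfl, rfl⟩ | ⟨rfl, rfl⟩ : i = 1 ∧ l = 0 ∨ i = 0 ∧ l = 1 := by omega
      · obtain ⟨v, rfl⟩ := hA a ha
        obtain ⟨c, rfl⟩ := M.exists_unit_of_mem_deg_zero hb
        refine ⟨BT.mk F k v (rsm F c w), 0, ?_⟩
        rw [map_zero, add_zero, genL_mk, ← FB.mk_unit_mul, mul_one]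
      · obtain ⟨v, rfl⟩ := hA b hb
        obtain ⟨c, rfl⟩ := M.exists_unit_of_mem_deg_zero ha
        refine ⟨0, BT.mk F k (lsm F c w) v, ?_⟩
        rw [map_zero, zero_add, genR_mk, ← FB.mk_mul_unit, one_mul]
    · rw [eq_zero_of_mem_pureDeg hj hw, FB.mk_zero_mid]
      exact ⟨0, 0, by rw [map_zero, map_zero, add_zero]⟩
  · rintro _ _ ⟨y, z, rfl⟩ ⟨y', z', rfl⟩
    exact ⟨y + y', z + z', by rw [map_add, map_add]; abel⟩

end

theorem mulMap_ι_incR_mem (y : BT F k V M.R) :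
    mulMap (TAlg.ι F k) M.incR y ∈ TAlg.deg F k V (M.N + 1) := by
  induction y using BT.induction with
  | zero => rw [map_zero]; exact zero_mem _
  | tmul v r =>
    have := TAlg.deg_mul (TAlg.ι_mem_deg v) (M.incR_mem r)
    rwa [add_comm] at this
  | add x y hx hy => rw [map_add]; exact add_mem hx hy

theorem mulMap_incR_ι_mem (y : BT F k M.R V) :
    mulMap M.incR (TAlg.ι F k) y ∈ TAlg.deg F k V (M.N + 1) := by
  induction y using BT.induction with
  | zero => rw [map_zero]; exact zero_mem _
  | tmul r v => exact TAlg.deg_mul (M.incR_mem r) (TAlg.ι_mem_deg v)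
  | add x y hx hy => rw [map_add]; exact add_mem hx hy

/-- The two outer faces carry a factor from I_+ and die. What remains is the differential of k ⊗_A C
⊗_A k, with the opposite sign to the complex computing Tor. -/
theorem augFB_b3 (x : FB F k M.A M.I3) :
    M.augFB (M.b3 x) = M.m32 (M.augFB x) - M.m31 (M.augFB x) := by
  refine M.augFB_bimodHom M.b3_hom (φ := M.m32 - M.m31) (fun t => ?_) x
  have h3 : M.b3 (gen t) = genL M.j t - gen (M.m31 t) + gen (M.m32 t) - genR M.j (BT.assoc t) :=
    ext_gen _ _
  rw [h3, map_sub, map_add, map_sub, augFB_genL, augFB_genR, augFB_gen, augFB_gen, sub_zero,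
    zero_sub,
    neg_add_eq_sub, LinearMap.sub_apply]

theorem augFB_b4_gen (x : M.I4) :
    M.augFB (M.b4 (gen x)) = -(M.m41 x - M.m42 x + M.m43 x) := by
  have h3 : M.b4 (gen x) = genL M.j x - gen (M.m41 x) + gen (M.m42 x) - gen (M.m43 x) +
      genR M.j (BT.assoc (BT.map LinearMap.id BT.assoc x)) := ext_gen _ _
  rw [h3, map_add, map_sub, map_add, map_sub, augFB_genL, augFB_genR, augFB_gen, augFB_gen,
    augFB_gen]
  abel

/-- The only use of the hypothesis on Tor. The contraction of σ₂(z) is a chain with boundary σ₂(z).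
Its image in I_+ ⊗ I_+ ⊗ I_+ is a cycle of degree n, because σ₂(z) has augmentation zero in degree n
≠ N. As n ≠ N + 1 it bounds, and adding a b₄-boundary removes it without changing the image under
b₃. -/
theorem exists_b3_eq (hTor : M.TorThreeConcentrated) {n : ℕ} (hn : M.N < n)
    (hn' : n ≠ M.N + 1) {z : FB F k M.A M.R} (hz : z ∈ M.degFB (pureDeg F M.R M.N) n)
    (h0 : M.d2 z = 0) : ∃ y, M.b3 y = M.σ2 z ∧ M.augFB y = 0 := by
  have h1 := M.b3_contr (M.σ2 z)
  rw [b2_σ2, h0, map_zero, map_zero, add_zero] at h1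
  have h2 : M.augFB (M.contr (M.σ2 z)) ∈ M.degI3 n :=
    M.augFB_mem (M.gradingI.bt (M.gradingI.bt M.gradingI)) (M.contr_mem (M.σ2_mem hz))
  have h3 := M.augFB_b3 (M.contr (M.σ2 z))
  have h4 : M.augFB (M.σ2 z) = 0 := M.augFB_bimodHom_of_ne M.σ2_hom hn.ne' hz
  rw [h1, h4] at h3
  obtain ⟨y, hy⟩ := hTor n hn' _ h2 (by rw [← neg_sub, ← h3, neg_zero])
  exact ⟨M.contr (M.σ2 z) + M.b4 (gen y), by rw [map_add, h1, b3_b4, add_zero],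
    by rw [map_add, augFB_b4_gen, hy, add_neg_cancel]⟩

namespace Sections

variable {M} (T : M.Sections)

/-- The terms `v|u|b` of a decomposition. -/
def second : FB F k M.A V →ₗ[Env F k] TAlg F k V :=
  mulMap (T.θ ∘ₗ M.gradingA.proj 1) (mulMap (TAlg.ι F k) T.θ)

theorem second_mk (a : M.A) (v : V) (b : M.A) : T.second (FB.mk F k a v b) =
    T.θ (M.gradingA.proj 1 a) * (TAlg.ι F k v * T.θ b) := rfl

theorem second_ιA_smul (v v' : V) (x : FB F k M.A V) :
    T.second (M.ιA v • M.ιA v' • x) = 0 := by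
  have h1 : ∀ a, M.gradingA.proj 1 (M.ιA v * (M.ιA v' * a)) = 0 := by
    intro a
    induction a using M.gradingA.induction with
    | zero => rw [mul_zero, mul_zero, map_zero]
    | hom n a ha =>
      exact M.gradingA.proj_ne (M.deg_mul (M.ιA_mem v) (M.deg_mul (M.ιA_mem v') ha)) (by omega)
    | add x y hx hy => rw [mul_add, mul_add, map_add, hx, hy, add_zero]
  induction x using FB.induction with
  | zero => rw [smul_zero, smul_zero, map_zero]
  | mk a w b => rw [FB.smul_mk, FB.smul_mk, second_mk, h1, map_zero, zero_mul]
  | add x y hx hy => rw [smul_add, smul_add, map_add, hx, hy, add_zero]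

/-- Used in degree N + 1, where the last term y|v|1 is of no help: its first factor has degree N and
may vanish in A. The terms u|v|b with u of degree one have b of degree N - 1, where TV → A is still
injective. -/
theorem second_decomp {n : ℕ} (hn : n < M.N) {x : TAlg F k V}
    (hx : x ∈ TAlg.deg F k V (n + 1 + 1)) : T.second (M.decomp x) = x := by
  refine TAlg.succ_deg_induction (p := fun x => T.second (M.decomp x) = x)
    (by rw [map_zero, map_zero]) (fun x y hx hy => by rw [map_add, map_add, hx, hy])
    (fun u x hx => ?_) hx
  refine TAlg.succ_deg_induction (p := fun x => T.second (M.decomp (TAlg.ι F k u * x)) =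
    TAlg.ι F k u * x) (by rw [mul_zero, map_zero, map_zero])
    (fun x y hx hy => by rw [mul_add, map_add, map_add, hx, hy]) (fun v y hy => ?_) hx
  have h1 : T.θ (M.ιA u) = TAlg.ι F k u :=
    T.θ_q (lt_of_lt_of_le one_lt_two M.two_le) (TAlg.ι_mem_deg u)
  rw [decomp_ι_mul, decomp_ι_mul, smul_add, map_add, map_add, second_ιA_smul, FB.smul_mk, mul_one,
    second_mk, second_mk, M.gradingA.proj_ne M.one_mem_deg one_ne_zero, map_zero, zero_mul,
    add_zero, zero_add, M.gradingA.proj_self (M.ιA_mem u), T.θ_q hn hy, h1]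

/-- Below degree N there is nothing, and in degree N the differential d₂ is injective. Degree N + 1
is the definition of R_{N+1}, and higher degrees reduce to smaller ones. -/
theorem exists_d3_of_mem_degFB (T : M.Sections) (hTor : M.TorThreeConcentrated) (n : ℕ) :
    ∀ z ∈ M.degFB (pureDeg F M.R M.N) n, M.d2 z = 0 → ∃ y, M.d3 y = z := by
  induction n using Nat.strong_induction_on with
  | _ n ih =>
  intro z hz h0
  rcases lt_trichotomy n M.N with hn | rfl | hn
  · exact ⟨0, by rw [map_zero, M.degFB_pure_of_lt hn hz]⟩
  · obtain ⟨r, rfl⟩ := M.degFB_pure_self hz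
    rw [d2_gen] at h0
    exact ⟨0, by rw [map_zero, T.eq_zero_of_decomp_incR h0, map_zero]⟩
  -- In degree N + 1 a cycle is ∑ v|s|1 + ∑ 1|r|u. The decomposition of ∑ v s + ∑ r u vanishes,
  -- hence so does this element of TV, and the pair (-∑ r ⊗ u, ∑ v ⊗ s) is an element of R_{N+1}.
  rcases eq_or_ne n (M.N + 1) with rfl | hn'
  · obtain ⟨y, x, rfl⟩ := M.exists_of_mem_degFB_pure_succ hz
    rw [map_add, d2_genL, d2_genR, ← map_add] at h0
    have hdeg : mulMap (TAlg.ι F k) M.incR y + mulMap M.incR (TAlg.ι F k) x ∈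
        TAlg.deg F k V (M.N + 1) := by
      exact add_mem (M.mulMap_ι_incR_mem y) (M.mulMap_incR_ι_mem x)
    obtain ⟨m, hm⟩ : ∃ m, M.N = m + 1 := ⟨M.N - 1, by have := M.two_le; omega⟩
    rw [hm] at hdeg
    have h1 := T.second_decomp (by omega) hdeg
    rw [h0, map_zero] at h1
    obtain ⟨w, hw1, hw2⟩ := M.exists_S (x := -x) (y := y) (by
      rw [map_neg, eq_comm, ← add_eq_zero_iff_eq_neg]; exact h1.symm)
    exact ⟨gen w, by rw [d3_gen, hw1, hw2, map_neg, sub_neg_eq_add]⟩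
  obtain ⟨y, hy0, hy1⟩ := M.exists_b3_eq hTor hn hn' hz h0
  let C : Submodule F (FB F k M.A M.R) := LinearMap.range M.d3
  let P := (M.gradingFB (Grading.pure F k M.N)).proj n (M := FB F k M.A M.R)
  -- As z = τ₂(b₃(y)) and y has zero augmentation, it suffices to treat multiples of chains by
  -- elements of I_+. The chain y need not be homogeneous, so the component of degree n is taken at
  -- the end.
  suffices h : ∀ x ∈ AddSubmonoid.closure
      ({y | ∃ (a : M.I) (z : FB F k M.A M.I3), y = M.j a • z} ∪
        {y | ∃ (a : M.I) (z : FB F k M.A M.I3), y = op (M.j a) • z}),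
      P (ext T.τ2E (M.b3 x)) ∈ C by
    have h1 := h y (by have := M.sub_gen_augFB_mem y; rwa [hy1, map_zero, sub_zero] at this)
    rw [hy0, τ2_σ2] at h1
    rwa [show P z = z from Grading.proj_self _ hz] at h1
  -- Left and right multiplication by a are handled together as f(a). The components of a have
  -- positive degree i, so only components of x of degree n - i < n matter, and these are again
  -- cycles.
  have key : ∀ (f : M.A → FB F k M.A M.R →+ FB F k M.A M.R)
      (hf : ∀ i e, ∀ a ∈ M.deg i, ∀ x ∈ M.degFB (pureDeg F M.R M.N) e,
        f a x ∈ M.degFB (pureDeg F M.R M.N) (i + e)) (hf' : ∀ a a' x, f (a + a') x = f a x + f a' x)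
      (hf0 : ∀ x, f 0 x = 0) (hfC : ∀ a x, x ∈ C → f a x ∈ C) (a : M.I) (x : FB F k M.A M.R),
      M.d2 x = 0 → P (f (M.j a) x) ∈ C := by
    intro f hf hf' hf0 hfC a x hx
    induction a using M.gradingI.induction with
    | zero => rw [map_zero, hf0, map_zero]; exact zero_mem _
    | add a a' ha ha' => rw [map_add, hf', map_add]; exact add_mem ha ha'
    | hom i a ha =>
      rcases Nat.eq_zero_or_pos i with rfl | hi
      · rw [M.degI_zero ha, map_zero, hf0, map_zero]; exact zero_mem _
      obtain ⟨s, hs⟩ := (M.gradingFB (Grading.pure F k M.N)).exists_sum x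
      rw [hs, map_sum, map_sum]
      refine sum_mem fun e _ => ?_
      have h1 := (M.gradingFB (Grading.pure F k M.N)).mem e x
      have h2 := hf i e _ (M.mem_degI.1 ha) _ h1
      by_cases he : n = i + e
      · rw [← he] at h2
        rw [show P _ = _ from Grading.proj_self _ h2]
        refine hfC _ _ (ih e (by omega) _ h1 ?_)
        have h3 := (M.gradingFB (Grading.pure F k M.N)).map_proj (M.gradingFB (Grading.pure F k 1))
          (extE (M.decomp ∘ₗ M.incR)) (fun n x hx => M.d2_mem hx) e x
        refine h3.trans ?_
        rw [show extE (M.decomp ∘ₗ M.incR) x = 0 from hx, map_zero]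
      · rw [show P _ = 0 from Grading.proj_ne _ h2 he]; exact zero_mem _
  intro x hx
  induction hx using AddSubmonoid.closure_induction with
  | mem x hx =>
    rcases hx with ⟨a, m, rfl⟩ | ⟨a, m, rfl⟩
    · have h1 : M.b3 (M.j a • m) = M.j a • M.b3 m := M.b3_hom.smul _ _
      rw [h1, ext_smul]
      refine key (fun a => DistribSMul.toAddMonoidHom _ a)
        (fun i e a ha x hx => M.smul_mem_degFB ha hx) (fun a a' x => add_smul _ _ _)
        (fun x => zero_smul _ _) ?_ a _ (T.d2_τ2_b3 m)
      rintro a _ ⟨y, rfl⟩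
      exact ⟨a • y, M.d3_hom.smul _ _⟩
    · have h1 : M.b3 (op (M.j a) • m) = op (M.j a) • M.b3 m := M.b3_hom.op_smul _ _
      rw [h1, ext_op_smul]
      refine key (fun a => DistribSMul.toAddMonoidHom _ (op a))
        (fun i e a ha x hx => by rw [add_comm]; exact M.op_smul_mem_degFB ha hx)
        (fun a a' x => add_smul (op a) (op a') x)
        (fun x => zero_smul M.Aᵐᵒᵖ x) ?_ a _ (T.d2_τ2_b3 m)
      rintro a _ ⟨y, rfl⟩
      exact ⟨op a • y, M.d3_hom.op_smul _ _⟩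
  | zero => rw [map_zero, map_zero, map_zero]; exact zero_mem _
  | add x y _ _ hx hy => rw [map_add, map_add, map_add]; exact add_mem hx hy

theorem exists_d3 (T : M.Sections) (hTor : M.TorThreeConcentrated) {z : FB F k M.A M.R}
    (hz : M.d2 z = 0) : ∃ y, M.d3 y = z := by
  obtain ⟨s, hs⟩ := (M.gradingFB (Grading.pure F k M.N)).exists_sum z
  change z ∈ LinearMap.range M.d3
  rw [hs]
  refine sum_mem fun e _ => T.exists_d3_of_mem_degFB hTor e _
    ((M.gradingFB (Grading.pure F k M.N)).mem e z) ?_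
  have h3 := (M.gradingFB (Grading.pure F k M.N)).map_proj (M.gradingFB (Grading.pure F k 1))
    (extE (M.decomp ∘ₗ M.incR)) (fun n x hx => M.d2_mem hx) e z
  refine h3.trans ?_
  rw [show extE (M.decomp ∘ₗ M.incR) z = 0 from hz, map_zero]

end Sections
end Setting

/-! ### The comparison in degree three and the homotopies -/

namespace Setting

variable {F : Type u₁} {k : Type u₂} {V : Type u₃} [Field F] [Ring k] [Algebra F k]
  [AddCommGroup V] [FModule F V] [EnvModule F k V] [EnvTower F k V]
variable (M : Setting.{u₁, u₂, u₃, u₄} F k V)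

/-- The contraction identity at u|t|1, whose contraction is 1|u ⊗ t|1. It computes b₃ without
expanding t. -/
theorem b3_gen_mk (u : M.I) (t : M.I2) : M.b3 (gen (BT.mk F k u t)) =
    M.j u • gen t - M.contr (M.b2 (M.j u • gen t)) := by
  rw [← contr_j_smul_gen]
  exact eq_sub_of_add_eq (M.b3_contr _)

theorem b2_mem {n : ℕ} {x : FB F k M.A M.I2} (hx : x ∈ M.degFB M.degI2 n) :
    M.b2 x ∈ M.degFB M.degI n := by
  refine M.bimodHom_mem_degFB M.b2_hom (fun n t ht => ?_) hx
  induction ht using Submodule.span_induction with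
  | mem t ht =>
    obtain ⟨i, j, a, b, rfl, ha, hb, rfl⟩ := ht
    rw [b2_gen_mk]
    have h1 := M.op_smul_mem_degFB (M.mem_degI.1 hb) (M.gen_mem_degFB ha)
    exact add_mem (sub_mem (M.smul_mem_degFB (M.mem_degI.1 ha) (M.gen_mem_degFB hb))
      (M.gen_mem_degFB (M.μ_mk_mem ha hb))) h1
  | zero => rw [map_zero, map_zero]; exact zero_mem _
  | add x y _ _ hx hy => rw [map_add, map_add]; exact add_mem hx hy
  | smul s x _ hx => rw [env_map_smul, map_smul]; exact Submodule.smul_mem _ _ hx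

theorem b3_mem {n : ℕ} {x : FB F k M.A M.I3} (hx : x ∈ M.degFB M.degI3 n) :
    M.b3 x ∈ M.degFB M.degI2 n := by
  refine M.bimodHom_mem_degFB M.b3_hom (fun n t ht => ?_) hx
  induction ht using Submodule.span_induction with
  | mem t ht =>
    obtain ⟨i, j, a, b, rfl, ha, hb, rfl⟩ := ht
    rw [b3_gen_mk]
    have h1 := M.smul_mem_degFB (M.mem_degI.1 ha) (M.gen_mem_degFB hb)
    exact sub_mem h1 (M.contr_mem (M.b2_mem h1))
  | zero => rw [map_zero, map_zero]; exact zero_mem _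
  | add x y _ _ hx hy => rw [map_add, map_add]; exact add_mem hx hy
  | smul s x _ hx => rw [env_map_smul, map_smul]; exact Submodule.smul_mem _ _ hx

/-- A contraction is a right A-combination of elements 1|t|1, and contr is right A-linear, so the
vanishing on the values f(t) is enough. -/
theorem contr_ext_contr {W X : Type*} [AddCommGroup W] [FModule F W] [EnvModule F k W]
    [EnvTower F k W] [AddCommGroup X] [FModule F X] [EnvModule F k X]
    [EnvTower F k X] {f : BT F k M.I W →ₗ[Env F k] FB F k M.A X}
    (hf : ∀ t, M.contr (f t) = 0) (z : FB F k M.A W) : M.contr (ext f (M.contr z)) = 0 := by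
  induction z using FB.induction with
  | zero => rw [map_zero, map_zero, map_zero]
  | mk a w b => rw [contr_mk, ← op_smul_gen, ext_op_smul, contr_op_smul, ext_gen, hf, smul_zero]
  | add x y hx hy => rw [map_add, map_add, map_add, hx, hy, add_zero]

theorem contr_split2 (x : TAlg F k V) : M.contr (M.split2 x) = 0 := by
  rw [split2_eq, contr_contr]

namespace Sections

variable {M} (T : M.Sections)

/-- The comparison map in degree three. -/
def τ3E : M.I3 →ₗ[Env F k] FB F k M.A M.S :=
  T.e3 ∘ₗ extE T.τ2E ∘ₗ M.b3_hom.toEnv ∘ₗ gen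

theorem τ3E_apply (t : M.I3) : T.τ3E t = T.e3 (ext T.τ2E (M.b3 (gen t))) := rfl

theorem τ3E_mem {n : ℕ} {t : M.I3} (ht : t ∈ M.degI3 n) :
    T.τ3E t ∈ M.degFB (pureDeg F M.S (M.N + 1)) n := by
  rw [τ3E_apply]
  exact T.e3_mem (M.ext_mem_degFB (fun n t ht => T.τ2E_mem ht) (M.b3_mem (M.gen_mem_degFB ht)))

/-- By exactness at K₂ the d₂-cycle τ₂(b₃(1|t|1)) is a d₃-boundary, for which e₃ supplies a
preimage. -/
theorem τ2_b3 (hTor : M.TorThreeConcentrated) (x : FB F k M.A M.I3) :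
    ext T.τ2E (M.b3 x) = M.d3 (ext T.τ3E x) := by
  refine (ext_isBimodHom T.τ2E).ext_comp M.b3_hom M.d3_hom (ext_isBimodHom T.τ3E) (fun t => ?_) x
  obtain ⟨y, hy⟩ := T.exists_d3 hTor (T.d2_τ2_b3 (gen t))
  rw [ext_gen, τ3E_apply, ← hy, T.d3_e3]

/-- The homotopy in degree one. -/
def s1E : M.I →ₗ[Env F k] FB F k M.A M.I2 := -(M.split2 ∘ₗ T.θI)

theorem s1E_apply (a : M.I) : T.s1E a = -M.split2 (T.θI a) := rfl

/-- The homotopy in degree two. -/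
def s2E : M.I2 →ₗ[Env F k] FB F k M.A M.I3 :=
  M.contr ∘ₗ (gen - M.σ2_hom.toEnv ∘ₗ T.τ2E - extE T.s1E ∘ₗ M.b2_hom.toEnv ∘ₗ gen)

theorem s2E_apply (t : M.I2) :
    T.s2E t = M.contr (gen t - M.σ2 (T.τ2E t) - ext T.s1E (M.b2 (gen t))) := rfl

/-- The homotopy in degree three. -/
def s3E : M.I3 →ₗ[Env F k] FB F k M.A M.I4 :=
  M.contr ∘ₗ (gen - M.σ3_hom.toEnv ∘ₗ T.τ3E - extE T.s2E ∘ₗ M.b3_hom.toEnv ∘ₗ gen)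

theorem s3E_apply (t : M.I3) :
    T.s3E t = M.contr (gen t - M.σ3 (T.τ3E t) - ext T.s2E (M.b3 (gen t))) := rfl

theorem s1E_mem {n : ℕ} {a : M.I} (ha : a ∈ M.degI n) : T.s1E a ∈ M.degFB M.degI2 n :=
  neg_mem (M.split2_mem (T.θI_mem ha))

theorem s2E_mem {n : ℕ} {t : M.I2} (ht : t ∈ M.degI2 n) : T.s2E t ∈ M.degFB M.degI3 n := by
  rw [s2E_apply]
  exact M.contr_mem (sub_mem (sub_mem (M.gen_mem_degFB ht) (M.σ2_mem (T.τ2E_mem ht)))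
    (M.ext_mem_degFB (fun n a ha => T.s1E_mem ha) (M.b2_mem (M.gen_mem_degFB ht))))

theorem s3E_mem {n : ℕ} {t : M.I3} (ht : t ∈ M.degI3 n) : T.s3E t ∈ M.degFB M.degI4 n := by
  rw [s3E_apply]
  exact M.contr_mem (sub_mem (sub_mem (M.gen_mem_degFB ht) (M.σ3_mem (T.τ3E_mem ht)))
    (M.ext_mem_degFB (fun n a ha => T.s2E_mem ha) (M.b3_mem (M.gen_mem_degFB ht))))

theorem b2_s1 (x : FB F k M.A M.I) : M.b2 (ext T.s1E x) = x - M.σ1 (ext T.τ1E x) := by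
  refine M.b2_hom.ext_homotopy_one (ext_isBimodHom T.s1E) M.σ1_hom (ext_isBimodHom T.τ1E)
    (fun a => ?_) x
  rw [ext_gen, ext_gen, s1E_apply, τ1E_apply, map_neg, b2_split2, cls_θI, neg_sub]

theorem b3_s2 (x : FB F k M.A M.I2) :
    M.b3 (ext T.s2E x) + ext T.s1E (M.b2 x) = x - M.σ2 (ext T.τ2E x) := by
  refine M.b3_hom.ext_homotopy (ext_isBimodHom T.s2E) (ext_isBimodHom T.s1E) M.b2_hom M.σ2_hom
    (ext_isBimodHom T.τ2E) (fun t => ?_) x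
  rw [ext_gen, ext_gen, s2E_apply]
  refine homotopy_aux M.b3_contr (map_zero _) ?_
  rw [map_sub, map_sub, b2_s1, b2_σ2, τ1_b2, ext_gen, sub_self]

theorem b4_s3 (hTor : M.TorThreeConcentrated) (x : FB F k M.A M.I3) :
    M.b4 (ext T.s3E x) + ext T.s2E (M.b3 x) = x - M.σ3 (ext T.τ3E x) := by
  refine M.b4_hom.ext_homotopy (ext_isBimodHom T.s3E) (ext_isBimodHom T.s2E) M.b3_hom M.σ3_hom
    (ext_isBimodHom T.τ3E) (fun t => ?_) x
  rw [ext_gen, ext_gen, s3E_apply]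
  refine homotopy_aux M.b4_contr (map_zero _) ?_
  have h3 := T.b3_s2 (M.b3 (gen t))
  rw [b2_b3, map_zero, add_zero, T.τ2_b3 hTor, ext_gen] at h3
  rw [map_sub, map_sub, h3, b3_σ3, sub_self]

/-- Up to degree N the value of τ₂ is 0 or some 1|r|1, and σ₂(1|r|1) is itself a contraction. The
same reason gives `contr_σ3_τ3`, one degree higher. -/
theorem contr_σ2_τ2 {n : ℕ} (hn : n ≤ M.N) {t : M.I2} (ht : t ∈ M.degI2 n) :
    M.contr (M.σ2 (T.τ2E t)) = 0 := by
  rcases hn.lt_or_eq with hn | rfl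
  · rw [M.degFB_pure_of_lt hn (T.τ2E_mem ht), map_zero, map_zero]
  · obtain ⟨r, hr⟩ := M.degFB_pure_self (T.τ2E_mem ht)
    rw [hr, σ2_gen, contr_split2]

theorem contr_σ3_τ3 {n : ℕ} (hn : n ≤ M.N + 1) {t : M.I3} (ht : t ∈ M.degI3 n) :
    M.contr (M.σ3 (T.τ3E t)) = 0 := by
  rcases hn.lt_or_eq with hn | rfl
  · rw [M.degFB_pure_of_lt hn (T.τ3E_mem ht), map_zero, map_zero]
  · obtain ⟨r, hr⟩ := M.degFB_pure_self (T.τ3E_mem ht)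
    rw [hr, σ3_gen, contr_split3]

theorem contr_s1E (a : M.I) : M.contr (T.s1E a) = 0 := by
  rw [s1E_apply, map_neg, contr_split2, neg_zero]

theorem contr_s2E (t : M.I2) : M.contr (T.s2E t) = 0 := by rw [s2E_apply, contr_contr]

/-- The faces 1|uv|1 and 1|u|v are sent by s₁ to contractions and their right multiples, which contr
kills. Only u • s₁(v) survives. -/
theorem contr_s1_b2 (u v : M.I) : M.contr (ext T.s1E (M.b2 (gen (BT.mk F k u v)))) =
    -M.split3 (BT.mk F k u (T.θI v)) := by
  rw [b2_gen_mk, map_add, map_sub, ext_smul, ext_op_smul, ext_gen, ext_gen, ext_gen,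
    map_add, map_sub, contr_op_smul, contr_s1E, contr_s1E, s1E_apply, smul_neg, map_neg,
    contr_smul_split2, M.p_j, smul_zero, add_zero, sub_zero]

theorem s2E_mk (u v : M.I) : T.s2E (BT.mk F k u v) =
    -M.contr (M.σ2 (T.τ2E (BT.mk F k u v))) + M.split3 (BT.mk F k u (T.θI v)) := by
  rw [s2E_apply, map_sub, map_sub, contr_s1_b2, contr_gen, zero_sub, sub_neg_eq_add]

theorem contr_s2_b3 (u : M.I) (t : M.I2) : M.contr (ext T.s2E (M.b3 (gen (BT.mk F k u t)))) =
    M.contr (M.j u • T.s2E t) := by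
  rw [b3_gen_mk, map_sub, ext_smul, ext_gen, map_sub, M.contr_ext_contr T.contr_s2E, sub_zero]

theorem s3E_mk (u : M.I) (t : M.I2) : T.s3E (BT.mk F k u t) =
    -M.contr (M.σ3 (T.τ3E (BT.mk F k u t))) - M.contr (M.j u • T.s2E t) := by
  rw [s3E_apply, map_sub, map_sub, contr_s2_b3, contr_gen, zero_sub]

theorem s2E_cls {a b : ℕ} (hb : 0 < b) (hb' : b < M.N) (hab : a + b ≤ M.N) {u : M.I}
    (hu : u ∈ M.degI a) {y : TAlg F k V} (hy : y ∈ TAlg.deg F k V b) :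
    T.s2E (BT.mk F k u (M.cls y)) = M.split3 (BT.mk F k u y) := by
  rw [s2E_mk, T.θI_cls hb hb' hy, T.contr_σ2_τ2 hab (M.mk_mem_degI2 hu (M.cls_mem hy)), neg_zero,
    zero_add]

theorem s3E_cls {a b c : ℕ} (hc : 0 < c) (hc' : c < M.N) (hbc : b + c ≤ M.N)
    (habc : a + (b + c) ≤ M.N + 1) {u v : M.I} (hu : u ∈ M.degI a) (hv : v ∈ M.degI b)
    {z : TAlg F k V} (hz : z ∈ TAlg.deg F k V c) :
    T.s3E (BT.mk F k u (BT.mk F k v (M.cls z))) =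
      -M.split4 (BT.mk F k u (BT.mk F k v z)) := by
  rw [s3E_mk, T.contr_σ3_τ3 habc (M.mk_mem_degI3 hu (M.mk_mem_degI2 hv (M.cls_mem hz))),
    T.s2E_cls hc hc' hbc hv hz, contr_smul_split3, M.p_j, neg_zero,
    zero_sub]

theorem τ3E_of_le {n : ℕ} (hn : n ≤ M.N) {t : M.I3} (ht : t ∈ M.degI3 n) : T.τ3E t = 0 :=
  M.degFB_pure_of_lt (Nat.lt_succ_of_le hn) (T.τ3E_mem ht)

end Sections
end Setting

/-! ### Existence of comparison data -/

namespace Setting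

variable {F : Type u₁} {k : Type u₂} {V : Type u₃} [Field F] [Ring k] [Algebra F k]
  [AddCommGroup V] [FModule F V] [EnvModule F k V] [EnvTower F k V]
variable {M : Setting.{u₁, u₂, u₃, u₄} F k V}

namespace Sections

variable (T : M.Sections)

/-- The value of `τ₂ ∘ b₃` on the decompositions of an element of degree `N + 1`. -/
def bound : TAlg F k V →ₗ[Env F k] FB F k M.A M.R :=
  extE T.G ∘ₗ genL M.ιA ∘ₗ TAlg.unshuffleL F k V -
    T.τ2E ∘ₗ BT.map M.cls M.ιI ∘ₗ TAlg.unshuffleR F k V +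
    T.τ2E ∘ₗ BT.map M.ιI M.cls ∘ₗ TAlg.unshuffleL F k V -
    extE T.G ∘ₗ genR M.ιA ∘ₗ TAlg.unshuffleR F k V

theorem bound_apply (x : TAlg F k V) : T.bound x =
    ext T.G (genL M.ιA (TAlg.unshuffleL F k V x)) -
      T.τ2E (BT.map M.cls M.ιI (TAlg.unshuffleR F k V x)) +
      T.τ2E (BT.map M.ιI M.cls (TAlg.unshuffleL F k V x)) -
      ext T.G (genR M.ιA (TAlg.unshuffleR F k V x)) := rfl

/-- The two inner faces contain the class in A/k of a relation, which is zero. The outer faces give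
∑ v|s|1 - ∑ 1|r|u, because G(r) = 1|r|1. -/
theorem bound_incS (w : M.S) : T.bound (M.incS w) = M.d3 (gen w) := by
  have h1 : ∀ t : BT F k V M.R, ext T.G (genL M.ιA (BT.map LinearMap.id M.incR t)) =
      genL M.ιA t := by
    intro t
    induction t using BT.induction with
    | zero => simp only [map_zero]
    | tmul v r =>
      rw [BT.map_mk, genL_mk, ← smul_gen, ext_smul, ext_gen, G_incR, smul_gen, genL_mk]; rfl
    | add x y hx hy => simp only [map_add, hx, hy]
  have h2 : ∀ t : BT F k M.R V, ext T.G (genR M.ιA (BT.map M.incR LinearMap.id t)) =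
      genR M.ιA t := by
    intro t
    induction t using BT.induction with
    | zero => simp only [map_zero]
    | tmul r v =>
      rw [BT.map_mk, genR_mk, ← op_smul_gen, ext_op_smul, ext_gen, G_incR, op_smul_gen, genR_mk]
      rfl
    | add x y hx hy => simp only [map_add, hx, hy]
  have h3 : ∀ t : BT F k V M.R, BT.map M.ιI M.cls (BT.map LinearMap.id M.incR t) = 0 := by
    intro t
    induction t using BT.induction with
    | zero => simp only [map_zero]
    | tmul v r => rw [BT.map_mk, BT.map_mk, M.cls_incR, BT.mk_zero_right]
    | add x y hx hy => simp only [map_add, hx, hy, add_zero]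
  have h4 : ∀ t : BT F k M.R V, BT.map M.cls M.ιI (BT.map M.incR LinearMap.id t) = 0 := by
    intro t
    induction t using BT.induction with
    | zero => simp only [map_zero]
    | tmul v r => rw [BT.map_mk, BT.map_mk, M.cls_incR, BT.mk_zero_left]
    | add x y hx hy => simp only [map_add, hx, hy, add_zero]
  rw [bound_apply, M.unshuffleL_incS, M.unshuffleR_incS, h1, h2, h3, h4, map_zero, sub_zero,
    add_zero, d3_gen]

/-- Each of the four faces of v|y|u depends only on the product v y u, with its first or last letter
split off. Hence the value of τ₃ on a double relation decomposition depends only on w. -/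
theorem τ2_b3_cls {x y z : TAlg F k V} (hx : x ∈ TAlg.deg F k V 1)
    (hy : y ∈ TAlg.deg F k V (M.N - 1)) (hz : z ∈ TAlg.deg F k V 1) :
    ext T.τ2E (M.b3 (gen (BT.mk F k (M.cls x) (BT.mk F k (M.cls y) (M.cls z))))) =
      T.bound (x * y * z) := by
  obtain ⟨v, rfl⟩ := TAlg.exists_ι_of_mem_deg_one hx
  obtain ⟨u, rfl⟩ := TAlg.exists_ι_of_mem_deg_one hz
  have hN := M.two_le
  have h1 : M.b3 (gen (BT.mk F k (M.ιI v) (BT.mk F k (M.cls y) (M.ιI u)))) =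
      M.ιA v • gen (BT.mk F k (M.cls y) (M.ιI u)) -
      gen (BT.mk F k (M.cls (TAlg.ι F k v * y)) (M.ιI u)) +
      gen (BT.mk F k (M.ιI v) (M.cls (y * TAlg.ι F k u))) -
      op (M.ιA u) • gen (BT.mk F k (M.ιI v) (M.cls y)) := by
    rw [gen_apply, b3_mk, one_mul, mul_one, M.j_ιI, M.j_ιI, ← M.μ_cls one_ne_zero hx
      (by omega) hy, ← M.μ_cls (by omega) hy one_ne_zero hz, smul_gen, op_smul_gen]
    rfl
  change ext T.τ2E (M.b3 (gen (BT.mk F k (M.ιI v) (BT.mk F k (M.cls y) (M.ιI u))))) = _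
  rw [h1, map_sub, map_add, map_sub, ext_smul, ext_op_smul, ext_gen, ext_gen, ext_gen, ext_gen,
    bound_apply, TAlg.unshuffleR_mul_ι, mul_assoc, TAlg.unshuffleL_ι_mul, BT.map_mk, BT.map_mk,
    genL_mk, genR_mk, ← smul_gen, ← op_smul_gen, ext_smul, ext_op_smul, ext_gen, ext_gen,
    M.ιI_apply v, M.ιI_apply u, T.τ2E_cls (by omega) one_pos (by omega) hy hz,
    T.τ2E_cls one_pos (by omega) (by omega) hx hy]

/-- In degree N + 1 the value of τ₃ is 1|w'|1 for some w', and d₃ is injective on such elements. -/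
theorem τ3E_double (hTor : M.TorThreeConcentrated) {t : M.I3} (ht : t ∈ M.degI3 (M.N + 1))
    {w : M.S} (h : ext T.τ2E (M.b3 (gen t)) = M.d3 (gen w)) : T.τ3E t = gen w := by
  obtain ⟨w', hw'⟩ := M.degFB_pure_self (T.τ3E_mem ht)
  rw [T.τ2_b3 hTor, ext_gen, hw'] at h
  have h2 : w' - w = 0 := T.eq_zero_of_d3_gen (by rw [map_sub, map_sub, h, sub_self])
  rw [hw', sub_eq_zero.1 h2]

theorem τ2E_sum {n : ℕ} {x y : Fin n → TAlg F k V} {r : M.R}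
    (h : ∀ i, ∃ a b, 0 < a ∧ 0 < b ∧ a + b = M.N ∧ x i ∈ TAlg.deg F k V a ∧
      y i ∈ TAlg.deg F k V b) (hr : ∑ i, x i * y i = M.incR r) :
    T.τ2E (∑ i, BT.mk F k (M.cls (x i)) (M.cls (y i))) = gen r := by
  rw [← T.G_incR, ← hr, map_sum, map_sum]
  refine Finset.sum_congr rfl fun i _ => ?_
  obtain ⟨a, b, ha, hb, hab, hx, hy⟩ := h i
  exact T.τ2E_cls ha hb hab.le hx hy

theorem s2E_sum {n : ℕ} {x y : Fin n → TAlg F k V}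
    (h : ∀ i, ∃ a b, 0 < a ∧ 0 < b ∧ a + b = M.N ∧ x i ∈ TAlg.deg F k V a ∧
      y i ∈ TAlg.deg F k V b) :
    T.s2E (∑ i, BT.mk F k (M.cls (x i)) (M.cls (y i))) =
      M.split3 (∑ i, BT.mk F k (M.cls (x i)) (y i)) := by
  rw [map_sum, map_sum]
  refine Finset.sum_congr rfl fun i _ => ?_
  obtain ⟨a, b, ha, hb, hab, hx, hy⟩ := h i
  exact T.s2E_cls hb (by omega) hab.le (M.cls_mem hx) hy

theorem s3E_sum {n : ℕ} {x y z : Fin n → TAlg F k V}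
    (h : ∀ i, ∃ a b c, 0 < c ∧ c < M.N ∧ b + c ≤ M.N ∧ a + b + c ≤ M.N + 1 ∧
      x i ∈ TAlg.deg F k V a ∧ y i ∈ TAlg.deg F k V b ∧ z i ∈ TAlg.deg F k V c) :
    T.s3E (∑ i, BT.mk F k (M.cls (x i)) (BT.mk F k (M.cls (y i)) (M.cls (z i)))) =
      -M.split4 (∑ i, BT.mk F k (M.cls (x i)) (BT.mk F k (M.cls (y i)) (z i))) := by
  rw [map_sum, map_sum, ← Finset.sum_neg_distrib]
  refine Finset.sum_congr rfl fun i _ => ?_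
  obtain ⟨a, b, c, hc, hcN, hbc, habc, hx, hy, hz⟩ := h i
  exact T.s3E_cls hc hcN hbc (by omega) (M.cls_mem hx) (M.cls_mem hy) hz

end Sections
end Setting

namespace Setting

variable {F : Type u₁} {k : Type u₂} {V : Type u₃} [Field F] [Ring k] [Algebra F k]
  [AddCommGroup V] [FModule F V] [EnvModule F k V] [EnvTower F k V]
variable {M : Setting.{u₁, u₂, u₃, u₄} F k V} (T : M.Sections)

theorem Sections.values1 {n : ℕ} (hn : n < M.N) {x : TAlg F k V} (hx : x ∈ TAlg.deg F k V n) :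
    T.τ1E (M.cls x) = M.decomp x ∧ T.s1E (M.cls x) = -M.split2 x := by
  rw [τ1E_apply, s1E_apply]
  rcases Nat.eq_zero_or_pos n with rfl | h0
  · rw [M.cls_of_mem_deg_zero hx, map_zero, M.decomp_of_mem_deg_zero hx,
      M.split2_of_mem_deg_zero hx, map_zero, map_zero]
    exact ⟨rfl, rfl⟩
  · rw [T.θI_cls h0 hn hx]
    exact ⟨rfl, rfl⟩

theorem Sections.τ3E_cls {a b c : ℕ} (habc : a + b + c ≤ M.N) {x y z : TAlg F k V}
    (hx : x ∈ TAlg.deg F k V a) (hy : y ∈ TAlg.deg F k V b) (hz : z ∈ TAlg.deg F k V c) :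
    T.τ3E (BT.mk F k (M.cls x) (BT.mk F k (M.cls y) (M.cls z))) = 0 :=
  T.τ3E_of_le (by omega)
    (M.mk_mem_degI3 (M.cls_mem hx) (M.mk_mem_degI2 (M.cls_mem hy) (M.cls_mem hz)))

theorem Sections.τ3E_sum (hTor : M.TorThreeConcentrated) {n : ℕ} {x y z : Fin n → TAlg F k V}
    (h : ∀ i, x i ∈ TAlg.deg F k V 1 ∧ y i ∈ TAlg.deg F k V (M.N - 1) ∧ z i ∈ TAlg.deg F k V 1)
    {w : M.S} (hw : ∑ i, x i * y i * z i = M.incS w) :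
    T.τ3E (∑ i, BT.mk F k (M.cls (x i)) (BT.mk F k (M.cls (y i)) (M.cls (z i)))) = gen w := by
  refine T.τ3E_double hTor (sum_mem fun i _ => ?_) ?_
  · have h1 := M.mk_mem_degI3 (M.cls_mem (h i).1)
      (M.mk_mem_degI2 (M.cls_mem (h i).2.1) (M.cls_mem (h i).2.2))
    rwa [show 1 + (M.N - 1 + 1) = M.N + 1 by have := M.two_le; omega] at h1
  · rw [← bound_incS, ← hw, map_sum, map_sum, map_sum, map_sum]
    exact Finset.sum_congr rfl fun i _ => T.τ2_b3_cls (h i).1 (h i).2.1 (h i).2.2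

end Setting

namespace HomogData

variable {F k V : Type*} [Field F] [Ring k] [Algebra F k]
  [AddCommGroup V] [FModule F V] [EnvModule F k V] [EnvTower F k V]
variable {h : HomogData F k V}

/-- The comparison data defined by graded sections. -/
def _root_.PBW.Setting.Sections.comparison (T : h.setting.Sections) : h.ComparisonMaps :=
  (BimodHom.of T.τ1E, BimodHom.of T.τ2E, BimodHom.of T.τ3E, BimodHom.of T.s1E, BimodHom.of T.s2E,
    BimodHom.of T.s3E)

theorem isComparison (T : h.setting.Sections) (hTor : h.TorThreeConcentrated) :
    h.IsComparison T.comparison := by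
  have hN : 2 ≤ h.setting.N := h.two_le
  have e : h.N = h.setting.N := rfl
  refine ⟨⟨?_, ?_, ?_, ?_, ?_, ?_⟩, ⟨T.b1_eq, fun x => T.τ1_b2 x, fun x => T.τ2_b3 hTor x⟩,
    ⟨T.b2_s1, fun x => T.b3_s2 x, fun x => T.b4_s3 hTor x⟩, ?_, ?_, ?_, ?_, ?_, ?_⟩
  · exact fun n x hx => h.setting.ext_mem_degFB (fun n w hw => T.τ1E_mem hw) hx
  · exact fun n x hx => h.setting.ext_mem_degFB (fun n w hw => T.τ2E_mem hw) hx
  · exact fun n x hx => h.setting.ext_mem_degFB (fun n w hw => T.τ3E_mem hw) hx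
  · exact fun n x hx => h.setting.ext_mem_degFB (fun n w hw => T.s1E_mem hw) hx
  · exact fun n x hx => h.setting.ext_mem_degFB (fun n w hw => T.s2E_mem hw) hx
  · exact fun n x hx => h.setting.ext_mem_degFB (fun n w hw => T.s3E_mem hw) hx
  · intro a ha x hx
    exact ⟨(ext_gen _ _).trans (T.values1 ha hx).1, (ext_gen _ _).trans (T.values1 ha hx).2⟩
  · intro a b ha hb hab x hx y hy
    exact ⟨(ext_gen _ _).trans ((T.τ2E_cls ha hb hab.le hx hy).trans
      (T.G_of_lt hab (TAlg.deg_mul hx hy))),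
      (ext_gen _ _).trans (T.s2E_cls hb (by omega) hab.le (h.setting.cls_mem hx) hy)⟩
  · rintro r n x y ⟨h1, h2⟩
    exact ⟨(ext_gen _ _).trans (T.τ2E_sum h1 h2), (ext_gen _ _).trans (T.s2E_sum h1)⟩
  · intro a b d ha hb hd habd x hx y hy z hz
    exact ⟨(ext_gen _ _).trans (T.τ3E_cls habd.le hx hy hz), (ext_gen _ _).trans
      (T.s3E_cls hd (by omega) (by omega) (by omega) (h.setting.cls_mem hx)
        (h.setting.cls_mem hy) hz)⟩
  · rintro r n x y z ⟨h1, h2⟩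
    refine ⟨(ext_gen _ _).trans ?_, (ext_gen _ _).trans (T.s3E_sum fun i => ?_)⟩
    · rw [map_sum]
      refine Finset.sum_eq_zero fun i _ => ?_
      obtain ⟨a, b, c, ha, hb, hc, habc, hx, hy, hz⟩ := h1 i
      exact T.τ3E_cls habc.le hx hy hz
    · obtain ⟨a, b, c, ha, hb, hc, habc, hx, hy, hz⟩ := h1 i
      exact ⟨a, b, c, hc, by omega, by omega, by omega, hx, hy, hz⟩
  · rintro w n x y z ⟨h1, h2⟩
    exact ⟨(ext_gen _ _).trans (T.τ3E_sum hTor h1 h2), (ext_gen _ _).trans (T.s3E_sum fun i =>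
      ⟨1, h.N - 1, 1, one_pos, by omega, by omega, by omega, h1 i⟩)⟩

end HomogData

/-! ### Products on polynomials given by sequences of bilinear maps -/

section PolynomialProduct

open Polynomial Finset

variable {F A : Type*} [Field F] [Ring A] [Algebra F A]

theorem exists_polynomial_coeff {f : ℕ → A} (hf : ∃ N, ∀ n ≥ N, f n = 0) :
    ∃ p : A[X], ∀ n, p.coeff n = f n := by
  obtain ⟨N, hN⟩ := hf
  refine ⟨∑ i ∈ range N, monomial i (f i), fun n => ?_⟩
  simp only [finsetSum_coeff, coeff_monomial, sum_ite_eq', mem_range]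
  split_ifs with h
  · rfl
  · exact (hN n (not_lt.1 h)).symm

/-- A sequence of bilinear maps, almost all of which vanish on given elements. -/
def IsLocallyFinite (β : ℕ → A →ₗ[F] A →ₗ[F] A) : Prop := ∀ a b, ∃ N, ∀ n ≥ N, β n a b = 0

variable {β : ℕ → A →ₗ[F] A →ₗ[F] A} (hβ : IsLocallyFinite β)

/-- The polynomial `∑ β_n(a, b) t^n`. -/
def seriesVal (a b : A) : A[X] := (exists_polynomial_coeff (hβ a b)).choose

theorem coeff_seriesVal (a b : A) (n : ℕ) : (seriesVal hβ a b).coeff n = β n a b :=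
  (exists_polynomial_coeff (hβ a b)).choose_spec n

/-- The bilinear map `(a, b) ↦ ∑ β_n(a, b) t^n`. -/
def series : A →ₗ[F] A →ₗ[F] A[X] :=
  LinearMap.mk₂ F (seriesVal hβ)
    (fun a a' b => by ext n; simp only [coeff_seriesVal, coeff_add, map_add, LinearMap.add_apply])
    (fun s a b => by ext n; simp only [coeff_seriesVal, coeff_smul, map_smul, LinearMap.smul_apply])
    (fun a b b' => by ext n; simp only [coeff_seriesVal, coeff_add, map_add])
    (fun s a b => by ext n; simp only [coeff_seriesVal, coeff_smul, map_smul])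

theorem coeff_series (a b : A) (n : ℕ) : (series hβ a b).coeff n = β n a b :=
  coeff_seriesVal hβ a b n

/-- The `F[t]`-bilinear product on `A[t]` with `a × b = ∑ β_n(a, b) t^n` on `A`. -/
def polyMul : A[X] →ₗ[F] A[X] →ₗ[F] A[X] :=
  lsum fun i => (LinearMap.mulLeft F (X ^ i)).compRight F ∘ₗ
    (lsum fun j => (LinearMap.mulLeft F (X ^ j)).compRight F ∘ₗ (series hβ).flip).flip

theorem polyMul_monomial (i j : ℕ) (a b : A) :
    polyMul hβ (monomial i a) (monomial j b) = X ^ i * (X ^ j * series hβ a b) := by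
  simp only [polyMul, lsum_apply]
  rw [sum_monomial_index _ _ (by simp)]
  simp only [LinearMap.comp_apply, LinearMap.compRight_apply, LinearMap.flip_apply, lsum_apply,
    LinearMap.mulLeft_apply]
  rw [sum_monomial_index _ _ (by simp)]
  simp

theorem polyMul_C_C (a b : A) : polyMul hβ (C a) (C b) = series hβ a b := by
  have := polyMul_monomial hβ 0 0 a b
  simpa using this

theorem polyMul_X_mul (x y : A[X]) : polyMul hβ (X * x) y = X * polyMul hβ x y := by
  induction x using Polynomial.induction_on' with
  | add x x' hx hx' => simp only [mul_add, map_add, LinearMap.add_apply, hx, hx']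
  | monomial i a =>
    induction y using Polynomial.induction_on' with
    | add y y' hy hy' => simp only [mul_add, map_add, hy, hy']
    | monomial j b =>
      rw [X_mul_monomial, polyMul_monomial, polyMul_monomial, pow_succ', mul_assoc]

theorem polyMul_mul_X (x y : A[X]) : polyMul hβ x (X * y) = X * polyMul hβ x y := by
  induction x using Polynomial.induction_on' with
  | add x x' hx hx' => simp only [mul_add, map_add, LinearMap.add_apply, hx, hx']
  | monomial i a =>
    induction y using Polynomial.induction_on' with
    | add y y' hy hy' => simp only [mul_add, map_add, hy, hy']
    | monomial j b =>
      rw [X_mul_monomial, polyMul_monomial, polyMul_monomial, pow_succ', mul_assoc X,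
        ← mul_assoc (X ^ i), ← mul_assoc X, ← pow_succ, pow_succ']

/-- An induction principle for polynomials. -/
theorem polynomial_induction {p : A[X] → Prop} (C : ∀ a, p (C a)) (X : ∀ x, p x → p (X * x))
    (add : ∀ x y, p x → p y → p (x + y)) (x : A[X]) : p x := by
  induction x using Polynomial.induction_on' with
  | add x y hx hy => exact add x y hx hy
  | monomial i a =>
    induction i with
    | zero => exact C a
    | succ i ih => rw [← X_mul_monomial]; exact X _ ih

theorem coeff_polyMul_C_left (a : A) (y : A[X]) (n : ℕ) : (polyMul hβ (C a) y).coeff n =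
    ∑ ij ∈ antidiagonal n, β ij.1 a (y.coeff ij.2) := by
  induction y using polynomial_induction generalizing n with
  | C b =>
    rw [polyMul_C_C, coeff_series, sum_eq_single (n, 0)]
    · simp
    · rintro ⟨i, j⟩ hij h
      rw [coeff_C, if_neg, map_zero]
      rintro rfl
      exact h (by simpa using hij)
    · simp
  | X y ih =>
    rw [polyMul_mul_X]
    cases n with
    | zero => simp
    | succ n => rw [coeff_X_mul, ih, Nat.antidiagonal_succ']; simp
  | add x y hx hy => simp only [map_add, coeff_add, hx, hy, sum_add_distrib]

theorem coeff_polyMul_C_right (x : A[X]) (b : A) (n : ℕ) : (polyMul hβ x (C b)).coeff n =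
    ∑ ij ∈ antidiagonal n, β ij.1 (x.coeff ij.2) b := by
  induction x using polynomial_induction generalizing n with
  | C a =>
    rw [polyMul_C_C, coeff_series, sum_eq_single (n, 0)]
    · simp
    · rintro ⟨i, j⟩ hij h
      rw [coeff_C, if_neg, map_zero, LinearMap.zero_apply]
      rintro rfl
      exact h (by simpa using hij)
    · simp
  | X y ih =>
    rw [polyMul_X_mul]
    cases n with
    | zero => simp
    | succ n => rw [coeff_X_mul, ih, Nat.antidiagonal_succ']; simp
  | add x y hx hy =>
    simp only [map_add, coeff_add, hx, hy, sum_add_distrib, LinearMap.add_apply]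

/-- The associator of the product given by `β`. -/
def polyAssoc (x y z : A[X]) : A[X] :=
  polyMul hβ x (polyMul hβ y z) - polyMul hβ (polyMul hβ x y) z

/-- The components of the associator. -/
def assocCoeff (β : ℕ → A →ₗ[F] A →ₗ[F] A) (n : ℕ) (a b c : A) : A :=
  ∑ ij ∈ antidiagonal n, (β ij.1 a (β ij.2 b c) - β ij.1 (β ij.2 a b) c)

theorem coeff_polyAssoc_C (a b c : A) (n : ℕ) :
    (polyAssoc hβ (C a) (C b) (C c)).coeff n = assocCoeff β n a b c := by
  rw [polyAssoc, coeff_sub, polyMul_C_C, polyMul_C_C, coeff_polyMul_C_left, coeff_polyMul_C_right,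
    assocCoeff, sum_sub_distrib]
  simp only [coeff_series]

/-- Holds for every bilinear product: the ten fourfold products occur in pairs of opposite sign. -/
theorem polyAssoc_pentagon (w x y z : A[X]) :
    polyMul hβ w (polyAssoc hβ x y z) - polyAssoc hβ (polyMul hβ w x) y z +
      polyAssoc hβ w (polyMul hβ x y) z - polyAssoc hβ w x (polyMul hβ y z) +
      polyMul hβ (polyAssoc hβ w x y) z = 0 := by
  simp only [polyAssoc, map_sub, LinearMap.sub_apply]
  abel

/-- The associator is linear over F[t] in each argument, so its low coefficients are governed by
constant arguments. -/
theorem coeff_polyAssoc_of_lt {n : ℕ} (h : ∀ m < n, ∀ a b c, assocCoeff β m a b c = 0)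
    (x y z : A[X]) {m : ℕ} (hm : m < n) : (polyAssoc hβ x y z).coeff m = 0 := by
  induction x using polynomial_induction generalizing m with
  | C a =>
    induction y using polynomial_induction generalizing m with
    | C b =>
      induction z using polynomial_induction generalizing m with
      | C c => rw [coeff_polyAssoc_C, h m hm]
      | X z ih =>
        have : polyAssoc hβ (C a) (C b) (X * z) = X * polyAssoc hβ (C a) (C b) z := by
          simp only [polyAssoc, polyMul_mul_X, mul_sub]
        rw [this]
        cases m with
        | zero => simp
        | succ m => rw [coeff_X_mul, ih (by omega)]
      | add z z' hz hz' =>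
        have : polyAssoc hβ (C a) (C b) (z + z') =
            polyAssoc hβ (C a) (C b) z + polyAssoc hβ (C a) (C b) z' := by
          simp only [polyAssoc, map_add]; abel
        rw [this, coeff_add, hz hm, hz' hm, add_zero]
    | X y ih =>
      have : polyAssoc hβ (C a) (X * y) z = X * polyAssoc hβ (C a) y z := by
        simp only [polyAssoc, polyMul_mul_X, polyMul_X_mul, mul_sub]
      rw [this]
      cases m with
      | zero => simp
      | succ m => rw [coeff_X_mul, ih (by omega)]
    | add y y' hy hy' =>
      have : polyAssoc hβ (C a) (y + y') z =
          polyAssoc hβ (C a) y z + polyAssoc hβ (C a) y' z := by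
        simp only [polyAssoc, map_add, LinearMap.add_apply]; abel
      rw [this, coeff_add, hy hm, hy' hm, add_zero]
  | X x ih =>
    have : polyAssoc hβ (X * x) y z = X * polyAssoc hβ x y z := by
      simp only [polyAssoc, polyMul_X_mul, mul_sub]
    rw [this]
    cases m with
    | zero => simp
    | succ m => rw [coeff_X_mul, ih (by omega)]
  | add x x' hx hx' =>
    have : polyAssoc hβ (x + x') y z = polyAssoc hβ x y z + polyAssoc hβ x' y z := by
      simp only [polyAssoc, map_add, LinearMap.add_apply]; abel
    rw [this, coeff_add, hx hm, hx' hm, add_zero]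

theorem polyMul_assoc (h : ∀ n a b c, assocCoeff β n a b c = 0) (x y z : A[X]) :
    polyMul hβ (polyMul hβ x y) z = polyMul hβ x (polyMul hβ y z) := by
  refine (sub_eq_zero.1 ?_ : polyMul hβ x (polyMul hβ y z) = polyMul hβ (polyMul hβ x y) z).symm
  ext m
  exact coeff_polyAssoc_of_lt hβ (n := m + 1) (fun m _ => h m) x y z (Nat.lt_succ_self m)

theorem eq_C_add_X_mul (x : A[X]) : ∃ y, x = C (x.coeff 0) + X * y :=
  ⟨x.divX, by rw [X_mul, add_comm, divX_mul_X_add]⟩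

/-- The first nontrivial component of the associator is a cocycle. -/
theorem assocCoeff_cocycle (hβ : IsLocallyFinite β) {n : ℕ}
    (h : ∀ m < n, ∀ a b c, assocCoeff β m a b c = 0) (a b c d : A) :
    β 0 a (assocCoeff β n b c d) - assocCoeff β n (β 0 a b) c d + assocCoeff β n a (β 0 b c) d -
      assocCoeff β n a b (β 0 c d) + β 0 (assocCoeff β n a b c) d = 0 := by
  have h1 := congrArg (fun x => x.coeff n) (polyAssoc_pentagon hβ (C a) (C b) (C c) (C d))
  -- A factor t moves the coefficient of t^n to one of lower order, where the associator vanishes.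
  -- Therefore only the undeformed part of each inner product contributes.
  have hX : ∀ x y z : A[X], (X * polyAssoc hβ x y z).coeff n = 0 := by
    intro x y z
    cases n with
    | zero => simp
    | succ m => rw [coeff_X_mul, coeff_polyAssoc_of_lt hβ h x y z (Nat.lt_succ_self m)]
  have hs : ∀ a b : A, (series hβ a b).coeff 0 = β 0 a b := fun a b => coeff_series hβ a b 0
  have e1 : (polyMul hβ (C a) (polyAssoc hβ (C b) (C c) (C d))).coeff n =
      β 0 a (assocCoeff β n b c d) := by
    rw [coeff_polyMul_C_left, sum_eq_single (0, n), coeff_polyAssoc_C]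
    · rintro ⟨i, j⟩ hij hne
      have hij' : i + j = n := by simpa using hij
      rw [coeff_polyAssoc_of_lt hβ h _ _ _ (?_ : j < n), map_zero]
      by_contra hj
      exact hne (by rw [Prod.mk.injEq]; omega)
    · simp
  have e5 : (polyMul hβ (polyAssoc hβ (C a) (C b) (C c)) (C d)).coeff n =
      β 0 (assocCoeff β n a b c) d := by
    rw [coeff_polyMul_C_right, sum_eq_single (0, n), coeff_polyAssoc_C]
    · rintro ⟨i, j⟩ hij hne
      have hij' : i + j = n := by simpa using hij
      rw [coeff_polyAssoc_of_lt hβ h _ _ _ (?_ : j < n), map_zero, LinearMap.zero_apply]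
      by_contra hj
      exact hne (by rw [Prod.mk.injEq]; omega)
    · simp
  have e2 : (polyAssoc hβ (series hβ a b) (C c) (C d)).coeff n =
      assocCoeff β n (β 0 a b) c d := by
    obtain ⟨y, hy⟩ := eq_C_add_X_mul (series hβ a b)
    rw [hs] at hy
    have : polyAssoc hβ (C (β 0 a b) + X * y) (C c) (C d) =
        polyAssoc hβ (C (β 0 a b)) (C c) (C d) + X * polyAssoc hβ y (C c) (C d) := by
      simp only [polyAssoc, map_add, LinearMap.add_apply, polyMul_X_mul, mul_sub]; abel
    rw [hy, this, coeff_add, hX, add_zero, coeff_polyAssoc_C]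
  have e3 : (polyAssoc hβ (C a) (series hβ b c) (C d)).coeff n =
      assocCoeff β n a (β 0 b c) d := by
    obtain ⟨y, hy⟩ := eq_C_add_X_mul (series hβ b c)
    rw [hs] at hy
    have : polyAssoc hβ (C a) (C (β 0 b c) + X * y) (C d) =
        polyAssoc hβ (C a) (C (β 0 b c)) (C d) + X * polyAssoc hβ (C a) y (C d) := by
      simp only [polyAssoc, map_add, LinearMap.add_apply, polyMul_X_mul, polyMul_mul_X, mul_sub]
      abel
    rw [hy, this, coeff_add, hX, add_zero, coeff_polyAssoc_C]
  have e4 : (polyAssoc hβ (C a) (C b) (series hβ c d)).coeff n =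
      assocCoeff β n a b (β 0 c d) := by
    obtain ⟨y, hy⟩ := eq_C_add_X_mul (series hβ c d)
    rw [hs] at hy
    have : polyAssoc hβ (C a) (C b) (C (β 0 c d) + X * y) =
        polyAssoc hβ (C a) (C b) (C (β 0 c d)) + X * polyAssoc hβ (C a) (C b) y := by
      simp only [polyAssoc, map_add, polyMul_mul_X, mul_sub]; abel
    rw [hy, this, coeff_add, hX, add_zero, coeff_polyAssoc_C]
  rw [polyMul_C_C, polyMul_C_C, polyMul_C_C] at h1
  simp only [coeff_add, coeff_sub, e1, e2, e3, e4, e5, coeff_zero] at h1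
  exact h1

theorem polyMul_C_mul {u : A} (h : ∀ n a b, β n (u * a) b = u * β n a b) (x y : A[X]) :
    polyMul hβ (C u * x) y = C u * polyMul hβ x y := by
  induction x using polynomial_induction with
  | C a =>
    ext n
    rw [← C_mul, coeff_polyMul_C_left, coeff_C_mul, coeff_polyMul_C_left, mul_sum]
    simp only [h]
  | X x ih => rw [← mul_assoc, ← X_mul, mul_assoc, polyMul_X_mul, ih, polyMul_X_mul, ← mul_assoc,
      ← mul_assoc, X_mul]
  | add x x' hx hx' => simp only [mul_add, map_add, LinearMap.add_apply, hx, hx']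

theorem polyMul_mul_C {u : A} (h : ∀ n a b, β n a (b * u) = β n a b * u) (x y : A[X]) :
    polyMul hβ x (y * C u) = polyMul hβ x y * C u := by
  induction y using polynomial_induction with
  | C a =>
    ext n
    rw [← C_mul, coeff_polyMul_C_right, coeff_mul_C, coeff_polyMul_C_right, sum_mul]
    simp only [h]
  | X y ih => rw [mul_assoc, polyMul_mul_X, ih, polyMul_mul_X, mul_assoc]
  | add y y' hy hy' => simp only [add_mul, map_add, hy, hy']

theorem polyMul_bal {u : A} (h : ∀ n a b, β n (a * u) b = β n a (u * b)) (x y : A[X]) :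
    polyMul hβ (x * C u) y = polyMul hβ x (C u * y) := by
  induction x using polynomial_induction with
  | C a =>
    ext n
    rw [← C_mul, coeff_polyMul_C_left, coeff_polyMul_C_left]
    simp only [h, coeff_C_mul]
  | X x ih => rw [mul_assoc, polyMul_X_mul, ih, polyMul_X_mul]
  | add x x' hx hx' => simp only [add_mul, map_add, LinearMap.add_apply, hx, hx']

theorem polyMul_C_left {u : A} (h0 : ∀ b, β 0 u b = u * b) (h : ∀ n b, β (n + 1) u b = 0)
    (y : A[X]) : polyMul hβ (C u) y = C u * y := by
  ext n
  rw [coeff_polyMul_C_left, coeff_C_mul, sum_eq_single (0, n), h0]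
  · rintro ⟨i, j⟩ hij hne
    rcases i with _ | i
    · have hj : j = n := by simpa using hij
      exact absurd (by rw [hj]) hne
    · exact h i _
  · simp

theorem polyMul_C_right {u : A} (h0 : ∀ a, β 0 a u = a * u) (h : ∀ n a, β (n + 1) a u = 0)
    (x : A[X]) : polyMul hβ x (C u) = x * C u := by
  ext n
  rw [coeff_polyMul_C_right, coeff_mul_C, sum_eq_single (0, n), h0]
  · rintro ⟨i, j⟩ hij hne
    rcases i with _ | i
    · have hj : j = n := by simpa using hij
      exact absurd (by rw [hj]) hne
    · exact h i _
  · simp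

end PolynomialProduct

/-! ### The product given by a sequence of maps `A/k ⊗ A/k → A` -/

namespace Setting

open Polynomial

variable {F : Type u₁} {k : Type u₂} {V : Type u₃} [Field F] [Ring k] [Algebra F k]
  [AddCommGroup V] [FModule F V] [EnvModule F k V] [EnvTower F k V]
variable (M : Setting.{u₁, u₂, u₃, u₄} F k V)

/-- The component of degree `m - n` of `A`, which is zero if `m < n`. -/
def degSub (n m : ℕ) : Submodule F M.A := if n ≤ m then M.deg (m - n) else ⊥

variable {M}

theorem mem_degSub {n m l : ℕ} (h : l + n = m) {a : M.A} : a ∈ M.degSub n m ↔ a ∈ M.deg l := by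
  rw [degSub, if_pos (by omega), show m - n = l by omega]

theorem eq_zero_of_mem_degSub {n m : ℕ} (h : m < n) {a : M.A} (ha : a ∈ M.degSub n m) : a = 0 := by
  rwa [degSub, if_neg (by omega), Submodule.mem_bot] at ha

theorem mul_mem_degSub {n m l : ℕ} {a b : M.A} (ha : a ∈ M.deg l) (hb : b ∈ M.degSub n m) :
    a * b ∈ M.degSub n (l + m) := by
  by_cases h : n ≤ m
  · rw [mem_degSub (l := m - n) (by omega)] at hb
    rw [mem_degSub (l := l + (m - n)) (by omega)]
    exact M.deg_mul ha hb
  · rw [eq_zero_of_mem_degSub (by omega) hb, mul_zero]; exact zero_mem _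

theorem mem_degSub_mul {n m l : ℕ} {a b : M.A} (ha : a ∈ M.degSub n m) (hb : b ∈ M.deg l) :
    a * b ∈ M.degSub n (m + l) := by
  by_cases h : n ≤ m
  · rw [mem_degSub (l := m - n) (by omega)] at ha
    rw [mem_degSub (l := m - n + l) (by omega)]
    exact M.deg_mul ha hb
  · rw [eq_zero_of_mem_degSub (by omega) ha, zero_mul]; exact zero_mem _

theorem ext_mem_degSub {W : Type*} [AddCommGroup W] [FModule F W] [EnvModule F k W]
    [EnvTower F k W] {GW : ℕ → Submodule F W} {f : W →ₗ[Env F k] M.A} {n : ℕ}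
    (hf : ∀ m, ∀ w ∈ GW m, f w ∈ M.degSub n m) {m : ℕ} {x : FB F k M.A W}
    (hx : x ∈ M.degFB GW m) : ext f x ∈ M.degSub n m := by
  refine M.degFB_induction (p := fun x => ext f x ∈ M.degSub n m) ?_ ?_ ?_ hx
  · rw [map_zero]; exact zero_mem _
  · rintro i j l rfl a ha w hw b hb
    rw [FB.mk_eq, ext_smul, ext_op_smul, ext_gen, smul_eq_mul, op_smul_eq_mul, add_assoc]
    exact mul_mem_degSub ha (mem_degSub_mul (hf j w hw) hb)
  · intro x y hx hy
    rw [map_add]; exact add_mem hx hy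

theorem ext_eq_zero {W : Type*} [AddCommGroup W] [FModule F W] [EnvModule F k W]
    [EnvTower F k W] {GW : ℕ → Submodule F W} {f : W →ₗ[Env F k] M.A} {m : ℕ}
    (hf : ∀ i ≤ m, ∀ w ∈ GW i, f w = 0) {x : FB F k M.A W} (hx : x ∈ M.degFB GW m) :
    ext f x = 0 := by
  refine M.degFB_induction (p := fun x => ext f x = 0) (map_zero _) ?_ ?_ hx
  · intro i j l e a ha w hw b hb
    rw [FB.mk_eq, ext_smul, ext_op_smul, ext_gen, hf j (by omega) w hw, smul_zero, smul_zero]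
  · intro x y hx hy
    rw [map_add, hx, hy, add_zero]

/-- A sequence of maps `ψ_n` of degree `-n`. -/
def Lowers (ψ : ℕ → M.I2 →ₗ[Env F k] M.A) : Prop :=
  ∀ n, 1 ≤ n → ∀ m, ∀ t ∈ M.degI2 m, ψ n t ∈ M.degSub n m

variable (ψ : ℕ → M.I2 →ₗ[Env F k] M.A)

/-- The product of `A`, followed by the maps `(a, b) ↦ ψ_n(a ⊗ b)`. -/
def coefMul : ℕ → M.A →ₗ[F] M.A →ₗ[F] M.A
  | 0 => LinearMap.mul F M.A
  | n + 1 => LinearMap.mk₂ F (fun a b => ψ (n + 1) (BT.mk F k (M.p a) (M.p b)))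
      (fun a a' b => by rw [map_add, BT.mk_add_left, map_add])
      (fun s a b => by rw [env_map_smul, BT.mk_smul_left, env_map_smul])
      (fun a b b' => by rw [map_add, BT.mk_add_right, map_add])
      (fun s a b => by rw [env_map_smul, BT.mk_smul_right, env_map_smul])

theorem coefMul_zero (a b : M.A) : coefMul ψ 0 a b = a * b := rfl

theorem coefMul_succ (n : ℕ) (a b : M.A) :
    coefMul ψ (n + 1) a b = ψ (n + 1) (BT.mk F k (M.p a) (M.p b)) := rfl

variable {ψ}

theorem coefMul_mem (hψ : Lowers ψ) (n : ℕ) {i j : ℕ} {a b : M.A} (ha : a ∈ M.deg i)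
    (hb : b ∈ M.deg j) : coefMul ψ n a b ∈ M.degSub n (i + j) := by
  cases n with
  | zero => exact (mem_degSub (by omega)).2 (M.deg_mul ha hb)
  | succ n => exact hψ _ (by omega) _ _ (M.mk_mem_degI2 (M.p_mem_degI ha) (M.p_mem_degI hb))

theorem coefMul_finite (hψ : Lowers ψ) : IsLocallyFinite (coefMul ψ) := by
  intro a b
  induction a using M.gradingA.induction with
  | zero => exact ⟨0, fun n _ => by rw [map_zero, LinearMap.zero_apply]⟩
  | hom i a ha =>
    induction b using M.gradingA.induction with
    | zero => exact ⟨0, fun n _ => by rw [map_zero]⟩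
    | hom j b hb =>
      exact ⟨i + j + 1, fun n hn => eq_zero_of_mem_degSub (by omega) (coefMul_mem hψ n ha hb)⟩
    | add x y hx hy =>
      obtain ⟨m, hm⟩ := hx
      obtain ⟨m', hm'⟩ := hy
      exact ⟨max m m', fun n hn => by rw [map_add, hm n (le_of_max_le_left hn),
        hm' n (le_of_max_le_right hn), add_zero]⟩
  | add x y hx hy =>
    obtain ⟨m, hm⟩ := hx
    obtain ⟨m', hm'⟩ := hy
    exact ⟨max m m', fun n hn => by rw [map_add, LinearMap.add_apply, hm n (le_of_max_le_left hn),
      hm' n (le_of_max_le_right hn), add_zero]⟩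

theorem coefMul_unit_mul (n : ℕ) (c : k) (a b : M.A) :
    coefMul ψ n (KAlg.unit F M.A c * a) b = KAlg.unit F M.A c * coefMul ψ n a b := by
  cases n with
  | zero => exact mul_assoc _ _ _
  | succ n =>
    rw [coefMul_succ, coefMul_succ, ← KAlg.lsm_eq, ← KAlg.lsm_eq, map_lsm, ← BT.lsm_mk, map_lsm]

theorem coefMul_mul_unit (n : ℕ) (c : k) (a b : M.A) :
    coefMul ψ n a (b * KAlg.unit F M.A c) = coefMul ψ n a b * KAlg.unit F M.A c := by
  cases n with
  | zero => exact (mul_assoc _ _ _).symm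
  | succ n =>
    rw [coefMul_succ, coefMul_succ, ← KAlg.rsm_eq, ← KAlg.rsm_eq, map_rsm, ← BT.rsm_mk, map_rsm]

theorem coefMul_bal (n : ℕ) (c : k) (a b : M.A) :
    coefMul ψ n (a * KAlg.unit F M.A c) b = coefMul ψ n a (KAlg.unit F M.A c * b) := by
  cases n with
  | zero => exact mul_assoc _ _ _
  | succ n =>
    rw [coefMul_succ, coefMul_succ, ← KAlg.rsm_eq, ← KAlg.lsm_eq, map_rsm, map_lsm, BT.mk_bal]

theorem coefMul_succ_unit_left (n : ℕ) (c : k) (b : M.A) :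
    coefMul ψ (n + 1) (KAlg.unit F M.A c) b = 0 := by
  rw [coefMul_succ, M.p_unit, BT.mk_zero_left, map_zero]

theorem coefMul_succ_unit_right (n : ℕ) (c : k) (a : M.A) :
    coefMul ψ (n + 1) a (KAlg.unit F M.A c) = 0 := by
  rw [coefMul_succ, M.p_unit, BT.mk_zero_right, map_zero]

variable (ψ) in
/-- The map `a ⊗ b ⊗ c ↦ ∑_{i=1}^n ψ_i(a, ψ_{n+1-i}(b, c)) - ψ_i(ψ_{n+1-i}(a, b), c)`. -/
def sq (n : ℕ) : M.I3 →ₗ[Env F k] M.A :=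
  ∑ i ∈ Finset.Icc 1 n,
    (ψ i ∘ₗ BT.map LinearMap.id (M.p ∘ₗ ψ (n + 1 - i)) -
      ψ i ∘ₗ BT.map (M.p ∘ₗ ψ (n + 1 - i)) LinearMap.id ∘ₗ BT.assoc)

variable (ψ) in
/-- The components of the associator, as maps on `I_+ ⊗ I_+ ⊗ I_+`. -/
def assocE (n : ℕ) : M.I3 →ₗ[Env F k] M.A :=
  extE (ψ (n + 1)) ∘ₗ M.b3_hom.toEnv ∘ₗ gen + sq ψ n

theorem assocE_apply (n : ℕ) (t : M.I3) :
    assocE ψ n t = ext (ψ (n + 1)) (M.b3 (gen t)) + sq ψ n t := rfl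

theorem sq_mk (n : ℕ) (u v w : M.I) : sq ψ n (BT.mk F k u (BT.mk F k v w)) =
    ∑ i ∈ Finset.Icc 1 n, (ψ i (BT.mk F k u (M.p (ψ (n + 1 - i) (BT.mk F k v w)))) -
      ψ i (BT.mk F k (M.p (ψ (n + 1 - i) (BT.mk F k u v))) w)) := by
  rw [sq, LinearMap.sum_apply]
  refine Finset.sum_congr rfl fun i _ => ?_
  rw [LinearMap.sub_apply, LinearMap.comp_apply, LinearMap.comp_apply, LinearMap.comp_apply,
    BT.assoc_mk, BT.map_mk, BT.map_mk]
  rfl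

theorem b3_gen_mk_mk (u v w : M.I) : M.b3 (gen (BT.mk F k u (BT.mk F k v w))) =
    M.j u • gen (BT.mk F k v w) - gen (BT.mk F k (M.μ (BT.mk F k u v)) w) +
      gen (BT.mk F k u (M.μ (BT.mk F k v w))) - op (M.j w) • gen (BT.mk F k u v) := by
  rw [gen_apply, b3_mk, one_mul, mul_one, smul_gen, op_smul_gen, gen_apply, gen_apply]

theorem b4_gen_mk_mk (u v w x : M.I) :
    M.b4 (gen (BT.mk F k u (BT.mk F k v (BT.mk F k w x)))) =
      M.j u • gen (BT.mk F k v (BT.mk F k w x)) -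
      gen (BT.mk F k (M.μ (BT.mk F k u v)) (BT.mk F k w x)) +
      gen (BT.mk F k u (BT.mk F k (M.μ (BT.mk F k v w)) x)) -
      gen (BT.mk F k u (BT.mk F k v (M.μ (BT.mk F k w x)))) +
      op (M.j x) • gen (BT.mk F k u (BT.mk F k v w)) := by
  rw [gen_apply, b4_mk, one_mul, mul_one, smul_gen, op_smul_gen, gen_apply, gen_apply, gen_apply]

/-- The terms in which one of the two indices is 0 involve the undeformed product and assemble to
ψ_{n+1}^~ ∘ b₃. The remaining ones are sq(ψ_1, …, ψ_n). -/
theorem assocCoeff_j (n : ℕ) (u v w : M.I) :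
    assocCoeff (coefMul ψ) (n + 1) (M.j u) (M.j v) (M.j w) =
      assocE ψ n (BT.mk F k u (BT.mk F k v w)) := by
  have hμ : ∀ a b, M.p (M.j a * M.j b) = M.μ (BT.mk F k a b) := fun a b => by
    rw [← M.j_μ, M.p_j]
  have h1 : ∀ i ∈ Finset.range n, coefMul ψ (i + 1) (M.j u) (coefMul ψ (n - i) (M.j v) (M.j w)) -
      coefMul ψ (i + 1) (coefMul ψ (n - i) (M.j u) (M.j v)) (M.j w) =
      ψ (i + 1) (BT.mk F k u (M.p (ψ (n - i) (BT.mk F k v w)))) -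
      ψ (i + 1) (BT.mk F k (M.p (ψ (n - i) (BT.mk F k u v))) w) := by
    intro i hi
    have hi' := Finset.mem_range.1 hi
    obtain ⟨l, hl⟩ : ∃ l, n - i = l + 1 := ⟨n - i - 1, by omega⟩
    rw [hl, coefMul_succ, coefMul_succ, coefMul_succ, coefMul_succ, M.p_j, M.p_j, M.p_j]
  rw [assocE_apply, sq_mk, assocCoeff, Finset.Nat.sum_antidiagonal_eq_sum_range_succ_mk,
    Finset.sum_range_succ, Finset.sum_range_succ']
  simp only [Nat.add_sub_add_right, Nat.sub_zero, Nat.sub_self]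
  rw [Finset.sum_congr rfl h1, ← Finset.Ico_succ_right_eq_Icc, Finset.sum_Ico_eq_sum_range,
    b3_gen_mk_mk, map_sub, map_add, map_sub, ext_smul, ext_op_smul, ext_gen, ext_gen, ext_gen,
    ext_gen, smul_eq_mul, op_smul_eq_mul, coefMul_zero, coefMul_zero, coefMul_zero, coefMul_zero,
    coefMul_succ, coefMul_succ, coefMul_succ, coefMul_succ, hμ, hμ, M.p_j, M.p_j, M.p_j]
  have h2 : ∀ i, 1 + i = i + 1 := fun i => add_comm _ _
  simp only [Order.succ_eq_add_one, Nat.add_sub_cancel, h2, Nat.add_sub_add_right]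
  abel

/-- Multiplication by scalars of k is undeformed, so the three vanishing statements are the left
linearity, balancedness and right linearity of the product over k. Consequently the associator only
depends on classes in A/k. -/
theorem assocCoeff_unit (hψ : Lowers ψ) (n : ℕ) (c : k) (a b : M.A) :
    assocCoeff (coefMul ψ) n (KAlg.unit F M.A c) a b = 0 ∧
    assocCoeff (coefMul ψ) n a (KAlg.unit F M.A c) b = 0 ∧
    assocCoeff (coefMul ψ) n a b (KAlg.unit F M.A c) = 0 := by
  have hl := polyMul_C_left (coefMul_finite hψ) (coefMul_zero ψ (KAlg.unit F M.A c))
    (fun n => coefMul_succ_unit_left n c)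
  have hr := polyMul_C_right (coefMul_finite hψ) (fun a => coefMul_zero ψ a (KAlg.unit F M.A c))
    (fun n => coefMul_succ_unit_right n c)
  rw [← coeff_polyAssoc_C (coefMul_finite hψ), ← coeff_polyAssoc_C (coefMul_finite hψ),
    ← coeff_polyAssoc_C (coefMul_finite hψ), polyAssoc, polyAssoc, polyAssoc, hl, hl, hl, hr, hr,
    hr, polyMul_C_mul _ fun n => coefMul_unit_mul n c,
    polyMul_mul_C _ fun n => coefMul_mul_unit n c,
    polyMul_bal _ fun n => coefMul_bal n c, sub_self, sub_self, sub_self]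
  exact ⟨rfl, rfl, rfl⟩

theorem assocCoeff_eq (hψ : Lowers ψ) (n : ℕ) (a b c : M.A) :
    assocCoeff (coefMul ψ) n a b c =
      assocCoeff (coefMul ψ) n (M.j (M.p a)) (M.j (M.p b)) (M.j (M.p c)) := by
  have ha : ∀ a a' b c, assocCoeff (coefMul ψ) n (a - a') b c =
      assocCoeff (coefMul ψ) n a b c - assocCoeff (coefMul ψ) n a' b c := by
    intro a a' b c
    simp only [assocCoeff, map_sub, LinearMap.sub_apply, ← Finset.sum_sub_distrib]
    exact Finset.sum_congr rfl fun _ _ => by abel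
  have hb : ∀ a b b' c, assocCoeff (coefMul ψ) n a (b - b') c =
      assocCoeff (coefMul ψ) n a b c - assocCoeff (coefMul ψ) n a b' c := by
    intro a b b' c
    simp only [assocCoeff, map_sub, LinearMap.sub_apply, ← Finset.sum_sub_distrib]
    exact Finset.sum_congr rfl fun _ _ => by abel
  have hc : ∀ a b c c', assocCoeff (coefMul ψ) n a b (c - c') =
      assocCoeff (coefMul ψ) n a b c - assocCoeff (coefMul ψ) n a b c' := by
    intro a b c c'
    simp only [assocCoeff, map_sub, ← Finset.sum_sub_distrib]
    exact Finset.sum_congr rfl fun _ _ => by abel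
  rw [M.j_p, M.j_p, M.j_p, ha, (assocCoeff_unit hψ n _ _ _).1, sub_zero, hb,
    (assocCoeff_unit hψ n _ _ _).2.1, sub_zero, hc, (assocCoeff_unit hψ n _ _ _).2.2, sub_zero]

theorem assocCoeff_zero (a b c : M.A) : assocCoeff (coefMul ψ) 0 a b c = 0 := by
  rw [assocCoeff, Finset.Nat.antidiagonal_zero, Finset.sum_singleton, coefMul_zero, coefMul_zero,
    coefMul_zero, coefMul_zero, mul_assoc, sub_self]

theorem assocCoeff_succ (hψ : Lowers ψ) {n : ℕ} (h : assocE ψ n = 0) (a b c : M.A) :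
    assocCoeff (coefMul ψ) (n + 1) a b c = 0 := by
  rw [assocCoeff_eq hψ, assocCoeff_j, h, LinearMap.zero_apply]

/-- If the associator vanishes up to order `n`, then the next obstruction is a cocycle. -/
theorem ext_assocE_b4 (hψ : Lowers ψ) {n : ℕ} (h : ∀ m < n, assocE ψ m = 0)
    (x : FB F k M.A M.I4) : ext (assocE ψ n) (M.b4 x) = 0 := by
  have h0 : ∀ m < n + 1, ∀ a b c, assocCoeff (coefMul ψ) m a b c = 0 := by
    intro m hm
    cases m with
    | zero => exact assocCoeff_zero
    | succ m => exact assocCoeff_succ hψ (h m (by omega))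
  induction x using FB.induction with
  | zero => rw [map_zero, map_zero]
  | add x y hx hy => rw [map_add, map_add, hx, hy, add_zero]
  | mk a t b =>
    rw [FB.mk_eq, M.b4_hom.smul, M.b4_hom.op_smul, ext_smul, ext_op_smul]
    suffices ext (assocE ψ n) (M.b4 (gen t)) = 0 by rw [this, smul_zero, smul_zero]
    induction t using BT.induction with
    | zero => rw [map_zero, map_zero, map_zero]
    | add x y hx hy => rw [map_add, map_add, map_add, hx, hy, add_zero]
    | tmul u t =>
      induction t using BT.induction with
      | zero => rw [BT.mk_zero_right, map_zero, map_zero, map_zero]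
      | add x y hx hy => rw [BT.mk_add_right, map_add, map_add, map_add, hx, hy, add_zero]
      | tmul v t =>
        induction t using BT.induction with
        | zero => rw [BT.mk_zero_right, BT.mk_zero_right, map_zero, map_zero, map_zero]
        | add x y hx hy =>
          rw [BT.mk_add_right, BT.mk_add_right, map_add, map_add, map_add, hx, hy, add_zero]
        | tmul w x =>
          have h1 := assocCoeff_cocycle (coefMul_finite hψ) h0 (M.j u) (M.j v) (M.j w) (M.j x)
          rw [coefMul_zero, coefMul_zero, coefMul_zero, coefMul_zero, coefMul_zero, ← M.j_μ,
            ← M.j_μ, ← M.j_μ, assocCoeff_j, assocCoeff_j, assocCoeff_j, assocCoeff_j,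
            assocCoeff_j] at h1
          rw [b4_gen_mk_mk, map_add, map_sub, map_add, map_sub, ext_smul, ext_op_smul, ext_gen,
            ext_gen, ext_gen, ext_gen, ext_gen, smul_eq_mul, op_smul_eq_mul, h1]

end Setting

/-! ### The deformation given by comparison data -/

/-- Each iterate changes one value of a whole sequence. Since earlier values never change again, the
diagonal satisfies the recursion. -/
theorem exists_recursive {X : Type*} (x₀ : X) {step : ℕ → (ℕ → X) → X}
    (hstep : ∀ n f g, (∀ i, 1 ≤ i → i ≤ n → f i = g i) → step n f = step n g) :
    ∃ ψ : ℕ → X, ∀ n, ψ (n + 1) = step n ψ := by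
  let iter : ℕ → ℕ → X := fun n =>
    Nat.rec (fun _ => x₀) (fun n f => Function.update f (n + 1) (step n f)) n
  have h1 : ∀ n, iter (n + 1) = Function.update (iter n) (n + 1) (step n (iter n)) := fun n => rfl
  have h2 : ∀ m i, i ≤ m → iter m i = iter i i := by
    intro m
    induction m with
    | zero => intro i hi; rw [Nat.le_zero.1 hi]
    | succ m ih =>
      intro i hi
      rcases hi.lt_or_eq with hi | rfl
      · rw [h1, Function.update_of_ne hi.ne, ih i (by omega)]
      · rfl
  refine ⟨fun n => iter n n, fun n => ?_⟩
  change iter (n + 1) (n + 1) = _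
  rw [h1, Function.update_self]
  exact hstep n _ _ fun i _ hi => h2 n i hi

theorem BT.deg_bt_induction {F k M N L : Type*} [Field F] [Ring k] [Algebra F k]
    [AddCommGroup M] [FModule F M] [EnvModule F k M] [EnvTower F k M]
    [AddCommGroup N] [FModule F N] [EnvModule F k N] [EnvTower F k N]
    [AddCommGroup L] [FModule F L] [EnvModule F k L] [EnvTower F k L]
    {GM : ℕ → Submodule F M} {GN : ℕ → Submodule F N} {GQ : ℕ → Submodule F L} {n : ℕ}
    {p : BT F k M (BT F k N L) → Prop} (zero : p 0)
    (mk : ∀ i j l, i + j + l = n → ∀ a ∈ GM i, ∀ w ∈ GN j, ∀ b ∈ GQ l,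
      p (BT.mk F k a (BT.mk F k w b)))
    (add : ∀ x y, p x → p y → p (x + y)) {x : BT F k M (BT F k N L)}
    (hx : x ∈ BT.deg (k := k) GM (BT.deg GN GQ) n) : p x := by
  have hp : ∀ {m : ℕ} {y : BT F k N L}, y ∈ BT.deg (k := k) GN GQ m → ∀ i, i + m = n →
      ∀ a ∈ GM i, p (BT.mk F k a y) := by
    intro m y hy
    induction hy using Submodule.span_induction with
    | mem y hy =>
      obtain ⟨j, l, w, b, rfl, hw, hb, rfl⟩ := hy
      intro i hi a ha
      exact mk i j l (by omega) a ha w hw b hb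
    | zero => intro i _ a _; rw [BT.mk_zero_right]; exact zero
    | add x y _ _ hx hy =>
      intro i hi a ha
      rw [BT.mk_add_right]; exact add _ _ (hx i hi a ha) (hy i hi a ha)
    | smul s y _ hy =>
      intro i hi a ha
      rw [BT.mk_smul_right, ← BT.mk_smul_left]
      exact hy i hi _ (Submodule.smul_mem _ _ ha)
  have key : ∀ s : F, p (s • x) := by
    induction hx using Submodule.span_induction with
    | mem x hx =>
      obtain ⟨i, m, a, y, hi, ha, hy, rfl⟩ := hx
      intro s
      rw [← BT.mk_smul_left]
      exact hp hy i hi _ (Submodule.smul_mem _ _ ha)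
    | zero => intro s; rw [smul_zero]; exact zero
    | add x y _ _ hx hy => intro s; rw [smul_add]; exact add _ _ (hx s) (hy s)
    | smul t x _ hx => intro s; rw [smul_smul]; exact hx _
  simpa using key 1

namespace Setting

variable {F : Type u₁} {k : Type u₂} {V : Type u₃} [Field F] [Ring k] [Algebra F k]
  [AddCommGroup V] [FModule F V] [EnvModule F k V] [EnvTower F k V]
variable (M : Setting.{u₁, u₂, u₃, u₄} F k V)

/-- The map `φ ⊗ 1_V - 1_V ⊗ φ` on `R_{N+1}`. -/
def diff (φ : M.R →ₗ[Env F k] TAlg F k V) : M.S →ₗ[Env F k] TAlg F k V :=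
  mulMap φ (TAlg.ι F k) ∘ₗ M.toRV - mulMap (TAlg.ι F k) φ ∘ₗ M.toVR

theorem diff_apply (φ : M.R →ₗ[Env F k] TAlg F k V) (w : M.S) :
    M.diff φ w = mulMap φ (TAlg.ι F k) (M.toRV w) - mulMap (TAlg.ι F k) φ (M.toVR w) := rfl

/-- The conditions on maps `φ_j : R → V^{⊗ j}` that describe a weak PBW-deformation. -/
structure WeakPBW (φ : ℕ → M.R →ₗ[Env F k] TAlg F k V) : Prop where
  mem : ∀ j < M.N, ∀ r, φ j r ∈ TAlg.deg F k V j
  exists_eq : ∀ w, ∃ r, M.incR r = M.diff (φ (M.N - 1)) w ∧ φ 0 r = 0 ∧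
    ∀ j, 0 < j → j < M.N → φ j r + M.diff (φ (j - 1)) w = 0

/-- The part of the comparison data that is used to construct deformations. -/
structure Comparison where
  /-- The comparison map in degree two. -/
  τ2 : FB F k M.A M.I2 →ₗ[F] FB F k M.A M.R
  /-- The comparison map in degree three. -/
  τ3 : FB F k M.A M.I3 →ₗ[F] FB F k M.A M.S
  /-- The homotopy in degree two. -/
  s2 : FB F k M.A M.I2 →ₗ[F] FB F k M.A M.I3
  /-- The homotopy in degree three. -/
  s3 : FB F k M.A M.I3 →ₗ[F] FB F k M.A M.I4
  τ2_hom : IsBimodHom M.A τ2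
  s2_hom : IsBimodHom M.A s2
  τ2_mem : ∀ n, ∀ x ∈ M.degFB M.degI2 n, τ2 x ∈ M.degFB (pureDeg F M.R M.N) n
  τ3_mem : ∀ n, ∀ x ∈ M.degFB M.degI3 n, τ3 x ∈ M.degFB (pureDeg F M.S (M.N + 1)) n
  s2_mem : ∀ n, ∀ x ∈ M.degFB M.degI2 n, s2 x ∈ M.degFB M.degI3 n
  τ2_b3 : ∀ x, τ2 (M.b3 x) = M.d3 (τ3 x)
  b4_s3 : ∀ x, M.b4 (s3 x) + s2 (M.b3 x) = x - M.σ3 (τ3 x)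
  τ2_sum : ∀ (r : M.R) (n : ℕ) (x y : Fin n → TAlg F k V),
    (∀ i, ∃ a b, 0 < a ∧ 0 < b ∧ a + b = M.N ∧ x i ∈ TAlg.deg F k V a ∧ y i ∈ TAlg.deg F k V b) →
    ∑ i, x i * y i = M.incR r → τ2 (gen (∑ i, BT.mk F k (M.cls (x i)) (M.cls (y i)))) = gen r

variable {M}

theorem p_mem_of_mem_degSub {l m : ℕ} {a : M.A} (ha : a ∈ M.degSub l m) :
    M.p a = 0 ∨ l ≤ m ∧ M.p a ∈ M.degI (m - l) := by
  by_cases h : l ≤ m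
  · exact Or.inr ⟨h, M.p_mem_degI ((mem_degSub (by omega)).1 ha)⟩
  · exact Or.inl (by rw [eq_zero_of_mem_degSub (by omega) ha, map_zero])

/-- Adding back what an inner map has subtracted allows degrees to be compared without truncated
differences. -/
theorem degSub_add (i l m : ℕ) : M.degSub (i + l) (m + l) = M.degSub i m := by
  simp only [degSub, Nat.add_le_add_iff_right, Nat.add_sub_add_right]

theorem sq_mem {ψ : ℕ → M.I2 →ₗ[Env F k] M.A} {n : ℕ}
    (h : ∀ i, 1 ≤ i → i ≤ n → ∀ m, ∀ t ∈ M.degI2 m, ψ i t ∈ M.degSub i m) {m : ℕ} {t : M.I3}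
    (ht : t ∈ M.degI3 m) : sq ψ n t ∈ M.degSub (n + 1) m := by
  refine BT.deg_bt_induction (p := fun t => sq ψ n t ∈ M.degSub (n + 1) m)
    (by rw [map_zero]; exact zero_mem _) ?_
    (fun x y hx hy => by rw [map_add]; exact add_mem hx hy) ht
  rintro a b c rfl u hu v hv w hw
  rw [sq_mk]
  refine sum_mem fun i hi => ?_
  obtain ⟨hi, hi'⟩ := Finset.mem_Icc.1 hi
  refine sub_mem ?_ ?_
  · rcases p_mem_of_mem_degSub (h (n + 1 - i) (by omega) (by omega) _ _ (M.mk_mem_degI2 hv hw)) with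
      h1 | ⟨h1, h2⟩
    · rw [h1, BT.mk_zero_right, map_zero]; exact zero_mem _
    · have h3 := h i hi hi' _ _ (M.mk_mem_degI2 hu h2)
      rwa [← degSub_add _ (n + 1 - i), show i + (n + 1 - i) = n + 1 by omega,
        show a + (b + c - (n + 1 - i)) + (n + 1 - i) = a + b + c by omega] at h3
  · rcases p_mem_of_mem_degSub (h (n + 1 - i) (by omega) (by omega) _ _ (M.mk_mem_degI2 hu hv)) with
      h1 | ⟨h1, h2⟩
    · rw [h1, BT.mk_zero_left, map_zero]; exact zero_mem _
    · have h3 := h i hi hi' _ _ (M.mk_mem_degI2 h2 hw)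
      rwa [← degSub_add _ (n + 1 - i), show i + (n + 1 - i) = n + 1 by omega,
        show a + b - (n + 1 - i) + c + (n + 1 - i) = a + b + c by omega] at h3

/-- Three factors of positive degree and total degree at most N leave total degree below N for any
adjacent pair, so every inner value vanishes. A factor of degree 0 in I_+ is zero. -/
theorem sq_eq_zero {ψ : ℕ → M.I2 →ₗ[Env F k] M.A} {n : ℕ}
    (h : ∀ i, 1 ≤ i → i ≤ n → ∀ m < M.N, ∀ t ∈ M.degI2 m, ψ i t = 0) {m : ℕ} (hm : m ≤ M.N)
    {t : M.I3} (ht : t ∈ M.degI3 m) : sq ψ n t = 0 := by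
  refine BT.deg_bt_induction (p := fun t => sq ψ n t = 0) (map_zero _) ?_
    (fun x y hx hy => by rw [map_add, hx, hy, add_zero]) ht
  rintro a b c rfl u hu v hv w hw
  rcases Nat.eq_zero_or_pos a with rfl | ha
  · rw [M.degI_zero hu, BT.mk_zero_left, map_zero]
  rcases Nat.eq_zero_or_pos c with rfl | hc
  · rw [M.degI_zero hw, BT.mk_zero_right, BT.mk_zero_right, map_zero]
  rw [sq_mk]
  refine Finset.sum_eq_zero fun i hi => ?_
  obtain ⟨hi, hi'⟩ := Finset.mem_Icc.1 hi
  rw [h (n + 1 - i) (by omega) (by omega) _ (by omega) _ (M.mk_mem_degI2 hv hw),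
    h (n + 1 - i) (by omega) (by omega) _ (by omega) _ (M.mk_mem_degI2 hu hv), map_zero,
    BT.mk_zero_left, BT.mk_zero_right, sub_self]

/-- The sign arises because d₃ takes ∑ v|s|1 minus ∑ 1|r|u, whereas ∂ takes the right multiplication
first. -/
theorem ext_d3_gen (φ : M.R →ₗ[Env F k] TAlg F k V) (w : M.S) :
    ext (M.q ∘ₗ φ) (M.d3 (gen w)) = -M.q (M.diff φ w) := by
  have h1 : ∀ t : BT F k V M.R, ext (M.q ∘ₗ φ) (genL M.ιA t) =
      M.q (mulMap (TAlg.ι F k) φ t) := by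
    intro t
    induction t using BT.induction with
    | zero => simp only [map_zero]
    | tmul v r => rw [genL_mk, ← smul_gen, ext_smul, ext_gen]; exact (M.q_mul _ _).symm
    | add x y hx hy => simp only [map_add, hx, hy]
  have h2 : ∀ t : BT F k M.R V, ext (M.q ∘ₗ φ) (genR M.ιA t) =
      M.q (mulMap φ (TAlg.ι F k) t) := by
    intro t
    induction t using BT.induction with
    | zero => simp only [map_zero]
    | tmul r v => rw [genR_mk, ← op_smul_gen, ext_op_smul, ext_gen]; exact (M.q_mul _ _).symm
    | add x y hx hy => simp only [map_add, hx, hy]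
  rw [d3_gen, map_sub, h1, h2, diff_apply, map_sub, neg_sub]

namespace Comparison

variable (C : M.Comparison) (φ : ℕ → M.R →ₗ[Env F k] TAlg F k V)

/-- The maps `ψ'_n^~ = φ_{N-n}^~ ∘ τ₂` for `1 ≤ n ≤ N`, and `0` otherwise. -/
def psiPrime (n : ℕ) : FB F k M.A M.I2 →ₗ[F] M.A :=
  if 1 ≤ n ∧ n ≤ M.N then ext (M.q ∘ₗ φ (M.N - n)) ∘ₗ C.τ2 else 0

theorem psiPrime_of_le {n : ℕ} (h1 : 1 ≤ n) (hN : n ≤ M.N) (x : FB F k M.A M.I2) :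
    C.psiPrime φ n x = ext (M.q ∘ₗ φ (M.N - n)) (C.τ2 x) := by
  rw [psiPrime, if_pos ⟨h1, hN⟩, LinearMap.comp_apply]

theorem psiPrime_of_lt {n : ℕ} (hN : M.N < n) (x : FB F k M.A M.I2) : C.psiPrime φ n x = 0 := by
  rw [psiPrime, if_neg (by omega), LinearMap.zero_apply]

theorem psiPrime_hom (n : ℕ) : IsBimodHom M.A (C.psiPrime φ n) := by
  rw [psiPrime]
  split_ifs
  · exact (ext_isBimodHom _).comp C.τ2_hom
  · exact IsBimodHom.zero

/-- The maps defined by `ψ_{n+1}^~ = ψ'_{n+1}^~ - ψ'_{n+1}^~ b₃ s₂ - sq(ψ_1, …, ψ_n)^~ s₂`. -/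
def IsRecursive (ψ : ℕ → M.I2 →ₗ[Env F k] M.A) : Prop :=
  ∀ n x, ext (ψ (n + 1)) x = C.psiPrime φ (n + 1) x -
    (C.psiPrime φ (n + 1) (M.b3 (C.s2 x)) + ext (sq ψ n) (C.s2 x))

theorem exists_isRecursive : ∃ ψ : ℕ → M.I2 →ₗ[Env F k] M.A, C.IsRecursive φ ψ := by
  obtain ⟨ψ, hψ⟩ := exists_recursive (0 : M.I2 →ₗ[Env F k] M.A)
    (step := fun n ψ => (C.psiPrime_hom φ (n + 1)).toEnv ∘ₗ gen -
      ((C.psiPrime_hom φ (n + 1)).toEnv ∘ₗ M.b3_hom.toEnv + extE (sq ψ n)) ∘ₗ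
        C.s2_hom.toEnv ∘ₗ gen) (fun n f g h => by
      have : sq f n = sq g n := by
        rw [sq, sq]
        refine Finset.sum_congr rfl fun i hi => ?_
        obtain ⟨hi, hi'⟩ := Finset.mem_Icc.1 hi
        rw [h i hi hi', h (n + 1 - i) (by omega) (by omega)]
      rw [this])
  refine ⟨ψ, fun n x => ?_⟩
  refine (ext_isBimodHom (ψ (n + 1))).ext ((C.psiPrime_hom φ (n + 1)).sub
    ((((C.psiPrime_hom φ (n + 1)).comp M.b3_hom).comp C.s2_hom).add
      ((ext_isBimodHom (sq ψ n)).comp C.s2_hom))) (fun t => ?_) x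
  rw [ext_gen, hψ]
  rfl

variable {C φ} {ψ : ℕ → M.I2 →ₗ[Env F k] M.A} (hψ : C.IsRecursive φ ψ)

include hψ in
theorem IsRecursive.apply (n : ℕ) (t : M.I2) : ψ (n + 1) t = C.psiPrime φ (n + 1) (gen t) -
    (C.psiPrime φ (n + 1) (M.b3 (C.s2 (gen t))) + ext (sq ψ n) (C.s2 (gen t))) := by
  rw [← hψ, ext_gen]

theorem psiPrime_mem (hφ : ∀ j < M.N, ∀ r, φ j r ∈ TAlg.deg F k V j) {n m : ℕ} (hn : 1 ≤ n)
    {x : FB F k M.A M.I2} (hx : x ∈ M.degFB M.degI2 m) : C.psiPrime φ n x ∈ M.degSub n m := by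
  rcases le_or_gt n M.N with hN | hN
  · rw [C.psiPrime_of_le φ hn hN]
    refine ext_mem_degSub (fun m r hr => ?_) (C.τ2_mem m x hx)
    by_cases hm : m = M.N
    · rw [hm, mem_degSub (l := M.N - n) (by omega)]
      exact M.q_mem (hφ _ (by omega) r)
    · rw [eq_zero_of_mem_pureDeg hm hr, map_zero]; exact zero_mem _
  · rw [C.psiPrime_of_lt φ hN]; exact zero_mem _

include hψ in
theorem IsRecursive.lowers (hφ : ∀ j < M.N, ∀ r, φ j r ∈ TAlg.deg F k V j) : Lowers ψ := by
  intro n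
  induction n using Nat.strong_induction_on with
  | h n ih =>
    intro hn m t ht
    obtain ⟨n, rfl⟩ : ∃ l, n = l + 1 := ⟨n - 1, by omega⟩
    have h1 := C.s2_mem m _ (M.gen_mem_degFB ht)
    rw [hψ.apply]
    refine sub_mem (psiPrime_mem hφ hn (M.gen_mem_degFB ht))
      (add_mem (psiPrime_mem hφ hn (M.b3_mem h1)) (ext_mem_degSub (fun m t ht => ?_) h1))
    exact sq_mem (fun i hi hi' => ih i (by omega) hi) ht

theorem psiPrime_b3 {n : ℕ} (hn : 1 ≤ n) (hN : n ≤ M.N) (x : FB F k M.A M.I3) :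
    C.psiPrime φ n (M.b3 x) = ext (M.q ∘ₗ φ (M.N - n)) (M.d3 (C.τ3 x)) := by
  rw [C.psiPrime_of_le φ hn hN, C.τ2_b3]

/-- Through ψ' ∘ b₃ = φ^~ ∘ d₃ ∘ τ₃, as τ₃ takes values in a bimodule that starts in degree N + 1.
-/
theorem psiPrime_b3_s2 {n m : ℕ} (hm : m ≤ M.N) {x : FB F k M.A M.I2}
    (hx : x ∈ M.degFB M.degI2 m) (hn : 1 ≤ n) : C.psiPrime φ n (M.b3 (C.s2 x)) = 0 := by
  rcases le_or_gt n M.N with hN | hN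
  · rw [psiPrime_b3 hn hN, M.degFB_pure_of_lt (Nat.lt_succ_of_le hm)
      (C.τ3_mem m _ (C.s2_mem m _ hx)), map_zero, map_zero]
  · exact C.psiPrime_of_lt φ hN _

theorem psiPrime_of_degree_lt {n m : ℕ} (hm : m < M.N) {x : FB F k M.A M.I2}
    (hx : x ∈ M.degFB M.degI2 m) (hn : 1 ≤ n) : C.psiPrime φ n x = 0 := by
  rcases le_or_gt n M.N with hN | hN
  · rw [C.psiPrime_of_le φ hn hN, M.degFB_pure_of_lt hm (C.τ2_mem m _ hx), map_zero]
  · exact C.psiPrime_of_lt φ hN _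

-- Both corrections in the recursion vanish in degrees at most N: the first because τ₃ does, the
-- second because the earlier ψ are normalized. That they are normalized is this same statement for
-- smaller n, in degrees below N.
include hψ in
theorem IsRecursive.ext_eq {n : ℕ} (hn : 1 ≤ n) {m : ℕ} (hm : m ≤ M.N) {x : FB F k M.A M.I2}
    (hx : x ∈ M.degFB M.degI2 m) : ext (ψ n) x = C.psiPrime φ n x := by
  induction n using Nat.strong_induction_on generalizing m x with
  | h n ih =>
    obtain ⟨n, rfl⟩ : ∃ l, n = l + 1 := ⟨n - 1, by omega⟩
    rw [hψ, psiPrime_b3_s2 hm hx hn,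
      ext_eq_zero (GW := M.degI3) (fun i hi w hw => sq_eq_zero (fun l hl hl' m' hm' t' ht' => ?_)
        (hi.trans hm) hw) (C.s2_mem m _ hx), add_zero, sub_zero]
    have h1 := M.gen_mem_degFB ht'
    rw [← psiPrime_of_degree_lt (φ := φ) hm' h1 hl, ← ih l (by omega) hl hm'.le h1, ext_gen]

include hψ in
theorem IsRecursive.eq_psiPrime {n : ℕ} (hn : 1 ≤ n) {m : ℕ} (hm : m ≤ M.N) {t : M.I2}
    (ht : t ∈ M.degI2 m) : ψ n t = C.psiPrime φ n (gen t) := by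
  rw [← hψ.ext_eq hn hm (M.gen_mem_degFB ht), ext_gen]

include hψ in
theorem IsRecursive.eq_zero {n : ℕ} (hn : 1 ≤ n) {m : ℕ} (hm : m < M.N) {t : M.I2}
    (ht : t ∈ M.degI2 m) : ψ n t = 0 := by
  rw [hψ.eq_psiPrime hn hm.le ht, psiPrime_of_degree_lt hm (M.gen_mem_degFB ht) hn]

end Comparison
end Setting

/-! ### Vanishing of the obstructions -/

namespace Setting

variable {F : Type u₁} {k : Type u₂} {V : Type u₃} [Field F] [Ring k] [Algebra F k]
  [AddCommGroup V] [FModule F V] [EnvModule F k V] [EnvTower F k V]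
variable {M : Setting.{u₁, u₂, u₃, u₄} F k V}

theorem split3_mem {a n : ℕ} {u : M.I} (hu : u ∈ M.degI a) {x : TAlg F k V}
    (hx : x ∈ TAlg.deg F k V n) : M.split3 (BT.mk F k u x) ∈ M.degFB M.degI3 (a + n) := by
  rw [← M.p_j u, ← contr_smul_split2]
  exact M.contr_mem (M.smul_mem_degFB (M.mem_degI.1 hu) (M.split2_mem hx))

/-- The map `x y ↦ ψ(x, y)` on `V^{⊗ N}`, for a map `ψ` that only depends on the product. -/
def prodMap (ψ : M.I2 →ₗ[Env F k] M.A) : TAlg F k V →ₗ[Env F k] M.A :=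
  ψ ∘ₗ BT.map M.cls M.ιI ∘ₗ TAlg.unshuffleR F k V

theorem prodMap_mul_ι (ψ : M.I2 →ₗ[Env F k] M.A) (y : TAlg F k V) (v : V) :
    prodMap ψ (y * TAlg.ι F k v) = ψ (BT.mk F k (M.cls y) (M.ιI v)) := by
  rw [prodMap, LinearMap.comp_apply, LinearMap.comp_apply, TAlg.unshuffleR_mul_ι, BT.map_mk]

namespace Comparison

variable {C : M.Comparison} {φ : ℕ → M.R →ₗ[Env F k] TAlg F k V}
  {ψ : ℕ → M.I2 →ₗ[Env F k] M.A} (hψ : C.IsRecursive φ ψ)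

include hψ in
theorem IsRecursive.sum {n : ℕ} (hn : 1 ≤ n) {m : ℕ} {x y : Fin m → TAlg F k V} {r : M.R}
    (h : ∀ i, ∃ a b, 0 < a ∧ 0 < b ∧ a + b = M.N ∧ x i ∈ TAlg.deg F k V a ∧
      y i ∈ TAlg.deg F k V b) (hr : ∑ i, x i * y i = M.incR r) :
    ∑ i, ψ n (BT.mk F k (M.cls (x i)) (M.cls (y i))) =
      if n ≤ M.N then M.q (φ (M.N - n) r) else 0 := by
  have ht : ∑ i, BT.mk F k (M.cls (x i)) (M.cls (y i)) ∈ M.degI2 M.N := sum_mem fun i _ => by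
    obtain ⟨a, b, -, -, hab, hx, hy⟩ := h i
    rw [← hab]
    exact M.mk_mem_degI2 (M.cls_mem hx) (M.cls_mem hy)
  rw [← map_sum, hψ.eq_psiPrime hn le_rfl ht]
  split_ifs with hN
  · rw [C.psiPrime_of_le φ hn hN, C.τ2_sum r m x y h hr, ext_gen]; rfl
  · exact C.psiPrime_of_lt φ (by omega) _

-- In total degree N the value only depends on the product, since the difference of two
-- factorizations of one tensor is a relation decomposition of 0.
include hψ in
theorem IsRecursive.cls {n : ℕ} (hn : 1 ≤ n) {a b : ℕ} (ha : 0 < a) (hb : 0 < b)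
    (hab : a + b = M.N) {x y : TAlg F k V} (hx : x ∈ TAlg.deg F k V a)
    (hy : y ∈ TAlg.deg F k V b) :
    ψ n (BT.mk F k (M.cls x) (M.cls y)) = prodMap (ψ n) (x * y) := by
  have hN := M.two_le
  have h1 := TAlg.deg_mul hx hy
  rw [show a + b = M.N - 1 + 1 by omega] at h1
  obtain ⟨m, z, v, hz, hxy⟩ := TAlg.exists_sum_mul_ι h1
  -- The pair (x, -y) together with the pairs (z_i, v_i), where xy = ∑ z_i v_i, decomposes the
  -- relation r = 0.
  have h2 := hψ.sum hn (m := m + 1) (x := Fin.cons x z) (r := 0)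
    (y := Fin.cons (-y) fun i => TAlg.ι F k (v i)) (fun i => by
      refine Fin.cases ⟨a, b, ha, hb, hab, hx, neg_mem hy⟩ (fun i => ?_) i
      exact ⟨M.N - 1, 1, by omega, one_pos, by omega, hz i, TAlg.ι_mem_deg _⟩) (by
      rw [Fin.sum_univ_succ]
      simp only [Fin.cons_zero, Fin.cons_succ]
      rw [← hxy, mul_neg, neg_add_cancel, map_zero])
  rw [Fin.sum_univ_succ] at h2
  simp only [Fin.cons_zero, Fin.cons_succ, map_zero, ite_self] at h2
  rw [map_neg, BT.mk_neg_right, map_neg, neg_add_eq_zero] at h2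
  rw [h2, hxy, map_sum]
  exact Finset.sum_congr rfl fun i _ => (prodMap_mul_ι _ _ _).symm

include hψ in
theorem IsRecursive.prodMap_incR {n : ℕ} (hn : 1 ≤ n) (r : M.R) :
    prodMap (ψ n) (M.incR r) = if n ≤ M.N then M.q (φ (M.N - n) r) else 0 := by
  have hN := M.two_le
  have h1 := M.incR_mem r
  rw [show M.N = M.N - 1 + 1 by omega] at h1
  obtain ⟨m, z, v, hz, hr⟩ := TAlg.exists_sum_mul_ι h1
  rw [← hψ.sum hn (fun i => ⟨M.N - 1, 1, by omega, one_pos, by omega, hz i, TAlg.ι_mem_deg (v i)⟩)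
    hr.symm, hr, map_sum]
  exact Finset.sum_congr rfl fun i _ => prodMap_mul_ι _ _ _

include hψ in
theorem IsRecursive.ext_split2 {n : ℕ} (hn : 1 ≤ n) (hN : n ≤ M.N) (r : M.R) :
    ext (ψ n) (M.split2 (M.incR r)) = M.q (φ (M.N - n) r) := by
  rw [M.ext_split2_eq (G := prodMap (ψ n))
    (fun a b _ _ hab x hx y hy => hψ.eq_zero hn hab (M.mk_mem_degI2 (M.cls_mem hx) (M.cls_mem hy)))
    (fun a b ha hb hab x hx y hy => hψ.cls hn ha hb hab hx hy) (M.incR_mem r),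
    hψ.prodMap_incR hn, if_pos hN]

-- The inner map ψ_{n+1-i} sees total degree N and lowers it by n + 1 - i. For i < n the drop is at
-- least 2, the outer map then has total degree below N and vanishes. Only i = n, with inner map ψ₁,
-- remains.
include hψ in
theorem IsRecursive.sq_cls (hl : Lowers ψ) {n : ℕ} (hn : 1 ≤ n) (v u : V) {y : TAlg F k V}
    (hy : y ∈ TAlg.deg F k V (M.N - 1)) :
    sq ψ n (BT.mk F k (M.ιI v) (BT.mk F k (M.cls y) (M.ιI u))) =
      ψ n (BT.mk F k (M.ιI v) (M.p (prodMap (ψ 1) (y * TAlg.ι F k u)))) -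
      ψ n (BT.mk F k (M.p (prodMap (ψ 1) (TAlg.ι F k v * y))) (M.ιI u)) := by
  have hN := M.two_le
  have hv := TAlg.ι_mem_deg (F := F) (k := k) v
  have hu := TAlg.ι_mem_deg (F := F) (k := k) u
  rw [sq_mk, Finset.sum_eq_single n]
  · rw [Nat.add_sub_cancel_left, ← hψ.cls le_rfl (by omega) one_pos (by omega) hy hu,
      ← hψ.cls le_rfl one_pos (by omega) (by omega) hv hy]
    rfl
  · intro i hi hin
    obtain ⟨hi, hi'⟩ := Finset.mem_Icc.1 hi
    have h1 : ψ i (BT.mk F k (M.ιI v) (M.p (ψ (n + 1 - i)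
        (BT.mk F k (M.cls y) (M.ιI u))))) = 0 := by
      rcases p_mem_of_mem_degSub (hl (n + 1 - i) (by omega) _ _
        (M.mk_mem_degI2 (M.cls_mem hy) (M.ιI_mem u))) with h | ⟨h1, h2⟩
      · rw [h, BT.mk_zero_right, map_zero]
      · exact hψ.eq_zero hi (by omega) (M.mk_mem_degI2 (M.ιI_mem v) h2)
    have h2 : ψ i (BT.mk F k (M.p (ψ (n + 1 - i)
        (BT.mk F k (M.ιI v) (M.cls y)))) (M.ιI u)) = 0 := by
      rcases p_mem_of_mem_degSub (hl (n + 1 - i) (by omega) _ _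
        (M.mk_mem_degI2 (M.ιI_mem v) (M.cls_mem hy))) with h | ⟨h1, h2⟩
      · rw [h, BT.mk_zero_left, map_zero]
      · exact hψ.eq_zero hi (by omega) (M.mk_mem_degI2 h2 (M.ιI_mem u))
    rw [h1, h2, sub_self]
  · intro h
    exact absurd (Finset.mem_Icc.2 ⟨hn, le_rfl⟩) h

/-- The map `v y u ↦ ψ(v, χ(y u)) - ψ(χ(v y), u)`. -/
def sqMap (ψ : M.I2 →ₗ[Env F k] M.A) (χ : TAlg F k V →ₗ[Env F k] M.A) :
    TAlg F k V →ₗ[Env F k] M.A :=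
  ψ ∘ₗ BT.map M.ιI (M.p ∘ₗ χ) ∘ₗ TAlg.unshuffleL F k V -
    ψ ∘ₗ BT.map (M.p ∘ₗ χ) M.ιI ∘ₗ TAlg.unshuffleR F k V

theorem sqMap_apply (ψ : M.I2 →ₗ[Env F k] M.A) (χ : TAlg F k V →ₗ[Env F k] M.A)
    (x : TAlg F k V) : sqMap ψ χ x =
      ψ (BT.map M.ιI (M.p ∘ₗ χ) (TAlg.unshuffleL F k V x)) -
        ψ (BT.map (M.p ∘ₗ χ) M.ιI (TAlg.unshuffleR F k V x)) := rfl

-- Among the terms of `split3` only the last one has all its N + 1 letters inside I_+ ⊗ I_+ ⊗ I_+.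
-- The others are multiples of elements of degree at most N, where sq vanishes.
include hψ in
theorem IsRecursive.ext_sq_split3 (hl : Lowers ψ) {n : ℕ} (hn : 1 ≤ n) (v : V) {x : TAlg F k V}
    (hx : x ∈ TAlg.deg F k V M.N) : ext (sq ψ n) (M.split3 (BT.mk F k (M.ιI v) x)) =
      sqMap (ψ n) (prodMap (ψ 1)) (TAlg.ι F k v * x) := by
  have hN := M.two_le
  rw [show M.N = M.N - 1 + 1 by omega] at hx
  refine TAlg.deg_succ_induction (p := fun x => ext (sq ψ n) (M.split3 (BT.mk F k (M.ιI v) x)) =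
      sqMap (ψ n) (prodMap (ψ 1)) (TAlg.ι F k v * x)) ?_ ?_ (fun y hy u => ?_) hx
  · rw [BT.mk_zero_right, map_zero, map_zero, mul_zero, map_zero]
  · intro x y hx hy
    rw [BT.mk_add_right, map_add, map_add, mul_add, map_add, hx, hy]
  · rw [split3_mul_ι, map_add, ext_op_smul, ext_gen, ext_eq_zero (GW := M.degI3)
      (fun i hi w hw => sq_eq_zero (fun l hl _ m' hm' t' ht' => hψ.eq_zero hl hm' ht')
        (hi.trans (by omega)) hw) (split3_mem (M.ιI_mem v) hy), smul_zero, add_zero,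
      hψ.sq_cls hl hn v u hy, sqMap_apply, ← mul_assoc, TAlg.unshuffleR_mul_ι, mul_assoc,
      TAlg.unshuffleL_ι_mul, BT.map_mk, BT.map_mk]
    rfl

-- Since ψ₁ is φ_{N-1} on relations, the two terms of sq at w are ψ_n of ∑ v ⊗ φ_{N-1}(s) and of ∑
-- φ_{N-1}(r) ⊗ u. These only depend on the products, and their difference is the value at
-- -∂φ_{N-1}(w).
include hψ in
theorem IsRecursive.ext_sq_σ3 (hφ : M.WeakPBW φ) {n : ℕ} (hn : 1 ≤ n) (w : M.S) :
    ext (sq ψ n) (M.σ3 (gen w)) = -prodMap (ψ n) (M.diff (φ (M.N - 1)) w) := by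
  have hN := M.two_le
  have h1 : ∀ t : BT F k V M.R, ext (sq ψ n) (M.split3 (BT.map M.ιI M.incR t)) =
      sqMap (ψ n) (prodMap (ψ 1)) (mulMap (TAlg.ι F k) M.incR t) := by
    intro t
    induction t using BT.induction with
    | zero => simp only [map_zero]
    | tmul v r =>
      rw [BT.map_mk, hψ.ext_sq_split3 (hψ.lowers hφ.mem) hn v (M.incR_mem r)]; rfl
    | add x y hx hy => simp only [map_add, hx, hy]
  have hr : ∀ r, M.p (prodMap (ψ 1) (M.incR r)) = M.cls (φ (M.N - 1) r) := fun r => by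
    rw [hψ.prodMap_incR le_rfl, if_pos (by omega)]; rfl
  have hφ1 := hφ.mem (M.N - 1) (by omega)
  have h2 : ∀ t : BT F k V M.R, ψ n (BT.map M.ιI (M.p ∘ₗ prodMap (ψ 1))
      (BT.map LinearMap.id M.incR t)) = prodMap (ψ n) (mulMap (TAlg.ι F k) (φ (M.N - 1)) t) := by
    intro t
    induction t using BT.induction with
    | zero => simp only [map_zero]
    | tmul v r =>
      rw [BT.map_mk, BT.map_mk, LinearMap.comp_apply, hr]
      exact hψ.cls hn one_pos (by omega) (by omega) (TAlg.ι_mem_deg v) (hφ1 r)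
    | add x y hx hy => simp only [map_add, hx, hy]
  have h3 : ∀ t : BT F k M.R V, ψ n (BT.map (M.p ∘ₗ prodMap (ψ 1)) M.ιI
      (BT.map M.incR LinearMap.id t)) = prodMap (ψ n) (mulMap (φ (M.N - 1)) (TAlg.ι F k) t) := by
    intro t
    induction t using BT.induction with
    | zero => simp only [map_zero]
    | tmul r v =>
      rw [BT.map_mk, BT.map_mk, LinearMap.comp_apply, hr]
      exact hψ.cls hn (by omega) one_pos (by omega) (hφ1 r) (TAlg.ι_mem_deg v)
    | add x y hx hy => simp only [map_add, hx, hy]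
  rw [σ3_gen, h1, ← M.incS_eq, sqMap_apply, M.unshuffleL_incS, M.unshuffleR_incS, h2, h3,
    diff_apply, map_sub, neg_sub]

/-- After composing with d₃ only ∂φ_{N-1}(w) matters, which lies in R and is zero in A. -/
theorem psiPrime_one_b3 (hφ : M.WeakPBW φ) (x : FB F k M.A M.I3) :
    C.psiPrime φ 1 (M.b3 x) = 0 := by
  have hN := M.two_le
  rw [psiPrime_b3 le_rfl (by omega)]
  refine (ext_isBimodHom (M.q ∘ₗ φ (M.N - 1))).ext_comp_zero M.d3_hom (fun w => ?_) _
  obtain ⟨r, hr, -⟩ := hφ.exists_eq w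
  rw [ext_d3_gen, ← hr, M.q_incR, neg_zero]

-- Arbitrary comparison data are not required to satisfy τ₂ ∘ σ₂ = 1. The value on σ₂(1|r|1) is
-- obtained instead from the values on relation decompositions.
include hψ in
theorem IsRecursive.psiPrime_σ2 {n : ℕ} (hn : 1 ≤ n) (hN : n ≤ M.N) (x : FB F k M.A M.R) :
    C.psiPrime φ n (M.σ2 x) = ext (M.q ∘ₗ φ (M.N - n)) x := by
  refine ((C.psiPrime_hom φ n).comp M.σ2_hom).ext (ext_isBimodHom _) (fun r => ?_) x
  rw [LinearMap.comp_apply, σ2_gen, ← hψ.ext_eq hn le_rfl (M.split2_mem (M.incR_mem r)),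
    hψ.ext_split2 hn hN, ext_gen]
  rfl

-- The bridge between the two sets of equations: the obstruction evaluated on R_{N+1} is exactly
-- what the conditions for a weak PBW-deformation require to vanish.
include hψ in
theorem IsRecursive.obstruction_σ3 (hφ : M.WeakPBW φ) (n : ℕ) (x : FB F k M.A M.S) :
    C.psiPrime φ (n + 1) (M.b3 (M.σ3 x)) + ext (sq ψ n) (M.σ3 x) = 0 := by
  refine (((C.psiPrime_hom φ (n + 1)).comp (M.b3_hom.comp M.σ3_hom)).add
    ((ext_isBimodHom (sq ψ n)).comp M.σ3_hom)).ext IsBimodHom.zero (g := 0) (fun w => ?_) x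
  change C.psiPrime φ (n + 1) (M.b3 (M.σ3 (gen w))) + ext (sq ψ n) (M.σ3 (gen w)) = 0
  have hN := M.two_le
  rcases Nat.eq_zero_or_pos n with rfl | hn
  · have h0 : sq ψ 0 = 0 := by rw [sq, Finset.Icc_eq_empty (by omega), Finset.sum_empty]
    rw [psiPrime_one_b3 hφ, h0, ext_zero, add_zero]
  obtain ⟨r, hr, h0, hpos⟩ := hφ.exists_eq w
  rw [hψ.ext_sq_σ3 hφ hn, ← hr, hψ.prodMap_incR hn]
  -- For n < N the sum is minus the class of φ_{N-n}(∂φ_{N-1}(w)) + ∂φ_{N-n-1}(w). For n = N only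
  -- φ_0(∂φ_{N-1}(w)) is left, as ψ'_{N+1} = 0. For n > N both terms are zero by definition.
  rcases lt_trichotomy n M.N with h | rfl | h
  · rw [if_pos h.le, M.b3_σ3, hψ.psiPrime_σ2 (by omega) h, ext_d3_gen, ← neg_add, ← map_add,
      add_comm, show M.N - (n + 1) = M.N - n - 1 by omega, hpos _ (by omega) (by omega), map_zero,
      neg_zero]
  · rw [if_pos le_rfl, Nat.sub_self, h0, map_zero, neg_zero, add_zero,
      C.psiPrime_of_lt φ (Nat.lt_succ_self _)]
  · rw [if_neg (by omega), C.psiPrime_of_lt φ (by omega), neg_zero, add_zero]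

-- Induction on the order. By the recursion and the homotopy identity, everything cancels except the
-- obstruction on the image of σ₃ ∘ τ₃, which is zero by the previous result.
include hψ in
theorem IsRecursive.assocE_eq_zero (hφ : M.WeakPBW φ) (n : ℕ) : assocE ψ n = 0 := by
  induction n using Nat.strong_induction_on with
  | h n ih =>
    have h1 : ∀ z, ext (assocE ψ n) z = ext (ψ (n + 1)) (M.b3 z) + ext (sq ψ n) z :=
      (ext_isBimodHom (assocE ψ n)).ext (((ext_isBimodHom (ψ (n + 1))).comp M.b3_hom).add
        (ext_isBimodHom (sq ψ n))) (fun t => by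
          rw [ext_gen, assocE_apply, LinearMap.add_apply, ext_gen]; rfl)
    -- The associator of order n + 1 kills boundaries by the pentagon, and its part ψ_{n+1}^~ ∘ b₃
    -- does so because b₃b₄ = 0. Hence sq kills them as well.
    have h2 : ∀ z, ext (sq ψ n) (M.b4 z) = 0 := by
      intro z
      have h3 := ext_assocE_b4 (hψ.lowers hφ.mem) ih z
      rwa [h1, M.b3_b4, map_zero, zero_add] at h3
    refine LinearMap.ext fun t => ?_
    -- Rewrites s₂(b₃(t)) as t - σ₃(τ₃(t)) - b₄(s₃(t)). The last term contributes nothing, and the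
    -- terms in t cancel those of ψ' ∘ b₃ and of sq.
    have h4 := eq_sub_of_add_eq' (C.b4_s3 (gen t))
    have h5 := eq_neg_of_add_eq_zero_left (hψ.obstruction_σ3 hφ n (C.τ3 (gen t)))
    rw [assocE_apply, hψ n, h4, map_sub M.b3, map_sub M.b3, M.b3_b4, sub_zero, map_sub,
      map_sub (ext (sq ψ n)), map_sub (ext (sq ψ n)), h2, h5, ext_gen, LinearMap.zero_apply]
    abel

-- The uniform recursion also applies at n = 0, where it contains the extra term ψ'₁(b₃(s₂(x))); it
-- vanishes for a weak PBW-deformation, which restores ψ₁ = ψ'₁.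
include hψ in
theorem IsRecursive.one (hφ : M.WeakPBW φ) (x : FB F k M.A M.I2) :
    ext (ψ 1) x = C.psiPrime φ 1 x := by
  have h0 : sq ψ 0 = 0 := by rw [sq, Finset.Icc_eq_empty (by omega), Finset.sum_empty]
  rw [hψ 0, psiPrime_one_b3 hφ, h0, ext_zero, add_zero, sub_zero]

end Comparison
end Setting

/-! ### The deformation attached to maps with vanishing associators -/

namespace Setting

open Polynomial

variable {F : Type u₁} {k : Type u₂} {V : Type u₃} [Field F] [Ring k] [Algebra F k]
  [AddCommGroup V] [FModule F V] [EnvModule F k V] [EnvTower F k V]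
variable {M : Setting.{u₁, u₂, u₃, u₄} F k V}

variable (M) in
/-- The homogeneous component of degree `m` of `A[t]`, where `t` has degree `1`. -/
def degPoly (m : ℕ) : Submodule F M.A[X] :=
  Submodule.span F {x | ∃ i j a, i + j = m ∧ a ∈ M.deg i ∧ x = C a * X ^ j}

theorem mem_degPoly {m : ℕ} {x : M.A[X]} :
    x ∈ M.degPoly m ↔ ∀ i, x.coeff i ∈ M.degSub i m := by
  constructor
  · intro hx i
    refine (Submodule.span_le.2 ?_ : M.degPoly m ≤
      (M.degSub i m).comap ((lcoeff M.A i).restrictScalars F)) hx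
    rintro _ ⟨l, j, a, hl, ha, rfl⟩
    change (C a * X ^ j).coeff i ∈ M.degSub i m
    rw [coeff_C_mul_X_pow]
    split_ifs with hi
    · exact (mem_degSub (by omega)).2 ha
    · exact zero_mem _
  · intro hx
    rw [x.as_sum_support_C_mul_X_pow]
    refine sum_mem fun i _ => ?_
    by_cases hi : i ≤ m
    · exact Submodule.subset_span ⟨m - i, i, _, by omega, (mem_degSub (by omega)).1 (hx i), rfl⟩
    · rw [eq_zero_of_mem_degSub (by omega) (hx i), C_0, zero_mul]
      exact zero_mem _

variable (M) in
/-- The inclusion `k[t] → A[t]`. -/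
def incl (c : k[X]) : M.A[X] := c.map (KAlg.unit F M.A : k →ₐ[F] M.A).toRingHom

theorem incl_C (c : k) : M.incl (C c) = C (KAlg.unit F M.A c) := by simp [incl]

theorem incl_X_mul (c : k[X]) : M.incl (X * c) = X * M.incl c := by simp [incl]

theorem incl_add (c d : k[X]) : M.incl (c + d) = M.incl c + M.incl d := by simp [incl]

variable {ψ : ℕ → M.I2 →ₗ[Env F k] M.A} (hl : Lowers ψ)

/-- The deformed product on `A[t]`. -/
def defMul : M.A[X] →ₗ[F] M.A[X] →ₗ[F] M.A[X] := polyMul (coefMul_finite hl)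

theorem defMul_assoc (ha : ∀ n, assocE ψ n = 0) (x y z : M.A[X]) :
    defMul hl (defMul hl x y) z = defMul hl x (defMul hl y z) :=
  polyMul_assoc _ (fun n => by
    rcases n with _ | n
    · exact assocCoeff_zero
    · exact assocCoeff_succ hl (ha n)) x y z

theorem defMul_one_left (x : M.A[X]) : defMul hl 1 x = x := by
  have h1 := polyMul_C_left (coefMul_finite hl) (u := KAlg.unit F M.A 1)
    (fun _ => rfl) (fun n => coefMul_succ_unit_left n 1) x
  rwa [map_one, C_1, one_mul] at h1

theorem defMul_one_right (x : M.A[X]) : defMul hl x 1 = x := by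
  have h1 := polyMul_C_right (coefMul_finite hl) (u := KAlg.unit F M.A 1)
    (fun _ => rfl) (fun n => coefMul_succ_unit_right n 1) x
  rwa [map_one, C_1, mul_one] at h1

theorem defMul_X_mul (x y : M.A[X]) : defMul hl (X * x) y = X * defMul hl x y :=
  polyMul_X_mul _ x y

theorem defMul_mul_X (x y : M.A[X]) : defMul hl x (X * y) = X * defMul hl x y :=
  polyMul_mul_X _ x y

theorem defMul_incl_mul (c : k[X]) (x y : M.A[X]) :
    defMul hl (M.incl c * x) y = M.incl c * defMul hl x y := by
  induction c using polynomial_induction with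
  | C c =>
    rw [incl_C]
    exact polyMul_C_mul _ (fun n => coefMul_unit_mul n c) x y
  | X c hc => rw [incl_X_mul, mul_assoc, defMul_X_mul, hc, mul_assoc]
  | add c d hc hd => rw [incl_add, add_mul, map_add, LinearMap.add_apply, hc, hd, add_mul]

theorem mul_X_mul {A : Type*} [Ring A] (x y : A[X]) : x * (X * y) = X * (x * y) := by
  rw [← mul_assoc, ← X_mul, mul_assoc]

theorem defMul_bal (c : k[X]) (x y : M.A[X]) :
    defMul hl (x * M.incl c) y = defMul hl x (M.incl c * y) := by
  induction c using polynomial_induction with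
  | C c =>
    rw [incl_C]
    exact polyMul_bal _ (fun n => coefMul_bal n c) x y
  | X c hc => rw [incl_X_mul, mul_X_mul, mul_assoc, defMul_X_mul, defMul_mul_X, hc]
  | add c d hc hd => rw [incl_add, mul_add, add_mul, map_add, map_add, LinearMap.add_apply, hc, hd]

theorem defMul_mul_incl (c : k[X]) (x y : M.A[X]) :
    defMul hl x (y * M.incl c) = defMul hl x y * M.incl c := by
  induction c using polynomial_induction with
  | C c =>
    rw [incl_C]
    exact polyMul_mul_C _ (fun n => coefMul_mul_unit n c) x y
  | X c hc => rw [incl_X_mul, mul_X_mul, defMul_mul_X, hc, mul_X_mul]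
  | add c d hc hd => rw [incl_add, mul_add, map_add, hc, hd, mul_add]

theorem defMul_mem {m n : ℕ} {x y : M.A[X]} (hx : x ∈ M.degPoly m) (hy : y ∈ M.degPoly n) :
    defMul hl x y ∈ M.degPoly (m + n) := by
  refine (Submodule.span_le.2 ?_ : M.degPoly m ≤ (M.degPoly (m + n)).comap
    ((defMul hl).flip y)) hx
  rintro _ ⟨i, i', a, hi, ha, rfl⟩
  refine (Submodule.span_le.2 ?_ : M.degPoly n ≤ (M.degPoly (m + n)).comap
    (defMul hl (C a * X ^ i'))) hy
  rintro _ ⟨j, j', b, hj, hb, rfl⟩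
  change polyMul _ (C a * X ^ i') (C b * X ^ j') ∈ M.degPoly (m + n)
  rw [C_mul_X_pow_eq_monomial, C_mul_X_pow_eq_monomial, polyMul_monomial, mem_degPoly]
  intro l
  rw [coeff_X_pow_mul', coeff_X_pow_mul']
  split_ifs with h1 h2
  · have h3 := coefMul_mem hl (l - i' - j') ha hb
    rw [coeff_series]
    rwa [← degSub_add _ (i' + j'), show l - i' - j' + (i' + j') = l by omega,
      show i + j + (i' + j') = m + n by omega] at h3
  · exact zero_mem _
  · exact zero_mem _

theorem coeff_zero_defMul (x y : M.A[X]) :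
    (defMul hl x y).coeff 0 = x.coeff 0 * y.coeff 0 := by
  induction x using polynomial_induction with
  | C a =>
    rw [defMul, coeff_polyMul_C_left, Finset.Nat.antidiagonal_zero, Finset.sum_singleton,
      coeff_C_zero]
    rfl
  | X x hx => rw [defMul_X_mul, coeff_X_mul_zero, coeff_X_mul_zero, zero_mul]
  | add x x' hx hx' =>
    rw [map_add, LinearMap.add_apply, coeff_add, coeff_add, hx, hx', add_mul]

theorem coeff_defMul_C_C (a b : M.A) {j : ℕ} (hj : 1 ≤ j) :
    (defMul hl (C a) (C b)).coeff j = ψ j (BT.mk F k (M.p a) (M.p b)) := by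
  obtain ⟨n, rfl⟩ := Nat.exists_eq_add_of_le' hj
  rw [defMul, polyMul_C_C, coeff_series, coefMul_succ]

end Setting

namespace HomogData

variable {F k V : Type*} [Field F] [Ring k] [Algebra F k]
  [AddCommGroup V] [FModule F V] [EnvModule F k V] [EnvTower F k V]

/-- The graded deformation given by maps `ψ_j` whose associators vanish. -/
def deformation (h : HomogData F k V) {ψ : ℕ → h.setting.I2 →ₗ[Env F k] h.setting.A}
    (hl : Setting.Lowers (M := h.setting) ψ)
    (ha : ∀ n, Setting.assocE (M := h.setting) ψ n = 0) : h.GradedDeformation where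
  mul := Setting.defMul (M := h.setting) hl
  mul_assoc := Setting.defMul_assoc (M := h.setting) hl ha
  one_mul := Setting.defMul_one_left (M := h.setting) hl
  mul_one := Setting.defMul_one_right (M := h.setting) hl
  smul_mul := Setting.defMul_incl_mul (M := h.setting) hl
  mul_bal := Setting.defMul_bal (M := h.setting) hl
  mul_smul := Setting.defMul_mul_incl (M := h.setting) hl
  graded _ _ _ hx _ hy := Setting.defMul_mem (M := h.setting) hl hx hy
  special := Setting.coeff_zero_defMul (M := h.setting) hl

theorem deformation_givenBy {h : HomogData F k V}
    {ψ : ℕ → h.setting.I2 →ₗ[Env F k] h.setting.A}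
    (hl : Setting.Lowers (M := h.setting) ψ)
    (ha : ∀ n, Setting.assocE (M := h.setting) ψ n = 0) : (h.deformation hl ha).GivenBy ψ :=
  fun a b _ hj => Setting.coeff_defMul_C_C (M := h.setting) hl a b hj

end HomogData

/-! ### The filtered algebra of a deformation -/

section Filtrations

variable {F M : Type*} [Field F] [AddCommGroup M] [Module F M]

theorem mem_lower {Fil : ℕ → Submodule F M} (hF : Monotone Fil) {n : ℕ} {x : M}
    (hx : x ∈ lower Fil n) : x = 0 ∨ ∃ m < n, x ∈ Fil m := by
  rcases n with _ | n
  · left; simpa [lower] using hx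
  · exact Or.inr ⟨n, n.lt_succ_self,
      (iSup₂_le fun i hi => hF (Nat.lt_succ_iff.1 hi) : lower Fil (n + 1) ≤ Fil n) hx⟩

end Filtrations

section

variable {F k V : Type*} [Field F] [Ring k] [Algebra F k]
  [AddCommGroup V] [FModule F V] [EnvModule F k V] [EnvTower F k V]

theorem TAlg.exists_mem_fil (x : TAlg F k V) : ∃ n, x ∈ TAlg.fil F k V n := by
  refine Submodule.iSup_induction _ (motive := fun x => ∃ n, x ∈ TAlg.fil F k V n)
    (TAlg.mem_iSup_deg x) (fun n x hx => ⟨n, TAlg.deg_le_fil le_rfl hx⟩) ⟨0, zero_mem _⟩ ?_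
  rintro x y ⟨m, hx⟩ ⟨n, hy⟩
  exact ⟨max m n, add_mem (TAlg.fil_mono (le_max_left m n) hx)
    (TAlg.fil_mono (le_max_right m n) hy)⟩

namespace TQuot

variable (S : Set (TAlg F k V))

theorem fil_monotone : Monotone (TQuot.fil S) := fun _ _ hmn =>
  Submodule.map_mono (TAlg.fil_mono hmn)

theorem deg_le_fil (n : ℕ) : TQuot.deg S n ≤ TQuot.fil S n :=
  Submodule.map_mono (TAlg.deg_le_fil le_rfl)

theorem mk_sub_proj_mem {n : ℕ} {x : TAlg F k V} (hx : x ∈ TAlg.fil F k V n) :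
    TQuot.mk S (x - TAlg.proj F k V n x) ∈ lower (TQuot.fil S) n := by
  refine TAlg.mem_fil_induction (p := fun x => TQuot.mk S (x - TAlg.proj F k V n x) ∈
    lower (TQuot.fil S) n) (by simp) (fun x y hx hy => ?_) (fun i hi x hx => ?_) hx
  · rw [map_add, add_sub_add_comm, map_add]; exact add_mem hx hy
  · rw [TAlg.proj_deg hx]
    split_ifs with hn
    · simp
    · rw [sub_zero]
      exact lower_mono _ (by omega) (TQuot.mk_mem_fil S (TAlg.deg_le_fil le_rfl hx))

end TQuot
end

namespace HomogData

open Polynomial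

variable {F k V : Type*} [Field F] [Ring k] [Algebra F k]
  [AddCommGroup V] [FModule F V] [EnvModule F k V] [EnvTower F k V]
variable {h : HomogData F k V}

theorem comp_of_mem_lower {n : ℕ} {a : h.A} (ha : a ∈ lower h.fil n) : h.comp n a = 0 := by
  rcases mem_lower (TQuot.fil_monotone _) ha with rfl | ⟨m, hm, x, hx, rfl⟩
  · exact map_zero _
  · change h.comp n (h.q x) = 0
    rw [comp_q, TAlg.proj_eq_zero_of_mem_fil hm hx, map_zero]

namespace FilteredRel

variable (S : h.FilteredRel)

/-- In U each relation of A equals terms of lower filtration, so the ideal generated by R in degree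
n falls into the previous step. -/
theorem mk_mem_lower {n : ℕ} {x : TAlg F k V} (hx : x ∈ TAlg.deg F k V n) (h0 : h.q x = 0) :
    TQuot.mk (S.P : Set (TAlg F k V)) x ∈ lower S.fil n := by
  have h1 := S.coeff_toRees_mem ((TQuot.mk_eq_zero_iff _).1 h0) n
  rwa [TQuot.toRees_deg _ hx, coeff_C_mul, coeff_X_pow_self, mul_one] at h1

theorem p_surjective (n : ℕ) : Function.Surjective (S.p n) := by
  intro y
  obtain ⟨⟨_, x, hx, rfl⟩, rfl⟩ := Submodule.Quotient.mk_surjective _ y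
  refine ⟨⟨TQuot.mk _ (TAlg.proj F k V n x), h.mk_mem_deg (TAlg.proj_mem n x)⟩, ?_⟩
  rw [S.p_mk n _ (TAlg.proj_mem n x)]
  refine ((Submodule.Quotient.eq _).2 ?_).symm
  have h1 := TQuot.mk_sub_proj_mem (S.P : Set (TAlg F k V)) hx
  rwa [map_sub] at h1

end FilteredRel

namespace GradedDeformation

variable (D : h.GradedDeformation)

theorem unit_alg (c : k) : KAlg.unit F D.Alg c = D.of (C (KAlg.unit F h.A c)) := by
  change D.of (h.incl (C c)) = _
  simp [incl]

theorem unit_mul_of (c : k) (x : h.A[X]) :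
    KAlg.unit F D.Alg c * D.of x = D.of (C (KAlg.unit F h.A c) * x) := by
  have h1 := D.smul_mul (C c) 1 x
  rw [D.one_mul, _root_.mul_one] at h1
  have h2 : h.incl (C c) = C (KAlg.unit F h.A c) := by simp [incl]
  rw [unit_alg, of_mul_of, ← h2, h1]

theorem of_mul_unit (c : k) (x : h.A[X]) :
    D.of x * KAlg.unit F D.Alg c = D.of (x * C (KAlg.unit F h.A c)) := by
  have h1 := D.mul_smul (C c) x 1
  rw [D.mul_one, _root_.one_mul] at h1
  have h2 : h.incl (C c) = C (KAlg.unit F h.A c) := by simp [incl]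
  rw [unit_alg, of_mul_of, ← h2, h1]

/-- The morphism `TV → A_t` that extends `V ⊆ A`. -/
def fromT : TAlg F k V →ₐ[F] D.Alg :=
  TAlg.lift (KAlg.unit F D.Alg)
    (D.of.toLinearMap ∘ₗ CAlgHom.toLinearMap ∘ₗ h.ιA.restrictScalars F)
    (fun c v => by
      change D.of (C (h.ιA (lsm F c v))) = _ * D.of (C (h.ιA v))
      rw [unit_mul_of, map_lsm, KAlg.lsm_eq, C_mul])
    (fun c v => by
      change D.of (C (h.ιA (rsm F c v))) = D.of (C (h.ιA v)) * _
      rw [of_mul_unit, map_rsm, KAlg.rsm_eq, C_mul])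

/-- The polynomial underlying the image of an element of `TV` in `A_t`. -/
def poly : TAlg F k V →ₗ[F] h.A[X] := D.of.symm.toLinearMap ∘ₗ D.fromT.toLinearMap

theorem fromT_eq (x : TAlg F k V) : D.fromT x = D.of (D.poly x) := rfl

theorem poly_unit (c : k) : D.poly (KAlg.unit F _ c) = C (KAlg.unit F h.A c) := by
  apply D.of.injective
  rw [← fromT_eq, fromT, TAlg.lift_unit, unit_alg]

theorem poly_ι (v : V) : D.poly (TAlg.ι F k v) = C (h.ιA v) := by
  apply D.of.injective
  rw [← fromT_eq, fromT, TAlg.lift_ι]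
  rfl

theorem poly_mul (x y : TAlg F k V) : D.poly (x * y) = D.mul (D.poly x) (D.poly y) := by
  apply D.of.injective
  rw [← fromT_eq, map_mul, fromT_eq, fromT_eq, of_mul_of]

theorem coeff_zero_poly (x : TAlg F k V) : (D.poly x).coeff 0 = h.q x := by
  induction x using TAlg.induction with
  | unit c => rw [poly_unit, coeff_C_zero, q_unit]
  | ι v => rw [poly_ι, coeff_C_zero, ιA_eq]
  | mul x y hx hy => rw [poly_mul, D.special, hx, hy, q_mul]
  | add x y hx hy => rw [map_add, map_add, coeff_add, hx, hy]

theorem poly_mem {n : ℕ} {x : TAlg F k V} (hx : x ∈ TAlg.deg F k V n) :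
    D.poly x ∈ h.degPoly n := by
  have hC : ∀ {i : ℕ} {a : h.A}, a ∈ h.deg i → C a ∈ h.degPoly i := fun {i a} ha =>
    Submodule.subset_span ⟨i, 0, a, rfl, ha, by rw [pow_zero, _root_.mul_one]⟩
  induction n generalizing x with
  | zero =>
    obtain ⟨c, rfl⟩ := TAlg.exists_unit_of_mem_deg_zero hx
    rw [poly_unit]
    exact hC (h.unit_mem_deg c)
  | succ n ih =>
    refine TAlg.deg_succ_induction (p := fun x => D.poly x ∈ h.degPoly (n + 1)) ?_ ?_ ?_ hx
    · rw [map_zero]; exact zero_mem _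
    · intro x y hx hy; rw [map_add]; exact add_mem hx hy
    · intro y hy v
      rw [poly_mul, poly_ι]
      exact D.graded _ _ _ (ih hy) _ (hC (h.ιA_mem_deg v))

theorem coeff_poly_mem {n : ℕ} {x : TAlg F k V} (hx : x ∈ TAlg.deg F k V n) (i : ℕ) :
    (D.poly x).coeff i ∈ h.setting.degSub i n :=
  (Setting.mem_degPoly (M := h.setting)).1 (D.poly_mem hx) i

/-- The composition of `TV → A_t` with `∑ a_j t^j ↦ ∑ a_j`. -/
def sumT : TAlg F k V →ₗ[F] h.A := D.sumCoeff ∘ₗ D.fromT.toLinearMap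

theorem sumT_eq_eval (x : TAlg F k V) : D.sumT x = (D.poly x).eval 1 := rfl

theorem sumT_of_mem_deg {n : ℕ} {x : TAlg F k V} (hx : x ∈ TAlg.deg F k V n) :
    D.sumT x = h.q x + ∑ i ∈ Finset.range n, (D.poly x).coeff (i + 1) := by
  have h1 : (D.poly x).natDegree < n + 1 := by
    refine Nat.lt_succ_of_le (natDegree_le_iff_coeff_eq_zero.2 fun i hi => ?_)
    exact Setting.eq_zero_of_mem_degSub (M := h.setting) hi (D.coeff_poly_mem hx i)
  rw [sumT_eq_eval, eval_eq_sum_range' h1, Finset.sum_range_succ', add_comm]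
  simp only [one_pow, _root_.mul_one, coeff_zero_poly]

/-- For x of degree m the image in A_t is homogeneous with deg t = 1. The coefficient of t^i
therefore has degree m - i, and only the constant one, which is q(x), has degree m. -/
theorem sumT_sub_q_mem {n : ℕ} {x : TAlg F k V} (hx : x ∈ TAlg.fil F k V n) :
    D.sumT x - h.q x ∈ lower h.fil n := by
  refine TAlg.mem_fil_induction (p := fun x => D.sumT x - h.q x ∈ lower h.fil n) ?_ ?_ ?_ hx
  · rw [map_zero, map_zero, sub_zero]; exact zero_mem _
  · intro x y hx hy; rw [map_add, map_add, add_sub_add_comm]; exact add_mem hx hy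
  · intro m hm x hx
    rw [sumT_of_mem_deg D hx, add_sub_cancel_left]
    refine sum_mem fun i hi => ?_
    have hi := Finset.mem_range.1 hi
    have h1 : (D.poly x).coeff (i + 1) ∈ h.deg (m - (i + 1)) :=
      (Setting.mem_degSub (M := h.setting) (by omega)).1 (D.coeff_poly_mem hx (i + 1))
    exact lower_mono _ (by omega) (TQuot.deg_le_fil _ _ h1)

theorem comp_sumT {n : ℕ} {x : TAlg F k V} (hx : x ∈ TAlg.fil F k V n) :
    h.comp n (D.sumT x) = h.q (TAlg.proj F k V n x) := by
  have h1 := comp_of_mem_lower (D.sumT_sub_q_mem hx)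
  rwa [map_sub, sub_eq_zero, comp_q] at h1

theorem sumT_mem_fil {n : ℕ} {x : TAlg F k V} (hx : x ∈ TAlg.fil F k V n) :
    D.sumT x ∈ h.fil n := by
  rw [← sub_add_cancel (D.sumT x) (h.q x)]
  refine add_mem ?_ ⟨x, hx, rfl⟩
  exact (iSup₂_le fun i hi => TQuot.fil_monotone _ hi.le : lower h.fil n ≤ h.fil n)
    (D.sumT_sub_q_mem hx)

/-- Successive approximation: a lift x of a along q is correct up to lower filtration, and the error
is corrected by induction. -/
theorem exists_sumT_eq {n : ℕ} {a : h.A} (ha : a ∈ h.fil n) :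
    ∃ x ∈ TAlg.fil F k V n, D.sumT x = a := by
  induction n using Nat.strong_induction_on generalizing a with
  | h n ih =>
    obtain ⟨x, hx, rfl⟩ := ha
    rcases mem_lower (TQuot.fil_monotone _) (D.sumT_sub_q_mem hx) with h0 | ⟨m, hm, h1⟩
    · exact ⟨x, hx, sub_eq_zero.1 h0⟩
    · obtain ⟨y, hy, h2⟩ := ih m hm h1
      refine ⟨x - y, sub_mem hx (TAlg.fil_mono hm.le hy), ?_⟩
      rw [map_sub, h2, sub_sub_cancel]
      rfl

theorem quot_of_X_mul (x : h.A[X]) : D.quot (D.of (X * x)) = D.quot (D.of x) := by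
  have h1 := D.mul_X_left 1 x
  rw [_root_.mul_one, D.one_mul] at h1
  refine sub_eq_zero.1 ?_
  rw [← h1, ← of_mul_of, ← map_sub, ← sub_one_mul]
  exact Ideal.Quotient.eq_zero_iff_mem.2 (TwoSidedIdeal.mem_asIdeal.2
    (TwoSidedIdeal.mul_mem_right _ _ _ (TwoSidedIdeal.subset_span rfl)))

theorem quot_of (x : h.A[X]) : D.quot (D.of x) = D.fromA (x.eval 1) := by
  induction x using polynomial_induction with
  | C a => rw [eval_C]; rfl
  | X x hx => rw [quot_of_X_mul, hx, X_mul, eval_mul_X, _root_.mul_one]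
  | add x y hx hy => rw [map_add, map_add, hx, hy, eval_add, map_add]

theorem quot_fromT (x : TAlg F k V) : D.quot (D.fromT x) = D.fromA (D.sumT x) := D.quot_of _

theorem fromA_surjective : Function.Surjective D.fromA := by
  intro y
  obtain ⟨x, rfl⟩ := Ideal.Quotient.mkₐ_surjective F _ y
  exact ⟨(D.of.symm x).eval 1, (D.quot_of _).symm⟩

theorem fromA_injective : Function.Injective D.fromA :=
  Function.LeftInverse.injective D.rhoStar_fromA

variable {D} {S : h.FilteredRel} (hP : ∀ x ∈ S.P, D.sumT x = 0)

/-- The morphism `U → A_t / ⟨t - 1⟩`. -/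
def toFiber : S.U →ₐ[F] D.Fiber :=
  TQuot.lift (D.quot.comp D.fromT) fun x hx => by
    rw [AlgHom.comp_apply, quot_fromT, hP x hx, map_zero]

theorem toFiber_mk (x : TAlg F k V) : toFiber hP (TQuot.mk _ x) = D.fromA (D.sumT x) :=
  D.quot_fromT x

-- Injectivity of U → A_t / ⟨t - 1⟩ by descent. The leading component of x vanishes in A, so in U it
-- can be rewritten by terms of lower filtration. The new representative y has the same image in A_t
-- / ⟨t - 1⟩, hence again `sumT` zero, and induction applies to it.
include hP in
theorem mk_eq_zero_of_sumT {n : ℕ} {x : TAlg F k V} (hx : x ∈ TAlg.fil F k V n)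
    (h0 : D.sumT x = 0) : TQuot.mk (S.P : Set (TAlg F k V)) x = 0 := by
  induction n using Nat.strong_induction_on generalizing x with
  | h n ih =>
    have h1 : h.q (TAlg.proj F k V n x) = 0 := by rw [← D.comp_sumT hx, h0, map_zero]
    have h2 := add_mem (TQuot.mk_sub_proj_mem (S.P : Set (TAlg F k V)) hx)
      (S.mk_mem_lower (TAlg.proj_mem n x) h1)
    rw [← map_add, sub_add_cancel] at h2
    rcases mem_lower (TQuot.fil_monotone _) h2 with h3 | ⟨m, hm, y, hy, h3⟩
    · exact h3
    · have h3 : TQuot.mk (S.P : Set (TAlg F k V)) y = TQuot.mk _ x := h3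
      rw [← h3]
      refine ih m hm hy (D.fromA_injective ?_)
      rw [← toFiber_mk hP, h3, toFiber_mk, h0]

theorem toFiber_bijective : Function.Bijective (toFiber hP) := by
  constructor
  · refine (injective_iff_map_eq_zero _).2 fun y hy => ?_
    obtain ⟨x, rfl⟩ := TQuot.mk_surjective _ y
    obtain ⟨n, hn⟩ := TAlg.exists_mem_fil x
    refine mk_eq_zero_of_sumT hP hn (D.fromA_injective ?_)
    rw [← toFiber_mk hP, hy, map_zero]
  · intro y
    obtain ⟨a, rfl⟩ := D.fromA_surjective y
    obtain ⟨x, rfl⟩ := h.mk_surjective a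
    obtain ⟨n, hn⟩ := TAlg.exists_mem_fil x
    obtain ⟨y, -, hy⟩ := D.exists_sumT_eq (TQuot.mk_mem_fil _ hn)
    exact ⟨TQuot.mk _ y, by rw [toFiber_mk, hy]⟩

theorem isGoodIso : h.IsGoodIso S D (AlgEquiv.ofBijective (toFiber hP) (toFiber_bijective hP)) where
  unit c := by
    change D.quot (D.fromT (KAlg.unit F _ c)) = D.quot (KAlg.unit F D.Alg c)
    rw [fromT, TAlg.lift_unit]
  fil n := by
    ext y
    constructor
    · rintro ⟨_, ⟨x, hx, rfl⟩, rfl⟩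
      exact ⟨D.sumT x, D.sumT_mem_fil hx, (toFiber_mk hP x).symm⟩
    · rintro ⟨a, ha, rfl⟩
      obtain ⟨x, hx, rfl⟩ := D.exists_sumT_eq ha
      exact ⟨TQuot.mk _ x, ⟨x, hx, rfl⟩, toFiber_mk hP x⟩
  comp n a := by
    obtain ⟨_, x, hx, rfl⟩ := a
    have hx : x ∈ TAlg.deg F k V n := hx
    have h1 := D.comp_sumT (TAlg.deg_le_fil le_rfl hx)
    rw [TAlg.proj_deg hx, if_pos rfl] at h1
    refine (congrArg (fun y => D.rho n (Gr.map _ _ n y)) (S.p_mk n x hx)).trans (Eq.trans ?_ h1)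
    change h.comp n (D.rhoStar (toFiber hP (TQuot.mk _ x))) = _
    rw [toFiber_mk, rhoStar_fromA]

-- Surjectivity of p is automatic, and p is injective because the identity of A_n factors through
-- it.
include hP in
theorem isPBW : S.IsPBW := fun n => ⟨fun a b hab => Subtype.ext (by
    rw [← (isGoodIso hP).comp n a, ← (isGoodIso hP).comp n b, hab]), S.p_surjective n⟩

end GradedDeformation
end HomogData

/-! ### Evaluation at t = 1 for normalized maps. -/

namespace HomogData

open Polynomial

variable {F k V : Type*} [Field F] [Ring k] [Algebra F k]
  [AddCommGroup V] [FModule F V] [EnvModule F k V] [EnvTower F k V]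
variable {h : HomogData F k V}

namespace GradedDeformation

variable {D : h.GradedDeformation} {ψ : ℕ → h.I2 →ₗ[Env F k] h.A} (hD : D.GivenBy ψ)
  (hn : ∀ j, 1 ≤ j → h.IsNormalized (ψ j))

include hD in
theorem coeff_poly_mul_ι {y : TAlg F k V} (hy : D.poly y = C (h.q y)) (v : V) {j : ℕ}
    (hj : 1 ≤ j) :
    (D.poly (y * TAlg.ι F k v)).coeff j = ψ j (BT.mk F k (h.cls y) (h.ιI v)) := by
  rw [poly_mul, poly_ι, hy, hD _ _ j hj]
  rfl

-- Letters are multiplied one at a time, and a product of total degree below N is undeformed by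
-- normalization.
include hD hn in
theorem poly_of_mem_deg {n : ℕ} (hN : n < h.N) {x : TAlg F k V} (hx : x ∈ TAlg.deg F k V n) :
    D.poly x = C (h.q x) := by
  induction n generalizing x with
  | zero =>
    obtain ⟨c, rfl⟩ := TAlg.exists_unit_of_mem_deg_zero hx
    rw [poly_unit, q_unit]
  | succ n ih =>
    refine TAlg.deg_succ_induction (p := fun x => D.poly x = C (h.q x)) ?_ ?_ ?_ hx
    · rw [map_zero, map_zero, C_0]
    · intro x y hx hy; rw [map_add, map_add, C_add, hx, hy]
    · intro y hy v
      ext j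
      rcases Nat.eq_zero_or_pos j with rfl | hj
      · rw [coeff_zero_poly, coeff_C_zero]
      · rw [coeff_poly_mul_ι hD (ih (by omega) hy) v hj, coeff_C_of_ne_zero hj.ne']
        exact hn j hj n 1 hN _ (h.cls_mem_degI hy) _ (h.ιI_mem_degI v)

include hD hn in
theorem sumT_of_mem_fil {x : TAlg F k V} (hx : x ∈ TAlg.fil F k V (h.N - 1)) :
    D.sumT x = h.q x := by
  have hN := h.two_le
  refine TAlg.mem_fil_induction (p := fun x => D.sumT x = h.q x) (by rw [map_zero, map_zero])
    (fun x y hx hy => by rw [map_add, map_add, hx, hy]) (fun i hi x hx => ?_) hx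
  rw [sumT_eq_eval, poly_of_mem_deg hD hn (by omega) hx, eval_C]

include hn in
theorem ext_split2_mul_ι {y : TAlg F k V} (hy : y ∈ TAlg.deg F k V (h.N - 1)) (v : V) {j : ℕ}
    (hj : 1 ≤ j) :
    ext (ψ j) (h.split2 (y * TAlg.ι F k v)) = ψ j (BT.mk F k (h.cls y) (h.ιI v)) := by
  have hN : 2 ≤ h.setting.N := h.two_le
  have h2 : ext (ψ j) (h.setting.split2 y) = 0 :=
    Setting.ext_split2_of_lt (M := h.setting) (f := ψ j)
      (fun a b _ _ hab x hx y hy => hn j hj a b hab _ (h.cls_mem_degI hx) _ (h.cls_mem_degI hy))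
      (n := h.setting.N - 1) (by omega) hy
  refine (congrArg (ext (ψ j)) (Setting.split2_mul_ι (M := h.setting) y v)).trans ?_
  refine (map_add (ext (ψ j)) _ _).trans ?_
  rw [ext_gen, ext_op_smul, h2, smul_zero, add_zero]
  rfl

-- For x = y v with y of degree N - 1, only the last multiplication by v is deformed, and it
-- contributes ψ_j(y, v). This is also the only term of `split2`(x) on which a normalized map is
-- nonzero.
include hD hn in
theorem coeff_poly_N {x : TAlg F k V} (hx : x ∈ TAlg.deg F k V h.N) {j : ℕ} (hj : 1 ≤ j) :
    (D.poly x).coeff j = ext (ψ j) (h.split2 x) := by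
  have hN := h.two_le
  have h1 : x ∈ TAlg.deg F k V (h.N - 1 + 1) := by rwa [Nat.sub_add_cancel (by omega)]
  let E : TAlg F k V →ₗ[F] h.A := ext (ψ j) ∘ₗ h.split2.restrictScalars F
  refine TAlg.deg_succ_induction (p := fun x => (D.poly x).coeff j = E x) ?_ ?_ ?_ h1
  · rw [map_zero, map_zero, coeff_zero]
  · intro x y hx hy; rw [map_add, map_add, coeff_add, hx, hy]
  · intro y hy v
    rw [coeff_poly_mul_ι hD (poly_of_mem_deg hD hn (by omega) hy) v hj]
    exact (ext_split2_mul_ι hn hy v hj).symm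

include hD hn in
theorem sumT_N {x : TAlg F k V} (hx : x ∈ TAlg.deg F k V h.N) :
    D.sumT x = h.q x + ∑ i ∈ Finset.range h.N, ext (ψ (i + 1)) (h.split2 x) := by
  rw [sumT_of_mem_deg D hx]
  congr 1
  exact Finset.sum_congr rfl fun i _ => coeff_poly_N hD hn hx (by omega)

variable {φ : ℕ → h.R →ₗ[Env F k] TAlg F k V}

theorem sum_mem_fil (hφ : ∀ j < h.N, ∀ r, φ j r ∈ TAlg.deg F k V j) (r : h.R) :
    ∑ j ∈ Finset.range h.N, φ j r ∈ TAlg.fil F k V (h.N - 1) :=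
  sum_mem fun j hj => by
    have hj := Finset.mem_range.1 hj
    exact TAlg.deg_le_fil (by omega) (hφ j hj r)

-- At t = 1 the relation r becomes the sum of all ψ_j(σ₂(r)), as its undeformed part q(r) is zero.
-- The lower terms φ_j(r) are undeformed, and the two sums agree.
include hD hn in
theorem sumT_relation (hφ : ∀ j < h.N, ∀ r, φ j r ∈ TAlg.deg F k V j)
    (hψφ : ∀ j, 1 ≤ j → j ≤ h.N → ∀ r : h.R, ext (ψ j) (h.split2 r) = h.q (φ (h.N - j) r))
    (r : h.R) : D.sumT (r - ∑ j ∈ Finset.range h.N, φ j r) = 0 := by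
  -- The coefficient of t^{i+1} has degree N - 1 - i and corresponds to φ_{N-1-i}, which is why the
  -- sum is reflected.
  rw [map_sub, sumT_of_mem_fil hD hn (sum_mem_fil hφ r), sumT_N hD hn (h.R_le r.2), h.q_R,
    zero_add, map_sum, sub_eq_zero, ← Finset.sum_range_reflect]
  refine Finset.sum_congr rfl fun i hi => ?_
  have hi := Finset.mem_range.1 hi
  rw [hψφ _ (by omega) (by omega)]
  congr 3
  omega

end GradedDeformation

/-- The part of comparison data that is used to construct deformations. -/
def IsComparison.toSetting {c : h.ComparisonMaps} (hc : h.IsComparison c) :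
    h.setting.Comparison where
  τ2 := c.τ2.toLin
  τ3 := c.τ3.toLin
  s2 := c.s2.toLin
  s3 := c.s3.toLin
  τ2_hom := c.τ2.isBimodHom
  s2_hom := c.s2.isBimodHom
  τ2_mem := hc.1.2.1
  τ3_mem := hc.1.2.2.1
  s2_mem := hc.1.2.2.2.2.1
  τ2_b3 := hc.2.1.2.2
  b4_s3 := hc.2.2.1.2.2
  τ2_sum r n x y h1 h2 := (hc.2.2.2.2.2.1 r n x y ⟨h1, h2⟩).1

theorem IsWeakPBW.toSetting {S : h.FilteredRel} {φ : ℕ → h.R →ₗ[Env F k] TAlg F k V}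
    (hw : h.IsWeakPBW S φ) : h.setting.WeakPBW φ where
  mem := hw.graph.1
  exists_eq w := ⟨⟨_, hw.mem_R w⟩, rfl, hw.zero w, fun j hj hN => hw.pos j hj hN w⟩

theorem exists_deformation {S : h.FilteredRel} {φ : ℕ → h.R →ₗ[Env F k] TAlg F k V}
    (hw : h.IsWeakPBW S φ) {c : h.ComparisonMaps} (hc : h.IsComparison c) :
    ∃ ψ : ℕ → h.I2 →ₗ[Env F k] h.A,
      h.IsRecursive c φ ψ ∧ (∀ j, 1 ≤ j → h.IsNormalized (ψ j)) ∧
      ∃ D : h.GradedDeformation, D.GivenBy ψ ∧ S.IsPBW ∧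
        ∃ g : S.U ≃ₐ[F] D.Fiber, h.IsGoodIso S D g := by
  obtain ⟨ψ, hψ⟩ := hc.toSetting.exists_isRecursive φ
  have hs := hw.toSetting
  have hl := hψ.lowers hs.mem
  have ha := hψ.assocE_eq_zero hs
  have hn : ∀ j, 1 ≤ j → h.IsNormalized (ψ j) := fun j hj a b hab x hx y hy =>
    hψ.eq_zero hj hab (Setting.mk_mem_degI2 (M := h.setting) hx hy)
  have hD := deformation_givenBy hl ha
  have hP : ∀ x ∈ S.P, (h.deformation hl ha).sumT x = 0 := by
    intro x hx
    obtain ⟨r, rfl⟩ := (hw.graph.2 x).1 hx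
    exact GradedDeformation.sumT_relation hD hn hs.mem
      (fun j hj hN r => hψ.ext_split2 hj hN r) r
  exact ⟨ψ, ⟨hψ.one hs, fun j _ => hψ j⟩, hn, _, hD, GradedDeformation.isPBW hP, _,
    GradedDeformation.isGoodIso hP⟩

end HomogData

section

variable {F k V : Type*} [Field F] [Ring k] [Algebra F k]
  [AddCommGroup V] [FModule F V] [EnvModule F k V] [EnvTower F k V]

theorem TAlg.proj_sum_range {f : ℕ → TAlg F k V} {n : ℕ} (hf : ∀ j < n, f j ∈ TAlg.deg F k V j)
    {m : ℕ} (hm : m < n) : TAlg.proj F k V m (∑ j ∈ Finset.range n, f j) = f m := by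
  rw [map_sum, Finset.sum_eq_single_of_mem m (Finset.mem_range.2 hm), TAlg.proj_deg (hf m hm),
    if_pos rfl]
  intro j hj hjm
  rw [TAlg.proj_deg (hf j (Finset.mem_range.1 hj)), if_neg hjm.symm]

end

/-! ### Weak PBW conditions derived from a deformation. -/

namespace HomogData

variable {F k V : Type*} [Field F] [Ring k] [Algebra F k]
  [AddCommGroup V] [FModule F V] [EnvModule F k V] [EnvTower F k V]
variable {h : HomogData F k V}

section Graph

variable (φ : ℕ → h.R →ₗ[Env F k] TAlg F k V)

/-- The map `r ↦ r - ∑ φ_j(r)`. -/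
def relMap : h.R →ₗ[Env F k] TAlg F k V := h.R.subtype - ∑ j ∈ Finset.range h.N, φ j

theorem relMap_apply (r : h.R) : relMap φ r = r - ∑ j ∈ Finset.range h.N, φ j r := by
  rw [relMap, LinearMap.sub_apply, LinearMap.sum_apply]; rfl

variable {φ} (hφ : ∀ j < h.N, ∀ r, φ j r ∈ TAlg.deg F k V j)

include hφ in
theorem proj_relMap (r : h.R) : TAlg.proj F k V h.N (relMap φ r) = r := by
  have hN := h.two_le
  rw [relMap_apply, map_sub, TAlg.proj_deg (h.R_le r.2), if_pos rfl,
    TAlg.proj_eq_zero_of_mem_fil (by omega) (GradedDeformation.sum_mem_fil hφ r), sub_zero]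

/-- The filtered algebra with the relations `r = ∑ φ_j(r)`. -/
def graphRel : h.FilteredRel where
  P := LinearMap.range (relMap φ)
  P_le := by
    rintro _ ⟨r, rfl⟩
    rw [relMap_apply]
    exact sub_mem (TAlg.deg_le_fil le_rfl (h.R_le r.2))
      (TAlg.fil_mono (Nat.sub_le _ _) (GradedDeformation.sum_mem_fil hφ r))
  R_eq := by
    ext x
    constructor
    · exact fun hx => ⟨relMap φ ⟨x, hx⟩, ⟨_, rfl⟩, proj_relMap hφ ⟨x, hx⟩⟩
    · rintro ⟨_, ⟨r, rfl⟩, rfl⟩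
      rw [proj_relMap hφ]
      exact r.2

theorem graphRel_isGraphOf : (graphRel hφ).IsGraphOf φ := by
  refine ⟨hφ, fun x => ⟨?_, ?_⟩⟩
  · rintro ⟨r, rfl⟩
    exact ⟨r, relMap_apply φ r⟩
  · rintro ⟨r, rfl⟩
    exact ⟨r, relMap_apply φ r⟩

theorem graphRel_disjoint : (graphRel hφ).P ⊓ TAlg.fil F k V (h.N - 1) = ⊥ := by
  have hN := h.two_le
  refine (Submodule.eq_bot_iff _).2 ?_
  rintro _ ⟨⟨r, rfl⟩, hx⟩
  have h1 := proj_relMap hφ r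
  rw [TAlg.proj_eq_zero_of_mem_fil (by omega) hx] at h1
  have h2 : r = 0 := Subtype.ext h1.symm
  rw [h2, map_zero]

end Graph

theorem mulMap_sum_left (φ : ℕ → h.R →ₗ[Env F k] TAlg F k V) (n : ℕ) (y : h.RV) :
    mulMap (∑ j ∈ Finset.range n, φ j) (TAlg.ι F k) y =
      ∑ j ∈ Finset.range n, mulMap (φ j) (TAlg.ι F k) y := by
  induction y using BT.induction with
  | zero => simp only [map_zero, Finset.sum_const_zero]
  | tmul r v =>
    change (∑ j ∈ Finset.range n, φ j) r * TAlg.ι F k v =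
      ∑ j ∈ Finset.range n, φ j r * TAlg.ι F k v
    rw [LinearMap.sum_apply, Finset.sum_mul]
  | add x y hx hy => simp only [map_add, hx, hy, Finset.sum_add_distrib]

theorem mulMap_sum_right (φ : ℕ → h.R →ₗ[Env F k] TAlg F k V) (n : ℕ) (y : h.VR) :
    mulMap (TAlg.ι F k) (∑ j ∈ Finset.range n, φ j) y =
      ∑ j ∈ Finset.range n, mulMap (TAlg.ι F k) (φ j) y := by
  induction y using BT.induction with
  | zero => simp only [map_zero, Finset.sum_const_zero]
  | tmul v r =>
    change TAlg.ι F k v * (∑ j ∈ Finset.range n, φ j) r =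
      ∑ j ∈ Finset.range n, TAlg.ι F k v * φ j r
    rw [LinearMap.sum_apply, Finset.mul_sum]
  | add x y hx hy => simp only [map_add, hx, hy, Finset.sum_add_distrib]

theorem diff_mem {φ : h.R →ₗ[Env F k] TAlg F k V} {j : ℕ} (hφ : ∀ r, φ r ∈ TAlg.deg F k V j)
    (w : h.RN1) : h.diff φ w ∈ TAlg.deg F k V (j + 1) := by
  refine sub_mem ?_ ?_
  · change mulMap φ (TAlg.ι F k) (h.toRV w) ∈ _
    generalize h.toRV w = y
    induction y using BT.induction with
    | zero => rw [map_zero]; exact zero_mem _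
    | tmul r v => exact TAlg.deg_mul (hφ r) (TAlg.ι_mem_deg v)
    | add x y hx hy => rw [map_add]; exact add_mem hx hy
  · change mulMap (TAlg.ι F k) φ (h.toVR w) ∈ _
    generalize h.toVR w = y
    induction y using BT.induction with
    | zero => rw [map_zero]; exact zero_mem _
    | tmul v r =>
      have h1 := TAlg.deg_mul (TAlg.ι_mem_deg (F := F) (k := k) v) (hφ r)
      rwa [add_comm] at h1
    | add x y hx hy => rw [map_add]; exact add_mem hx hy

namespace GradedDeformation

variable {D : h.GradedDeformation}

variable (D) in
/-- The morphism `TV → A_t / ⟨t - 1⟩`. -/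
def eval : TAlg F k V →ₐ[F] D.Fiber := D.quot.comp D.fromT

theorem eval_eq_zero_iff {x : TAlg F k V} : D.eval x = 0 ↔ D.sumT x = 0 := by
  rw [eval, AlgHom.comp_apply, quot_fromT, map_eq_zero_iff _ D.fromA_injective]

variable {φ : ℕ → h.R →ₗ[Env F k] TAlg F k V} (hP : ∀ r, D.sumT (relMap φ r) = 0)

include hP in
theorem eval_sum (r : h.R) : D.eval ((∑ j ∈ Finset.range h.N, φ j) r) = D.eval r := by
  have h1 := eval_eq_zero_iff.2 (hP r)
  rw [relMap, LinearMap.sub_apply, map_sub, sub_eq_zero] at h1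
  exact h1.symm

-- In A_t / ⟨t - 1⟩ a relation equals the sum of its lower terms. Carrying this out in ∑ r u and in
-- ∑ v s gives two expressions for the image of the same element w of TV.
include hP in
theorem sumT_diff (w : h.RN1) : D.sumT (∑ j ∈ Finset.range h.N, h.diff (φ j) w) = 0 := by
  have h1 : ∀ y, D.eval (mulMap (∑ j ∈ Finset.range h.N, φ j) (TAlg.ι F k) y) =
      D.eval (h.mulRV y) := by
    intro y
    induction y using BT.induction with
    | zero => simp only [map_zero]
    | tmul r v =>
      change D.eval ((∑ j ∈ Finset.range h.N, φ j) r * TAlg.ι F k v) = D.eval (r * TAlg.ι F k v)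
      rw [map_mul, map_mul, eval_sum hP]
    | add x y hx hy => simp only [map_add, hx, hy]
  have h2 : ∀ y, D.eval (mulMap (TAlg.ι F k) (∑ j ∈ Finset.range h.N, φ j) y) =
      D.eval (h.mulVR y) := by
    intro y
    induction y using BT.induction with
    | zero => simp only [map_zero]
    | tmul v r =>
      change D.eval (TAlg.ι F k v * (∑ j ∈ Finset.range h.N, φ j) r) = D.eval (TAlg.ι F k v * r)
      rw [map_mul, map_mul, eval_sum hP]
    | add x y hx hy => simp only [map_add, hx, hy]
  have h3 : ∑ j ∈ Finset.range h.N, h.diff (φ j) w =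
      mulMap (∑ j ∈ Finset.range h.N, φ j) (TAlg.ι F k) (h.toRV w) -
        mulMap (TAlg.ι F k) (∑ j ∈ Finset.range h.N, φ j) (h.toVR w) := by
    rw [mulMap_sum_left, mulMap_sum_right, ← Finset.sum_sub_distrib]
    rfl
  have h4 : h.mulRV (h.toRV w) = h.mulVR (h.toVR w) := w.2
  rw [← eval_eq_zero_iff, h3, map_sub, h1, h2, h4, sub_self]

variable {ψ : ℕ → h.I2 →ₗ[Env F k] h.A} (hD : D.GivenBy ψ)
  (hn : ∀ j, 1 ≤ j → h.IsNormalized (ψ j)) (hφ : ∀ j < h.N, ∀ r, φ j r ∈ TAlg.deg F k V j)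

-- A critical-pair argument: the two ways of reducing w agree at t = 1. Comparing leading terms puts
-- ∂φ_{N-1}(w) into R, and reducing it once more leaves an identity below degree N, which splits
-- into homogeneous components.
include hP hD hn hφ in
theorem exists_diff_eq (w : h.RN1) : ∃ hr : h.diff (φ (h.N - 1)) w ∈ h.R,
    φ 0 ⟨_, hr⟩ = 0 ∧ ∀ j, 0 < j → j < h.N → φ j ⟨_, hr⟩ + h.diff (φ (j - 1)) w = 0 := by
  have hN := h.two_le
  -- The shift accounts for ∂ raising degrees by one: g j is the part of degree j of ∑_i ∂φ_i(w),
  -- with nothing in degree 0.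
  let g : ℕ → TAlg F k V := fun j => if j = 0 then 0 else h.diff (φ (j - 1)) w
  have hg : ∀ j ≤ h.N, g j ∈ TAlg.deg F k V j := by
    intro j hj
    simp only [g]
    split_ifs with h0
    · exact zero_mem _
    · have h1 := diff_mem (hφ (j - 1) (by omega)) w
      rwa [Nat.sub_add_cancel (by omega)] at h1
  have hgN : g h.N = h.diff (φ (h.N - 1)) w := if_neg (by omega)
  have h1 : D.sumT (∑ j ∈ Finset.range (h.N + 1), g j) = 0 := by
    rw [Finset.sum_range_succ', show g 0 = 0 from if_pos rfl, add_zero, ← sumT_diff hP w]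
    rfl
  have h2 : ∑ j ∈ Finset.range (h.N + 1), g j ∈ TAlg.fil F k V h.N := sum_mem fun j hj =>
    TAlg.deg_le_fil (Nat.lt_succ_iff.1 (Finset.mem_range.1 hj))
      (hg j (Nat.lt_succ_iff.1 (Finset.mem_range.1 hj)))
  have h3 := D.comp_sumT h2
  rw [h1, map_zero, TAlg.proj_sum_range (fun j hj => hg j (Nat.lt_succ_iff.1 hj))
    (Nat.lt_succ_self _), hgN] at h3
  -- At t = 1 the leading component is not deformed, so the component of degree N has class zero in
  -- A, and in degree N the ideal of relations is R.
  have hr : h.diff (φ (h.N - 1)) w ∈ h.R := h.mem_R_of_q (hgN ▸ hg h.N le_rfl) h3.symm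
  have h4 := hP ⟨_, hr⟩
  -- The component of degree N is now a relation and may be replaced by its lower terms. The result
  -- has degree at most N - 1, where `sumT` coincides with q and is injective.
  have h5 : ∑ j ∈ Finset.range h.N, (φ j ⟨_, hr⟩ + g j) = 0 := by
    refine h.eq_zero_of_q_of_mem_fil (sum_mem fun j hj => ?_) ?_
    · have hj := Finset.mem_range.1 hj
      exact TAlg.deg_le_fil (by omega) (add_mem (hφ j hj _) (hg j hj.le))
    · rw [← sumT_of_mem_fil hD hn (sum_mem fun j hj => by
        have hj := Finset.mem_range.1 hj
        exact TAlg.deg_le_fil (by omega) (add_mem (hφ j hj _) (hg j hj.le)))]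
      rw [Finset.sum_range_succ, hgN, map_add] at h1
      rw [relMap_apply, map_sub] at h4
      rw [Finset.sum_add_distrib, map_add, ← sub_eq_zero.1 h4, add_comm]
      exact h1
  have h6 : ∀ j < h.N, φ j ⟨_, hr⟩ + g j = 0 := by
    intro j hj
    have h7 := TAlg.proj_sum_range (f := fun j => φ j ⟨_, hr⟩ + g j)
      (fun j hj => add_mem (hφ j hj _) (hg j hj.le)) hj
    rw [← h7, h5, map_zero]
  refine ⟨hr, ?_, fun j hj hjN => ?_⟩
  · have h7 := h6 0 (by omega)
    rwa [show g 0 = 0 from if_pos rfl, add_zero] at h7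
  · have h7 := h6 j hjN
    rwa [show g j = h.diff (φ (j - 1)) w from if_neg hj.ne'] at h7

include hP hD hn in
theorem isWeakPBW : h.IsWeakPBW (graphRel hφ) φ where
  disjoint := graphRel_disjoint hφ
  graph := graphRel_isGraphOf hφ
  mem_R w := (exists_diff_eq hP hD hn hφ w).1
  zero w := (exists_diff_eq hP hD hn hφ w).2.1
  pos j hj hN w := (exists_diff_eq hP hD hn hφ w).2.2 j hj hN

/-- The maps `R → V^{⊗ j}` attached to a graded deformation. -/
def inducedMap (T : h.setting.Sections) (ψ : ℕ → h.I2 →ₗ[Env F k] h.A) (i : ℕ) :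
    h.R →ₗ[Env F k] TAlg F k V :=
  T.θ ∘ₗ extE (ψ (h.N - i)) ∘ₗ h.split2 ∘ₗ h.R.subtype

theorem inducedMap_apply (T : h.setting.Sections) (ψ : ℕ → h.I2 →ₗ[Env F k] h.A) (i : ℕ) (r : h.R) :
    inducedMap T ψ i r = T.θ (ext (ψ (h.N - i)) (h.split2 r)) := rfl

theorem q_inducedMap (T : h.setting.Sections) (ψ : ℕ → h.I2 →ₗ[Env F k] h.A) (i : ℕ) (r : h.R) :
    h.q (inducedMap T ψ i r) = ext (ψ (h.N - i)) (h.split2 r) := T.q_θ _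

-- The degree comes from the grading of A_t: the value is the lift by θ of the coefficient of
-- t^{N-i} in an element of degree N.
include hD hn in
theorem inducedMap_mem (T : h.setting.Sections) (i : ℕ) (hi : i < h.N) (r : h.R) :
    inducedMap T ψ i r ∈ TAlg.deg F k V i := by
  rw [inducedMap_apply, ← coeff_poly_N hD hn (h.R_le r.2) (by omega)]
  exact T.θ_mem ((Setting.mem_degSub (M := h.setting) (show i + (h.N - i) = h.N by omega)).1
    (D.coeff_poly_mem (h.R_le r.2) (h.N - i)))

include hD hn in
theorem exists_inducedMap (T : h.setting.Sections) :
    ∃ (φ : ℕ → h.R →ₗ[Env F k] TAlg F k V) (S : h.FilteredRel),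
      h.IsInduced ψ φ ∧ S.IsGraphOf φ ∧ h.IsWeakPBW S φ ∧ S.IsPBW ∧
      ∃ g : S.U ≃ₐ[F] D.Fiber, h.IsGoodIso S D g := by
  have hφ := inducedMap_mem hD hn T
  have h1 : ∀ j, 1 ≤ j → j ≤ h.N → ∀ r : h.R,
      ext (ψ j) (h.split2 r) = h.q (inducedMap T ψ (h.N - j) r) := by
    intro j _ hjN r
    rw [q_inducedMap, Nat.sub_sub_self hjN]
  have hP : ∀ r, D.sumT (relMap (inducedMap T ψ) r) = 0 := by
    intro r
    rw [relMap_apply]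
    exact sumT_relation hD hn hφ h1 r
  have hS : ∀ x ∈ (graphRel hφ).P, D.sumT x = 0 := by
    rintro _ ⟨r, rfl⟩
    exact hP r
  refine ⟨_, graphRel hφ, fun j hj hjN => ⟨hφ _ (by omega), fun x => ?_⟩,
    graphRel_isGraphOf hφ, isWeakPBW hP hD hn hφ, isPBW hS, _, isGoodIso hS⟩
  refine (ext_isBimodHom _).ext ((ext_isBimodHom (ψ j)).comp h.setting.σ2_hom) (fun r => ?_) x
  rw [ext_gen]
  refine (h1 j hj hjN r).symm.trans (congrArg (ext (ψ j)) ?_)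
  exact (Setting.σ2_gen (M := h.setting) r).symm

end GradedDeformation
end HomogData

end PBW
end

theorem mainTheorem1 {F k V : Type*} [Field F] [CharZero F] [Ring k] [Nontrivial k] [Algebra F k]
    [IsSemisimpleRing k] [IsSemisimpleRing (k ⊗[F] kᵐᵒᵖ)]
    [AddCommGroup V] [Module F V] [Module (k ⊗[F] kᵐᵒᵖ) V] [IsScalarTower F (k ⊗[F] kᵐᵒᵖ) V]
    (h : PBW.HomogData F k V) (hTor : h.TorThreeConcentrated) :
    (∀ (D : h.GradedDeformation) (ψ : ℕ → h.I2 →ₗ[k ⊗[F] kᵐᵒᵖ] h.A),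
      D.GivenBy ψ → (∀ j, 1 ≤ j → h.IsNormalized (ψ j)) →
      ∃ (φ : ℕ → h.R →ₗ[k ⊗[F] kᵐᵒᵖ] PBW.TAlg F k V) (S : h.FilteredRel),
        h.IsInduced ψ φ ∧ S.IsGraphOf φ ∧ h.IsWeakPBW S φ ∧ S.IsPBW ∧
        ∃ g : S.U ≃ₐ[F] D.Fiber, h.IsGoodIso S D g) ∧
    (∃ c : h.ComparisonMaps, h.IsComparison c) ∧
    (∀ (S : h.FilteredRel) (φ : ℕ → h.R →ₗ[k ⊗[F] kᵐᵒᵖ] PBW.TAlg F k V), h.IsWeakPBW S φ →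
      ∀ c : h.ComparisonMaps, h.IsComparison c →
      ∃ ψ : ℕ → h.I2 →ₗ[k ⊗[F] kᵐᵒᵖ] h.A,
        h.IsRecursive c φ ψ ∧ (∀ j, 1 ≤ j → h.IsNormalized (ψ j)) ∧
        ∃ D : h.GradedDeformation, D.GivenBy ψ ∧ S.IsPBW ∧
          ∃ g : S.U ≃ₐ[F] D.Fiber, h.IsGoodIso S D g) := by
  have : IsSemisimpleRing (PBW.Env F k) := ‹IsSemisimpleRing (k ⊗[F] kᵐᵒᵖ)›
  -- Semisimplicity of k^e enters through these sections. The first part uses θ to lift ψ_j(σ₂(r))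
  -- from A_{N-j} to V^{⊗(N-j)}; the comparison data use all three sections.
  obtain ⟨T⟩ := h.setting.exists_sections
  exact ⟨fun _ _ hD hn => PBW.HomogData.GradedDeformation.exists_inducedMap hD hn T,
    ⟨T.comparison, h.isComparison T hTor⟩,
    fun _ _ hw _ hc => PBW.HomogData.exists_deformation hw hc⟩
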